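/- **Setting.** Let $n,N\ge 1$, let $\Omega\subset\mathbb R^n$ be non-empty, open and bounded with Lipschitz boundary, and let $1\le p\le q<\infty$ with $q<\frac{np}{n-1}$ (no upper bound on $q$ if $n=1$). On $\mathbb R^{N\times n}$ let $|\cdot|$ be the Hilbert–Schmidt norm and put $V_p(z):=(1+|z|^2)^{p/2}-1$. A continuous $G\colon\mathbb R^{N\times n}\to\mathbb R$ is *quasiconvex at* $z_0$ if $G(z_0)\le \frac{1}{|B_1(0)|}\int_{B_1(0)}G(z_0+\nabla\varphi)\,\mathrm dx$ for all $\varphi\in C_c^\infty(B_1(0);\mathbb R^N)$. Let $F\in C(\mathbb R^{N\times n})$ satisfy * (H1) there is $L>0$ with $|F(z)|\le L(1+|z|^q)$ for all $z$; * (H2$_p$) for every $m>0$ there is $\ell_m>0$ such that $F-\ell_mV_p$ is quasiconvex at every $z_0$ with $|z_0|\le m$ (for $p=1$ this is called (H2)). For $u\in W^{1,q}$ write $\mathscr F[u;\omega]:=\int_\omega F(\nabla u)\,\mathrm dx$. Let $\mathrm{tr}_{\partial\Omega}$ be the boundary trace, given for $\mathscr H^{n-1}$-a.e. $x\in\partial\Omega$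 by $\lim_{r\searrow0}\frac{1}{|B_r(x)\cap\Omega|}\int_{B_r(x)\cap\Omega}|u(y)-\mathrm{tr}_{\partial\Omega}(u)(x)|\,\mathrm dy=0$. Let $W^{1-1/q,q}(\partial\Omega;\mathbb R^N)$ be, for $q>1$, the space of all $g\in L^q(\partial\Omega;\mathbb R^N)$ (with respect to $\mathscr H^{n-1}$) such that $\iint_{\partial\Omega\times\partial\Omega}\frac{|g(x)-g(y)|^q}{|x-y|^{n+q-2}}\,\mathrm d\mathscr H^{n-1}(x)\,\mathrm d\mathscr H^{n-1}(y)<\infty$, and let it be $L^1(\partial\Omega;\mathbb R^N)$ for $q=1$. **Relaxed functionals.** Let $v\in BV(\Omega;\mathbb R^N)$ if $p=1$, $v\in W^{1,p}(\Omega;\mathbb R^N)$ if $p>1$, with $\mathrm{tr}_{\partial\Omega}(v)\in W^{1-1/q,q}(\partial\Omega;\mathbb R^N)$. Choose an open and bounded $\Omega'$ with $\overline\Omega\subset\Omega'$ and $u_0\in W^{1,q}(\Omega';\mathbb R^N)$ with $\mathrm{tr}_{\partial\Omega}(u_0)=\mathrm{tr}_{\partial\Omega}(v)$ $\mathscr H^{n-1}$-a.e.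 on $\partial\Omega$, and put $\mathscr A:=\{w\in W^{1,q}(\Omega';\mathbb R^N): w=u_0\text{ a.e. in }\Omega'\setminus\overline\Omega\}$. For a map $u$ on $\Omega$ let $\mathbf u:=u$ in $\Omega$ and $\mathbf u:=u_0$ in $\Omega'\setminus\overline\Omega$. With $\inf\emptyset=+\infty$, define for $p=1$ and $u\in BV(\Omega;\mathbb R^N)$ $$\overline{\mathscr F}{}^*_v[u;\Omega]:=\inf\Big\{\liminf_{j\to\infty}\mathscr F[u_j;\Omega']:\ (u_j)\subset\mathscr A,\ u_j\overset{*}{\rightharpoonup}\mathbf u\text{ in }BV(\Omega';\mathbb R^N)\Big\}-\mathscr F[u_0;\Omega'\setminus\overline\Omega],$$ and for $p>1$ and $u\in W^{1,p}(\Omega;\mathbb R^N)$ $$\overline{\mathscr F}_v[u;\Omega]:=\inf\Big\{\liminf_{j\to\infty}\mathscr F[u_j;\Omega']:\ (u_j)\subset\mathscr A,\ u_j\rightharpoonup\mathbf u\text{ in }W^{1,p}(\Omega';\mathbb R^N)\Big\}-\mathscr F[u_0;\Omega'\setminus\overline\Omega].$$ Here $u_j\overset{*}{\rightharpoonup}\mathbf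 u$ in $BV(\Omega')$ means $u_j\to\mathbf u$ in $L^1(\Omega')$ and $Du_j\overset{*}{\rightharpoonup}D\mathbf u$ in $C_0(\Omega';\mathbb R^{N\times n})'$. **Proposition (Existence of minimizers).** 1. Let $p=1$. Then $\overline{\mathscr F}{}^*_v[-;\Omega]$ is well-defined (independent of the choice of $(\Omega',u_0)$) and possesses a minimizer on $BV(\Omega;\mathbb R^N)$: there is $u\in BV(\Omega;\mathbb R^N)$ with $-\infty<\overline{\mathscr F}{}^*_v[u;\Omega]<\infty$ and $\overline{\mathscr F}{}^*_v[u;\Omega]\le\overline{\mathscr F}{}^*_v[w;\Omega]$ for all $w\in BV(\Omega;\mathbb R^N)$. 2. Let $p>1$. Then $\overline{\mathscr F}_v[-;\Omega]$ is well-defined (independent of the choice of $(\Omega',u_0)$) and possesses a minimizer on $W^{1,p}_v(\Omega;\mathbb R^N):=v+W^{1,p}_0(\Omega;\mathbb R^N)$: there is $u\in W^{1,p}_v(\Omega;\mathbb R^N)$ with $-\infty<\overline{\mathscr F}_v[u;\Omega]<\infty$ and $\overline{\mathscr F}_v[u;\Omega]\le\overline{\mathscr F}_v[w;\Omega]$ for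 all $w\in W^{1,p}(\Omega;\mathbb R^N)$, in particular for all $w\in W^{1,p}_v(\Omega;\mathbb R^N)$. -/

import Mathlib

open MeasureTheory Filter Topology Set
open scoped ENNReal ContDiff ZeroAtInfty

noncomputable section

namespace RelaxedMin

/-- `ℝⁿ` with its Euclidean structure. -/
abbrev Vec (n : ℕ) := EuclideanSpace ℝ (Fin n)

/-- `ℝ^{N×n}` with the Hilbert-Schmidt inner product and norm. -/
abbrev Mat (N n : ℕ) := EuclideanSpace ℝ (Fin N × Fin n)

variable {n N : ℕ}

/-! ### Lipschitz boundaries, test maps, classical derivatives -/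

/-- `Ω` has Lipschitz boundary: near every boundary point and in suitable orthonormal coordinates
(with vertical direction `ν`), `Ω` is the region strictly above the graph of a Lipschitz function
of the horizontal variable `y - ⟨ν, y⟩ ν`. -/
def HasLipschitzBoundary (Ω : Set (Vec n)) : Prop :=
  ∀ x₀ ∈ frontier Ω, ∃ (ν : Vec n) (r : ℝ) (K : NNReal) (γ : Vec n → ℝ),
    ‖ν‖ = 1 ∧ 0 < r ∧ LipschitzWith K γ ∧
      ∀ y ∈ Metric.ball x₀ r, y ∈ Ω ↔ γ (y - inner ℝ ν y • ν) < inner ℝ ν y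

/-- `φ ∈ C_c^∞(Ω; V)`, extended by zero to `ℝⁿ`. -/
def IsTest {V : Type*} [NormedAddCommGroup V] [NormedSpace ℝ V]
    (Ω : Set (Vec n)) (φ : Vec n → V) : Prop :=
  ContDiff ℝ ∞ φ ∧ HasCompactSupport φ ∧ tsupport φ ⊆ Ω

/-- The `j`-th partial derivative of a differentiable map. -/
def pderiv {V : Type*} [NormedAddCommGroup V] [NormedSpace ℝ V]
    (j : Fin n) (φ : Vec n → V) (x : Vec n) : V :=
  fderiv ℝ φ x (EuclideanSpace.single j 1)

/-- The classical gradient `(∂_j φ_i)_{ij}` of a differentiable map `φ : ℝⁿ → ℝᴺ`. -/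
def grad (φ : Vec n → Vec N) (x : Vec n) : Mat N n :=
  WithLp.toLp 2 fun ij : Fin N × Fin n => pderiv ij.2 φ x ij.1

/-- The row-wise divergence of a differentiable matrix field. -/
def rowDiv (φ : Vec n → Mat N n) (x : Vec n) : Vec N :=
  WithLp.toLp 2 fun i : Fin N => ∑ j : Fin n, pderiv j φ x (i, j)

/-! ### Sobolev spaces -/

/-- `U` is a weak gradient of `u` on the open set `Ω`. -/
def HasWeakGrad (Ω : Set (Vec n)) (u : Vec n → Vec N) (U : Vec n → Mat N n) : Prop :=
  LocallyIntegrableOn u Ω ∧ LocallyIntegrableOn U Ω ∧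
    ∀ φ : Vec n → ℝ, IsTest Ω φ → ∀ (i : Fin N) (j : Fin n),
      ∫ x in Ω, u x i * pderiv j φ x = -∫ x in Ω, U x (i, j) * φ x

open Classical in
/-- The weak gradient `∇u` of `u` on `Ω` (unique up to null sets; `0` if there is none). -/
def weakGrad (Ω : Set (Vec n)) (u : Vec n → Vec N) : Vec n → Mat N n :=
  if h : ∃ U, HasWeakGrad Ω u U then h.choose else 0

/-- `u ∈ W^{1,p}(Ω; ℝᴺ)`. -/
def MemW1 (p : ℝ) (Ω : Set (Vec n)) (u : Vec n → Vec N) : Prop :=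
  MemLp u (ENNReal.ofReal p) (volume.restrict Ω) ∧
    ∃ U, HasWeakGrad Ω u U ∧ MemLp U (ENNReal.ofReal p) (volume.restrict Ω)

/-- `u ∈ W^{1,p}_0(Ω; ℝᴺ)`, the closure of `C_c^∞(Ω; ℝᴺ)` in `W^{1,p}(Ω; ℝᴺ)`. -/
def MemW10 (p : ℝ) (Ω : Set (Vec n)) (u : Vec n → Vec N) : Prop :=
  MemW1 p Ω u ∧ ∀ ε : ℝ≥0∞, 0 < ε → ∃ φ : Vec n → Vec N, IsTest Ω φ ∧
    eLpNorm (u - φ) (ENNReal.ofReal p) (volume.restrict Ω) ≤ ε ∧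
    eLpNorm (weakGrad Ω u - grad φ) (ENNReal.ofReal p) (volume.restrict Ω) ≤ ε

/-- `u ∈ W^{1,p}_v(Ω; ℝᴺ) = v + W^{1,p}_0(Ω; ℝᴺ)`. -/
def MemDirichlet (p : ℝ) (Ω : Set (Vec n)) (v u : Vec n → Vec N) : Prop :=
  MemW1 p Ω u ∧ MemW10 p Ω (u - v)

/-- Weak convergence `u_j ⇀ u` in `W^{1,p}(Ω; ℝᴺ)`, `1 < p < ∞`: all maps belong to the space, and
`u_j ⇀ u`, `∇u_j ⇀ ∇u` weakly in `L^p`, that is, when tested with `L^{p'}`, `p' = p / (p - 1)`. -/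
def WeakTendstoW1 (p : ℝ) (Ω : Set (Vec n)) (w : ℕ → Vec n → Vec N) (u : Vec n → Vec N) : Prop :=
  (∀ k, MemW1 p Ω (w k)) ∧ MemW1 p Ω u ∧
    (∀ f : Vec n → Vec N, MemLp f (ENNReal.ofReal (p / (p - 1))) (volume.restrict Ω) →
      Tendsto (fun k => ∫ x in Ω, inner ℝ (f x) (w k x)) atTop
        (𝓝 (∫ x in Ω, inner ℝ (f x) (u x)))) ∧
    (∀ G : Vec n → Mat N n, MemLp G (ENNReal.ofReal (p / (p - 1))) (volume.restrict Ω) →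
      Tendsto (fun k => ∫ x in Ω, inner ℝ (G x) (weakGrad Ω (w k) x)) atTop
        (𝓝 (∫ x in Ω, inner ℝ (G x) (weakGrad Ω u x))))

/-! ### Functions of bounded variation -/

/-- The total variation `|Du|(Ω)`. -/
def totalVar (Ω : Set (Vec n)) (u : Vec n → Vec N) : ℝ≥0∞ :=
  ⨆ (φ : Vec n → Mat N n) (_ : IsTest Ω φ) (_ : ∀ x, ‖φ x‖ ≤ 1),
    ENNReal.ofReal (∫ x in Ω, inner ℝ (u x) (rowDiv φ x))

/-- `u ∈ BV(Ω; ℝᴺ)`. -/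
def MemBV (Ω : Set (Vec n)) (u : Vec n → Vec N) : Prop :=
  MemLp u 1 (volume.restrict Ω) ∧ totalVar Ω u < ⊤

/-- `T` is the gradient measure `Du` of `u ∈ BV(Ω; ℝᴺ)`, regarded as an element of
`C₀(Ω; ℝ^{N×n})' ≅ RM_fin(Ω; ℝ^{N×n})`: it is the continuous linear functional with
`⟨Du, φ⟩ = -∫_Ω ⟨u, div φ⟩ dx` for all `φ ∈ C_c^∞(Ω; ℝ^{N×n})`. -/
def IsGradMeasure (Ω : Set (Vec n)) (u : Vec n → Vec N) (T : C₀(Ω, Mat N n) →L[ℝ] ℝ) : Prop :=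
  ∀ φ : Vec n → Mat N n, IsTest Ω φ → ∀ ψ : C₀(Ω, Mat N n), (∀ x : Ω, ψ x = φ x) →
    T ψ = -∫ x in Ω, inner ℝ (u x) (rowDiv φ x)

/-- Weak*-convergence in `BV(Ω; ℝᴺ)`: all maps belong to `BV`, `u_j → u` in `L¹(Ω; ℝᴺ)`, and
`Du_j ⇀* Du` in `RM_fin(Ω; ℝ^{N×n}) ≅ C₀(Ω; ℝ^{N×n})'`. -/
def WeakStarTendstoBV (Ω : Set (Vec n)) (w : ℕ → Vec n → Vec N) (u : Vec n → Vec N) : Prop :=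
  (∀ k, MemBV Ω (w k)) ∧ MemBV Ω u ∧
    Tendsto (fun k => eLpNorm (w k - u) 1 (volume.restrict Ω)) atTop (𝓝 0) ∧
    ∃ (S : ℕ → C₀(Ω, Mat N n) →L[ℝ] ℝ) (T : C₀(Ω, Mat N n) →L[ℝ] ℝ),
      (∀ k, IsGradMeasure Ω (w k) (S k)) ∧ IsGradMeasure Ω u T ∧
        ∀ ψ : C₀(Ω, Mat N n), Tendsto (fun k => S k ψ) atTop (𝓝 (T ψ))

/-! ### Boundary traces -/

/-- Surface measure on `∂Ω`: the `(n-1)`-dimensional Hausdorff measure restricted to `∂Ω`. (The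
normalising constant of the Hausdorff measure is irrelevant for null sets and for finiteness of
integrals, the only way in which it is used.) -/
def surfaceMeasure (Ω : Set (Vec n)) : Measure (Vec n) :=
  (Measure.hausdorffMeasure ((n : ℝ) - 1)).restrict (frontier Ω)

/-- `g` is the boundary trace of `u` on `∂Ω`: for `ℋ^{n-1}`-a.e. `x ∈ ∂Ω`, the integral means of
`|u - g(x)|` over `B_r(x) ∩ Ω` tend to zero as `r ↘ 0`. -/
def HasTrace (Ω : Set (Vec n)) (u g : Vec n → Vec N) : Prop :=
  ∀ᵐ x ∂(surfaceMeasure Ω),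
    Tendsto (fun r : ℝ => ⨍⁻ y in Metric.ball x r ∩ Ω, ‖u y - g x‖ₑ ∂volume) (𝓝[>] 0) (𝓝 0)

/-- `u` and `v` have the same trace `ℋ^{n-1}`-a.e. on `∂Ω`. -/
def SameTrace (Ω : Set (Vec n)) (u v : Vec n → Vec N) : Prop :=
  ∃ g : Vec n → Vec N, HasTrace Ω u g ∧ HasTrace Ω v g

/-- `g ∈ W^{1-1/q,q}(∂Ω; ℝᴺ)`: `g ∈ L^q(∂Ω)` and, for `q > 1`, the Gagliardo seminorm of `g` is
finite, with exponent `n - 1 + s q` for `s = 1 - 1/q`; for `q = 1` this is `W^{0,1} := L¹`. -/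
def MemTraceSpace (q : ℝ) (Ω : Set (Vec n)) (g : Vec n → Vec N) : Prop :=
  MemLp g (ENNReal.ofReal q) (surfaceMeasure Ω) ∧
    (1 < q → ∫⁻ x, ∫⁻ y, ‖g x - g y‖ₑ ^ q / edist x y ^ ((n : ℝ) - 1 + (1 - 1 / q) * q)
      ∂(surfaceMeasure Ω) ∂(surfaceMeasure Ω) < ⊤)

/-- `u` has a boundary trace on `∂Ω`, which belongs to `W^{1-1/q,q}(∂Ω; ℝᴺ)`. -/
def TraceMem (q : ℝ) (Ω : Set (Vec n)) (u : Vec n → Vec N) : Prop :=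
  ∃ g : Vec n → Vec N, HasTrace Ω u g ∧ MemTraceSpace q Ω g

/-! ### Hypotheses on the integrand -/

/-- The growth bound `|F(z)| ≤ L (1 + |z|^q)` for some `L > 0`. -/
def GrowthBound (q : ℝ) (F : Mat N n → ℝ) : Prop :=
  ∃ L : ℝ, 0 < L ∧ ∀ z, |F z| ≤ L * (1 + ‖z‖ ^ q)

/-- The reference integrand `V_p(z) = (1 + |z|²)^{p/2} - 1`. -/
def refV (p : ℝ) (z : Mat N n) : ℝ := (1 + ‖z‖ ^ 2) ^ (p / 2) - 1

/-- `G` is quasiconvex at `z₀`. -/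
def QuasiconvexAt (G : Mat N n → ℝ) (z₀ : Mat N n) : Prop :=
  ∀ φ : Vec n → Vec N, IsTest (Metric.ball (0 : Vec n) 1) φ →
    G z₀ ≤ ⨍ x in Metric.ball (0 : Vec n) 1, G (z₀ + grad φ x)

/-- Strong `p`-quasiconvexity: for every `m > 0` there is `ℓ_m > 0` such that `F - ℓ_m V_p` is
quasiconvex at all `z₀` with `|z₀| ≤ m`. -/
def StronglyQuasiconvex (p : ℝ) (F : Mat N n → ℝ) : Prop :=
  ∀ m : ℝ, 0 < m → ∃ l : ℝ, 0 < l ∧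
    ∀ z₀ : Mat N n, ‖z₀‖ ≤ m → QuasiconvexAt (fun z => F z - l * refV p z) z₀

/-! ### The relaxed functionals -/

/-- `ℱ[u; Ω] = ∫_Ω F(∇u) dx`. -/
def energy (F : Mat N n → ℝ) (u : Vec n → Vec N) (Ω : Set (Vec n)) : ℝ :=
  ∫ x in Ω, F (weakGrad Ω u x)

/-- The solid boundary value class: `w ∈ W^{1,q}(Ω'; ℝᴺ)` with `w = u₀` a.e. in `Ω' \ Ω̄`. -/
def SolidClass (q : ℝ) (Ω Ω' : Set (Vec n)) (u₀ w : Vec n → Vec N) : Prop :=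
  MemW1 q Ω' w ∧ w =ᵐ[volume.restrict (Ω' \ closure Ω)] u₀

open Classical in
/-- The map equal to `u` in `Ω` and to `u₀` elsewhere. -/
def glue (Ω : Set (Vec n)) (u u₀ : Vec n → Vec N) : Vec n → Vec N := Ω.piecewise u u₀

/-- The weak*-relaxed functional on `BV(Ω'; ℝᴺ)` for solid boundary values `u₀`. -/
def solidRelaxedBV (q : ℝ) (F : Mat N n → ℝ) (u₀ U : Vec n → Vec N) (Ω Ω' : Set (Vec n)) : EReal :=
  sInf {e | ∃ w : ℕ → Vec n → Vec N, (∀ k, SolidClass q Ω Ω' u₀ (w k)) ∧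
    WeakStarTendstoBV Ω' w U ∧ e = liminf (fun k => (energy F (w k) Ω' : EReal)) atTop}

/-- The weakly relaxed functional on `W^{1,p}(Ω'; ℝᴺ)` for solid boundary values `u₀`. -/
def solidRelaxedW1 (p q : ℝ) (F : Mat N n → ℝ) (u₀ U : Vec n → Vec N) (Ω Ω' : Set (Vec n)) :
    EReal :=
  sInf {e | ∃ w : ℕ → Vec n → Vec N, (∀ k, SolidClass q Ω Ω' u₀ (w k)) ∧
    WeakTendstoW1 p Ω' w U ∧ e = liminf (fun k => (energy F (w k) Ω' : EReal)) atTop}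

/-- `(Ω', u₀)` is an admissible choice of solid boundary values for the Dirichlet datum `v`:
`Ω'` is open and bounded with `Ω ⋐ Ω'`, and `u₀ ∈ W^{1,q}(Ω'; ℝᴺ)` has the trace of `v` on `∂Ω`. -/
def IsSolidDatum (q : ℝ) (Ω : Set (Vec n)) (v : Vec n → Vec N)
    (Ω' : Set (Vec n)) (u₀ : Vec n → Vec N) : Prop :=
  IsOpen Ω' ∧ Bornology.IsBounded Ω' ∧ closure Ω ⊆ Ω' ∧ MemW1 q Ω' u₀ ∧ SameTrace Ω u₀ v

/-- `ℱ̄*_v[u; Ω]`: the value computed from an admissible choice `(Ω', u₀)`. The value is the same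
for all choices (asserted alongside the existence of minimizers); the infimum serves to pick
it, and it is `+∞` if there is no admissible choice. -/
def relaxedBV (q : ℝ) (F : Mat N n → ℝ) (v u : Vec n → Vec N) (Ω : Set (Vec n)) : EReal :=
  sInf {e | ∃ Ω' u₀, IsSolidDatum q Ω v Ω' u₀ ∧
    e = solidRelaxedBV q F u₀ (glue Ω u u₀) Ω Ω' - (energy F u₀ (Ω' \ closure Ω) : EReal)}

/-- `ℱ̄_v[u; Ω]`: the value computed from an admissible choice `(Ω', u₀)`, as for `relaxedBV`. -/
def relaxedW1 (p q : ℝ) (F : Mat N n → ℝ) (v u : Vec n → Vec N) (Ω : Set (Vec n)) : EReal :=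
  sInf {e | ∃ Ω' u₀, IsSolidDatum q Ω v Ω' u₀ ∧
    e = solidRelaxedW1 p q F u₀ (glue Ω u u₀) Ω Ω' - (energy F u₀ (Ω' \ closure Ω) : EReal)}

/-- `u` is a `BV`-minimizer of `ℱ̄*_v[-; Ω]`, with finite minimal value. -/
def IsBVMinimizer (q : ℝ) (F : Mat N n → ℝ) (v u : Vec n → Vec N) (Ω : Set (Vec n)) : Prop :=
  MemBV Ω u ∧ ⊥ < relaxedBV q F v u Ω ∧ relaxedBV q F v u Ω < ⊤ ∧
    ∀ w, MemBV Ω w → relaxedBV q F v u Ω ≤ relaxedBV q F v w Ω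

/-- `u` is a minimizer of `ℱ̄_v[-; Ω]` among all maps in `W^{1,p}(Ω; ℝᴺ)`, with finite minimal
value. -/
def IsW1Minimizer (p q : ℝ) (F : Mat N n → ℝ) (v u : Vec n → Vec N) (Ω : Set (Vec n)) : Prop :=
  MemW1 p Ω u ∧ ⊥ < relaxedW1 p q F v u Ω ∧ relaxedW1 p q F v u Ω < ⊤ ∧
    ∀ w, MemW1 p Ω w → relaxedW1 p q F v u Ω ≤ relaxedW1 p q F v w Ω

end RelaxedMin

end

open RelaxedMin

namespace RelaxedMin

variable {n N : ℕ}

/-! ### Test functions -/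

section Test
variable {V : Type*} [NormedAddCommGroup V] [NormedSpace ℝ V] {O O' : Set (Vec n)}

/-! The proof is the direct method; the work lies in making its ingredients available.

Existence. On the solid class over a large ball, the energy is coercive in `L^p` of the gradient
(`StronglyQuasiconvex.coercive`). Quasiconvexity of `F - ℓ V_p` is used only at the origin, and is
tested with the competitor plus a fixed cut-off copy of the boundary values, so that the test map
has compact support in the ball. Hence the infimum `m` of the energy over the solid class is finite
and minimizing sequences have bounded gradients. After subtracting `u₀` they vanish off `Ω`, and
Rellich compactness (`exists_subseq_sobolev`, `exists_subseq_sobolev_weak`) yields a limit, weak* in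
`BV` or weak in `W^{1,p}`. The subsequence is admissible in the definition of the relaxed functional
at its limit, so the value there is at most `m`. On the other hand each admissible sequence for any
map has energies at least `m`, so every relaxed value is at least `m`. No lower semicontinuity of
the energy enters. For `p > 1` the limit also belongs to the Dirichlet class of `v`: its difference
to `v` extends by zero to a Sobolev map on the whole space, and on a Lipschitz domain such maps are
limits of test maps (`IsLipDomain.testApprox`).

Independence of `(Ω', u₀)`. Replacing the outer values `u₁` of a competitor by `u₂` keeps it a
Sobolev map, because `u₁ - u₂` has zero trace on `∂Ω` and may be extended by zero
(`HasWeakGrad.zero_trace`, `memW1_glue`). The energy changes by a constant that the normalisation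
removes, and the mode of convergence is preserved. In `BV` this rests on the equivalence of weak*
convergence with `L¹` convergence plus bounded variations, from Banach–Steinhaus in one direction
and density of test maps in the other.

Admissible data exist by extension of boundary values (`exists_solidDatum`). For `q > 1` the
boundary function is averaged over the boundary at a scale equal to the distance from it, and the
Gagliardo seminorm bounds the gradient. For `q = 1` the boundary function is a series of smooth
functions, each extended to a very thin collar. Both constructions, and the zero extension, rest on
the `(n-1)`-regularity of surface measure (`boundary_regular`), read off from the Lipschitz charts.
-/

lemma IsTest.mono {φ : Vec n → V} (h : IsTest O φ) (hO : O ⊆ O') : IsTest O' φ :=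
  ⟨h.1, h.2.1, h.2.2.trans hO⟩

lemma tsupport_pderiv_subset (j : Fin n) (φ : Vec n → V) : tsupport (pderiv j φ) ⊆ tsupport φ := by
  refine closure_minimal (fun x hx => ?_) (isClosed_tsupport φ)
  by_contra h
  apply hx
  have : fderiv ℝ φ x = 0 := by
    by_contra h'
    exact h (support_fderiv_subset ℝ h')
  simp [pderiv, this]

lemma IsTest.pderiv {φ : Vec n → V} (h : IsTest O φ) (j : Fin n) : IsTest O (pderiv j φ) := by
  refine ⟨?_, h.2.1.mono' ((subset_tsupport _).trans (tsupport_pderiv_subset j φ)),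
    (tsupport_pderiv_subset j φ).trans h.2.2⟩
  unfold RelaxedMin.pderiv
  exact (h.1.fderiv_right (m := ∞) le_rfl).clm_apply contDiff_const

lemma IsTest.continuous {φ : Vec n → V} (h : IsTest O φ) : Continuous φ := h.1.continuous

lemma IsTest.differentiable {φ : Vec n → V} (h : IsTest O φ) : Differentiable ℝ φ :=
  h.1.differentiable (by simp)

lemma IsTest.eq_zero {φ : Vec n → V} (h : IsTest O φ) {x : Vec n} (hx : x ∉ O) : φ x = 0 :=
  image_eq_zero_of_notMem_tsupport (fun h' => hx (h.2.2 h'))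

lemma IsTest.add {φ ψ : Vec n → V} (h : IsTest O φ) (h' : IsTest O ψ) :
    IsTest O (fun x => φ x + ψ x) :=
  ⟨h.1.add h'.1, h.2.1.add h'.2.1, (tsupport_add φ ψ).trans (union_subset h.2.2 h'.2.2)⟩

lemma IsTest.smul_left {φ : Vec n → V} (h : IsTest O φ) {χ : Vec n → ℝ} (hχ : ContDiff ℝ ∞ χ) :
    IsTest O (fun x => χ x • φ x) :=
  ⟨hχ.smul h.1, h.2.1.smul_left, (tsupport_smul_subset_right χ φ).trans h.2.2⟩

lemma IsTest.mul_left {φ : Vec n → ℝ} (h : IsTest O φ) {χ : Vec n → ℝ} (hχ : ContDiff ℝ ∞ χ) :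
    IsTest O (fun x => χ x * φ x) := h.smul_left hχ

lemma IsTest.mul_of_left {φ : Vec n → ℝ} (h : IsTest O φ) {χ : Vec n → ℝ} (hχ : ContDiff ℝ ∞ χ) :
    IsTest O (fun x => φ x * χ x) := by
  simpa only [mul_comm] using h.mul_left hχ

lemma isTest_zero : IsTest O (fun _ : Vec n => (0 : V)) :=
  ⟨contDiff_const, HasCompactSupport.zero, by simp [tsupport]⟩

lemma IsTest.const_smul {φ : Vec n → V} (h : IsTest O φ) (c : ℝ) : IsTest O (fun x => c • φ x) :=
  h.smul_left contDiff_const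

lemma IsTest.sum {ι : Type*} (s : Finset ι) {φ : ι → Vec n → V} (h : ∀ i ∈ s, IsTest O (φ i)) :
    IsTest O (fun x => ∑ i ∈ s, φ i x) := by
  classical
  induction s using Finset.induction_on with
  | empty => simpa using isTest_zero
  | insert a s ha ih =>
    simp only [Finset.sum_insert ha]
    exact (h a (by simp)).add (ih fun i hi => h i (by simp [hi]))

lemma pderiv_mul {φ ψ : Vec n → ℝ} {x : Vec n} (hφ : DifferentiableAt ℝ φ x)
    (hψ : DifferentiableAt ℝ ψ x) (j : Fin n) :
    pderiv j (fun x => φ x * ψ x) x = φ x * pderiv j ψ x + pderiv j φ x * ψ x := by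
  simp only [pderiv]
  rw [fderiv_fun_mul hφ hψ]
  simp [mul_comm]

lemma abs_pderiv_le {φ : Vec n → ℝ} {K : NNReal} (h : LipschitzWith K φ) (j : Fin n) (x : Vec n) :
    |pderiv j φ x| ≤ K := by
  have h1 := (fderiv ℝ φ x).le_opNorm (EuclideanSpace.single j (1 : ℝ))
  have h2 := norm_fderiv_le_of_lipschitz ℝ h (x₀ := x)
  simp only [PiLp.norm_single, norm_one, mul_one] at h1
  exact h1.trans h2

lemma IsTest.isTest_coord {ι : Type*} [Fintype ι] {φ : Vec n → EuclideanSpace ℝ ι} (h : IsTest O φ)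
    (i : ι) : IsTest O (fun x => φ x i) := by
  have hs : tsupport (fun x => φ x i) ⊆ tsupport φ := by
    refine closure_mono fun x hx h' => hx ?_
    show φ x i = 0
    simp [h']
  refine ⟨?_, h.2.1.mono' ((subset_tsupport _).trans hs), hs.trans h.2.2⟩
  exact (contDiff_euclidean.1 h.1) i

lemma isTest_of_coord {ι : Type*} [Fintype ι] {φ : Vec n → EuclideanSpace ℝ ι}
    (h : ∀ i, IsTest O (fun x => φ x i)) : IsTest O φ := by
  have hsub : tsupport φ ⊆ ⋃ i, tsupport (fun x => φ x i) := by
    refine closure_minimal (fun x hx => ?_) (isClosed_iUnion_of_finite fun i => isClosed_tsupport _)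
    by_contra h'
    simp only [mem_iUnion, not_exists] at h'
    apply hx
    ext i
    simpa using image_eq_zero_of_notMem_tsupport (h' i)
  have hc : IsCompact (⋃ i, tsupport (fun x => φ x i)) := isCompact_iUnion fun i => (h i).2.1
  exact ⟨contDiff_euclidean.2 fun i => (h i).1, hc.of_isClosed_subset (isClosed_tsupport _) hsub,
    hsub.trans (iUnion_subset fun i => (h i).2.2)⟩

lemma pderiv_coord {ι : Type*} [Fintype ι] {φ : Vec n → EuclideanSpace ℝ ι} {x : Vec n}
    (h : DifferentiableAt ℝ φ x) (j : Fin n) (i : ι) :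
    pderiv j φ x i = pderiv j (fun x => φ x i) x := by
  have := ((EuclideanSpace.proj (𝕜 := ℝ) i).hasFDerivAt.comp x h.hasFDerivAt).fderiv
  simp only [pderiv]
  have h2 : (fun x => φ x i) = (EuclideanSpace.proj (𝕜 := ℝ) i) ∘ φ := rfl
  rw [h2, this]; rfl

lemma integrable_mul_of_tsupport_subset {u g : Vec n → ℝ} (hu : LocallyIntegrableOn u O)
    (hg : Continuous g) (hc : HasCompactSupport g) (hs : tsupport g ⊆ O) :
    Integrable (fun x => u x * g x) := by
  have h1 : IntegrableOn u (tsupport g) := hu.integrableOn_compact_subset hs hc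
  have h2 : IntegrableOn (fun x => u x * g x) (tsupport g) :=
    h1.mul_continuousOn hg.continuousOn hc
  refine (integrableOn_iff_integrable_of_support_subset fun x hx => ?_).1 h2
  by_contra h
  exact hx (by simp [image_eq_zero_of_notMem_tsupport h])

lemma IsTest.integrable_mul {u g : Vec n → ℝ} (hg : IsTest O g) (hu : LocallyIntegrableOn u O) :
    Integrable (fun x => u x * g x) :=
  integrable_mul_of_tsupport_subset hu hg.continuous hg.2.1 hg.2.2

lemma IsTest.setIntegral_mul {g : Vec n → ℝ} (hg : IsTest O g) (u : Vec n → ℝ) :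
    ∫ x in O, u x * g x = ∫ x, u x * g x :=
  setIntegral_eq_integral_of_forall_compl_eq_zero fun x hx => by simp [hg.eq_zero hx]

end Test

/-! ### Weak partial derivatives of scalar functions -/

/-- `w` is the weak `j`-th partial derivative of `u` on the open set `O`. -/
structure WD (O : Set (Vec n)) (j : Fin n) (u w : Vec n → ℝ) : Prop where
  locL : LocallyIntegrableOn u O
  locR : LocallyIntegrableOn w O
  parts : ∀ φ : Vec n → ℝ, IsTest O φ → ∫ x, u x * pderiv j φ x = -∫ x, w x * φ x

section WDcalc
variable {O O' : Set (Vec n)} {j : Fin n} {u w u' w' : Vec n → ℝ}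

lemma locallyIntegrableOn_coord {ι : Type*} [Fintype ι] {u : Vec n → EuclideanSpace ℝ ι} :
    LocallyIntegrableOn u O ↔ ∀ i, LocallyIntegrableOn (fun x => u x i) O := by
  constructor
  · intro h i x hx
    obtain ⟨s, hs, h'⟩ := h x hx
    exact ⟨s, hs, integrable_piLp_iff.1 h' i⟩
  · intro h x hx
    choose s hs h' using fun i => h i x hx
    refine ⟨⋂ i, s i, Filter.iInter_mem.2 hs, ?_⟩
    exact integrable_piLp_iff.2 fun i => (h' i).mono_set (iInter_subset _ i)

/-- Test functions vanish off `O`, so the integrals over `O` may be taken over the whole space. This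
reduces the calculus of weak gradients to scalar components. -/
lemma hasWeakGrad_iff {u : Vec n → Vec N} {U : Vec n → Mat N n} :
    HasWeakGrad O u U ↔ LocallyIntegrableOn u O ∧ LocallyIntegrableOn U O ∧
      ∀ i j, WD O j (fun x => u x i) (fun x => U x (i, j)) := by
  constructor
  · rintro ⟨h1, h2, h3⟩
    refine ⟨h1, h2, fun i j => ⟨locallyIntegrableOn_coord.1 h1 i, locallyIntegrableOn_coord.1 h2 _,
      fun φ hφ => ?_⟩⟩
    rw [← hφ.setIntegral_mul, ← (hφ.pderiv j).setIntegral_mul]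
    exact h3 φ hφ i j
  · rintro ⟨h1, h2, h3⟩
    refine ⟨h1, h2, fun φ hφ i j => ?_⟩
    have := (h3 i j).parts φ hφ
    rw [← hφ.setIntegral_mul, ← (hφ.pderiv j).setIntegral_mul] at this
    exact this

lemma WD.mono (h : WD O j u w) (hO : O' ⊆ O) : WD O' j u w :=
  ⟨h.locL.mono_set hO, h.locR.mono_set hO, fun φ hφ => h.parts φ (hφ.mono hO)⟩

lemma integral_mul_test_congr {g : Vec n → ℝ} (hg : IsTest O g)
    (h : u =ᵐ[volume.restrict O] u') : ∫ x, u x * g x = ∫ x, u' x * g x := by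
  rw [← hg.setIntegral_mul, ← hg.setIntegral_mul]
  exact integral_congr_ae (h.mono fun x hx => by simp [hx])

lemma WD.congr (h : WD O j u w) (hu : u =ᵐ[volume.restrict O] u')
    (hw : w =ᵐ[volume.restrict O] w') : WD O j u' w' := by
  refine ⟨h.locL.congr hu, h.locR.congr hw, fun φ hφ => ?_⟩
  rw [← integral_mul_test_congr hφ hw, ← integral_mul_test_congr (hφ.pderiv j) hu]
  exact h.parts φ hφ

lemma WD.add (h : WD O j u w) (h' : WD O j u' w') :
    WD O j (fun x => u x + u' x) (fun x => w x + w' x) := by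
  refine ⟨h.locL.add h'.locL, h.locR.add h'.locR, fun φ hφ => ?_⟩
  simp only [add_mul]
  rw [integral_add ((hφ.pderiv j).integrable_mul h.locL) ((hφ.pderiv j).integrable_mul h'.locL),
    integral_add (hφ.integrable_mul h.locR) (hφ.integrable_mul h'.locR), h.parts φ hφ,
    h'.parts φ hφ]
  ring

lemma WD.const_mul (h : WD O j u w) (c : ℝ) :
    WD O j (fun x => c * u x) (fun x => c * w x) := by
  refine ⟨h.locL.smul c, h.locR.smul c, fun φ hφ => ?_⟩
  simp only [mul_assoc]
  rw [integral_const_mul, integral_const_mul, h.parts φ hφ]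
  ring

lemma WD.neg (h : WD O j u w) : WD O j (fun x => - u x) (fun x => - w x) := by
  simpa using h.const_mul (-1)

lemma WD.sub (h : WD O j u w) (h' : WD O j u' w') :
    WD O j (fun x => u x - u' x) (fun x => w x - w' x) := by
  simpa [sub_eq_add_neg] using h.add h'.neg

/-- The difference integrates to zero against every test function, so the fundamental lemma of the
calculus of variations applies. -/
lemma WD.unique (h : WD O j u w) (h' : WD O j u w') (hO : IsOpen O) :
    w =ᵐ[volume.restrict O] w' := by
  have := hO.ae_eq_zero_of_integral_contDiff_smul_eq_zero (μ := volume)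
    (f := fun x => w x - w' x) (h.locR.sub h'.locR) (fun g h1 h2 h3 => by
      have hg : IsTest O g := ⟨h1, h2, h3⟩
      have e1 := h.parts g hg
      have e2 := h'.parts g hg
      simp only [smul_eq_mul, mul_sub]
      simp only [mul_comm (g _)]
      rw [integral_sub (hg.integrable_mul h.locR) (hg.integrable_mul h'.locR)]
      linarith)
  rw [EventuallyEq, ae_restrict_iff' hO.measurableSet]
  filter_upwards [this] with x hx hxO
  have := hx hxO
  linarith

lemma WD.unique' (h : WD O j u w) (h' : WD O j u' w') (hO : IsOpen O)
    (hu : u =ᵐ[volume.restrict O] u') : w =ᵐ[volume.restrict O] w' :=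
  (h.congr hu EventuallyEq.rfl).unique h' hO

lemma WD.eq_zero (h : WD O j u w) (hO : IsOpen O) (hu : u =ᵐ[volume.restrict O] 0) :
    w =ᵐ[volume.restrict O] 0 := by
  refine h.unique' (u' := fun _ => 0) (w' := fun _ => 0) ?_ hO hu
  exact ⟨locallyIntegrableOn_zero, locallyIntegrableOn_zero, by simp⟩

/-- Leibniz rule: `χ φ` is again a test function, and its classical product rule moves the
derivative of `χ` to the other side. -/
lemma WD.smooth_mul (h : WD O j u w) {χ : Vec n → ℝ} (hχ : ContDiff ℝ ∞ χ) :
    WD O j (fun x => χ x * u x) (fun x => χ x * w x + pderiv j χ x * u x) := by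
  have hpc : Continuous (pderiv j χ) := by
    unfold pderiv
    exact ((hχ.continuous_fderiv (by simp)).clm_apply continuous_const)
  have loc : ∀ {f g : Vec n → ℝ}, LocallyIntegrableOn f O → Continuous g →
      LocallyIntegrableOn (fun x => g x * f x) O := by
    intro f g hf hg x hx
    obtain ⟨s, hs, hi⟩ := hf x hx
    obtain ⟨K, hK, hKx⟩ := exists_compact_mem_nhds x
    refine ⟨s ∩ interior K, inter_mem hs (mem_nhdsWithin_of_mem_nhds (interior_mem_nhds.2 hKx)), ?_⟩
    have hb := hK.exists_bound_of_continuousOn hg.continuousOn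
    obtain ⟨C, hC⟩ := hb
    have hi' : IntegrableOn f (s ∩ interior K) := hi.mono_set inter_subset_left
    have : IntegrableOn f (s ∩ interior K) := hi'
    refine Integrable.bdd_mul (c := C) hi' hg.aestronglyMeasurable ?_
    have : ∀ᵐ y ∂(volume.restrict (s ∩ interior K)), y ∈ interior K := by
      have h0 := ae_restrict_mem (μ := (volume : Measure (Vec n)).restrict s)
        (isOpen_interior (s := K)).measurableSet
      rw [Measure.restrict_restrict isOpen_interior.measurableSet] at h0
      rwa [inter_comm]
    filter_upwards [this] with y hy using hC y (interior_subset hy)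
  refine ⟨loc h.locL hχ.continuous, (loc h.locR hχ.continuous).add (loc h.locL hpc),
    fun φ hφ => ?_⟩
  have hχφ := hφ.mul_left hχ
  have e := h.parts _ hχφ
  have hd : ∀ x, pderiv j (fun x => χ x * φ x) x = χ x * pderiv j φ x + pderiv j χ x * φ x :=
    fun x => pderiv_mul (hχ.differentiable (by simp) x) (hφ.differentiable x) j
  simp only [hd, mul_add] at e
  have t1 : IsTest O (fun x => χ x * pderiv j φ x) := (hφ.pderiv j).mul_left hχ
  have hpχ : ContDiff ℝ ∞ (pderiv j χ) := by
    unfold pderiv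
    exact (hχ.fderiv_right (m := ∞) le_rfl).clm_apply contDiff_const
  have t2 : IsTest O (fun x => pderiv j χ x * φ x) := hφ.mul_left hpχ
  rw [integral_add (t1.integrable_mul h.locL) (t2.integrable_mul h.locL)] at e
  have e1 : ∫ x, χ x * u x * pderiv j φ x = ∫ x, u x * (χ x * pderiv j φ x) := by
    congr 1; ext x; ring
  have e2 : ∫ x, (χ x * w x + pderiv j χ x * u x) * φ x =
      (∫ x, w x * (χ x * φ x)) + ∫ x, u x * (pderiv j χ x * φ x) := by
    rw [← integral_add (hχφ.integrable_mul h.locR) (t2.integrable_mul h.locL)]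
    congr 1; ext x; ring
  rw [e1, e2]
  linarith

/-- A smooth cutoff between a compact set and an open neighbourhood. -/
lemma exists_cutoff {K O : Set (Vec n)} (hK : IsCompact K) (hO : IsOpen O) (hKO : K ⊆ O) :
    ∃ χ : Vec n → ℝ, IsTest O χ ∧ (∀ᶠ x in 𝓝ˢ K, χ x = 1) ∧ ∀ x, χ x ∈ Icc (0 : ℝ) 1 := by
  obtain ⟨K', hK', hKK', hK'O⟩ := exists_compact_between hK hO hKO
  obtain ⟨K'', hK'', hKK'', hK''O⟩ := exists_compact_between hK' hO hK'O
  obtain ⟨f, hf1, hf2, hf3⟩ := exists_contMDiff_zero_iff_one_iff_of_isClosed (modelWithCornersSelf ℝ (Vec n))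
    (n := (⊤ : ℕ∞)) (s := (interior K'')ᶜ) (t := K') isOpen_interior.isClosed_compl hK'.isClosed
    (by rw [disjoint_compl_left_iff_subset]; exact hKK'')
  have hsupp : tsupport f ⊆ K'' := by
    refine closure_minimal (fun x hx => ?_) hK''.isClosed
    by_contra h'
    exact hx ((hf3.1 x).1 (fun h => h' (interior_subset h)))
  refine ⟨f, ⟨hf1.contDiff, hK''.of_isClosed_subset (isClosed_tsupport _) hsupp, hsupp.trans hK''O⟩,
    ?_, fun x => hf2 ⟨x, rfl⟩⟩
  have : interior K' ∈ 𝓝ˢ K := isOpen_interior.mem_nhdsSet.2 hKK'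
  filter_upwards [this] with x hx
  exact (hf3.2 x).1 (interior_subset hx)

/-- A weakly differentiable function vanishing off a compact subset `K` of `O` is weakly
differentiable on the whole space. -/
lemma WD.extend_zero (h : WD O j u w) (hO : IsOpen O) {K : Set (Vec n)} (hK : IsCompact K)
    (hKO : K ⊆ O) (hu : ∀ x ∉ K, u x = 0) (hw : ∀ x ∉ K, w x = 0) : WD univ j u w := by
  have loc : ∀ {f : Vec n → ℝ}, LocallyIntegrableOn f O → (∀ x ∉ K, f x = 0) →
      LocallyIntegrableOn f univ := by
    intro f hf h0
    have h1 : IntegrableOn f K := hf.integrableOn_compact_subset hKO hK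
    have h2 : Integrable f := (integrableOn_iff_integrable_of_support_subset fun x hx => by
      by_contra h'; exact hx (h0 x h')).1 h1
    exact h2.locallyIntegrable.locallyIntegrableOn _
  refine ⟨loc h.locL hu, loc h.locR hw, fun φ hφ => ?_⟩
  -- A test function `φ` on the whole space is not admissible on `O`, but `χ φ` is, and it agrees
  -- with `φ` near `K`, off which `u` and `w` vanish.
  obtain ⟨χ, hχ, hχ1, -⟩ := exists_cutoff hK hO hKO
  have e := h.parts _ (hχ.mul_of_left hφ.1)
  have hx1 : ∀ x ∈ K, χ =ᶠ[𝓝 x] fun _ => 1 := by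
    intro x hx
    exact (mem_nhdsSet_iff_forall.1 hχ1) x hx
  have e1 : ∀ x, u x * pderiv j (fun x => χ x * φ x) x = u x * pderiv j φ x := by
    intro x
    by_cases hx : x ∈ K
    · have : (fun x => χ x * φ x) =ᶠ[𝓝 x] φ := (hx1 x hx).mono fun y hy => by
        simp only at hy; simp [hy]
      simp only [pderiv, this.fderiv_eq]
    · simp [hu x hx]
  have e2 : ∀ x, w x * (χ x * φ x) = w x * φ x := by
    intro x
    by_cases hx : x ∈ K
    · simp [(hx1 x hx).eq_of_nhds]
    · simp [hw x hx]
  simpa only [e1, e2] using e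

end WDcalc

/-! ### Translations and mollification -/

section Moll
open scoped Convolution
open ContinuousLinearMap (lsmul)

/-- Translation is continuous in `L^p`, `p < ∞`. -/
lemma tendsto_eLpNorm_translate {F : Type*} [NormedAddCommGroup F] {p : ℝ≥0∞} (hp1 : 1 ≤ p)
    (hp : p ≠ ⊤) {f : Vec n → F} (hf : MemLp f p) :
    Tendsto (fun t : Vec n => eLpNorm (fun x => f (x - t) - f x) p) (𝓝 0) (𝓝 0) := by
  have : Fact (1 ≤ p) := ⟨hp1⟩
  -- By currying, the translations form a continuous family for the compact-open topology, and
  -- composition with measure-preserving maps is continuous in `L^p` for that topology.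
  let g : Vec n → C(Vec n, Vec n) := fun t => ⟨fun x => x - t, by fun_prop⟩
  have hg : Continuous g := by
    let G : C(Vec n × Vec n, Vec n) := ⟨fun z => z.2 - z.1, by fun_prop⟩
    exact G.curry.continuous
  have hgm : ∀ t, MeasurePreserving (g t) (volume : Measure (Vec n)) volume := fun t =>
    measurePreserving_sub_right volume t
  have hc : Continuous fun t => Lp.compMeasurePreserving (g t) (hgm t) (hf.toLp f) :=
    continuous_const.compMeasurePreservingLp hg hgm hp
  have h0 : Tendsto (fun t => ‖Lp.compMeasurePreserving (g t) (hgm t) (hf.toLp f) - hf.toLp f‖ₑ)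
      (𝓝 0) (𝓝 ‖Lp.compMeasurePreserving (g 0) (hgm 0) (hf.toLp f) - hf.toLp f‖ₑ) :=
    (hc.sub (continuous_const (y := hf.toLp f))).enorm.tendsto 0
  have e : ∀ t, ‖Lp.compMeasurePreserving (g t) (hgm t) (hf.toLp f) - hf.toLp f‖ₑ =
      eLpNorm (fun x => f (x - t) - f x) p := by
    intro t
    rw [Lp.enorm_def]
    refine eLpNorm_congr_ae ?_
    have h1 := Lp.coeFn_compMeasurePreserving (hf.toLp f) (hgm t)
    have h2 := hf.coeFn_toLp
    have h3 := (hgm t).quasiMeasurePreserving.ae_eq_comp h2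
    filter_upwards [Lp.coeFn_sub (Lp.compMeasurePreserving (g t) (hgm t) (hf.toLp f)) (hf.toLp f),
      h1, h2, h3] with x a1 a2 a3 a4
    rw [a1, Pi.sub_apply, a2, a3, a4]
    rfl
  simp only [e] at h0
  simpa using h0

/-- The standard bump function of radius `1 / (k + 1)`. -/
noncomputable def bump (n k : ℕ) : ContDiffBump (0 : Vec n) where
  rIn := 1 / (2 * ((k : ℝ) + 1))
  rOut := 1 / ((k : ℝ) + 1)
  rIn_pos := by positivity
  rIn_lt_rOut := by
    apply one_div_lt_one_div_of_lt <;> [positivity; linarith [show (0 : ℝ) ≤ k by positivity]]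

/-- The mollification kernel. -/
noncomputable def ker (n k : ℕ) : Vec n → ℝ := (bump n k).normed volume

lemma ker_nonneg (k : ℕ) (x : Vec n) : 0 ≤ ker n k x := (bump n k).nonneg_normed x
lemma ker_contDiff (k : ℕ) : ContDiff ℝ ∞ (ker n k) := (bump n k).contDiff_normed
lemma ker_compact (k : ℕ) : HasCompactSupport (ker n k) := (bump n k).hasCompactSupport_normed
lemma integral_ker (k : ℕ) : ∫ x, ker n k x = 1 := (bump n k).integral_normed
lemma ker_continuous (k : ℕ) : Continuous (ker n k) := (ker_contDiff k).continuous
lemma ker_eq_zero {k : ℕ} {x : Vec n} (h : 1 / ((k : ℝ) + 1) ≤ ‖x‖) : ker n k x = 0 := by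
  have : Function.support (ker n k) = Metric.ball 0 (1 / ((k : ℝ) + 1)) :=
    (bump n k).support_normed_eq
  by_contra h'
  have h2 : x ∈ Function.support (ker n k) := h'
  rw [this] at h2
  simp only [Metric.mem_ball, dist_zero_right] at h2
  linarith
lemma ker_integrable (k : ℕ) : Integrable (ker n k) :=
  (ker_continuous k).integrable_of_hasCompactSupport (ker_compact k)

/-- Mollification at scale `1 / (k + 1)`. -/
noncomputable def moll (k : ℕ) (f : Vec n → ℝ) : Vec n → ℝ :=
  ker n k ⋆[lsmul ℝ ℝ, volume] f

lemma moll_apply (k : ℕ) (f : Vec n → ℝ) (x : Vec n) :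
    moll k f x = ∫ t, ker n k t * f (x - t) := rfl

lemma moll_apply' (k : ℕ) (f : Vec n → ℝ) (x : Vec n) :
    moll k f x = ∫ t, f t * ker n k (x - t) := by
  rw [moll, convolution_lsmul_swap]
  simp [mul_comm]

lemma moll_contDiff (k : ℕ) {f : Vec n → ℝ} (hf : LocallyIntegrable f) :
    ContDiff ℝ ∞ (moll k f) :=
  (ker_compact k).contDiff_convolution_left _ (ker_contDiff k) hf

lemma moll_eq_zero {k : ℕ} {f : Vec n → ℝ} {x : Vec n}
    (h : ∀ y, ‖y - x‖ < 1 / ((k : ℝ) + 1) → f y = 0) : moll k f x = 0 := by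
  rw [moll_apply]
  refine integral_eq_zero_of_ae (Eventually.of_forall fun t => ?_)
  by_cases ht : ‖t‖ < 1 / ((k : ℝ) + 1)
  · simp [h (x - t) (by simpa using ht)]
  · simp [ker_eq_zero (not_lt.1 ht)]

lemma moll_tsupport {k : ℕ} {f : Vec n → ℝ} {K : Set (Vec n)} (hf : ∀ x ∉ K, f x = 0) :
    tsupport (moll k f) ⊆ Metric.cthickening (1 / ((k : ℝ) + 1)) K := by
  refine closure_minimal (fun x hx => ?_) Metric.isClosed_cthickening
  by_contra h
  refine hx (moll_eq_zero fun y hy => ?_)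
  by_contra h'
  have hyK : y ∈ K := by by_contra h''; exact h' (hf y h'')
  exact h (Metric.mem_cthickening_of_dist_le x y _ K hyK (by
    rw [dist_comm, dist_eq_norm]; exact hy.le))

/-- Mollification enlarges the support by at most `1 / (k + 1)`, which fits between `K` and the
complement of `O` once `k` is large. -/
lemma isTest_moll {f : Vec n → ℝ} (hf : LocallyIntegrable f) {K O : Set (Vec n)}
    (hK : IsCompact K) (hO : IsOpen O) (hKO : K ⊆ O) (h0 : ∀ x ∉ K, f x = 0) :
    ∀ᶠ k : ℕ in atTop, IsTest O (moll k f) := by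
  obtain ⟨δ, hδ, hδO⟩ := hK.exists_cthickening_subset_open hO hKO
  have : ∀ᶠ k : ℕ in atTop, 1 / ((k : ℝ) + 1) < δ :=
    (tendsto_one_div_add_atTop_nhds_zero_nat (𝕜 := ℝ)).eventually_lt_const hδ
  filter_upwards [this] with k hk
  have hs : tsupport (moll k f) ⊆ Metric.cthickening δ K :=
    (moll_tsupport h0).trans (Metric.cthickening_mono hk.le K)
  exact ⟨moll_contDiff k hf, hK.cthickening.of_isClosed_subset (isClosed_tsupport _) hs,
    hs.trans hδO⟩

/-- The derivative falls on the kernel. Since `t ↦ ker n k (x - t)` is a test function, the weak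
derivative of `u` takes it over; the sign from the reflection cancels the sign from integration by
parts. -/
lemma pderiv_moll (k : ℕ) {j : Fin n} {u w : Vec n → ℝ} (h : WD univ j u w) (x : Vec n) :
    pderiv j (moll k u) x = moll k w x := by
  have hu : LocallyIntegrable u := locallyIntegrableOn_univ.1 h.locL
  have h1 := ((ker_compact k).hasFDerivAt_convolution_left (lsmul ℝ ℝ) (μ := volume)
    ((ker_contDiff k).of_le (by simp)) hu x).fderiv
  unfold pderiv moll
  rw [h1]
  have hcd : ContDiff ℝ ∞ (fun t => ker n k (x - t)) :=
    (ker_contDiff k).comp (contDiff_const.sub contDiff_id)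
  have hfd : ∀ t, HasFDerivAt (fun t => ker n k (x - t))
      (-(fderiv ℝ (ker n k) (x - t))) t := by
    intro t
    have := (((ker_contDiff k).differentiable (by simp) (x - t)).hasFDerivAt).comp t
      ((hasFDerivAt_id t).const_sub x)
    convert! this using 1
    ext; simp
  have htest : IsTest univ (fun t => ker n k (x - t)) := by
    refine ⟨hcd, ?_, subset_univ _⟩
    exact (ker_compact k).comp_homeomorph (Homeomorph.subLeft x)
  have h2 := h.parts _ htest
  have h3 : ∀ t, pderiv j (fun t => ker n k (x - t)) t =
      -(fderiv ℝ (ker n k) (x - t) (EuclideanSpace.single j 1)) := by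
    intro t
    simp [pderiv, (hfd t).fderiv]
  simp only [h3] at h2
  have hcont : Continuous (fderiv ℝ (ker n k)) := (ker_contDiff k).continuous_fderiv (by simp)
  have hex : ConvolutionExistsAt (fderiv ℝ (ker n k)) u x ((lsmul ℝ ℝ).precompL (Vec n)) volume :=
    ((ker_compact k).fderiv ℝ).convolutionExists_left _ hcont hu x
  have h4 : (fderiv ℝ (ker n k) ⋆[(lsmul ℝ ℝ).precompL (Vec n), volume] u) x
      (EuclideanSpace.single j 1) = ∫ t, fderiv ℝ (ker n k) t (EuclideanSpace.single j 1) * u (x - t)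
      := by
    exact ContinuousLinearMap.integral_apply hex _
  rw [h4]
  have h5 : ∫ t, fderiv ℝ (ker n k) t (EuclideanSpace.single j 1) * u (x - t) =
      ∫ t, fderiv ℝ (ker n k) (x - t) (EuclideanSpace.single j 1) * u t := by
    rw [← integral_sub_left_eq_self _ volume x]
    simp
  have h6 := moll_apply' k w x
  unfold moll at h6
  rw [h5, h6]
  simp only [mul_neg, integral_neg, neg_inj] at h2
  rw [← h2]
  simp [mul_comm]

lemma moll_congr_ae (k : ℕ) {f g : Vec n → ℝ} (h : f =ᵐ[volume] g) : moll k f = moll k g := by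
  ext x
  rw [moll_apply', moll_apply']
  exact integral_congr_ae (h.mono fun t ht => by simp [ht])

lemma moll_lipschitz (k : ℕ) {f : Vec n → ℝ} {K : NNReal} (hf : LipschitzWith K f) :
    LipschitzWith K (moll k f) := by
  refine LipschitzWith.of_dist_le_mul fun x y => ?_
  have hi : ∀ x, Integrable fun t => ker n k t * f (x - t) := fun x =>
    ((ker_continuous k).mul (hf.continuous.comp (continuous_const.sub continuous_id)))
      |>.integrable_of_hasCompactSupport ((ker_compact k).mul_right)
  rw [Real.dist_eq, moll_apply, moll_apply, ← integral_sub (hi x) (hi y)]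
  have hb : ∀ t, ‖ker n k t * f (x - t) - ker n k t * f (y - t)‖ ≤ (K * dist x y) * ker n k t := by
    intro t
    rw [← mul_sub, norm_mul, Real.norm_of_nonneg (ker_nonneg k t), mul_comm]
    have := hf.dist_le_mul (x - t) (y - t)
    rw [Real.dist_eq, dist_sub_right] at this
    exact mul_le_mul_of_nonneg_right this (ker_nonneg k t)
  calc |∫ t, ker n k t * f (x - t) - ker n k t * f (y - t)|
      ≤ ∫ t, (K * dist x y) * ker n k t :=
        norm_integral_le_of_norm_le ((ker_integrable k).const_mul _) (Eventually.of_forall hb)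
    _ = K * dist x y := by rw [integral_const_mul, integral_ker, mul_one]

lemma abs_moll_le (k : ℕ) {f : Vec n → ℝ} {C : ℝ} (hf : ∀ x, |f x| ≤ C) (x : Vec n) :
    |moll k f x| ≤ C := by
  rw [moll_apply]
  calc ‖∫ t, ker n k t * f (x - t)‖ ≤ ∫ t, C * ker n k t := by
        refine norm_integral_le_of_norm_le ((ker_integrable k).const_mul _)
          (Eventually.of_forall fun t => ?_)
        rw [norm_mul, Real.norm_of_nonneg (ker_nonneg k t), mul_comm]
        exact mul_le_mul_of_nonneg_right (hf _) (ker_nonneg k t)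
    _ = C := by rw [integral_const_mul, integral_ker, mul_one]

lemma moll_nonneg (k : ℕ) {f : Vec n → ℝ} (hf : ∀ x, 0 ≤ f x) (x : Vec n) : 0 ≤ moll k f x := by
  rw [moll_apply]
  exact integral_nonneg fun t => mul_nonneg (ker_nonneg k t) (hf _)

/-- The `L^p` mollification error is controlled by small translations. -/
lemma eLpNorm_moll_sub_le (k : ℕ) {p : ℝ} (hp : 1 ≤ p) {f : Vec n → ℝ} (hm : Measurable f)
    (hf : LocallyIntegrable f) {ε : ℝ≥0∞}
    (hε : ∀ t : Vec n, ‖t‖ < 1 / ((k : ℝ) + 1) →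
      eLpNorm (fun x => f (x - t) - f x) (ENNReal.ofReal p) ≤ ε) :
    eLpNorm (fun x => moll k f x - f x) (ENNReal.ofReal p) ≤ ε := by
  have hp0 : 0 < p := by linarith
  have hP0 : ENNReal.ofReal p ≠ 0 := by simpa using hp0
  have hPr : (ENNReal.ofReal p).toReal = p := ENNReal.toReal_ofReal hp0.le
  have key : ∀ g : Vec n → ℝ, eLpNorm g (ENNReal.ofReal p) ≤ ε ↔
      ∫⁻ x, ‖g x‖ₑ ^ p ≤ ε ^ p := by
    intro g
    rw [eLpNorm_eq_lintegral_rpow_enorm_toReal hP0 ENNReal.ofReal_ne_top, hPr, one_div,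
      ENNReal.rpow_inv_le_iff hp0]
  rw [key]
  -- The kernel is the density of a probability measure. The error at `x` is the mean of `f (x - t)
  -- - f x` in `t`, so its `p`-th power is at most the mean of the `p`-th powers; Tonelli then
  -- leaves only translations by `t` in the support of the kernel.
  set μ : Measure (Vec n) := volume.withDensity fun t => ENNReal.ofReal (ker n k t) with hμ
  have hkm : Measurable fun t => ENNReal.ofReal (ker n k t) :=
    (ker_continuous k).measurable.ennreal_ofReal
  have hμ1 : IsProbabilityMeasure μ := ⟨by
    rw [hμ, withDensity_apply _ MeasurableSet.univ, Measure.restrict_univ,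
      ← ofReal_integral_eq_lintegral_ofReal (ker_integrable k)
        (Eventually.of_forall (ker_nonneg k)), integral_ker]
    simp⟩
  have hmeas : Measurable fun z : Vec n × Vec n => ‖f (z.1 - z.2) - f z.1‖ₑ ^ p :=
    (((hm.comp (measurable_fst.sub measurable_snd)).sub (hm.comp measurable_fst)).enorm).pow_const p
  have h1 : ∀ x, ‖moll k f x - f x‖ₑ ^ p ≤ ∫⁻ t, ‖f (x - t) - f x‖ₑ ^ p ∂μ := by
    intro x
    have hi : Integrable fun t => ker n k t * f (x - t) := by
      have := ((ker_compact k).convolutionExists_left (lsmul ℝ ℝ) (ker_continuous k) hf x)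
      exact this
    have e : moll k f x - f x = ∫ t, ker n k t * (f (x - t) - f x) := by
      have e : f x = ∫ t, ker n k t * f x := by rw [integral_mul_const, integral_ker, one_mul]
      have e' : ∫ t, ker n k t * (f (x - t) - f x) =
          (∫ t, ker n k t * f (x - t)) - ∫ t, ker n k t * f x := by
        rw [← integral_sub hi ((ker_integrable k).mul_const _)]
        simp only [mul_sub]
      rw [e', ← e, moll_apply]
    have hm1 : Measurable fun t => f (x - t) - f x :=
      (hm.comp (measurable_const.sub measurable_id)).sub measurable_const
    have e1 : ‖moll k f x - f x‖ₑ ≤ ∫⁻ t, ‖f (x - t) - f x‖ₑ ∂μ := by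
      rw [e]
      refine (enorm_integral_le_lintegral_enorm _).trans (le_of_eq ?_)
      rw [hμ, lintegral_withDensity_eq_lintegral_mul _ hkm hm1.enorm]
      refine lintegral_congr fun t => ?_
      simp [enorm_mul, Real.enorm_of_nonneg (ker_nonneg k t)]
    have e2 := eLpNorm_le_eLpNorm_of_exponent_le (μ := μ) (p := 1) (q := ENNReal.ofReal p)
      (f := fun t => f (x - t) - f x) (by simpa using hp) hm1.aestronglyMeasurable
    rw [eLpNorm_one_eq_lintegral_enorm, eLpNorm_eq_lintegral_rpow_enorm_toReal hP0
      ENNReal.ofReal_ne_top, hPr] at e2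
    have e3 := ENNReal.rpow_le_rpow (e1.trans e2) hp0.le
    rwa [one_div, ENNReal.rpow_inv_rpow hp0.ne'] at e3
  calc ∫⁻ x, ‖moll k f x - f x‖ₑ ^ p
      ≤ ∫⁻ x, ∫⁻ t, ‖f (x - t) - f x‖ₑ ^ p ∂μ := lintegral_mono h1
    _ = ∫⁻ t, (∫⁻ x, ‖f (x - t) - f x‖ₑ ^ p) ∂μ :=
        lintegral_lintegral_swap hmeas.aemeasurable
    _ ≤ ∫⁻ t, ε ^ p ∂μ := by
        refine lintegral_mono_ae ?_
        have : ∀ᵐ t ∂μ, ‖t‖ < 1 / ((k : ℝ) + 1) := by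
          rw [hμ, ae_withDensity_iff hkm]
          refine Eventually.of_forall fun t ht => ?_
          by_contra h
          simp [ker_eq_zero (not_lt.1 h)] at ht
        filter_upwards [this] with t ht using (key _).1 (hε t ht)
    _ = ε ^ p := by simp

/-- Mollification converges in `L^p`. -/
lemma tendsto_moll {p : ℝ} (hp : 1 ≤ p) {f : Vec n → ℝ} (hf : MemLp f (ENNReal.ofReal p)) :
    Tendsto (fun k => eLpNorm (fun x => moll k f x - f x) (ENNReal.ofReal p)) atTop (𝓝 0) := by
  have hP1 : 1 ≤ ENNReal.ofReal p := by simpa using hp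
  -- Tonelli in the previous estimate needs joint measurability of `f (x - t)`, hence a measurable
  -- representative; mollification does not see the change.
  obtain ⟨g, hgm, hfg⟩ := hf.aestronglyMeasurable.aemeasurable
  have hg : MemLp g (ENNReal.ofReal p) := hf.ae_eq hfg
  have e : ∀ k, eLpNorm (fun x => moll k f x - f x) (ENNReal.ofReal p) =
      eLpNorm (fun x => moll k g x - g x) (ENNReal.ofReal p) := by
    intro k
    rw [moll_congr_ae k hfg]
    exact eLpNorm_congr_ae (hfg.mono fun x hx => by simp [hx])
  simp only [e]
  have ht := tendsto_eLpNorm_translate hP1 ENNReal.ofReal_ne_top hg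
  rw [ENNReal.tendsto_nhds_zero] at ht ⊢
  intro ε hε
  obtain ⟨δ, hδ, hδ'⟩ := Metric.eventually_nhds_iff.1 (ht ε hε)
  have : ∀ᶠ k : ℕ in atTop, 1 / ((k : ℝ) + 1) < δ :=
    (tendsto_one_div_add_atTop_nhds_zero_nat (𝕜 := ℝ)).eventually_lt_const hδ
  filter_upwards [this] with k hk
  exact eLpNorm_moll_sub_le k hp hgm (hg.locallyIntegrable hP1) fun t ht =>
    hδ' (by simpa using ht.trans hk)

end Moll

/-! ### Weak gradients of vector-valued maps -/

section Grad
variable {O O' : Set (Vec n)}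

lemma eLpNorm_euclidean_le {α ι : Type*} [Fintype ι] {m : MeasurableSpace α} {μ : Measure α}
    {f : α → EuclideanSpace ℝ ι} (hf : ∀ i, AEStronglyMeasurable (fun x => f x i) μ) {p : ℝ≥0∞}
    (hp : 1 ≤ p) : eLpNorm f p μ ≤ ∑ i, eLpNorm (fun x => f x i) p μ := by
  have h1 : eLpNorm f p μ ≤ eLpNorm (fun x => ∑ i, ‖f x i‖) p μ := by
    refine eLpNorm_mono_real fun x => ?_
    have : f x = ∑ i, f x i • EuclideanSpace.basisFun ι ℝ i := by
      simpa using ((EuclideanSpace.basisFun ι ℝ).sum_repr (f x)).symm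
    calc ‖f x‖ = ‖∑ i, f x i • EuclideanSpace.basisFun ι ℝ i‖ := by rw [← this]
      _ ≤ ∑ i, ‖f x i • EuclideanSpace.basisFun ι ℝ i‖ := norm_sum_le _ _
      _ = ∑ i, ‖f x i‖ := by simp [norm_smul]
  refine h1.trans ?_
  have h2 := eLpNorm_sum_le (s := (Finset.univ : Finset ι)) (f := fun i x => ‖f x i‖) (μ := μ)
    (fun i _ => (hf i).norm) hp
  have e : (∑ i, fun x => ‖f x i‖) = fun x => ∑ i, ‖f x i‖ := by ext x; simp
  rw [e] at h2
  simpa only [eLpNorm_norm] using h2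

lemma eLpNorm_coord_le {α ι : Type*} [Fintype ι] {m : MeasurableSpace α} {μ : Measure α}
    (f : α → EuclideanSpace ℝ ι) (i : ι) (p : ℝ≥0∞) :
    eLpNorm (fun x => f x i) p μ ≤ eLpNorm f p μ :=
  eLpNorm_mono fun x => PiLp.norm_apply_le (f x) i

lemma HasWeakGrad.mono {u : Vec n → Vec N} {U : Vec n → Mat N n} (h : HasWeakGrad O u U)
    (hO : O' ⊆ O) : HasWeakGrad O' u U := by
  rw [hasWeakGrad_iff] at h ⊢
  exact ⟨h.1.mono_set hO, h.2.1.mono_set hO, fun i j => (h.2.2 i j).mono hO⟩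

lemma HasWeakGrad.of_WD {u : Vec n → Vec N} {U : Vec n → Mat N n} (hu : LocallyIntegrableOn u O)
    (h : ∀ i j, WD O j (fun x => u x i) (fun x => U x (i, j))) : HasWeakGrad O u U :=
  hasWeakGrad_iff.2 ⟨hu, locallyIntegrableOn_coord.2 fun ij => (h ij.1 ij.2).locR, h⟩

lemma HasWeakGrad.wd {u : Vec n → Vec N} {U : Vec n → Mat N n} (h : HasWeakGrad O u U)
    (i : Fin N) (j : Fin n) : WD O j (fun x => u x i) (fun x => U x (i, j)) :=
  (hasWeakGrad_iff.1 h).2.2 i j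

lemma HasWeakGrad.congr {u u' : Vec n → Vec N} {U U' : Vec n → Mat N n} (h : HasWeakGrad O u U)
    (hu : u =ᵐ[volume.restrict O] u') (hU : U =ᵐ[volume.restrict O] U') :
    HasWeakGrad O u' U' :=
  .of_WD (h.1.congr hu) fun i j => (h.wd i j).congr (hu.mono fun x hx => by simp [hx])
    (hU.mono fun x hx => by simp [hx])

lemma HasWeakGrad.add {u u' : Vec n → Vec N} {U U' : Vec n → Mat N n} (h : HasWeakGrad O u U)
    (h' : HasWeakGrad O u' U') : HasWeakGrad O (u + u') (U + U') :=
  .of_WD (h.1.add h'.1) fun i j => (h.wd i j).add (h'.wd i j)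

lemma HasWeakGrad.sub {u u' : Vec n → Vec N} {U U' : Vec n → Mat N n} (h : HasWeakGrad O u U)
    (h' : HasWeakGrad O u' U') : HasWeakGrad O (u - u') (U - U') :=
  .of_WD (h.1.sub h'.1) fun i j => (h.wd i j).sub (h'.wd i j)

lemma ae_eq_of_coord {α ι : Type*} [Fintype ι] {m : MeasurableSpace α} {μ : Measure α}
    {f g : α → EuclideanSpace ℝ ι} (h : ∀ i, (fun x => f x i) =ᵐ[μ] fun x => g x i) :
    f =ᵐ[μ] g := by
  have : ∀ᵐ x ∂μ, ∀ i, f x i = g x i := ae_all_iff.2 h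
  filter_upwards [this] with x hx
  ext i; exact hx i

lemma HasWeakGrad.unique' {u u' : Vec n → Vec N} {U U' : Vec n → Mat N n} (h : HasWeakGrad O u U)
    (h' : HasWeakGrad O u' U') (hO : IsOpen O) (hu : u =ᵐ[volume.restrict O] u') :
    U =ᵐ[volume.restrict O] U' :=
  ae_eq_of_coord fun ij => (h.wd ij.1 ij.2).unique' (h'.wd ij.1 ij.2) hO
    (hu.mono fun x hx => by simp [hx])

lemma HasWeakGrad.unique {u : Vec n → Vec N} {U U' : Vec n → Mat N n} (h : HasWeakGrad O u U)
    (h' : HasWeakGrad O u U') (hO : IsOpen O) : U =ᵐ[volume.restrict O] U' :=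
  h.unique' h' hO EventuallyEq.rfl

lemma HasWeakGrad.zero_of_zero {u : Vec n → Vec N} {U : Vec n → Mat N n} (h : HasWeakGrad O u U)
    (hO : IsOpen O) (hu : u =ᵐ[volume.restrict O] 0) : U =ᵐ[volume.restrict O] 0 :=
  ae_eq_of_coord fun ij => (h.wd ij.1 ij.2).eq_zero hO (hu.mono fun x hx => by simp [hx])

lemma hasWeakGrad_weakGrad {u : Vec n → Vec N} {U : Vec n → Mat N n} (h : HasWeakGrad O u U) :
    HasWeakGrad O u (weakGrad O u) := by
  have hex : ∃ U, HasWeakGrad O u U := ⟨U, h⟩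
  rw [weakGrad, dif_pos hex]
  exact hex.choose_spec

lemma weakGrad_ae_eq {u : Vec n → Vec N} {U : Vec n → Mat N n} (h : HasWeakGrad O u U)
    (hO : IsOpen O) : weakGrad O u =ᵐ[volume.restrict O] U :=
  (hasWeakGrad_weakGrad h).unique h hO

lemma MemW1.hasWeakGrad {p : ℝ} {u : Vec n → Vec N} (h : MemW1 p O u) :
    HasWeakGrad O u (weakGrad O u) :=
  hasWeakGrad_weakGrad h.2.choose_spec.1

lemma MemW1.memLp_weakGrad {p : ℝ} {u : Vec n → Vec N} (h : MemW1 p O u) (hO : IsOpen O) :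
    MemLp (weakGrad O u) (ENNReal.ofReal p) (volume.restrict O) :=
  h.2.choose_spec.2.ae_eq (weakGrad_ae_eq h.2.choose_spec.1 hO).symm

lemma MemW1.mono {p : ℝ} {u : Vec n → Vec N} (h : MemW1 p O u) (hO : O' ⊆ O) : MemW1 p O' u := by
  obtain ⟨h1, U, h2, h3⟩ := h
  exact ⟨h1.mono_measure (Measure.restrict_mono_set _ hO), U, h2.mono hO,
    h3.mono_measure (Measure.restrict_mono_set _ hO)⟩

lemma MemW1.add {p : ℝ} {u v : Vec n → Vec N} (h : MemW1 p O u) (h' : MemW1 p O v) :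
    MemW1 p O (u + v) := by
  obtain ⟨h1, U, h2, h3⟩ := h
  obtain ⟨h1', U', h2', h3'⟩ := h'
  exact ⟨h1.add h1', _, h2.add h2', h3.add h3'⟩

lemma MemW1.sub {p : ℝ} {u v : Vec n → Vec N} (h : MemW1 p O u) (h' : MemW1 p O v) :
    MemW1 p O (u - v) := by
  obtain ⟨h1, U, h2, h3⟩ := h
  obtain ⟨h1', U', h2', h3'⟩ := h'
  exact ⟨h1.sub h1', _, h2.sub h2', h3.sub h3'⟩

lemma MemW1.congr {p : ℝ} {u v : Vec n → Vec N} (h : MemW1 p O u)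
    (huv : u =ᵐ[volume.restrict O] v) : MemW1 p O v := by
  obtain ⟨h1, U, h2, h3⟩ := h
  exact ⟨h1.ae_eq huv, U, h2.congr huv EventuallyEq.rfl, h3⟩

lemma MemW1.mono_exponent {p q : ℝ} (hpq : p ≤ q) (hO : volume O ≠ ⊤) {u : Vec n → Vec N}
    (h : MemW1 q O u) : MemW1 p O u := by
  have : IsFiniteMeasure (volume.restrict O) := ⟨by simpa using hO.lt_top⟩
  obtain ⟨h1, U, h2, h3⟩ := h
  exact ⟨h1.mono_exponent (ENNReal.ofReal_le_ofReal hpq), U, h2,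
    h3.mono_exponent (ENNReal.ofReal_le_ofReal hpq)⟩

/-! ### Lipschitz functions -/

lemma IsTest.lipschitz {V : Type*} [NormedAddCommGroup V] [NormedSpace ℝ V] {φ : Vec n → V}
    (h : IsTest O φ) : ∃ C, LipschitzWith C φ :=
  ContDiff.lipschitzWith_of_hasCompactSupport h.2.1 h.1 (by simp)

/-- Integration by parts for line derivatives of Lipschitz functions. It supplies the weak
derivatives of the collar functions and of the approximations to the averaged extension below. -/
lemma WD.of_lipschitz {f : Vec n → ℝ} {K : NNReal} (hf : LipschitzWith K f) (j : Fin n) :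
    WD univ j f (fun x => lineDeriv ℝ f x (EuclideanSpace.single j 1)) := by
  refine ⟨hf.continuous.locallyIntegrable.locallyIntegrableOn _,
    (hf.locallyIntegrable_lineDeriv _).locallyIntegrableOn _, fun φ hφ => ?_⟩
  obtain ⟨C, hC⟩ := hφ.lipschitz
  rw [hf.integral_lineDeriv_mul_eq hC hφ.2.1, ← integral_neg]
  refine integral_congr_ae (Eventually.of_forall fun x => ?_)
  simp only [pderiv, (hφ.differentiable x).lineDeriv_eq_fderiv, map_neg]
  ring

lemma IsTest.memLp {V : Type*} [NormedAddCommGroup V] [NormedSpace ℝ V] {φ : Vec n → V}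
    (h : IsTest O φ) (p : ℝ≥0∞) : MemLp φ p :=
  h.continuous.memLp_of_hasCompactSupport h.2.1

lemma IsTest.isTest_grad {φ : Vec n → Vec N} (h : IsTest O φ) : IsTest O (grad φ) := by
  refine isTest_of_coord fun ij => ?_
  exact (h.pderiv ij.2).isTest_coord ij.1

/-! ### Approximation by test maps -/

/-- Componentwise mollification. The support lies in `O` only from some index `k₀` on, so the
sequence is shifted by `k₀`; on that range the classical gradient is the mollified weak gradient. -/
lemma exists_test_seq {p : ℝ} (hp : 1 ≤ p) (hO : IsOpen O) {K : Set (Vec n)} (hK : IsCompact K)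
    (hKO : K ⊆ O) {z : Vec n → Vec N} {Z : Vec n → Mat N n} (hz : MemLp z (ENNReal.ofReal p))
    (hZ : MemLp Z (ENNReal.ofReal p)) (hg : HasWeakGrad univ z Z) (h0 : ∀ x ∉ K, z x = 0) :
    ∃ φ : ℕ → Vec n → Vec N, (∀ k, IsTest O (φ k)) ∧
      Tendsto (fun k => eLpNorm (φ k - z) (ENNReal.ofReal p)) atTop (𝓝 0) ∧
      Tendsto (fun k => eLpNorm (grad (φ k) - Z) (ENNReal.ofReal p)) atTop (𝓝 0) := by
  have hP1 : 1 ≤ ENNReal.ofReal p := by simpa using hp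
  let ψ : ℕ → Vec n → Vec N := fun k x => WithLp.toLp 2 fun i => moll k (fun y => z y i) x
  have hloc : ∀ i, LocallyIntegrable (fun y => z y i) := fun i =>
    (hz.eval_piLp i).locallyIntegrable hP1
  have hev : ∀ᶠ k in atTop, IsTest O (ψ k) := by
    have : ∀ i, ∀ᶠ k in atTop, IsTest O (moll k (fun y => z y i)) := fun i =>
      isTest_moll (hloc i) hK hO hKO fun x hx => by simp [h0 x hx]
    filter_upwards [eventually_all.2 this] with k hk
    exact isTest_of_coord hk
  obtain ⟨k₀, hk₀⟩ := eventually_atTop.1 hev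
  have c1 : Tendsto (fun k => eLpNorm (ψ k - z) (ENNReal.ofReal p)) atTop (𝓝 0) := by
    have hs : Tendsto (fun k => ∑ i, eLpNorm (fun x => moll k (fun y => z y i) x - z x i)
        (ENNReal.ofReal p)) atTop (𝓝 0) := by
      simpa using tendsto_finsetSum Finset.univ fun i _ => tendsto_moll hp (hz.eval_piLp i)
    refine tendsto_of_tendsto_of_tendsto_of_le_of_le tendsto_const_nhds hs (fun _ => zero_le)
      fun k => ?_
    refine eLpNorm_euclidean_le (f := ψ k - z) (fun i => ?_) hP1
    exact ((moll_contDiff k (hloc i)).continuous.aestronglyMeasurable).sub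
      (hz.eval_piLp i).aestronglyMeasurable
  have c2 : Tendsto (fun k => eLpNorm (grad (ψ (k + k₀)) - Z) (ENNReal.ofReal p)) atTop (𝓝 0) := by
    have hs : Tendsto (fun k => ∑ ij, eLpNorm (fun x => moll k (fun y => Z y ij) x - Z x ij)
        (ENNReal.ofReal p)) atTop (𝓝 0) := by
      simpa using tendsto_finsetSum Finset.univ fun i _ => tendsto_moll hp (hZ.eval_piLp i)
    refine tendsto_of_tendsto_of_tendsto_of_le_of_le tendsto_const_nhds
      ((tendsto_add_atTop_iff_nat k₀).2 hs) (fun _ => zero_le) fun k => ?_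
    have ht := hk₀ (k + k₀) (by omega)
    have e : ∀ x ij, grad (ψ (k + k₀)) x ij = moll (k + k₀) (fun y => Z y ij) x := by
      intro x ij
      have := pderiv_coord (ht.differentiable x) ij.2 ij.1
      rw [← pderiv_moll _ (hg.wd ij.1 ij.2)]
      exact this
    have hlocZ : ∀ ij, LocallyIntegrable (fun y => Z y ij) := fun i =>
      (hZ.eval_piLp i).locallyIntegrable hP1
    refine (eLpNorm_euclidean_le (f := grad (ψ (k + k₀)) - Z) (fun ij => ?_) hP1).trans
      (le_of_eq ?_)
    · have : (fun x => (grad (ψ (k + k₀)) - Z) x ij) =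
          fun x => moll (k + k₀) (fun y => Z y ij) x - Z x ij := by ext x; simp [e]
      rw [this]
      exact ((moll_contDiff _ (hlocZ ij)).continuous.aestronglyMeasurable).sub
        (hZ.eval_piLp ij).aestronglyMeasurable
    · refine Finset.sum_congr rfl fun ij _ => ?_
      congr 1
      ext x; simp [e]
  exact ⟨fun k => ψ (k + k₀), fun k => hk₀ _ (by omega), (tendsto_add_atTop_iff_nat k₀).2 c1, c2⟩

/-! ### Chain rule -/

lemma tendsto_integral_mul_of_eLpNorm_one {α : Type*} {m : MeasurableSpace α} {μ : Measure α}
    {f : ℕ → α → ℝ} {F g : α → ℝ} (hf : ∀ k, Integrable (f k) μ) (hF : Integrable F μ)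
    (h : Tendsto (fun k => eLpNorm (fun x => f k x - F x) 1 μ) atTop (𝓝 0)) {C : ℝ}
    (hgm : AEStronglyMeasurable g μ) (hg : ∀ x, |g x| ≤ C) :
    Tendsto (fun k => ∫ x, f k x * g x ∂μ) atTop (𝓝 (∫ x, F x * g x ∂μ)) := by
  have hi : ∀ {f}, Integrable f μ → Integrable (fun x => f x * g x) μ := fun hf =>
    hf.mul_bdd (c := C) hgm (Eventually.of_forall hg)
  refine tendsto_integral_of_L1 _ (hi hF).aestronglyMeasurable (Eventually.of_forall fun k => hi (hf k)) ?_
  have hb : ∀ k, ∫⁻ x, ‖f k x * g x - F x * g x‖ₑ ∂μ ≤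
      ENNReal.ofReal C * eLpNorm (fun x => f k x - F x) 1 μ := by
    intro k
    have hm : AEMeasurable (fun x => ‖f k x - F x‖ₑ) μ := ((hf k).sub hF).aestronglyMeasurable.enorm
    rw [eLpNorm_one_eq_lintegral_enorm, ← lintegral_const_mul'' _ hm]
    refine lintegral_mono fun x => ?_
    rw [← sub_mul, enorm_mul, mul_comm]
    gcongr
    rw [Real.enorm_eq_ofReal_abs]
    exact ENNReal.ofReal_le_ofReal (hg x)
  have := ENNReal.Tendsto.const_mul (a := ENNReal.ofReal C) h (Or.inr ENNReal.ofReal_ne_top)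
  rw [mul_zero] at this
  exact tendsto_of_tendsto_of_tendsto_of_le_of_le tendsto_const_nhds this (fun _ => zero_le) hb

lemma locallyIntegrableOn_of_norm_le {f g : Vec n → ℝ} (hf : LocallyIntegrableOn f O)
    (hg : AEStronglyMeasurable g (volume.restrict O)) (h : ∀ x, ‖g x‖ ≤ ‖f x‖) :
    LocallyIntegrableOn g O := by
  intro x hx
  obtain ⟨s, hs, hi⟩ := hf x hx
  refine ⟨s ∩ O, inter_mem hs self_mem_nhdsWithin, ?_⟩
  exact Integrable.mono (hi.mono_set inter_subset_left)
    (hg.mono_measure (Measure.restrict_mono_set _ inter_subset_right)) (Eventually.of_forall h)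

/-- Chain rule for smooth functions with bounded derivative. -/
lemma WD.comp {j : Fin n} {u w : Vec n → ℝ} (h : WD O j u w) (hO : IsOpen O) {β : ℝ → ℝ}
    (hβ : ContDiff ℝ ∞ β) (hβ1 : LipschitzWith 1 β) :
    WD O j (fun x => β (u x)) (fun x => deriv β (u x) * w x) := by
  have hd1 : ∀ s, ‖deriv β s‖ ≤ 1 := fun s => by
    simpa using norm_deriv_le_of_lipschitz (x₀ := s) hβ1
  have hdc : Continuous (deriv β) := hβ.continuous_deriv (by simp)
  have hum : AEStronglyMeasurable u (volume.restrict O) := h.locL.aestronglyMeasurable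
  refine ⟨?_, ?_, fun φ hφ => ?_⟩
  · have h0 : LocallyIntegrableOn (fun x => ‖u x‖ + ‖β 0‖) O :=
      h.locL.norm.add (locallyIntegrableOn_const _)
    refine locallyIntegrableOn_of_norm_le h0 (hβ.continuous.comp_aestronglyMeasurable hum) (fun x => ?_)
    have := hβ1.dist_le_mul (u x) 0
    simp only [NNReal.coe_one, one_mul, dist_eq_norm, sub_zero] at this
    calc ‖β (u x)‖ = ‖β (u x) - β 0 + β 0‖ := by simp
      _ ≤ ‖β (u x) - β 0‖ + ‖β 0‖ := norm_add_le _ _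
      _ ≤ ‖u x‖ + ‖β 0‖ := by gcongr
      _ = _ := (Real.norm_of_nonneg (add_nonneg (norm_nonneg _) (norm_nonneg _))).symm
  · have h0 := h.locR
    refine locallyIntegrableOn_of_norm_le h0 ((hdc.comp_aestronglyMeasurable hum).mul h.locR.aestronglyMeasurable)
      (fun x => ?_)
    rw [norm_mul]
    exact mul_le_of_le_one_left (norm_nonneg _) (hd1 _)
  -- Only `u` near the support of `φ` matters, so `u` is replaced by `χ u`, which is weakly
  -- differentiable on the whole space and can be mollified there.
  obtain ⟨χ, hχ, hχ1, -⟩ := exists_cutoff hφ.2.1 hO hφ.2.2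
  set v := fun x => χ x * u x with hv
  set wv := fun x => χ x * w x + pderiv j χ x * u x with hwv
  have hWD : WD univ j v wv := by
    refine (h.smooth_mul hχ.1).extend_zero hO hχ.2.1 hχ.2.2 (fun x hx => ?_) fun x hx => ?_
    · simp [image_eq_zero_of_notMem_tsupport hx]
    · have := image_eq_zero_of_notMem_tsupport (fun h' => hx (tsupport_pderiv_subset j χ h'))
      simp [image_eq_zero_of_notMem_tsupport hx, this]
  have hvi : Integrable v := by
    simpa only [hv, mul_comm] using hχ.integrable_mul h.locL
  have hwvi : Integrable wv := by
    refine ((hχ.integrable_mul h.locR).add ((hχ.pderiv j).integrable_mul h.locL)).congr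
      (Eventually.of_forall fun x => ?_)
    simp only [hwv, Pi.add_apply]
    ring
  have hvL : MemLp v (ENNReal.ofReal 1) := by simpa using memLp_one_iff_integrable.2 hvi
  have hwL : MemLp wv (ENNReal.ofReal 1) := by simpa using memLp_one_iff_integrable.2 hwvi
  have cv := tendsto_moll le_rfl hvL
  have cw := tendsto_moll le_rfl hwL
  simp only [ENNReal.ofReal_one] at cv cw
  have hcm : ∀ {f : Vec n → ℝ}, Integrable f → ∀ k, Continuous (moll k f) := fun hf k =>
    (moll_contDiff k hf.locallyIntegrable).continuous
  have hfin : ∀ {f : Vec n → ℝ}, Integrable f →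
      Tendsto (fun k => eLpNorm (fun x => moll k f x - f x) 1) atTop (𝓝 0) →
      ∀ᶠ k in atTop, Integrable (moll k f) := by
    intro f hf hc
    filter_upwards [hc.eventually_lt_const ENNReal.zero_lt_top] with k hk
    have : Integrable (fun x => moll k f x - f x) :=
      memLp_one_iff_integrable.1 ⟨(hcm hf k).aestronglyMeasurable.sub hf.aestronglyMeasurable, hk⟩
    refine (this.add hf).congr (Eventually.of_forall fun x => ?_)
    simp
  -- The factor `β'(v)` is merely continuous in `v`, so a subsequence converging almost everywhere
  -- is needed besides the `L¹` convergence.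
  obtain ⟨ns, hns, hae⟩ := (tendstoInMeasure_of_tendsto_eLpNorm (p := 1) (by simp)
    (fun k => (hcm hvi k).aestronglyMeasurable) hvi.aestronglyMeasurable cv).exists_seq_tendsto_ae
  have hev : ∀ᶠ k in atTop, Integrable (moll k v) ∧ Integrable (moll k wv) ∧
      IsTest O (moll k v) := by
    refine (hfin hvi cv).and ((hfin hwvi cw).and ?_)
    exact isTest_moll hvi.locallyIntegrable hχ.2.1 hO hχ.2.2 fun x hx => by
      simp [hv, image_eq_zero_of_notMem_tsupport hx]
  obtain ⟨k₀, hk₀⟩ := eventually_atTop.1 hev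
  set ms : ℕ → ℕ := fun i => ns (i + k₀) with hms
  have hmsge : ∀ i, k₀ ≤ ms i := fun i => (by omega : k₀ ≤ i + k₀).trans (hns.id_le _)
  have hmst : Tendsto ms atTop atTop := hns.tendsto_atTop.comp (tendsto_add_atTop_nat k₀)
  have hI : ∀ i, Integrable (moll (ms i) v) := fun i => (hk₀ _ (hmsge i)).1
  have hIw : ∀ i, Integrable (moll (ms i) wv) := fun i => (hk₀ _ (hmsge i)).2.1
  have hT : ∀ i, IsTest O (moll (ms i) v) := fun i => (hk₀ _ (hmsge i)).2.2
  have haes : ∀ᵐ x, Tendsto (fun i => moll (ms i) v x) atTop (𝓝 (v x)) := by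
    filter_upwards [hae] with x hx using hx.comp (tendsto_add_atTop_nat k₀)
  obtain ⟨C, hC⟩ := hφ.2.1.exists_bound_of_continuousOn hφ.continuous.continuousOn
  have hCb : ∀ x, |φ x| ≤ max C 0 := fun x => by
    by_cases hx : x ∈ tsupport φ
    · exact (hC x hx).trans (le_max_left _ _)
    · simp [image_eq_zero_of_notMem_tsupport hx]
  have hpφ := hφ.pderiv j
  obtain ⟨C', hC'⟩ := hpφ.2.1.exists_bound_of_continuousOn hpφ.continuous.continuousOn
  have hC'b : ∀ x, |pderiv j φ x| ≤ max C' 0 := fun x => by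
    by_cases hx : x ∈ tsupport (pderiv j φ)
    · exact (hC' x hx).trans (le_max_left _ _)
    · simp [image_eq_zero_of_notMem_tsupport hx]
  have eq_i : ∀ i, ∫ x, β (moll (ms i) v x) * pderiv j φ x =
      -∫ x, (deriv β (moll (ms i) v x) * moll (ms i) wv x) * φ x := by
    intro i
    obtain ⟨L, hL⟩ := (hT i).lipschitz
    have hl : LipschitzWith (1 * L) (fun x => β (moll (ms i) v x)) := hβ1.comp hL
    have := (WD.of_lipschitz hl j).parts φ (hφ.mono (subset_univ _))
    rw [this]
    congr 2
    ext x
    congr 1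
    have hder : HasFDerivAt (fun x => β (moll (ms i) v x))
        (deriv β (moll (ms i) v x) • fderiv ℝ (moll (ms i) v) x) x :=
      ((hβ.differentiable (by simp) _).hasDerivAt).comp_hasFDerivAt x
        ((hT i).differentiable x).hasFDerivAt
    rw [hder.differentiableAt.lineDeriv_eq_fderiv, hder.fderiv, ← pderiv_moll _ hWD]
    rfl
  -- left-hand side
  have lim1 : Tendsto (fun i => ∫ x, β (moll (ms i) v x) * pderiv j φ x) atTop
      (𝓝 (∫ x, β (v x) * pderiv j φ x)) := by
    have hbint : ∀ f : Vec n → ℝ, Integrable f → Integrable (fun x => β (f x) - β 0) := by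
      intro f hf
      refine hf.mono ((hβ.continuous.comp_aestronglyMeasurable hf.aestronglyMeasurable).sub
        aestronglyMeasurable_const) (Eventually.of_forall fun x => ?_)
      have := hβ1.dist_le_mul (f x) 0
      simpa [dist_eq_norm] using this
    have hpi : Integrable (fun x => β 0 * pderiv j φ x) :=
      (memLp_one_iff_integrable.1 (hpφ.memLp 1)).const_mul _
    have hpm : AEStronglyMeasurable (pderiv j φ) := hpφ.continuous.aestronglyMeasurable
    have hlim := tendsto_integral_mul_of_eLpNorm_one (μ := volume)
      (f := fun i x => β (moll (ms i) v x) - β 0) (F := fun x => β (v x) - β 0)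
      (fun i => hbint _ (hI i)) (hbint _ hvi) (by
        refine tendsto_of_tendsto_of_tendsto_of_le_of_le tendsto_const_nhds (cv.comp hmst)
          (fun _ => zero_le) fun i => eLpNorm_mono fun x => ?_
        have := hβ1.dist_le_mul (moll (ms i) v x) (v x)
        simpa [dist_eq_norm] using this) hpm hC'b
    have h2 := hlim.add_const (∫ x, β 0 * pderiv j φ x)
    have hb2 : ∀ f : Vec n → ℝ, Integrable f →
        (∫ x, (β (f x) - β 0) * pderiv j φ x) + ∫ x, β 0 * pderiv j φ x =
        ∫ x, β (f x) * pderiv j φ x := by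
      intro f hf
      rw [← integral_add ((hbint f hf).mul_bdd (c := max C' 0) hpm (Eventually.of_forall hC'b)) hpi]
      congr 1; ext x; ring_nf
    rw [hb2 v hvi] at h2
    exact h2.congr fun i => hb2 _ (hI i)
  -- right-hand side
  have hφm : AEStronglyMeasurable φ := hφ.continuous.aestronglyMeasurable
  have lim2 : Tendsto (fun i => ∫ x, (deriv β (moll (ms i) v x) * moll (ms i) wv x) * φ x) atTop
      (𝓝 (∫ x, (deriv β (v x) * wv x) * φ x)) := by
    have hmb : ∀ f g : Vec n → ℝ, Integrable f → Integrable g →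
        Integrable (fun x => deriv β (f x) * g x) := fun f g hf hg =>
      hg.bdd_mul (c := 1) (hdc.comp_aestronglyMeasurable hf.aestronglyMeasurable)
        (Eventually.of_forall fun x => hd1 _)
    -- Split `β'(vᵢ) wᵢ = β'(vᵢ) (wᵢ - w) + β'(vᵢ) w`. The first part vanishes in `L¹` since `|β'| ≤
    -- 1`; the second converges by domination.
    have l1 := tendsto_integral_mul_of_eLpNorm_one (μ := volume)
      (f := fun i x => deriv β (moll (ms i) v x) * (moll (ms i) wv x - wv x)) (F := fun x => 0)
      (fun i => hmb _ _ (hI i) ((hIw i).sub hwvi)) (integrable_zero _ _ _) (by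
        refine tendsto_of_tendsto_of_tendsto_of_le_of_le tendsto_const_nhds (cw.comp hmst)
          (fun _ => zero_le) fun i => eLpNorm_mono fun x => ?_
        rw [sub_zero, norm_mul]
        exact mul_le_of_le_one_left (norm_nonneg _) (hd1 _)) hφm hCb
    have l2 : Tendsto (fun i => ∫ x, (deriv β (moll (ms i) v x) * wv x) * φ x) atTop
        (𝓝 (∫ x, (deriv β (v x) * wv x) * φ x)) := by
      refine tendsto_integral_of_dominated_convergence (fun x => ‖wv x‖ * max C 0) (fun i => ?_)
        (hwvi.norm.mul_const _) (fun i => Eventually.of_forall fun x => ?_) ?_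
      · exact ((hdc.comp (hcm hvi _)).aestronglyMeasurable.mul
          hwvi.aestronglyMeasurable).mul hφm
      · rw [norm_mul, norm_mul]
        gcongr
        · exact mul_le_of_le_one_left (norm_nonneg _) (hd1 _)
        · exact hCb x
      · filter_upwards [haes] with x hx
        exact ((((hdc.tendsto _).comp hx).mul_const _).mul_const _)
    have l3 := l1.add l2
    simp only [zero_mul, integral_zero, zero_add] at l3
    refine l3.congr fun i => ?_
    rw [← integral_add]
    · congr 1; ext x; ring_nf
    · exact (hmb _ _ (hI i) ((hIw i).sub hwvi)).mul_bdd (c := max C 0) hφm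
        (Eventually.of_forall hCb)
    · exact (hmb _ _ (hI i) hwvi).mul_bdd (c := max C 0) hφm (Eventually.of_forall hCb)
  have hfinal := tendsto_nhds_unique lim1 ((lim2.neg).congr fun i => (eq_i i).symm)
  have hx1 : ∀ x ∈ tsupport φ, χ =ᶠ[𝓝 x] fun _ => 1 := fun x hx =>
    (mem_nhdsSet_iff_forall.1 hχ1) x hx
  have e1 : ∀ x, β (v x) * pderiv j φ x = β (u x) * pderiv j φ x := by
    intro x
    by_cases hx : x ∈ tsupport φ
    · simp [hv, (hx1 x hx).eq_of_nhds]
    · simp [image_eq_zero_of_notMem_tsupport (fun h' => hx (tsupport_pderiv_subset j φ h'))]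
  have e2 : ∀ x, (deriv β (v x) * wv x) * φ x = (deriv β (u x) * w x) * φ x := by
    intro x
    by_cases hx : x ∈ tsupport φ
    · have h1 := (hx1 x hx).eq_of_nhds
      have h2 : pderiv j χ x = 0 := by
        simp [pderiv, (hx1 x hx).fderiv_eq]
      simp only [hv, hwv, h1, h2]; ring_nf
    · simp [image_eq_zero_of_notMem_tsupport hx]
  simpa only [e1, e2] using hfinal

end Grad

/-! ### Geometry of Lipschitz boundaries -/

section Chart
variable {Ω : Set (Vec n)} {x₀ ν : Vec n} {r : ℝ} {K : NNReal} {γ : Vec n → ℝ}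

lemma norm_sub_inner_smul_le (hν : ‖ν‖ = 1) (y : Vec n) : ‖y - inner ℝ ν y • ν‖ ≤ ‖y‖ := by
  rw [← Submodule.starProjection_unit_singleton ℝ hν y]
  have := (Submodule.orthogonalProjectionOnto (ℝ ∙ ν)ᗮ).le_opNorm y
  have h2 := Submodule.norm_orthogonalProjectionOnto_apply_le (K := (ℝ ∙ ν)ᗮ) y
  rw [Submodule.orthogonalProjectionOnto_orthogonal] at h2
  exact h2

lemma lipschitz_height (hν : ‖ν‖ = 1) (hγ : LipschitzWith K γ) :
    LipschitzWith K (fun y : Vec n => γ (y - inner ℝ ν y • ν)) := by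
  refine LipschitzWith.of_dist_le_mul fun y z => (hγ.dist_le_mul _ _).trans ?_
  gcongr
  rw [dist_eq_norm, dist_eq_norm]
  refine le_trans (le_of_eq ?_) (norm_sub_inner_smul_le hν (y - z))
  rw [inner_sub_right, sub_smul]
  congr 1; abel

lemma inner_smul_self_one (hν : ‖ν‖ = 1) (t : ℝ) : inner ℝ ν (t • ν) = t := by
  rw [inner_smul_right, real_inner_self_eq_norm_sq, hν]; simp

lemma sub_inner_add_smul (hν : ‖ν‖ = 1) (y : Vec n) (t : ℝ) :
    (y + t • ν) - inner ℝ ν (y + t • ν) • ν = y - inner ℝ ν y • ν := by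
  rw [inner_add_right, inner_smul_self_one hν, add_smul]; abel

/-- In a chart the closure of `Ω` lies above the graph. -/
lemma chart_closure (hν : ‖ν‖ = 1) (hγ : LipschitzWith K γ)
    (hc : ∀ y ∈ Metric.ball x₀ r, y ∈ Ω ↔ γ (y - inner ℝ ν y • ν) < inner ℝ ν y)
    {y : Vec n} (hy : y ∈ Metric.ball x₀ r) (hyΩ : y ∈ closure Ω) :
    γ (y - inner ℝ ν y • ν) ≤ inner ℝ ν y := by
  by_contra! h
  have h1 : ∀ᶠ z in 𝓝 y, inner ℝ ν z < γ (z - inner ℝ ν z • ν) := by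
    have c1 : Continuous fun z : Vec n => inner ℝ ν z := by fun_prop
    exact c1.continuousAt.eventually_lt (lipschitz_height hν hγ).continuous.continuousAt h
  have h2 : ∀ᶠ z in 𝓝 y, z ∈ Metric.ball x₀ r := Metric.isOpen_ball.mem_nhds hy
  obtain ⟨z, ⟨hz1, hz2⟩, hz3⟩ := (mem_closure_iff_nhds.1 hyΩ) _ (h1.and h2)
  exact absurd ((hc z hz2).1 hz3) (not_lt.2 hz1.le)

/-- A point of the closure lies on or above the graph, and a point outside the open set `Ω` is not
strictly above it. Conversely, a point of the graph is approached from inside `Ω` in the direction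
`ν`. -/
lemma chart_frontier (hΩo : IsOpen Ω) (hν : ‖ν‖ = 1) (hγ : LipschitzWith K γ)
    (hc : ∀ y ∈ Metric.ball x₀ r, y ∈ Ω ↔ γ (y - inner ℝ ν y • ν) < inner ℝ ν y)
    {y : Vec n} (hy : y ∈ Metric.ball x₀ r) :
    y ∈ frontier Ω ↔ γ (y - inner ℝ ν y • ν) = inner ℝ ν y := by
  rw [hΩo.frontier_eq]
  constructor
  · rintro ⟨h1, h2⟩
    exact le_antisymm (chart_closure hν hγ hc hy h1) (not_lt.1 fun h => h2 ((hc y hy).2 h))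
  · intro h
    refine ⟨?_, fun h' => absurd ((hc y hy).1 h') (by simp [h])⟩
    have ht : Tendsto (fun t : ℝ => y + t • ν) (𝓝[>] 0) (𝓝 y) := by
      have : Continuous fun t : ℝ => y + t • ν := by fun_prop
      have := this.tendsto 0
      simp only [zero_smul, add_zero] at this
      exact this.mono_left nhdsWithin_le_nhds
    refine mem_closure_of_tendsto ht ?_
    filter_upwards [ht.eventually_mem (Metric.isOpen_ball.mem_nhds hy), self_mem_nhdsWithin]
      with t ht1 ht2
    rw [hc _ ht1, sub_inner_add_smul hν, h, inner_add_right, inner_smul_self_one hν]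
    have : (0 : ℝ) < t := ht2
    linarith

/-- Translations in the chart direction push the closure of `Ω` into `Ω`. -/
lemma chart_translate (hν : ‖ν‖ = 1) (hγ : LipschitzWith K γ)
    (hc : ∀ y ∈ Metric.ball x₀ r, y ∈ Ω ↔ γ (y - inner ℝ ν y • ν) < inner ℝ ν y)
    {y : Vec n} (hy : y ∈ Metric.ball x₀ (r / 2)) (hyΩ : y ∈ closure Ω) {t : ℝ} (ht : 0 < t)
    (htr : t < r / 2) : y + t • ν ∈ Ω := by
  rw [Metric.mem_ball] at hy
  have h1 : y + t • ν ∈ Metric.ball x₀ r := by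
    rw [Metric.mem_ball]
    calc dist (y + t • ν) x₀ ≤ dist (y + t • ν) y + dist y x₀ := dist_triangle _ _ _
      _ = t + dist y x₀ := by simp [dist_eq_norm, norm_smul, hν, abs_of_pos ht]
      _ < r := by linarith
  have h2 : y ∈ Metric.ball x₀ r := by rw [Metric.mem_ball]; linarith
  rw [hc _ h1, sub_inner_add_smul hν, inner_add_right, inner_smul_self_one hν]
  have := chart_closure hν hγ hc h2 hyΩ
  linarith

open Module in
lemma finrank_orth (hn : 1 ≤ n) (hν : ‖ν‖ = 1) : finrank ℝ (ℝ ∙ ν)ᗮ = n - 1 := by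
  have : Fact (finrank ℝ (Vec n) = (n - 1) + 1) := ⟨by rw [finrank_euclideanSpace_fin]; omega⟩
  exact Submodule.finrank_orthogonal_span_singleton (by rintro rfl; simp at hν)

open Module in
-- The graph map `G` over the hyperplane orthogonal to `ν` is `(1 + K)`-Lipschitz and is inverted by
-- the orthogonal projection, which is `1`-Lipschitz. Hausdorff measure is controlled under both
-- maps, and on the hyperplane it is a Haar measure of dimension `n - 1`; this gives both surface
-- bounds. For the volume bound, a ball of radius proportional to `ρ` about `x + (ρ/2) ν` fits above
-- the graph.
lemma chart_regular (hn : 1 ≤ n) (hΩo : IsOpen Ω) (hν : ‖ν‖ = 1) (hr : 0 < r)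
    (hγ : LipschitzWith K γ)
    (hc : ∀ y ∈ Metric.ball x₀ r, y ∈ Ω ↔ γ (y - inner ℝ ν y • ν) < inner ℝ ν y) :
    ∃ r₀ c C : ℝ, 0 < r₀ ∧ 0 < c ∧ 0 < C ∧ ∀ x ∈ frontier Ω ∩ Metric.ball x₀ (r / 2),
      ∀ ρ ∈ Ioc 0 r₀, ENNReal.ofReal (c * ρ ^ (n - 1)) ≤ surfaceMeasure Ω (Metric.ball x ρ) ∧
        surfaceMeasure Ω (Metric.ball x ρ) ≤ ENNReal.ofReal (C * ρ ^ (n - 1)) ∧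
        ENNReal.ofReal (c * ρ ^ n) ≤ volume (Metric.ball x ρ ∩ Ω) := by
  set W := (ℝ ∙ ν)ᗮ with hW
  have hfr : finrank ℝ W = n - 1 := finrank_orth hn hν
  set μ : Measure W := Measure.hausdorffMeasure ((n : ℝ) - 1) with hμ
  have hcast : ((n : ℝ) - 1) = (finrank ℝ W : ℝ) := by
    rw [hfr, Nat.cast_sub hn]; simp
  have hn0 : (0 : ℝ) ≤ (n : ℝ) - 1 := by rw [hcast]; positivity
  have hμH : μ.IsAddHaarMeasure := by
    rw [hμ, hcast]; infer_instance
  have hball : ∀ (w : W) {ρ : ℝ}, 0 < ρ → μ (Metric.ball w ρ) =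
      ENNReal.ofReal (ρ ^ (n - 1)) * μ (Metric.ball 0 1) := by
    intro w ρ hρ
    rw [Measure.addHaar_ball_of_pos μ w hρ, hfr]
  set m := (μ (Metric.ball 0 1)).toReal with hm
  have hmtop : μ (Metric.ball 0 1) ≠ ⊤ := measure_ball_lt_top.ne
  have hm0 : 0 < m := ENNReal.toReal_pos (Metric.measure_ball_pos μ _ one_pos).ne' hmtop
  have hball' : ∀ (w : W) {ρ : ℝ}, 0 < ρ → μ (Metric.ball w ρ) =
      ENNReal.ofReal (ρ ^ (n - 1) * m) := by
    intro w ρ hρ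
    rw [hball w hρ, ENNReal.ofReal_mul (by positivity), hm, ENNReal.ofReal_toReal hmtop]
  set P : Vec n → W := fun y => W.orthogonalProjectionOnto y with hP
  have hPv : ∀ y, (P y : Vec n) = y - inner ℝ ν y • ν := by
    intro y
    rw [← Submodule.starProjection_unit_singleton ℝ hν y]
    exact congrArg Subtype.val (Submodule.orthogonalProjectionOnto_orthogonal (K := ℝ ∙ ν) y)
  have hPlip : LipschitzWith 1 P := W.lipschitzWith_orthogonalProjectionOnto
  have hinner : ∀ w : W, inner ℝ ν (w : Vec n) = 0 := fun w =>
    Submodule.mem_orthogonal_singleton_iff_inner_right.1 w.2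
  set G : W → Vec n := fun w => (w : Vec n) + γ (w : Vec n) • ν with hG
  have hGlip : LipschitzWith (1 + K) G := by
    refine LipschitzWith.of_dist_le_mul fun w z => ?_
    have e : G w - G z = ((w : Vec n) - z) + (γ w - γ z) • ν := by
      simp only [hG, sub_smul]; abel
    rw [dist_eq_norm, e]
    refine (norm_add_le _ _).trans ?_
    have h1 := hγ.dist_le_mul (w : Vec n) z
    rw [Real.dist_eq] at h1
    rw [norm_smul, hν, mul_one, Real.norm_eq_abs, ← dist_eq_norm, Subtype.dist_eq]
    push_cast
    nlinarith
  have hPG : ∀ w, P (G w) = w := by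
    intro w
    apply Subtype.ext
    rw [hPv]
    simp only [hG, sub_inner_add_smul hν, hinner, zero_smul, sub_zero]
  have hinG : ∀ w, inner ℝ ν (G w) = γ w := by
    intro w
    simp only [hG, inner_add_right, hinner, inner_smul_self_one hν, zero_add]
  have hGP : ∀ y ∈ frontier Ω ∩ Metric.ball x₀ r, G (P y) = y := by
    rintro y ⟨h1, h2⟩
    have := (chart_frontier hΩo hν hγ hc h2).1 h1
    simp only [hG, hPv, this]
    abel
  have hGmem : ∀ w, G w ∈ Metric.ball x₀ r → G w ∈ frontier Ω := by
    intro w hw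
    rw [chart_frontier hΩo hν hγ hc hw, ← hPv, hPG, hinG]
  have hL : (0 : ℝ) < 1 + K := by positivity
  -- volume of small balls
  set b := (volume (Metric.ball (0 : Vec n) 1)).toReal with hb
  have hbtop : volume (Metric.ball (0 : Vec n) 1) ≠ ⊤ := measure_ball_lt_top.ne
  have hb0 : 0 < b := ENNReal.toReal_pos (Metric.measure_ball_pos volume _ one_pos).ne' hbtop
  have hvol : ∀ (x : Vec n) {ρ : ℝ}, 0 < ρ →
      volume (Metric.ball x ρ) = ENNReal.ofReal (ρ ^ n * b) := by
    intro x ρ hρ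
    rw [Measure.addHaar_ball_of_pos volume x hρ, finrank_euclideanSpace_fin,
      ENNReal.ofReal_mul (by positivity), hb, ENNReal.ofReal_toReal hbtop]
  -- With this choice `(2 + K) a ρ = ρ / 2`. Within `a ρ` of `x + (ρ/2) ν` the graph rises by at
  -- most `K a ρ` and the height drops by at most `a ρ`, so a positive gap remains.
  set a : ℝ := 1 / (2 * (2 + K)) with ha
  have ha0 : 0 < a := by positivity
  refine ⟨r / 2, min ((1 / (1 + K)) ^ (n - 1) * m) (a ^ n * b), (1 + K) ^ (n - 1) * m,
    by linarith, by positivity, by positivity, ?_⟩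
  rintro x ⟨hxf, hxb⟩ ρ ⟨hρ0, hρ⟩
  rw [Metric.mem_ball] at hxb
  have hsub : Metric.ball x ρ ⊆ Metric.ball x₀ r := by
    intro y hy
    rw [Metric.mem_ball] at hy ⊢
    linarith [dist_triangle y x x₀]
  have hxr : x ∈ Metric.ball x₀ r := hsub (Metric.mem_ball_self hρ0)
  refine ⟨?_, ?_, ?_⟩
  · -- lower bound
    have h1 : Metric.ball (P x) (ρ / (1 + K)) ⊆
        W.orthogonalProjectionOnto '' (Metric.ball x ρ ∩ frontier Ω) := by
      intro w hw
      have hd : dist (G w) x < ρ := by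
        rw [← hGP x ⟨hxf, hxr⟩]
        refine (hGlip.dist_le_mul _ _).trans_lt ?_
        rw [Metric.mem_ball, lt_div_iff₀ hL] at hw
        push_cast
        linarith
      have hm : G w ∈ Metric.ball x ρ := hd
      exact ⟨G w, ⟨hm, hGmem w (hsub hm)⟩, hPG w⟩
    rw [surfaceMeasure, Measure.restrict_apply measurableSet_ball]
    refine le_trans ?_ (hausdorffMeasure_orthogonalProjectionOnto_le W _ _ hn0)
    refine le_trans ?_ (measure_mono h1)
    have h3 : 0 < ρ / (1 + K) := by positivity
    rw [← hμ, hball' _ h3]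
    refine ENNReal.ofReal_le_ofReal ?_
    calc min ((1 / (1 + (K : ℝ))) ^ (n - 1) * m) (a ^ n * b) * ρ ^ (n - 1)
        ≤ ((1 / (1 + (K : ℝ))) ^ (n - 1) * m) * ρ ^ (n - 1) := by gcongr; exact min_le_left _ _
      _ = (ρ / (1 + K)) ^ (n - 1) * m := by
        rw [div_pow, div_pow, one_pow]; ring
  · have h1 : Metric.ball x ρ ∩ frontier Ω ⊆ G '' Metric.ball (P x) ρ := by
      rintro y ⟨hy1, hy2⟩
      refine ⟨P y, ?_, hGP y ⟨hy2, hsub hy1⟩⟩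
      rw [Metric.mem_ball]
      refine (hPlip.dist_le_mul _ _).trans_lt ?_
      simpa using hy1
    rw [surfaceMeasure, Measure.restrict_apply measurableSet_ball]
    refine (measure_mono h1).trans ((hGlip.hausdorffMeasure_image_le hn0 _).trans ?_)
    rw [← hμ, hball' _ hρ0, hcast, hfr, ENNReal.rpow_natCast]
    have : ((1 + K : NNReal) : ℝ≥0∞) = ENNReal.ofReal (1 + K) := by
      rw [← ENNReal.ofReal_coe_nnreal]; simp
    rw [this, ← ENNReal.ofReal_pow (by positivity), ← ENNReal.ofReal_mul (by positivity)]
    refine ENNReal.ofReal_le_ofReal (le_of_eq ?_)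
    ring
  · have haρ : 0 < a * ρ := by positivity
    have h1 : Metric.ball (x + (ρ / 2) • ν) (a * ρ) ⊆ Metric.ball x ρ ∩ Ω := by
      intro y hy
      rw [Metric.mem_ball] at hy
      have hK : (2 + K) * (a * ρ) = ρ / 2 := by rw [ha]; field_simp
      have hdd : dist (x + (ρ / 2) • ν) x = ρ / 2 := by
        simp [dist_eq_norm, norm_smul, hν, abs_of_pos hρ0]
      have haρ2 : a * ρ ≤ ρ / 4 := by
        have : (0 : ℝ) ≤ K * (a * ρ) := by positivity
        nlinarith
      have hyb : y ∈ Metric.ball x ρ := by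
        rw [Metric.mem_ball]
        linarith [dist_triangle y (x + (ρ / 2) • ν) x]
      refine ⟨hyb, ?_⟩
      rw [hc y (hsub hyb)]
      have e1 := (lipschitz_height hν hγ).dist_le_mul y (x + (ρ / 2) • ν)
      simp only [sub_inner_add_smul hν] at e1
      rw [(chart_frontier hΩo hν hγ hc hxr).1 hxf, Real.dist_eq] at e1
      have e2 : |inner ℝ ν y - inner ℝ ν (x + (ρ / 2) • ν)| ≤ dist y (x + (ρ / 2) • ν) := by
        rw [← inner_sub_right, dist_eq_norm]
        simpa [hν] using abs_real_inner_le_norm ν (y - (x + (ρ / 2) • ν))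
      rw [inner_add_right, inner_smul_self_one hν] at e2
      have e3 : (K : ℝ) * dist y (x + (ρ / 2) • ν) ≤ K * (a * ρ) := by gcongr
      have := abs_le.1 e1
      have := abs_le.1 e2
      nlinarith
    refine le_trans ?_ (measure_mono h1)
    rw [hvol _ haρ]
    refine ENNReal.ofReal_le_ofReal ?_
    calc min ((1 / (1 + (K : ℝ))) ^ (n - 1) * m) (a ^ n * b) * ρ ^ n
        ≤ (a ^ n * b) * ρ ^ n := by gcongr; exact min_le_right _ _
      _ = (a * ρ) ^ n * b := by ring

end Chart

section Global
variable {Ω : Set (Vec n)}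

lemma isCompact_frontier' (hΩb : Bornology.IsBounded Ω) : IsCompact (frontier Ω) :=
  Metric.isCompact_of_isClosed_isBounded isClosed_frontier
    (hΩb.closure.subset frontier_subset_closure)

/-- The chart constants become uniform by compactness of the boundary: under unions one takes the
smaller lower constants and the larger upper one. -/
lemma boundary_regular_small (hn : 1 ≤ n) (hΩo : IsOpen Ω) (hΩb : Bornology.IsBounded Ω)
    (hΩL : HasLipschitzBoundary Ω) :
    ∃ r₀ c C : ℝ, 0 < r₀ ∧ 0 < c ∧ 0 < C ∧ ∀ x ∈ frontier Ω,
      ∀ ρ ∈ Ioc 0 r₀, ENNReal.ofReal (c * ρ ^ (n - 1)) ≤ surfaceMeasure Ω (Metric.ball x ρ) ∧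
        surfaceMeasure Ω (Metric.ball x ρ) ≤ ENNReal.ofReal (C * ρ ^ (n - 1)) ∧
        ENNReal.ofReal (c * ρ ^ n) ≤ volume (Metric.ball x ρ ∩ Ω) := by
  -- Membership in the boundary is kept as a separate hypothesis, so that the property makes sense
  -- for arbitrary sets and passes to subsets, as the induction on compact sets requires.
  suffices h : ∃ r₀ c C : ℝ, 0 < r₀ ∧ 0 < c ∧ 0 < C ∧ ∀ x ∈ frontier Ω, x ∈ frontier Ω →
      ∀ ρ ∈ Ioc 0 r₀, ENNReal.ofReal (c * ρ ^ (n - 1)) ≤ surfaceMeasure Ω (Metric.ball x ρ) ∧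
        surfaceMeasure Ω (Metric.ball x ρ) ≤ ENNReal.ofReal (C * ρ ^ (n - 1)) ∧
        ENNReal.ofReal (c * ρ ^ n) ≤ volume (Metric.ball x ρ ∩ Ω) by
    obtain ⟨r₀, c, C, h1, h2, h3, h4⟩ := h
    exact ⟨r₀, c, C, h1, h2, h3, fun x hx => h4 x hx hx⟩
  refine (isCompact_frontier' hΩb).induction_on (p := fun S => ∃ r₀ c C : ℝ, 0 < r₀ ∧ 0 < c ∧
    0 < C ∧ ∀ x ∈ S, x ∈ frontier Ω →
      ∀ ρ ∈ Ioc 0 r₀, ENNReal.ofReal (c * ρ ^ (n - 1)) ≤ surfaceMeasure Ω (Metric.ball x ρ) ∧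
        surfaceMeasure Ω (Metric.ball x ρ) ≤ ENNReal.ofReal (C * ρ ^ (n - 1)) ∧
        ENNReal.ofReal (c * ρ ^ n) ≤ volume (Metric.ball x ρ ∩ Ω)) ?_ ?_ ?_ ?_
  · exact ⟨1, 1, 1, one_pos, one_pos, one_pos, by simp⟩
  · rintro s t hst ⟨r₀, c, C, h1, h2, h3, h4⟩
    exact ⟨r₀, c, C, h1, h2, h3, fun x hx => h4 x (hst hx)⟩
  · rintro s t ⟨r₁, c₁, C₁, a1, a2, a3, a4⟩ ⟨r₂, c₂, C₂, b1, b2, b3, b4⟩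
    have mono : ∀ {c c' ρ : ℝ} {k : ℕ}, 0 < ρ → c ≤ c' →
        ENNReal.ofReal (c * ρ ^ k) ≤ ENNReal.ofReal (c' * ρ ^ k) := fun hρ h =>
      ENNReal.ofReal_le_ofReal (by gcongr)
    refine ⟨min r₁ r₂, min c₁ c₂, max C₁ C₂, lt_min a1 b1, lt_min a2 b2, lt_max_of_lt_left a3, ?_⟩
    rintro x (hx | hx) hxf ρ ⟨hρ0, hρ⟩
    · obtain ⟨e1, e2, e3⟩ := a4 x hx hxf ρ ⟨hρ0, hρ.trans (min_le_left _ _)⟩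
      exact ⟨(mono hρ0 (min_le_left _ _)).trans e1, e2.trans (mono hρ0 (le_max_left _ _)),
        (mono hρ0 (min_le_left _ _)).trans e3⟩
    · obtain ⟨e1, e2, e3⟩ := b4 x hx hxf ρ ⟨hρ0, hρ.trans (min_le_right _ _)⟩
      exact ⟨(mono hρ0 (min_le_right _ _)).trans e1, e2.trans (mono hρ0 (le_max_right _ _)),
        (mono hρ0 (min_le_right _ _)).trans e3⟩
  · intro x hx
    obtain ⟨ν, r, K, γ, h1, h2, h3, h4⟩ := hΩL x hx
    obtain ⟨r₀, c, C, h5, h6, h7, h8⟩ := chart_regular hn hΩo h1 h2 h3 h4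
    exact ⟨Metric.ball x (r / 2), mem_nhdsWithin_of_mem_nhds (Metric.ball_mem_nhds _ (by linarith)),
      r₀, c, C, h5, h6, h7, fun y hy hyf => h8 y ⟨hyf, hy⟩⟩

lemma surfaceMeasure_finite (hn : 1 ≤ n) (hΩo : IsOpen Ω) (hΩb : Bornology.IsBounded Ω)
    (hΩL : HasLipschitzBoundary Ω) : IsFiniteMeasure (surfaceMeasure Ω) := by
  obtain ⟨r₀, c, C, h1, h2, h3, h4⟩ := boundary_regular_small hn hΩo hΩb hΩL
  have h5 : surfaceMeasure Ω (frontier Ω) < ⊤ := by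
    refine (isCompact_frontier' hΩb).measure_lt_top_of_nhdsWithin fun x hx => ?_
    exact ⟨Metric.ball x r₀, mem_nhdsWithin_of_mem_nhds (Metric.ball_mem_nhds _ h1),
      (h4 x hx r₀ ⟨h1, le_rfl⟩).2.1.trans_lt ENNReal.ofReal_lt_top⟩
  refine ⟨?_⟩
  rw [surfaceMeasure, Measure.restrict_apply_univ]
  rwa [surfaceMeasure, Measure.restrict_apply_self] at h5

/-- Ahlfors regularity of the surface measure and the interior measure density condition, at all
scales up to a given one. -/
lemma boundary_regular (hn : 1 ≤ n) (hΩo : IsOpen Ω) (hΩb : Bornology.IsBounded Ω)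
    (hΩL : HasLipschitzBoundary Ω) {R : ℝ} (hR : 0 < R) :
    ∃ c C : ℝ, 0 < c ∧ 0 < C ∧
      (∀ x ∈ frontier Ω, ∀ ρ ∈ Ioc 0 R,
        ENNReal.ofReal (c * ρ ^ (n - 1)) ≤ surfaceMeasure Ω (Metric.ball x ρ) ∧
        ENNReal.ofReal (c * ρ ^ n) ≤ volume (Metric.ball x ρ ∩ Ω)) ∧
      ∀ x, ∀ ρ > 0, surfaceMeasure Ω (Metric.ball x ρ) ≤ ENNReal.ofReal (C * ρ ^ (n - 1)) := by
  obtain ⟨r₀, c, C, h1, h2, h3, h4⟩ := boundary_regular_small hn hΩo hΩb hΩL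
  have hfin := surfaceMeasure_finite hn hΩo hΩb hΩL
  set s := min r₀ R with hs
  have hs0 : 0 < s := lt_min h1 hR
  set S := (surfaceMeasure Ω univ).toReal with hS
  have hS0 : 0 ≤ S := ENNReal.toReal_nonneg
  -- Radii up to `R` are reduced to `min ρ s ≥ (s / R) ρ`, at the cost of powers of `s / R`. The
  -- upper constant covers small balls centred off the boundary, via a ball of twice the radius
  -- about a boundary point, and large balls, via the total mass.
  refine ⟨min (c * (s / R) ^ (n - 1)) (c * (s / R) ^ n),
    max (C * 2 ^ (n - 1)) (S / (r₀ / 2) ^ (n - 1)), by positivity, by positivity, ?_, ?_⟩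
  · rintro x hx ρ ⟨hρ0, hρ⟩
    have key : ∀ k : ℕ, min (c * (s / R) ^ (n - 1)) (c * (s / R) ^ n) ≤ c * (s / R) ^ k →
        min (c * (s / R) ^ (n - 1)) (c * (s / R) ^ n) * ρ ^ k ≤ c * (min ρ s) ^ k := by
      intro k hk
      have h5 : s / R * ρ ≤ min ρ s := by
        refine le_min ?_ ?_
        · exact mul_le_of_le_one_left hρ0.le ((div_le_one hR).2 (min_le_right _ _))
        · rw [div_mul_eq_mul_div, div_le_iff₀ hR]
          gcongr
      calc _ ≤ c * (s / R) ^ k * ρ ^ k := by gcongr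
        _ = c * (s / R * ρ) ^ k := by rw [mul_pow]; ring
        _ ≤ _ := by gcongr
    have hmin0 : 0 < min ρ s := lt_min hρ0 hs0
    obtain ⟨e1, -, e3⟩ := h4 x hx (min ρ s) ⟨hmin0, (min_le_right _ _).trans (min_le_left _ _)⟩
    have hbs : Metric.ball x (min ρ s) ⊆ Metric.ball x ρ := Metric.ball_subset_ball (min_le_left _ _)
    exact ⟨(ENNReal.ofReal_le_ofReal (key _ (min_le_left _ _))).trans (e1.trans (measure_mono hbs)),
      (ENNReal.ofReal_le_ofReal (key _ (min_le_right _ _))).trans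
        (e3.trans (measure_mono (inter_subset_inter_left _ hbs)))⟩
  · intro x ρ hρ
    by_cases hne : (Metric.ball x ρ ∩ frontier Ω).Nonempty
    · obtain ⟨z, hz1, hz2⟩ := hne
      by_cases hρr : 2 * ρ ≤ r₀
      · have hsub : Metric.ball x ρ ⊆ Metric.ball z (2 * ρ) := by
          intro y hy
          rw [Metric.mem_ball] at *
          linarith [dist_triangle y x z, dist_comm x z]
        refine (measure_mono hsub).trans ((h4 z hz2 (2 * ρ) ⟨by linarith, hρr⟩).2.1.trans ?_)
        refine ENNReal.ofReal_le_ofReal ?_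
        rw [mul_pow, ← mul_assoc]
        gcongr
        exact le_max_left _ _
      · refine (measure_mono (subset_univ _)).trans ?_
        rw [← ENNReal.ofReal_toReal (measure_ne_top (surfaceMeasure Ω) univ), ← hS]
        refine ENNReal.ofReal_le_ofReal ?_
        have h6 : r₀ / 2 ≤ ρ := by push Not at hρr; linarith
        have h7 : (r₀ / 2) ^ (n - 1) ≤ ρ ^ (n - 1) := by gcongr
        calc S = S / (r₀ / 2) ^ (n - 1) * (r₀ / 2) ^ (n - 1) := by field_simp
          _ ≤ _ := by gcongr; exact le_max_right _ _
    · rw [surfaceMeasure, Measure.restrict_apply measurableSet_ball, not_nonempty_iff_eq_empty.1 hne]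
      simp

lemma frontier_nonempty' (hn : 1 ≤ n) (hΩne : Ω.Nonempty) (hΩb : Bornology.IsBounded Ω) :
    (frontier Ω).Nonempty := by
  have : Nonempty (Fin n) := ⟨⟨0, hn⟩⟩
  refine nonempty_frontier_iff.2 ⟨hΩne, fun h => ?_⟩
  rw [h] at hΩb
  exact NormedSpace.unbounded_univ ℝ (Vec n) hΩb

end Global

/-! ### Integrals over boundary strips -/

section Strip
variable {Ω : Set (Vec n)}

lemma measurable_setLIntegral_ball {f : Vec n → ℝ≥0∞} (hf : Measurable f) {S : Set (Vec n)}
    (hS : MeasurableSet S) (r : ℝ) :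
    Measurable fun x => ∫⁻ y in Metric.ball x r ∩ S, f y := by
  have e : ∀ x, ∫⁻ y in Metric.ball x r ∩ S, f y =
      ∫⁻ y, ({z : Vec n × Vec n | dist z.2 z.1 < r ∧ z.2 ∈ S}.indicator (fun z => f z.2)) (x, y) := by
    intro x
    rw [← lintegral_indicator (measurableSet_ball.inter hS)]
    rfl
  simp only [e]
  refine Measurable.lintegral_prod_right' ?_
  refine (hf.comp measurable_snd).indicator ?_
  exact (measurableSet_lt (measurable_snd.dist measurable_fst) measurable_const).inter
    (measurable_snd hS)

/-- Integrals over a boundary strip are controlled by means over balls centred on the boundary. -/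
lemma strip_lintegral_le [SFinite (surfaceMeasure Ω)] (hne : (frontier Ω).Nonempty)
    {t : ℝ} {κ : ℝ≥0∞}
    (hκ : ∀ x ∈ frontier Ω, κ ≤ surfaceMeasure Ω (Metric.ball x t))
    {f : Vec n → ℝ≥0∞} (hf : Measurable f) {S : Set (Vec n)} (hS : MeasurableSet S) :
    κ * ∫⁻ y in {y | Metric.infDist y (frontier Ω) < t} ∩ S, f y ≤
      ∫⁻ x, (∫⁻ y in Metric.ball x (2 * t) ∩ S, f y) ∂(surfaceMeasure Ω) := by
  set T := {y | Metric.infDist y (frontier Ω) < t} with hT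
  have hTm : MeasurableSet T :=
    measurableSet_lt (Metric.continuous_infDist_pt _).measurable measurable_const
  set A : Set (Vec n × Vec n) := {z | dist z.2 z.1 < 2 * t ∧ z.2 ∈ S} with hA
  have hAm : MeasurableSet A :=
    (measurableSet_lt (measurable_snd.dist measurable_fst) measurable_const).inter
      (measurable_snd hS)
  have e : ∀ x, ∫⁻ y in Metric.ball x (2 * t) ∩ S, f y =
      ∫⁻ y, A.indicator (fun z => f z.2) (x, y) := by
    intro x
    rw [← lintegral_indicator (measurableSet_ball.inter hS)]
    rfl
  simp only [e]
  -- After Tonelli a point `y` of the strip carries the weight `σ (B (y, 2 t))`, and this ball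
  -- contains `B (x₀, t)` for a boundary point `x₀` within `t` of `y`.
  rw [lintegral_lintegral_swap (f := fun x y => A.indicator (fun z => f z.2) (x, y))
      ((hf.comp measurable_snd).indicator hAm).aemeasurable,
    ← lintegral_const_mul _ hf, ← lintegral_indicator (hTm.inter hS)]
  refine lintegral_mono fun y => ?_
  by_cases hy : y ∈ T ∩ S
  · rw [indicator_of_mem hy]
    have hsub : ∀ x, A.indicator (fun z => f z.2) (x, y) =
        (Metric.ball y (2 * t)).indicator (fun _ => f y) x := by
      intro x
      by_cases hx : dist x y < 2 * t
      · rw [indicator_of_mem (show x ∈ Metric.ball y (2 * t) from hx), indicator_of_mem]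
        exact ⟨by rwa [dist_comm] at hx, hy.2⟩
      · rw [indicator_of_notMem (show x ∉ Metric.ball y (2 * t) from hx), indicator_of_notMem]
        rintro ⟨h, -⟩
        rw [dist_comm] at h; exact hx h
    simp only [hsub]
    rw [lintegral_indicator measurableSet_ball, setLIntegral_const, mul_comm]
    gcongr
    obtain ⟨x₀, hx₀, hd⟩ := (Metric.infDist_lt_iff hne).1 hy.1
    refine (hκ x₀ hx₀).trans (measure_mono fun z hz => ?_)
    rw [Metric.mem_ball] at *
    linarith [dist_triangle z x₀ y, dist_comm x₀ y]
  · rw [indicator_of_notMem hy]; exact zero_le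

lemma vol_ball (x : Vec n) {r : ℝ} (hr : 0 < r) :
    volume (Metric.ball x r) =
      ENNReal.ofReal (r ^ n) * volume (Metric.ball (0 : Vec n) 1) := by
  rw [Measure.addHaar_ball_of_pos volume x hr, finrank_euclideanSpace_fin]

/-- The volume of boundary strips is at most linear in their width. -/
lemma strip_volume_le (hn : 1 ≤ n) (hΩne : Ω.Nonempty) (hΩo : IsOpen Ω)
    (hΩb : Bornology.IsBounded Ω) (hΩL : HasLipschitzBoundary Ω) {R : ℝ} (hR : 0 < R) :
    ∃ A : ℝ, 0 < A ∧ ∀ t ∈ Ioc 0 R,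
      volume {y | Metric.infDist y (frontier Ω) < t} ≤ ENNReal.ofReal (A * t) := by
  obtain ⟨c, C, hc, hC, h1, h2⟩ := boundary_regular hn hΩo hΩb hΩL hR
  have := surfaceMeasure_finite hn hΩo hΩb hΩL
  have hne := frontier_nonempty' hn hΩne hΩb
  set s := (surfaceMeasure Ω univ).toReal with hs
  set b := (volume (Metric.ball (0 : Vec n) 1)).toReal with hb
  have hs0 : 0 ≤ s := ENNReal.toReal_nonneg
  have hb0 : 0 ≤ b := ENNReal.toReal_nonneg
  have hbt : volume (Metric.ball (0 : Vec n) 1) = ENNReal.ofReal b :=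
    (ENNReal.ofReal_toReal measure_ball_lt_top.ne).symm
  have hst : surfaceMeasure Ω univ = ENNReal.ofReal s :=
    (ENNReal.ofReal_toReal (measure_ne_top _ _)).symm
  refine ⟨2 ^ n * b * s / c + 1, by positivity, fun t ht => ?_⟩
  have h3 := strip_lintegral_le hne (fun x hx => (h1 x hx t ht).1) (f := fun _ => 1)
    measurable_const MeasurableSet.univ
  simp only [inter_univ, setLIntegral_const, one_mul] at h3
  have h4 : ∀ x : Vec n, volume (Metric.ball x (2 * t)) = ENNReal.ofReal ((2 * t) ^ n * b) := by
    intro x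
    have := ht.1
    rw [vol_ball x (by linarith), hbt, ENNReal.ofReal_mul (by positivity)]
  simp only [h4, lintegral_const, hst] at h3
  have ht0 := ht.1
  have hct : 0 < c * t ^ (n - 1) := by positivity
  rw [← ENNReal.ofReal_mul (by positivity)] at h3
  have h5 : volume {y | Metric.infDist y (frontier Ω) < t} ≤
      ENNReal.ofReal ((2 * t) ^ n * b * s) / ENNReal.ofReal (c * t ^ (n - 1)) := by
    rw [ENNReal.le_div_iff_mul_le (Or.inl (by simpa using hct)) (Or.inl ENNReal.ofReal_ne_top),
      mul_comm]
    exact h3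
  rw [← ENNReal.ofReal_div_of_pos hct] at h5
  refine h5.trans (ENNReal.ofReal_le_ofReal ?_)
  have hpow : t ^ n = t ^ (n - 1) * t := by rw [← pow_succ]; congr 1; omega
  rw [mul_pow, hpow]
  have : 2 ^ n * (t ^ (n - 1) * t) * b * s / (c * t ^ (n - 1)) = 2 ^ n * b * s / c * t := by
    field_simp
  rw [this]
  nlinarith

/-- The boundary lies in every strip, and the volume of the strip of width `t` is `O(t)`. -/
lemma volume_frontier (hn : 1 ≤ n) (hΩne : Ω.Nonempty) (hΩo : IsOpen Ω)
    (hΩb : Bornology.IsBounded Ω) (hΩL : HasLipschitzBoundary Ω) : volume (frontier Ω) = 0 := by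
  obtain ⟨A, hA, h⟩ := strip_volume_le hn hΩne hΩo hΩb hΩL one_pos
  have h1 : ∀ t ∈ Ioc (0 : ℝ) 1, volume (frontier Ω) ≤ ENNReal.ofReal (A * t) := fun t ht =>
    (measure_mono fun x hx => by
      show Metric.infDist x (frontier Ω) < t
      rw [Metric.infDist_zero_of_mem hx]; exact ht.1).trans (h t ht)
  have h2 : Tendsto (fun t : ℝ => ENNReal.ofReal (A * t)) (𝓝[>] 0) (𝓝 0) := by
    have : Tendsto (fun t : ℝ => ENNReal.ofReal (A * t)) (𝓝 0) (𝓝 (ENNReal.ofReal (A * 0))) :=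
      (ENNReal.continuous_ofReal.comp (continuous_const.mul continuous_id)).tendsto 0
    simp only [mul_zero, ENNReal.ofReal_zero] at this
    exact this.mono_left nhdsWithin_le_nhds
  refine le_antisymm (ge_of_tendsto h2 ?_) zero_le
  filter_upwards [Ioc_mem_nhdsGT one_pos] with t ht using h1 t ht

/-- By connectedness, the segment from `y` to a near point of the complement meets the boundary. It
converts the distance to the complement, used for cutoffs, into the distance to the boundary, used
for strips. -/
lemma infDist_frontier_lt {y : Vec n} {t : ℝ} (hy : y ∈ Ω) (hne : (Ωᶜ).Nonempty)
    (h : Metric.infDist y Ωᶜ < t) : Metric.infDist y (frontier Ω) < t := by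
  obtain ⟨z, hz, hd⟩ := (Metric.infDist_lt_iff hne).1 h
  obtain ⟨x, hx1, hx2⟩ : (segment ℝ y z ∩ frontier Ω).Nonempty := by
    by_contra hemp
    have hno : ∀ x ∈ segment ℝ y z, x ∉ frontier Ω := fun x hx hx' => hemp ⟨x, hx, hx'⟩
    have hin : ∀ x ∈ segment ℝ y z, x ∈ Ω → x ∈ interior Ω := fun x hx hxΩ => by
      by_contra h'
      exact hno x hx ⟨subset_closure hxΩ, h'⟩
    have hout : ∀ x ∈ segment ℝ y z, x ∉ Ω → x ∈ (closure Ω)ᶜ := fun x hx hxΩ h' =>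
      hno x hx ⟨h', fun h'' => hxΩ (interior_subset h'')⟩
    obtain ⟨x, -, hx1, hx2⟩ := (convex_segment (𝕜 := ℝ) y z).isPreconnected _ _ isOpen_interior
      isClosed_closure.isOpen_compl
      (fun x hx => (em (x ∈ Ω)).imp (hin x hx) (hout x hx))
      ⟨y, left_mem_segment ℝ _ _, hin y (left_mem_segment ℝ _ _) hy⟩
      ⟨z, right_mem_segment ℝ _ _, hout z (right_mem_segment ℝ _ _) hz⟩
    exact hx2 (subset_closure (interior_subset hx1))
  refine (Metric.infDist_le_dist_of_mem hx2).trans_lt (lt_of_le_of_lt ?_ hd)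
  have := dist_add_dist_of_mem_segment hx1
  linarith [dist_nonneg (x := x) (y := z)]

/-- Smooth interior cutoffs with gradient inversely proportional to the strip width. -/
lemma exists_interior_cutoff (hΩb : Bornology.IsBounded Ω) {t : ℝ} (ht : 0 < t) :
    ∃ η : Vec n → ℝ, IsTest Ω η ∧ (∀ x, 0 ≤ η x ∧ η x ≤ 1) ∧
      (∀ x, 3 * t ≤ Metric.infDist x Ωᶜ → η x = 1) ∧
      ∀ j x, |pderiv j η x| ≤ 1 / t ∧ (3 * t ≤ Metric.infDist x Ωᶜ → pderiv j η x = 0) := by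
  set d : Vec n → ℝ := fun x => Metric.infDist x Ωᶜ with hd
  have hdl : LipschitzWith 1 d := Metric.lipschitz_infDist_pt _
  set K : NNReal := ⟨1 / t, by positivity⟩ with hK
  -- The profile vanishes up to `t`, equals one from `2 t` on and has slope `1 / t`. Mollifying at a
  -- scale below `t / 2` preserves the Lipschitz constant and shrinks the two plateaus by less than
  -- `t / 2`; the value one is claimed from `3 t` on.
  set g : ℝ → ℝ := fun s => max 0 (min 1 (s / t - 1)) with hg
  have hgl : LipschitzWith K g := by
    have h1 : LipschitzWith K (fun s : ℝ => s / t - 1) := by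
      refine LipschitzWith.of_dist_le_mul fun a b => le_of_eq ?_
      simp only [Real.dist_eq, hK]
      rw [show a / t - 1 - (b / t - 1) = (1 / t) * (a - b) by ring, abs_mul,
        abs_of_pos (show (0 : ℝ) < 1 / t by positivity)]
      rfl
    exact (h1.const_min 1).const_max 0
  have hgd : LipschitzWith K (fun x => g (d x)) := by
    have := hgl.comp hdl
    rw [mul_one] at this
    exact this
  obtain ⟨k, hk⟩ := exists_nat_one_div_lt (show (0 : ℝ) < t / 2 by positivity)
  have hgc : ∀ s, 0 ≤ g s ∧ g s ≤ 1 := fun s =>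
    ⟨le_max_left _ _, max_le zero_le_one (min_le_left _ _)⟩
  have hzero : ∀ x, d x < t / 2 → moll k (fun x => g (d x)) x = 0 := by
    intro x hx
    refine moll_eq_zero fun y hy => ?_
    have h1 := hdl.dist_le_mul y x
    rw [Real.dist_eq, dist_eq_norm] at h1
    have h2 := (abs_le.1 h1).2
    simp only [NNReal.coe_one, one_mul] at h2
    have h3 : d y / t - 1 ≤ 0 := by
      rw [sub_nonpos, div_le_one ht]; linarith
    simp only [hg]
    exact max_eq_left ((min_le_right _ _).trans h3)
  have hone : ∀ x, 11 / 4 * t < d x → moll k (fun x => g (d x)) x = 1 := by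
    intro x hx
    have e : moll k (fun x => g (d x)) x - 1 = 0 := by
      have h1 : ∀ z, ‖z‖ < 1 / ((k : ℝ) + 1) → g (d (x - z)) = 1 := by
        intro z hz
        have h1 := hdl.dist_le_mul (x - z) x
        rw [Real.dist_eq, dist_eq_norm] at h1
        have h2 := (abs_le.1 h1).1
        simp only [NNReal.coe_one, one_mul, sub_sub_cancel_left, norm_neg] at h2
        have h3 : 1 ≤ d (x - z) / t - 1 := by
          rw [le_sub_iff_add_le, le_div_iff₀ ht]; linarith
        simp [hg, min_eq_left h3]
      rw [moll_apply, ← integral_ker (n := n) k, sub_eq_zero]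
      refine integral_congr_ae (Eventually.of_forall fun z => ?_)
      by_cases hz : ‖z‖ < 1 / ((k : ℝ) + 1)
      · simp [h1 z hz]
      · simp [ker_eq_zero (not_lt.1 hz)]
    linarith
  have hts : tsupport (moll k (fun x => g (d x))) ⊆ {x | t / 2 ≤ d x} := by
    refine closure_minimal (fun x hx => ?_)
      (isClosed_le continuous_const (Metric.continuous_infDist_pt _))
    by_contra h
    exact hx (hzero x (not_le.1 h))
  have hsub : {x | t / 2 ≤ d x} ⊆ Ω := by
    intro x hx
    by_contra h
    have h' : x ∈ Ωᶜ := h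
    have : d x = 0 := Metric.infDist_zero_of_mem h'
    simp only [mem_ofPred_eq, this] at hx
    linarith
  refine ⟨moll k (fun x => g (d x)), ⟨moll_contDiff k hgd.continuous.locallyIntegrable, ?_,
    hts.trans hsub⟩, fun x => ⟨moll_nonneg k (fun x => (hgc _).1) x, ?_⟩,
    fun x hx => hone x (by linarith), fun j x => ⟨?_, ?_⟩⟩
  · exact (Metric.isCompact_of_isClosed_isBounded isClosed_closure hΩb.closure).of_isClosed_subset
      (isClosed_tsupport _) ((hts.trans hsub).trans subset_closure)
  · exact (le_abs_self _).trans (abs_moll_le k (fun x => by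
      rw [abs_of_nonneg (hgc _).1]; exact (hgc _).2) x)
  · exact abs_pderiv_le (moll_lipschitz k hgd) j x
  · intro hx
    have : moll k (fun x => g (d x)) =ᶠ[𝓝 x] fun _ => 1 := by
      have ho : IsOpen {x | 11 / 4 * t < d x} := isOpen_lt continuous_const
        (Metric.continuous_infDist_pt _)
      filter_upwards [ho.mem_nhds (show 11 / 4 * t < d x by linarith)] with y hy using hone y hy
    simp [pderiv, this.fderiv_eq]

end Strip

/-! ### Extension by zero of functions with vanishing trace -/

section ZeroTrace
variable {Ω : Set (Vec n)}

/-- By `strip_lintegral_le`, the strip integral divided by `t` is at most a constant times the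
surface integral of the means over `B_{6t}(x) ∩ Ω`. These tend to zero almost everywhere, and
boundedness of `f` gives a constant dominating function for the finite surface measure. -/
lemma tendsto_strip_of_bounded (hn : 1 ≤ n) (hΩne : Ω.Nonempty) (hΩo : IsOpen Ω)
    (hΩb : Bornology.IsBounded Ω) (hΩL : HasLipschitzBoundary Ω) {f : Vec n → ℝ≥0∞}
    (hf : Measurable f) {M : ℝ} (hM : ∀ x, f x ≤ ENNReal.ofReal M)
    (ht : ∀ᵐ x ∂(surfaceMeasure Ω),
      Tendsto (fun r : ℝ => ⨍⁻ y in Metric.ball x r ∩ Ω, f y ∂volume) (𝓝[>] 0) (𝓝 0)) :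
    Tendsto (fun t : ℝ => (ENNReal.ofReal t)⁻¹ *
      ∫⁻ y in {y | Metric.infDist y (frontier Ω) < 3 * t} ∩ Ω, f y) (𝓝[>] 0) (𝓝 0) := by
  obtain ⟨c, C, hc, hC, h1, h2⟩ := boundary_regular hn hΩo hΩb hΩL one_pos
  have := surfaceMeasure_finite hn hΩo hΩb hΩL
  have hne := frontier_nonempty' hn hΩne hΩb
  set b := volume (Metric.ball (0 : Vec n) 1) with hb
  have hbt : b ≠ ⊤ := measure_ball_lt_top.ne
  set g : ℝ → Vec n → ℝ≥0∞ := fun r x =>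
    (ENNReal.ofReal (r ^ n))⁻¹ * ∫⁻ y in Metric.ball x r ∩ Ω, f y with hg
  have hgm : ∀ r, Measurable (g r) := fun r =>
    (measurable_setLIntegral_ball hf hΩo.measurableSet r).const_mul _
  have hvol : ∀ (x : Vec n) {r : ℝ}, 0 < r →
      volume (Metric.ball x r ∩ Ω) ≤ ENNReal.ofReal (r ^ n) * b := fun x r hr =>
    (measure_mono inter_subset_left).trans (vol_ball x hr).le
  have hinv : ∀ {r : ℝ}, 0 < r → (ENNReal.ofReal (r ^ n))⁻¹ * ENNReal.ofReal (r ^ n) = 1 := by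
    intro r hr
    exact ENNReal.inv_mul_cancel (by simpa using pow_pos hr n) ENNReal.ofReal_ne_top
  have hgle : ∀ {r : ℝ} (x : Vec n), 0 < r →
      g r x ≤ b * ⨍⁻ y in Metric.ball x r ∩ Ω, f y ∂volume := by
    intro r x hr
    have hfin : volume (Metric.ball x r ∩ Ω) ≠ ⊤ :=
      ((measure_mono inter_subset_left).trans_lt measure_ball_lt_top).ne
    simp only [hg]
    rw [← measure_mul_setLAverage f hfin, ← mul_assoc]
    gcongr
    calc (ENNReal.ofReal (r ^ n))⁻¹ * volume (Metric.ball x r ∩ Ω)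
        ≤ (ENNReal.ofReal (r ^ n))⁻¹ * (ENNReal.ofReal (r ^ n) * b) := by gcongr; exact hvol x hr
      _ = b := by rw [← mul_assoc, hinv hr, one_mul]
  have hgb : ∀ {r : ℝ} (x : Vec n), 0 < r → g r x ≤ b * ENNReal.ofReal M := by
    intro r x hr
    simp only [hg]
    calc (ENNReal.ofReal (r ^ n))⁻¹ * ∫⁻ y in Metric.ball x r ∩ Ω, f y
        ≤ (ENNReal.ofReal (r ^ n))⁻¹ * ∫⁻ y in Metric.ball x r ∩ Ω, ENNReal.ofReal M := by
          gcongr with y; exact hM y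
      _ = (ENNReal.ofReal (r ^ n))⁻¹ * (ENNReal.ofReal M * volume (Metric.ball x r ∩ Ω)) := by
          rw [setLIntegral_const]
      _ ≤ (ENNReal.ofReal (r ^ n))⁻¹ * (ENNReal.ofReal M * (ENNReal.ofReal (r ^ n) * b)) := by
          gcongr; exact hvol x hr
      _ = ((ENNReal.ofReal (r ^ n))⁻¹ * ENNReal.ofReal (r ^ n)) * (b * ENNReal.ofReal M) := by ring
      _ = _ := by rw [hinv hr, one_mul]
  have hlim : Tendsto (fun r : ℝ => ∫⁻ x, g r x ∂(surfaceMeasure Ω)) (𝓝[>] 0) (𝓝 0) := by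
    have h0 : (0 : ℝ≥0∞) = ∫⁻ x, (0 : ℝ≥0∞) ∂(surfaceMeasure Ω) := by simp
    rw [h0]
    refine tendsto_lintegral_filter_of_dominated_convergence (fun _ => b * ENNReal.ofReal M)
      (Eventually.of_forall hgm) ?_ ?_ ?_
    · filter_upwards [self_mem_nhdsWithin] with r hr
      exact Eventually.of_forall fun x => hgb x hr
    · rw [lintegral_const]
      exact ENNReal.mul_ne_top (ENNReal.mul_ne_top hbt ENNReal.ofReal_ne_top) (measure_ne_top _ _)
    · filter_upwards [ht] with x hx
      have h3 := ENNReal.Tendsto.const_mul (a := b) hx (Or.inr hbt)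
      rw [mul_zero] at h3
      refine tendsto_of_tendsto_of_tendsto_of_le_of_le' tendsto_const_nhds h3
        (Eventually.of_forall fun _ => zero_le) ?_
      filter_upwards [self_mem_nhdsWithin] with r hr using hgle x hr
  have hsc : Tendsto (fun t : ℝ => 6 * t) (𝓝[>] 0) (𝓝[>] 0) := by
    refine tendsto_nhdsWithin_iff.2 ⟨?_, ?_⟩
    · have : Tendsto (fun t : ℝ => 6 * t) (𝓝 0) (𝓝 (6 * 0)) :=
        (continuous_const.mul continuous_id).tendsto 0
      rw [mul_zero] at this
      exact this.mono_left nhdsWithin_le_nhds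
    · filter_upwards [self_mem_nhdsWithin] with t ht
      have : (0 : ℝ) < t := ht
      show (0 : ℝ) < 6 * t
      linarith
  -- The factor `(6 t) ^ n` undoes the normalisation of the means and `c (3 t) ^ (n - 1)` is the
  -- lower surface density at radius `3 t`; their quotient is `A t`.
  set A : ℝ := 6 ^ n / (c * 3 ^ (n - 1)) with hA
  have hfin := ENNReal.Tendsto.const_mul (a := ENNReal.ofReal A) (hlim.comp hsc)
    (Or.inr ENNReal.ofReal_ne_top)
  rw [mul_zero] at hfin
  refine tendsto_of_tendsto_of_tendsto_of_le_of_le' tendsto_const_nhds hfin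
    (Eventually.of_forall fun _ => zero_le) ?_
  filter_upwards [Ioc_mem_nhdsGT (show (0 : ℝ) < 1 / 3 by norm_num)] with t ht
  have ht0 : 0 < t := ht.1
  have h3t : 3 * t ∈ Ioc (0 : ℝ) 1 := ⟨by linarith, by linarith [ht.2]⟩
  have hs := strip_lintegral_le hne (fun x hx => (h1 x hx (3 * t) h3t).1) hf hΩo.measurableSet
  have e6 : 2 * (3 * t) = 6 * t := by ring
  rw [e6] at hs
  have hgi : ∫⁻ x, (∫⁻ y in Metric.ball x (6 * t) ∩ Ω, f y) ∂(surfaceMeasure Ω) =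
      ENNReal.ofReal ((6 * t) ^ n) * ∫⁻ x, g (6 * t) x ∂(surfaceMeasure Ω) := by
    simp only [hg]
    rw [lintegral_const_mul _ (measurable_setLIntegral_ball hf hΩo.measurableSet _), ← mul_assoc,
      mul_comm (ENNReal.ofReal _), hinv (by linarith), one_mul]
  rw [hgi] at hs
  set I := ∫⁻ y in {y | Metric.infDist y (frontier Ω) < 3 * t} ∩ Ω, f y
  set J := ∫⁻ x, g (6 * t) x ∂(surfaceMeasure Ω)
  have hct : 0 < c * (3 * t) ^ (n - 1) := by positivity
  have hI : I ≤ ENNReal.ofReal ((6 * t) ^ n / (c * (3 * t) ^ (n - 1))) * J := by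
    rw [ENNReal.ofReal_div_of_pos hct, ← ENNReal.mul_div_right_comm,
      ENNReal.le_div_iff_mul_le (Or.inl (by simpa using hct)) (Or.inl ENNReal.ofReal_ne_top),
      mul_comm]
    exact hs
  have hpow : t ^ n = t ^ (n - 1) * t := by rw [← pow_succ]; congr 1; omega
  have hAt : (6 * t) ^ n / (c * (3 * t) ^ (n - 1)) = t * A := by
    rw [hA, mul_pow, mul_pow, hpow]; field_simp
  rw [hAt, ENNReal.ofReal_mul ht0.le] at hI
  calc (ENNReal.ofReal t)⁻¹ * I ≤ (ENNReal.ofReal t)⁻¹ * (ENNReal.ofReal t * ENNReal.ofReal A * J) := by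
        gcongr
    _ = ((ENNReal.ofReal t)⁻¹ * ENNReal.ofReal t) * (ENNReal.ofReal A * J) := by ring
    _ = ENNReal.ofReal A * J := by
        rw [ENNReal.inv_mul_cancel (by simpa using ht0) ENNReal.ofReal_ne_top, one_mul]

/-- Test with `η φ`, where `η` is an interior cutoff of width `t`. Its gradient is at most `1 / t`
and vanishes in `Ω` off the boundary strip of width `3 t`, so the extra term is at most `sup |φ| t⁻¹
∫ |u|` over the strip. This vanishes as `t → 0` by `tendsto_strip_of_bounded`. -/
lemma WD.zero_trace_bounded (hn : 1 ≤ n) (hΩne : Ω.Nonempty) (hΩo : IsOpen Ω)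
    (hΩb : Bornology.IsBounded Ω) (hΩL : HasLipschitzBoundary Ω) {j : Fin n} {u w : Vec n → ℝ}
    (h : WD Ω j u w) (hum : Measurable u) (hu : IntegrableOn u Ω) (hw : IntegrableOn w Ω) {M : ℝ}
    (hM : ∀ x, |u x| ≤ M)
    (ht : ∀ᵐ x ∂(surfaceMeasure Ω),
      Tendsto (fun r : ℝ => ⨍⁻ y in Metric.ball x r ∩ Ω, ‖u y‖ₑ ∂volume) (𝓝[>] 0) (𝓝 0)) :
    WD univ j (Ω.indicator u) (Ω.indicator w) := by
  have hui : Integrable (Ω.indicator u) := (integrable_indicator_iff hΩo.measurableSet).2 hu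
  have hwi : Integrable (Ω.indicator w) := (integrable_indicator_iff hΩo.measurableSet).2 hw
  have hcne : (Ωᶜ).Nonempty := by
    obtain ⟨x, hx⟩ := frontier_nonempty' hn hΩne hΩb
    rw [hΩo.frontier_eq] at hx
    exact ⟨x, hx.2⟩
  refine ⟨hui.locallyIntegrable.locallyIntegrableOn _, hwi.locallyIntegrable.locallyIntegrableOn _,
    fun φ hφ => ?_⟩
  have hlim := tendsto_strip_of_bounded hn hΩne hΩo hΩb hΩL hum.enorm (M := M)
    (fun x => by rw [Real.enorm_eq_ofReal_abs]; exact ENNReal.ofReal_le_ofReal (hM x)) ht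
  set t : ℕ → ℝ := fun k => 1 / ((k : ℝ) + 1) with htk
  have ht0 : ∀ k, 0 < t k := fun k => by positivity
  have htt : Tendsto t atTop (𝓝[>] 0) := tendsto_nhdsWithin_iff.2
    ⟨tendsto_one_div_add_atTop_nhds_zero_nat, Eventually.of_forall ht0⟩
  choose η hη hη01 hη1 hηd using fun k => exists_interior_cutoff hΩb (ht0 k)
  have hηlim : ∀ x ∈ Ω, Tendsto (fun k => η k x) atTop (𝓝 1) := by
    intro x hx
    have hpos : 0 < Metric.infDist x Ωᶜ := by
      rw [← hΩo.isClosed_compl.notMem_iff_infDist_pos hcne]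
      exact fun h => h hx
    have : Tendsto (fun k => 3 * t k) atTop (𝓝 (3 * 0)) :=
      (htt.mono_right nhdsWithin_le_nhds).const_mul 3
    rw [mul_zero] at this
    refine tendsto_const_nhds.congr' ?_
    filter_upwards [this.eventually_lt_const hpos] with k hk using (hη1 k x hk.le).symm
  have hφc := hφ.continuous
  have bdd : ∀ {ψ : Vec n → ℝ}, IsTest univ ψ → ∃ C, ∀ x, |ψ x| ≤ C := by
    intro ψ hψ
    exact hψ.2.1.exists_bound_of_continuous hψ.continuous
  obtain ⟨C, hC⟩ := bdd hφ
  obtain ⟨C', hC'⟩ := bdd (hφ.pderiv j)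
  have parts : ∀ k, (∫ x, Ω.indicator u x * (η k x * pderiv j φ x)) +
      ∫ x, Ω.indicator u x * (pderiv j (η k) x * φ x) =
      -∫ x, Ω.indicator w x * (η k x * φ x) := by
    intro k
    have e := h.parts _ ((hη k).mul_of_left hφ.1)
    have hd : ∀ x, pderiv j (fun x => η k x * φ x) x =
        η k x * pderiv j φ x + pderiv j (η k) x * φ x := fun x =>
      pderiv_mul ((hη k).differentiable x) (hφ.differentiable x) j
    simp only [hd] at e
    have i1 : ∀ f g : Vec n → ℝ, (∀ x ∉ Ω, g x = 0) →
        (fun x => Ω.indicator f x * g x) = fun x => f x * g x := by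
      intro f g hg
      ext x
      by_cases hx : x ∈ Ω
      · simp [hx]
      · simp [hx, hg x hx]
    rw [i1 u _ (fun x hx => by simp [(hη k).eq_zero hx]),
      i1 u _ (fun x hx => by simp [((hη k).pderiv j).eq_zero hx]),
      i1 w _ (fun x hx => by simp [(hη k).eq_zero hx]), ← e, ← integral_add]
    · congr 1; ext x; ring
    · exact ((hη k).mul_of_left (hφ.pderiv j).1).integrable_mul h.locL
    · exact (((hη k).pderiv j).mul_of_left hφ.1).integrable_mul h.locL
  have dct : ∀ {f ψ : Vec n → ℝ} {D : ℝ}, Integrable (Ω.indicator f) → Continuous ψ →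
      (∀ x, |ψ x| ≤ D) → Tendsto (fun k => ∫ x, Ω.indicator f x * (η k x * ψ x)) atTop
        (𝓝 (∫ x, Ω.indicator f x * ψ x)) := by
    intro f ψ D hf hψ hD
    refine tendsto_integral_of_dominated_convergence (fun x => ‖Ω.indicator f x‖ * D) (fun k => ?_)
      (hf.norm.mul_const _) (fun k => Eventually.of_forall fun x => ?_)
      (Eventually.of_forall fun x => ?_)
    · exact hf.aestronglyMeasurable.mul ((hη k).continuous.mul hψ).aestronglyMeasurable
    · rw [norm_mul, norm_mul, Real.norm_of_nonneg (hη01 k x).1]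
      gcongr
      exact (mul_le_of_le_one_left (norm_nonneg _) (hη01 k x).2).trans (hD x)
    · by_cases hx : x ∈ Ω
      · have := ((hηlim x hx).mul_const (ψ x)).const_mul (Ω.indicator f x)
        rwa [one_mul] at this
      · simp [hx]
  have l1 := dct hui (hφ.pderiv j).continuous hC'
  have l2 := dct hwi hφc hC
  have l3 : Tendsto (fun k => ∫ x, Ω.indicator u x * (pderiv j (η k) x * φ x)) atTop (𝓝 0) := by
    rw [tendsto_zero_iff_norm_tendsto_zero]
    have hlk := ENNReal.Tendsto.const_mul (a := ENNReal.ofReal C) (hlim.comp htt)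
      (Or.inr ENNReal.ofReal_ne_top)
    rw [mul_zero] at hlk
    have hlr := (ENNReal.tendsto_toReal ENNReal.zero_ne_top).comp hlk
    refine tendsto_of_tendsto_of_tendsto_of_le_of_le' tendsto_const_nhds hlr
      (Eventually.of_forall fun _ => norm_nonneg _) ?_
    filter_upwards [hlk.eventually_lt_const ENNReal.zero_lt_top] with k hk
    rw [← toReal_enorm]
    refine ENNReal.toReal_mono hk.ne ?_
    refine (enorm_integral_le_lintegral_enorm _).trans ?_
    set S := {y | Metric.infDist y (frontier Ω) < 3 * t k} ∩ Ω with hS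
    have hSm : MeasurableSet S := (measurableSet_lt (Metric.continuous_infDist_pt _).measurable
      measurable_const).inter hΩo.measurableSet
    have hpt : ∀ x, ‖Ω.indicator u x * (pderiv j (η k) x * φ x)‖ₑ ≤
        S.indicator (fun x => ENNReal.ofReal C * ((ENNReal.ofReal (t k))⁻¹ * ‖u x‖ₑ)) x := by
      intro x
      by_cases hx : x ∈ S
      · rw [indicator_of_mem hx, indicator_of_mem hx.2, enorm_mul, enorm_mul]
        have a1 : ‖pderiv j (η k) x‖ₑ ≤ (ENNReal.ofReal (t k))⁻¹ := by
          rw [Real.enorm_eq_ofReal_abs, ← ENNReal.ofReal_inv_of_pos (ht0 k)]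
          exact ENNReal.ofReal_le_ofReal (by simpa using (hηd k j x).1)
        have a2 : ‖φ x‖ₑ ≤ ENNReal.ofReal C := by
          rw [Real.enorm_eq_ofReal_abs]; exact ENNReal.ofReal_le_ofReal (hC x)
        calc ‖u x‖ₑ * (‖pderiv j (η k) x‖ₑ * ‖φ x‖ₑ)
            ≤ ‖u x‖ₑ * ((ENNReal.ofReal (t k))⁻¹ * ENNReal.ofReal C) := by gcongr
          _ = _ := by ring
      · rw [indicator_of_notMem hx]
        by_cases hxΩ : x ∈ Ω
        · have hd : 3 * t k ≤ Metric.infDist x Ωᶜ := by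
            by_contra! h'
            exact hx ⟨infDist_frontier_lt hxΩ hcne h', hxΩ⟩
          have : pderiv j (η k) x = 0 := (hηd k j x).2 hd
          simp [this]
        · simp [hxΩ]
    calc ∫⁻ x, ‖Ω.indicator u x * (pderiv j (η k) x * φ x)‖ₑ
        ≤ ∫⁻ x, S.indicator (fun x => ENNReal.ofReal C * ((ENNReal.ofReal (t k))⁻¹ * ‖u x‖ₑ)) x :=
          lintegral_mono hpt
      _ = _ := by
          rw [lintegral_indicator hSm, lintegral_const_mul _ (hum.enorm.const_mul _),
            lintegral_const_mul _ hum.enorm]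
          rfl
  have := tendsto_nhds_unique (l1.add l3) (l2.neg.congr fun k => (parts k).symm)
  simpa using this

end ZeroTrace

/-! ### Removal of the boundedness assumption, and uniqueness of traces. -/

/-- Non-empty bounded open sets with Lipschitz boundary. -/
structure IsLipDomain (Ω : Set (Vec n)) : Prop where
  one_le : 1 ≤ n
  nonempty : Ω.Nonempty
  isOpen : IsOpen Ω
  bdd : Bornology.IsBounded Ω
  lip : HasLipschitzBoundary Ω

section
variable {Ω : Set (Vec n)}

lemma IsLipDomain.volume_frontier (hΩ : IsLipDomain Ω) : volume (frontier Ω) = 0 :=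
  RelaxedMin.volume_frontier hΩ.one_le hΩ.nonempty hΩ.isOpen hΩ.bdd hΩ.lip

lemma IsLipDomain.volume_ne_top (hΩ : IsLipDomain Ω) : volume Ω ≠ ⊤ :=
  hΩ.bdd.measure_lt_top.ne

/-- The means of `|z|` over `B_r(x) ∩ Ω` vanish in the limit at almost every boundary point. -/
def ZeroTrace {V : Type*} [NormedAddCommGroup V] (Ω : Set (Vec n)) (z : Vec n → V) : Prop :=
  ∀ᵐ x ∂(surfaceMeasure Ω),
    Tendsto (fun r : ℝ => ⨍⁻ y in Metric.ball x r ∩ Ω, ‖z y‖ₑ ∂volume) (𝓝[>] 0) (𝓝 0)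

lemma ZeroTrace.of_le {V W : Type*} [NormedAddCommGroup V] [NormedAddCommGroup W]
    {z : Vec n → V} {z' : Vec n → W} (h : ZeroTrace Ω z)
    (hz : ∀ᵐ x ∂(volume.restrict Ω), ‖z' x‖ₑ ≤ ‖z x‖ₑ) : ZeroTrace Ω z' := by
  filter_upwards [h] with x hx
  refine tendsto_of_tendsto_of_tendsto_of_le_of_le tendsto_const_nhds hx (fun _ => zero_le)
    fun r => ?_
  rw [setLAverage_eq, setLAverage_eq]
  gcongr 1
  exact lintegral_mono_ae (ae_mono (Measure.restrict_mono_set _ inter_subset_right) hz)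

/-- The arctangent truncation at height of order `m + 1`. -/
noncomputable def atrunc (m : ℕ) (s : ℝ) : ℝ := ((m : ℝ) + 1) * Real.arctan (s / ((m : ℝ) + 1))

lemma hasDerivAt_atrunc (m : ℕ) (s : ℝ) :
    HasDerivAt (atrunc m) (1 / (1 + (s / ((m : ℝ) + 1)) ^ 2)) s := by
  have h0 : ((m : ℝ) + 1) ≠ 0 := by positivity
  have h1 := ((hasDerivAt_id s).div_const ((m : ℝ) + 1)).arctan.const_mul ((m : ℝ) + 1)
  refine h1.congr_deriv ?_
  simp only [id_eq]
  rw [one_div_mul_one_div_rev] 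
  field_simp

lemma deriv_atrunc (m : ℕ) (s : ℝ) : deriv (atrunc m) s = 1 / (1 + (s / ((m : ℝ) + 1)) ^ 2) :=
  (hasDerivAt_atrunc m s).deriv

lemma deriv_atrunc_mem (m : ℕ) (s : ℝ) : |deriv (atrunc m) s| ≤ 1 := by
  rw [deriv_atrunc, abs_of_pos (by positivity), div_le_one (by positivity)]
  nlinarith [sq_nonneg (s / ((m : ℝ) + 1))]

lemma contDiff_atrunc (m : ℕ) : ContDiff ℝ ∞ (atrunc m) :=
  contDiff_const.mul (Real.contDiff_arctan.comp (contDiff_id.div_const _))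

lemma lipschitz_atrunc (m : ℕ) : LipschitzWith 1 (atrunc m) :=
  lipschitzWith_of_nnnorm_deriv_le ((contDiff_atrunc m).differentiable (by simp)) fun s => by
    rw [← NNReal.coe_le_coe]; simpa using deriv_atrunc_mem m s

lemma abs_atrunc_le (m : ℕ) (s : ℝ) : |atrunc m s| ≤ |s| := by
  have := (lipschitz_atrunc m).dist_le_mul s 0
  simpa [Real.dist_eq, atrunc] using this

lemma abs_atrunc_le' (m : ℕ) (s : ℝ) : |atrunc m s| ≤ ((m : ℝ) + 1) * 2 := by
  rw [atrunc, abs_mul, abs_of_pos (show (0 : ℝ) < m + 1 by positivity)]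
  gcongr
  have h1 := Real.arctan_lt_pi_div_two (s / ((m : ℝ) + 1))
  have h2 := Real.neg_pi_div_two_lt_arctan (s / ((m : ℝ) + 1))
  rw [abs_le]
  constructor <;> linarith [Real.pi_le_four]

lemma tendsto_deriv_atrunc (s : ℝ) : Tendsto (fun m => deriv (atrunc m) s) atTop (𝓝 1) := by
  simp only [deriv_atrunc]
  have h1 : Tendsto (fun m : ℕ => s / ((m : ℝ) + 1)) atTop (𝓝 0) :=
    tendsto_const_nhds.div_atTop (tendsto_atTop_add_const_right _ _ tendsto_natCast_atTop_atTop)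
  have := (tendsto_const_nhds (x := (1 : ℝ))).div ((tendsto_const_nhds (x := (1 : ℝ))).add (h1.pow 2))
    (by norm_num)
  simp only [ne_eq, OfNat.ofNat_ne_zero, not_false_eq_true, zero_pow, add_zero, div_one] at this
  exact this

lemma tendsto_atrunc (s : ℝ) : Tendsto (fun m => atrunc m s) atTop (𝓝 s) := by
  rcases eq_or_ne s 0 with rfl | hs
  · simp [atrunc]
  have h1 : Tendsto (fun m : ℕ => s / ((m : ℝ) + 1)) atTop (𝓝[≠] 0) := by
    refine tendsto_nhdsWithin_iff.2 ⟨tendsto_const_nhds.div_atTop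
      (tendsto_atTop_add_const_right _ _ tendsto_natCast_atTop_atTop), Eventually.of_forall fun m => ?_⟩
    have : (0 : ℝ) < m + 1 := by positivity
    exact div_ne_zero hs this.ne'
  have h2 := (hasDerivAt_iff_tendsto_slope.1 (Real.hasDerivAt_arctan 0)).comp h1
  have h3 := h2.const_mul s
  simp only [Function.comp_def, slope_def_field, Real.arctan_zero, sub_zero] at h3
  norm_num at h3
  refine h3.congr fun m => ?_
  have : (0 : ℝ) < m + 1 := by positivity
  rw [atrunc]
  field_simp

/-- The arctangent truncation is smooth and `1`-Lipschitz, so the chain rule applies; it is bounded,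
so `WD.zero_trace_bounded` applies; and it does not increase `|u|`, so the trace stays zero.
Truncations and their derivatives tend to `s` and `1`, and dominated convergence removes them. -/
lemma WD.zero_trace (hΩ : IsLipDomain Ω) {j : Fin n} {u w : Vec n → ℝ}
    (h : WD Ω j u w) (hu : IntegrableOn u Ω) (hw : IntegrableOn w Ω) (ht : ZeroTrace Ω u) :
    WD univ j (Ω.indicator u) (Ω.indicator w) := by
  have hΩm := hΩ.isOpen.measurableSet
  -- The bounded case asks for a measurable function; hypotheses and conclusion are insensitive to
  -- null sets.
  wlog hum : Measurable u generalizing u with H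
  · obtain ⟨u', hu', he⟩ := hu.aestronglyMeasurable
    have := H (h.congr he EventuallyEq.rfl) (hu.congr he)
      (ht.of_le (he.mono fun x hx => by rw [hx])) hu'.measurable
    refine this.congr ?_ EventuallyEq.rfl
    rw [Measure.restrict_univ]
    filter_upwards [(ae_restrict_iff' hΩm).1 he] with x hx
    by_cases hxΩ : x ∈ Ω
    · simp [hxΩ, hx hxΩ]
    · simp [hxΩ]
  have hui : Integrable (Ω.indicator u) := (integrable_indicator_iff hΩm).2 hu
  have hwi : Integrable (Ω.indicator w) := (integrable_indicator_iff hΩm).2 hw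
  refine ⟨hui.locallyIntegrable.locallyIntegrableOn _, hwi.locallyIntegrable.locallyIntegrableOn _,
    fun φ hφ => ?_⟩
  have hwd : ∀ m : ℕ, WD univ j (Ω.indicator fun x => atrunc m (u x))
      (Ω.indicator fun x => deriv (atrunc m) (u x) * w x) := by
    intro m
    have hm := (contDiff_atrunc m).continuous.measurable.comp hum
    refine WD.zero_trace_bounded hΩ.one_le hΩ.nonempty hΩ.isOpen hΩ.bdd hΩ.lip
      (h.comp hΩ.isOpen (contDiff_atrunc m) (lipschitz_atrunc m)) hm ?_ ?_
      (fun x => abs_atrunc_le' m (u x))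
      (ht.of_le (Eventually.of_forall fun x => by
        rw [Real.enorm_eq_ofReal_abs, Real.enorm_eq_ofReal_abs]
        exact ENNReal.ofReal_le_ofReal (abs_atrunc_le m _)))
    · exact Integrable.mono hu hm.aestronglyMeasurable (Eventually.of_forall fun x => abs_atrunc_le m _)
    · exact hw.bdd_mul (c := 1) ((((contDiff_atrunc m).continuous_deriv (by simp)).measurable.comp
        hum).aestronglyMeasurable) (Eventually.of_forall fun x => deriv_atrunc_mem m _)
  obtain ⟨C, hC⟩ := hφ.2.1.exists_bound_of_continuous hφ.continuous
  obtain ⟨C', hC'⟩ := (hφ.pderiv j).2.1.exists_bound_of_continuous (hφ.pderiv j).continuous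
  have l1 : Tendsto (fun m => ∫ x, Ω.indicator (fun x => atrunc m (u x)) x * pderiv j φ x) atTop
      (𝓝 (∫ x, Ω.indicator u x * pderiv j φ x)) := by
    refine tendsto_integral_of_dominated_convergence (fun x => ‖Ω.indicator u x‖ * C') (fun m => ?_)
      (hui.norm.mul_const _) (fun m => Eventually.of_forall fun x => ?_)
      (Eventually.of_forall fun x => ?_)
    · exact (((contDiff_atrunc m).continuous.measurable.comp hum).indicator
        hΩm).aestronglyMeasurable.mul (hφ.pderiv j).continuous.aestronglyMeasurable
    · rw [norm_mul]
      gcongr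
      · by_cases hx : x ∈ Ω
        · simpa [hx] using abs_atrunc_le m (u x)
        · simp [hx]
      · exact hC' x
    · refine Tendsto.mul_const _ ?_
      by_cases hx : x ∈ Ω
      · simpa [hx] using tendsto_atrunc (u x)
      · simp [hx]
  have l2 : Tendsto (fun m => ∫ x, Ω.indicator (fun x => deriv (atrunc m) (u x) * w x) x * φ x) atTop
      (𝓝 (∫ x, Ω.indicator w x * φ x)) := by
    refine tendsto_integral_of_dominated_convergence (fun x => ‖Ω.indicator w x‖ * C) (fun m => ?_)
      (hwi.norm.mul_const _) (fun m => Eventually.of_forall fun x => ?_)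
      (Eventually.of_forall fun x => ?_)
    · have : Integrable (Ω.indicator fun x => deriv (atrunc m) (u x) * w x) := by
        rw [integrable_indicator_iff hΩm]
        exact hw.bdd_mul (c := 1) ((((contDiff_atrunc m).continuous_deriv (by simp)).measurable.comp
          hum).aestronglyMeasurable) (Eventually.of_forall fun x => deriv_atrunc_mem m _)
      exact this.aestronglyMeasurable.mul hφ.continuous.aestronglyMeasurable
    · rw [norm_mul]
      gcongr
      · by_cases hx : x ∈ Ω
        · simpa [hx] using mul_le_of_le_one_left (abs_nonneg _) (deriv_atrunc_mem m (u x))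
        · simp [hx]
      · exact hC x
    · refine Tendsto.mul_const _ ?_
      by_cases hx : x ∈ Ω
      · simpa [hx] using (tendsto_deriv_atrunc (u x)).mul_const (w x)
      · simp [hx]
  exact tendsto_nhds_unique l1 (l2.neg.congr fun m => ((hwd m).parts φ hφ).symm)

lemma HasWeakGrad.zero_trace (hΩ : IsLipDomain Ω) {u : Vec n → Vec N} {U : Vec n → Mat N n}
    (h : HasWeakGrad Ω u U) (hu : IntegrableOn u Ω) (hU : IntegrableOn U Ω) (ht : ZeroTrace Ω u) :
    HasWeakGrad univ (Ω.indicator u) (Ω.indicator U) := by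
  refine .of_WD (((integrable_indicator_iff hΩ.isOpen.measurableSet).2
    hu).locallyIntegrable.locallyIntegrableOn _) fun i j => ?_
  have h1 := WD.zero_trace hΩ (h.wd i j) (integrable_piLp_iff.1 hu i) (integrable_piLp_iff.1 hU (i, j))
    (ht.of_le (Eventually.of_forall fun x => by
      rw [← ofReal_norm, ← ofReal_norm]; exact ENNReal.ofReal_le_ofReal (PiLp.norm_apply_le (u x) i)))
  refine h1.congr (Eventually.of_forall fun x => ?_) (Eventually.of_forall fun x => ?_)
  · by_cases hx : x ∈ Ω <;> simp [hx]
  · by_cases hx : x ∈ Ω <;> simp [hx]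

lemma setLAverage_add_le {α : Type*} {m : MeasurableSpace α} {μ : Measure α} {S : Set α}
    {f g : α → ℝ≥0∞} (hf : AEMeasurable f (μ.restrict S)) :
    ⨍⁻ y in S, (f y + g y) ∂μ = (⨍⁻ y in S, f y ∂μ) + ⨍⁻ y in S, g y ∂μ := by
  simp only [setLAverage_eq]
  rw [lintegral_add_left' hf, ENNReal.add_div]

lemma setLAverage_mono_fun {α : Type*} {m : MeasurableSpace α} {μ : Measure α} {S : Set α}
    {f g : α → ℝ≥0∞} (h : ∀ x, f x ≤ g x) : ⨍⁻ y in S, f y ∂μ ≤ ⨍⁻ y in S, g y ∂μ := by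
  simp only [setLAverage_eq]
  gcongr with x
  exact h x

/-- The mean of the constant `|g x - g' x|` is at most the sum of the two vanishing means. The mean
of a constant is that constant because `B_r(x) ∩ Ω` is open and non-empty for `x` in the boundary.
-/
lemma HasTrace.unique (hΩ : IsLipDomain Ω) {u g g' : Vec n → Vec N}
    (hu : AEStronglyMeasurable u (volume.restrict Ω)) (h : HasTrace Ω u g) (h' : HasTrace Ω u g') :
    g =ᵐ[surfaceMeasure Ω] g' := by
  have hfr : ∀ᵐ x ∂(surfaceMeasure Ω), x ∈ frontier Ω :=
    ae_restrict_mem isClosed_frontier.measurableSet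
  filter_upwards [h, h', hfr] with x hx hx' hxf
  have hsum := hx.add hx'
  rw [add_zero] at hsum
  have hle : ∀ᶠ r : ℝ in 𝓝[>] 0, ‖g x - g' x‖ₑ ≤
      (⨍⁻ y in Metric.ball x r ∩ Ω, ‖u y - g x‖ₑ ∂volume) +
        ⨍⁻ y in Metric.ball x r ∩ Ω, ‖u y - g' x‖ₑ ∂volume := by
    filter_upwards [self_mem_nhdsWithin] with r hr
    have hne : volume (Metric.ball x r ∩ Ω) ≠ 0 := by
      have : (Metric.ball x r ∩ Ω).Nonempty := by
        obtain ⟨y, hy, hd⟩ := Metric.mem_closure_iff.1 (frontier_subset_closure hxf) r hr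
        exact ⟨y, by rwa [Metric.mem_ball, dist_comm], hy⟩
      exact ((Metric.isOpen_ball.inter hΩ.isOpen).measure_pos volume this).ne'
    have hfin : volume (Metric.ball x r ∩ Ω) ≠ ⊤ :=
      ((measure_mono inter_subset_left).trans_lt measure_ball_lt_top).ne
    have hm : AEStronglyMeasurable u (volume.restrict (Metric.ball x r ∩ Ω)) :=
      hu.mono_measure (Measure.restrict_mono_set _ inter_subset_right)
    rw [← setLAverage_add_le (f := fun y => ‖u y - g x‖ₑ) (hm.sub aestronglyMeasurable_const).enorm,
      ← setLAverage_const hne hfin ‖g x - g' x‖ₑ]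
    refine setLAverage_mono_fun fun y => ?_
    have : g x - g' x = (u y - g' x) - (u y - g x) := by abel
    rw [this, add_comm]
    exact enorm_sub_le
  have h0 := ge_of_tendsto hsum hle
  have : ‖g x - g' x‖ₑ = 0 := le_antisymm h0 zero_le
  exact sub_eq_zero.1 (enorm_eq_zero.1 this)

lemma HasTrace.congr_right {u g g' : Vec n → Vec N} (h : HasTrace Ω u g)
    (hg : g =ᵐ[surfaceMeasure Ω] g') : HasTrace Ω u g' := by
  filter_upwards [h, hg] with x hx hx'
  rwa [← hx']

lemma HasTrace.zeroTrace_sub {u u' g : Vec n → Vec N}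
    (hu : AEStronglyMeasurable u (volume.restrict Ω)) (h : HasTrace Ω u g) (h' : HasTrace Ω u' g) :
    ZeroTrace Ω (u - u') := by
  filter_upwards [h, h'] with x hx hx'
  have hsum := hx.add hx'
  rw [add_zero] at hsum
  refine tendsto_of_tendsto_of_tendsto_of_le_of_le tendsto_const_nhds hsum (fun _ => zero_le)
    fun r => ?_
  have hm : AEStronglyMeasurable u (volume.restrict (Metric.ball x r ∩ Ω)) :=
    hu.mono_measure (Measure.restrict_mono_set _ inter_subset_right)
  simp only
  rw [← setLAverage_add_le (f := fun y => ‖u y - g x‖ₑ) (hm.sub aestronglyMeasurable_const).enorm]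
  refine setLAverage_mono_fun fun y => ?_
  have : (u - u') y = (u y - g x) - (u' y - g x) := by simp
  rw [this]
  exact enorm_sub_le

/-- `SameTrace` only provides some common trace, so transitivity goes through uniqueness of the
trace of `v`. -/
lemma SameTrace.zeroTrace (hΩ : IsLipDomain Ω) {u₁ u₂ v : Vec n → Vec N}
    (hu : AEStronglyMeasurable u₁ (volume.restrict Ω))
    (hv : AEStronglyMeasurable v (volume.restrict Ω)) (h₁ : SameTrace Ω u₁ v)
    (h₂ : SameTrace Ω u₂ v) : ZeroTrace Ω (u₁ - u₂) := by
  obtain ⟨g, hg, hg'⟩ := h₁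
  obtain ⟨g₂, hg₂, hg₂'⟩ := h₂
  exact hg.zeroTrace_sub hu (hg₂.congr_right (hg₂'.unique hΩ hv hg'))

end

/-! ### Radial integrals and weighted means -/

/-- Hölder's inequality against the constant one, that is, Jensen without normalisation. -/
lemma lintegral_rpow_le {α : Type*} {m : MeasurableSpace α} {μ : Measure α} {f : α → ℝ≥0∞}
    (hf : AEMeasurable f μ) {q : ℝ} (hq : 1 < q) :
    (∫⁻ x, f x ∂μ) ^ q ≤ μ univ ^ (q - 1) * ∫⁻ x, f x ^ q ∂μ := by
  have hpq := Real.HolderConjugate.conjExponent hq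
  have h := ENNReal.lintegral_mul_le_Lp_mul_Lq μ hpq hf (aemeasurable_const (b := (1 : ℝ≥0∞)))
  simp only [Pi.mul_apply, mul_one, ENNReal.one_rpow, lintegral_const, one_mul] at h
  have hq0 : 0 < q := by linarith
  calc (∫⁻ x, f x ∂μ) ^ q ≤ ((∫⁻ x, f x ^ q ∂μ) ^ (1 / q) * μ univ ^ (1 / q.conjExponent)) ^ q := by
        gcongr
    _ = _ := by
        rw [ENNReal.mul_rpow_of_nonneg _ _ hq0.le, ← ENNReal.rpow_mul, ← ENNReal.rpow_mul,
          one_div_mul_cancel hq0.ne', ENNReal.rpow_one, mul_comm]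
        congr 2
        rw [Real.conjExponent]
        field_simp

lemma nontrivial_vec (hn : 1 ≤ n) : Nontrivial (Vec n) := by
  have : Nonempty (Fin n) := ⟨⟨0, hn⟩⟩
  infer_instance

/-- In polar coordinates the weight cancels the Jacobian exactly, leaving the length of `(0, a)`. -/
lemma lintegral_norm_inv_pow_le (hn : 1 ≤ n) : ∃ A : ℝ, 0 < A ∧ ∀ (x : Vec n) (a : ℝ), 0 < a →
    ∫⁻ y in Metric.ball x a, ENNReal.ofReal ((dist y x ^ (n - 1))⁻¹) ≤ ENNReal.ofReal (A * a) := by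
  have := nontrivial_vec hn
  set b := volume.real (Metric.ball (0 : Vec n) 1) with hb
  refine ⟨n * b + 1, by positivity, fun x a ha => ?_⟩
  set f : ℝ → ℝ := (Iio a).indicator fun t => (t ^ (n - 1))⁻¹ with hf
  have e : EqOn (fun t : ℝ => t ^ (Module.finrank ℝ (Vec n) - 1) • f t)
      ((Ioo 0 a).indicator fun _ => 1) (Ioi 0) := by
    intro t ht
    have ht' : (0 : ℝ) < t := ht
    simp only [finrank_euclideanSpace_fin, smul_eq_mul, hf]
    by_cases h : t < a
    · rw [indicator_of_mem (show t ∈ Iio a from h), indicator_of_mem (show t ∈ Ioo 0 a from ⟨ht, h⟩)]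
      exact mul_inv_cancel₀ (pow_pos ht' _).ne'
    · rw [indicator_of_notMem (show t ∉ Iio a from h),
        indicator_of_notMem (show t ∉ Ioo 0 a from fun h' => h h'.2), mul_zero]
  have hint : Integrable (fun z : Vec n => f ‖z‖) := by
    rw [integrable_fun_norm_addHaar, integrableOn_congr_fun e measurableSet_Ioi]
    exact (integrable_indicator_iff measurableSet_Ioo).2 (by simp) |>.integrableOn
  have hval := integral_fun_norm_addHaar (volume : Measure (Vec n)) f
  rw [setIntegral_congr_fun measurableSet_Ioi e, setIntegral_indicator measurableSet_Ioo,
    inter_eq_self_of_subset_right (fun t ht => ht.1)] at hval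
  simp only [integral_const, MeasurableSet.univ, measureReal_restrict_apply, univ_inter,
    Real.volume_real_Ioo_of_le ha.le, sub_zero, smul_eq_mul, mul_one,
    finrank_euclideanSpace_fin, nsmul_eq_mul] at hval
  have hf0 : ∀ z : Vec n, 0 ≤ f ‖z‖ := fun z => by
    simp only [hf]
    exact indicator_apply_nonneg fun _ => by positivity
  have h1 : ∫⁻ y in Metric.ball x a, ENNReal.ofReal ((dist y x ^ (n - 1))⁻¹) =
      ∫⁻ y, ENNReal.ofReal (f ‖y - x‖) := by
    rw [← lintegral_indicator measurableSet_ball]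
    congr 1; ext y
    by_cases h : y ∈ Metric.ball x a
    · rw [indicator_of_mem h]
      rw [Metric.mem_ball, dist_eq_norm] at h
      simp [hf, h, dist_eq_norm]
    · rw [indicator_of_notMem h]
      rw [Metric.mem_ball, dist_eq_norm] at h
      simp [hf, h]
  rw [h1, lintegral_sub_right_eq_self (fun y => ENNReal.ofReal (f ‖y‖)) x,
    ← ofReal_integral_eq_lintegral_ofReal hint (Eventually.of_forall hf0), hval]
  refine ENNReal.ofReal_le_ofReal ?_
  have : (n : ℝ) * (b * a) = (n * b) * a := by ring
  nlinarith

/-- Polar coordinates and `r^(n-1) (a + r)^(-m) ≤ (a + r)^(n-1-m)`, which is integrable at infinity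
because `m > n`. -/
lemma lintegral_add_norm_rpow_le (hn : 1 ≤ n) {m : ℝ} (hm : n < m) : ∃ A : ℝ, 0 < A ∧
    ∀ (x : Vec n) (a : ℝ), 0 < a → ∫⁻ y : Vec n, ENNReal.ofReal ((a + dist y x) ^ (-m)) ≤
      ENNReal.ofReal (A * a ^ ((n : ℝ) - m)) := by
  have := nontrivial_vec hn
  set b := volume.real (Metric.ball (0 : Vec n) 1) with hb
  have hb0 : 0 ≤ b := measureReal_nonneg
  refine ⟨n * (b * (m - n)⁻¹) + 1, by
    have : 0 < (m - n)⁻¹ := by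
      have : 0 < m - n := by linarith
      positivity
    positivity, fun x a ha => ?_⟩
  set f : ℝ → ℝ := fun t => (a + t) ^ (-m) with hf
  have hsub : ∀ y : Vec n, ENNReal.ofReal ((a + dist y x) ^ (-m)) = ENNReal.ofReal (f ‖y - x‖) := by
    intro y; rw [dist_eq_norm]
  simp only [hsub]
  rw [lintegral_sub_right_eq_self (fun y => ENNReal.ofReal (f ‖y‖)) x]
  have hf0 : ∀ z : Vec n, 0 ≤ f ‖z‖ := fun z => Real.rpow_nonneg (by positivity) _
  have hgi : IntegrableOn (fun t : ℝ => (t + a) ^ ((n : ℝ) - 1 - m)) (Ioi 0) :=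
    integrableOn_add_rpow_Ioi_of_lt (by linarith) (by linarith)
  have hle : ∀ t ∈ Ioi (0 : ℝ), t ^ (n - 1) * f t ≤ (t + a) ^ ((n : ℝ) - 1 - m) := by
    intro t ht
    have ht' : (0 : ℝ) < t := ht
    have : (t + a) ^ ((n : ℝ) - 1 - m) = (t + a) ^ (n - 1) * (a + t) ^ (-m) := by
      rw [add_comm a t, ← Real.rpow_natCast, ← Real.rpow_add (by positivity)]
      congr 1
      push_cast [Nat.cast_sub hn]
      ring
    rw [this]
    simp only [hf]
    gcongr
    linarith
  have hmeas : AEStronglyMeasurable (fun t : ℝ => t ^ (n - 1) * f t) (volume.restrict (Ioi 0)) := by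
    refine ContinuousOn.aestronglyMeasurable (fun t ht => ?_) measurableSet_Ioi
    have ht' : (0 : ℝ) < t := ht
    refine ContinuousAt.continuousWithinAt ?_
    refine (continuous_pow _).continuousAt.mul ?_
    exact (continuousAt_const.add continuousAt_id).rpow_const (Or.inl (by simp; positivity))
  have hii : IntegrableOn (fun t : ℝ => t ^ (n - 1) * f t) (Ioi 0) := by
    refine Integrable.mono' hgi hmeas ?_
    filter_upwards [ae_restrict_mem measurableSet_Ioi] with t ht
    have ht' : (0 : ℝ) < t := ht
    rw [Real.norm_of_nonneg]
    · exact hle t ht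
    · exact mul_nonneg (by positivity) (Real.rpow_nonneg (by positivity) _)
  have hint : Integrable (fun z : Vec n => f ‖z‖) := by
    rw [integrable_fun_norm_addHaar]
    simpa using hii
  have hval := integral_fun_norm_addHaar (volume : Measure (Vec n)) f
  simp only [finrank_euclideanSpace_fin, nsmul_eq_mul, smul_eq_mul] at hval
  rw [← ofReal_integral_eq_lintegral_ofReal hint (Eventually.of_forall hf0), hval]
  refine ENNReal.ofReal_le_ofReal ?_
  have hI : ∫ t in Ioi (0 : ℝ), (t + a) ^ ((n : ℝ) - 1 - m) = (m - n)⁻¹ * a ^ ((n : ℝ) - m) := by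
    have h1 := (measurePreserving_add_right volume a).setIntegral_preimage_emb
      (measurableEmbedding_addRight a) (fun t : ℝ => t ^ ((n : ℝ) - 1 - m)) (Ioi a)
    rw [show (fun t : ℝ => t + a) ⁻¹' Ioi a = Ioi 0 by ext; simp] at h1
    rw [h1, integral_Ioi_rpow_of_lt (by linarith) ha]
    have : (n : ℝ) - 1 - m + 1 = -(m - n) := by ring
    rw [this, neg_div_neg_eq, div_eq_inv_mul]
    congr 2; ring
  have h2 : ∫ t in Ioi (0 : ℝ), t ^ (n - 1) * f t ≤ (m - n)⁻¹ * a ^ ((n : ℝ) - m) := by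
    rw [← hI]
    exact setIntegral_mono_on hii hgi measurableSet_Ioi hle
  have h3 : 0 ≤ a ^ ((n : ℝ) - m) := by positivity
  calc (n : ℝ) * (b * ∫ t in Ioi (0 : ℝ), t ^ (n - 1) * f t)
      ≤ n * (b * ((m - n)⁻¹ * a ^ ((n : ℝ) - m))) := by gcongr
    _ ≤ _ := by nlinarith

/-- Tonelli for integrals over moving balls of radius `3 s(y)` weighted with `s(y)^{1-n}`. -/
lemma lintegral_ball_potential_le (hn : 1 ≤ n) : ∃ A : ℝ, 0 < A ∧
    ∀ (σ : Measure (Vec n)) [SFinite σ] (f : Vec n → ℝ≥0∞), Measurable f →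
    ∀ (s : Vec n → ℝ), Measurable s → ∀ (S : Set (Vec n)), MeasurableSet S → ∀ ρ > 0,
    (∀ y ∈ S, 0 < s y ∧ s y ≤ ρ) →
    ∫⁻ y in S, ENNReal.ofReal ((s y ^ (n - 1))⁻¹) * ∫⁻ x in Metric.ball y (3 * s y), f x ∂σ ≤
      ENNReal.ofReal (A * ρ) * ∫⁻ x, f x ∂σ := by
  obtain ⟨A, hA, h⟩ := lintegral_norm_inv_pow_le hn
  have := nontrivial_vec hn
  refine ⟨3 ^ (n - 1) * (A * 3), by positivity, fun σ _ f hf s hs S hS ρ hρ hsS => ?_⟩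
  set T : Set (Vec n × Vec n) := {z | dist z.2 z.1 < 3 * s z.1} with hT
  have hTm : MeasurableSet T :=
    measurableSet_lt (measurable_snd.dist measurable_fst) ((hs.comp measurable_fst).const_mul _)
  have hwm : Measurable fun y => ENNReal.ofReal ((s y ^ (n - 1))⁻¹) := by fun_prop
  have e : ∀ y, ENNReal.ofReal ((s y ^ (n - 1))⁻¹) * ∫⁻ x in Metric.ball y (3 * s y), f x ∂σ =
      ∫⁻ x, T.indicator (fun z => ENNReal.ofReal ((s z.1 ^ (n - 1))⁻¹) * f z.2) (y, x) ∂σ := by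
    intro y
    rw [← lintegral_const_mul _ hf, ← lintegral_indicator measurableSet_ball]
    rfl
  simp only [e]
  rw [lintegral_lintegral_swap (f := fun y x =>
    T.indicator (fun z => ENNReal.ofReal ((s z.1 ^ (n - 1))⁻¹) * f z.2) (y, x))
    (((hwm.comp measurable_fst).mul (hf.comp measurable_snd)).indicator hTm).aemeasurable,
    ← lintegral_const_mul _ hf]
  refine lintegral_mono fun x => ?_
  -- At `y = x` the inverse power of the distance may carry the default value zero of division; a
  -- single point is negligible. Elsewhere `dist x y < 3 s(y)` gives `s(y)^(1-n) ≤ 3^(n-1) (dist y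
  -- x)^(1-n)`.
  have hae : ∀ᵐ y ∂(volume.restrict S), y ≠ x := by
    refine ae_restrict_of_ae ?_
    simp [ae_iff]
  calc ∫⁻ y in S, T.indicator (fun z => ENNReal.ofReal ((s z.1 ^ (n - 1))⁻¹) * f z.2) (y, x)
      ≤ ∫⁻ y in S, (Metric.ball x (3 * ρ)).indicator (fun y =>
          ENNReal.ofReal (3 ^ (n - 1)) * ENNReal.ofReal ((dist y x ^ (n - 1))⁻¹) * f x) y := by
        refine lintegral_mono_ae ?_
        filter_upwards [hae, ae_restrict_mem hS] with y hyx hyS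
        by_cases hy : (y, x) ∈ T
        · have hd : dist x y < 3 * s y := hy
          have hd0 : 0 < dist y x := dist_pos.2 hyx
          rw [indicator_of_mem hy, indicator_of_mem (by
            rw [Metric.mem_ball, dist_comm]; linarith [(hsS y hyS).2])]
          gcongr
          rw [← ENNReal.ofReal_mul (by positivity)]
          refine ENNReal.ofReal_le_ofReal ?_
          have h1 : dist y x ^ (n - 1) ≤ (3 * s y) ^ (n - 1) := by
            gcongr; rw [dist_comm]; exact hd.le
          have h0 := (hsS y hyS).1
          rw [← div_eq_mul_inv, le_div_iff₀ (by positivity), inv_mul_le_iff₀ (by positivity),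
            mul_comm, ← mul_pow]
          exact h1
        · rw [indicator_of_notMem hy]; exact zero_le
    _ ≤ ∫⁻ y, (Metric.ball x (3 * ρ)).indicator (fun y =>
          ENNReal.ofReal (3 ^ (n - 1)) * ENNReal.ofReal ((dist y x ^ (n - 1))⁻¹) * f x) y :=
        setLIntegral_le_lintegral _ _
    _ = (ENNReal.ofReal (3 ^ (n - 1)) * ∫⁻ y in Metric.ball x (3 * ρ),
          ENNReal.ofReal ((dist y x ^ (n - 1))⁻¹)) * f x := by
        rw [lintegral_indicator measurableSet_ball, lintegral_mul_const, lintegral_const_mul]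
        · fun_prop
        · fun_prop
    _ ≤ (ENNReal.ofReal (3 ^ (n - 1)) * ENNReal.ofReal (A * (3 * ρ))) * f x := by
        gcongr; exact h x _ (by positivity)
    _ = _ := by
        rw [← ENNReal.ofReal_mul (by positivity)]
        congr 2; ring

/-- Tonelli for double integrals over moving balls of radius `4 s(y)`. -/
lemma lintegral_ball_gagliardo_le (hn : 1 ≤ n) {q : ℝ} (hq : 1 < q) : ∃ A : ℝ, 0 < A ∧
    ∀ (σ : Measure (Vec n)) [SFinite σ] (F : Vec n × Vec n → ℝ≥0∞), Measurable F →
    (∀ x, F (x, x) = 0) →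
    ∀ (s : Vec n → ℝ), Measurable s → ∀ (S : Set (Vec n)), MeasurableSet S →
    (∀ y ∈ S, 0 < s y) →
    ∫⁻ y in S, ENNReal.ofReal (s y ^ (-(q + 2 * n - 2))) * ∫⁻ x in Metric.ball y (4 * s y),
      ∫⁻ x' in Metric.ball y (4 * s y), F (x, x') ∂σ ∂σ ≤
      ENNReal.ofReal A * ∫⁻ x, ∫⁻ x', F (x, x') / edist x x' ^ ((n : ℝ) + q - 2) ∂σ ∂σ := by
  set m : ℝ := q + 2 * n - 2 with hmdef
  have hn' : (1 : ℝ) ≤ n := by exact_mod_cast hn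
  obtain ⟨A, hA, h⟩ := lintegral_add_norm_rpow_le hn (m := m) (by rw [hmdef]; linarith)
  have hm0 : 0 ≤ m := by rw [hmdef]; linarith
  -- If `x` and `x'` lie within `4 s` of `y`, then `dist x x' + dist y x ≤ 12 s`. Hence `s^(-m)` is
  -- at most `12^m (dist x x' + dist y x)^(-m)`, whose integral in `y` is of order `dist x x' ^ (n -
  -- m)`, and `m - n = n + q - 2` is the Gagliardo exponent.
  refine ⟨12 ^ m * A, by positivity, fun σ _ F hF hF0 s hs S hS hsS => ?_⟩
  set T : Set (Vec n × (Vec n × Vec n)) :=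
    {z | dist z.2.1 z.1 < 4 * s z.1 ∧ dist z.2.2 z.1 < 4 * s z.1} with hT
  have hTm : MeasurableSet T :=
    (measurableSet_lt ((measurable_fst.comp measurable_snd).dist measurable_fst)
      ((hs.comp measurable_fst).const_mul _)).inter
    (measurableSet_lt ((measurable_snd.comp measurable_snd).dist measurable_fst)
      ((hs.comp measurable_fst).const_mul _))
  set w : Vec n → ℝ≥0∞ := fun y => ENNReal.ofReal (s y ^ (-m)) with hw
  have hwm : Measurable w := ENNReal.measurable_ofReal.comp (hs.pow_const _)
  have hGm : Measurable (T.indicator fun z => w z.1 * F z.2) :=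
    ((hwm.comp measurable_fst).mul (hF.comp measurable_snd)).indicator hTm
  have e : ∀ y, w y * ∫⁻ x in Metric.ball y (4 * s y),
      ∫⁻ x' in Metric.ball y (4 * s y), F (x, x') ∂σ ∂σ =
      ∫⁻ p, T.indicator (fun z => w z.1 * F z.2) (y, p) ∂(σ.prod σ) := by
    intro y
    rw [← lintegral_prod (μ := σ.restrict (Metric.ball y (4 * s y)))
      (ν := σ.restrict (Metric.ball y (4 * s y))) (fun p => F p) hF.aemeasurable,
      Measure.prod_restrict, ← lintegral_const_mul _ hF, ← lintegral_indicator
      (measurableSet_ball.prod measurableSet_ball)]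
    rfl
  have hQm : Measurable fun p : Vec n × Vec n => F p / edist p.1 p.2 ^ ((n : ℝ) + q - 2) :=
    hF.div ((measurable_fst.edist measurable_snd).pow_const _)
  have e' : ∫⁻ x, ∫⁻ x', F (x, x') / edist x x' ^ ((n : ℝ) + q - 2) ∂σ ∂σ =
      ∫⁻ p, F p / edist p.1 p.2 ^ ((n : ℝ) + q - 2) ∂(σ.prod σ) := by
    rw [lintegral_prod _ hQm.aemeasurable]
  rw [e', ← lintegral_const_mul _ hQm]
  rw [lintegral_congr (μ := volume.restrict S) e,
    lintegral_lintegral_swap (f := fun y p => T.indicator (fun z => w z.1 * F z.2) (y, p))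
    hGm.aemeasurable]
  refine lintegral_mono fun p => ?_
  obtain ⟨x, x'⟩ := p
  -- The estimate by powers of `dist x x'` degenerates on the diagonal, where the left-hand side is
  -- zero because `F` vanishes.
  rcases eq_or_ne x x' with rfl | hne
  · have : ∀ y, T.indicator (fun z => w z.1 * F z.2) (y, (x, x)) = 0 := by
      intro y
      by_cases hy : (y, (x, x)) ∈ T
      · rw [indicator_of_mem hy]; simp [hF0]
      · rw [indicator_of_notMem hy]
    simp [this]
  have hd0 : 0 < dist x x' := dist_pos.2 hne
  calc ∫⁻ y in S, T.indicator (fun z => w z.1 * F z.2) (y, (x, x'))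
      ≤ ∫⁻ y in S, ENNReal.ofReal (12 ^ m) * ENNReal.ofReal ((dist x x' + dist y x) ^ (-m)) *
          F (x, x') := by
        refine setLIntegral_mono_ae ?_ (Eventually.of_forall fun y hyS => ?_)
        · refine Measurable.aemeasurable ?_
          have : Measurable fun y : Vec n => (dist x x' + dist y x) ^ (-m) :=
            ((measurable_id.dist measurable_const).const_add _).pow_const _
          exact (this.ennreal_ofReal.const_mul _).mul_const _
        · by_cases hy : (y, (x, x')) ∈ T
          · rw [indicator_of_mem hy]
            have h1 : dist x y < 4 * s y := hy.1
            have h2 : dist x' y < 4 * s y := hy.2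
            simp only [hw]
            gcongr
            rw [← ENNReal.ofReal_mul (by positivity)]
            refine ENNReal.ofReal_le_ofReal ?_
            have h3 : dist x x' + dist y x ≤ 12 * s y := by
              have := dist_triangle_right x x' y
              rw [dist_comm y x]; linarith
            have hs0 := hsS y hyS
            have h4 : (12 * s y) ^ (-m) ≤ (dist x x' + dist y x) ^ (-m) :=
              Real.rpow_le_rpow_of_nonpos (by positivity) h3 (by linarith)
            rw [Real.mul_rpow (by norm_num) hs0.le] at h4
            calc s y ^ (-m) = 12 ^ m * (12 ^ (-m) * s y ^ (-m)) := by
                  rw [← mul_assoc, ← Real.rpow_add (by norm_num)]; simp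
              _ ≤ _ := by gcongr
          · rw [indicator_of_notMem hy]; exact zero_le
    _ ≤ ∫⁻ y, ENNReal.ofReal (12 ^ m) * ENNReal.ofReal ((dist x x' + dist y x) ^ (-m)) *
          F (x, x') := setLIntegral_le_lintegral _ _
    _ = ENNReal.ofReal (12 ^ m) * (∫⁻ y, ENNReal.ofReal ((dist x x' + dist y x) ^ (-m))) *
          F (x, x') := by
        have : Measurable fun y : Vec n => ENNReal.ofReal ((dist x x' + dist y x) ^ (-m)) :=
          (((measurable_id.dist measurable_const).const_add _).pow_const _).ennreal_ofReal
        rw [lintegral_mul_const _ (this.const_mul _), lintegral_const_mul _ this]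
    _ ≤ ENNReal.ofReal (12 ^ m) * ENNReal.ofReal (A * dist x x' ^ ((n : ℝ) - m)) * F (x, x') := by
        gcongr; exact h x _ hd0
    _ = _ := by
        have h5 : (edist x x' ^ ((n : ℝ) + q - 2))⁻¹ = ENNReal.ofReal (dist x x' ^ ((n : ℝ) - m)) := by
          rw [edist_dist, ENNReal.ofReal_rpow_of_pos hd0, ← ENNReal.ofReal_inv_of_pos (by positivity),
            ← Real.rpow_neg hd0.le]
          congr 2; rw [hmdef]; ring
        rw [ENNReal.div_eq_inv_mul, h5, ENNReal.ofReal_mul hA.le, ENNReal.ofReal_mul (by positivity)]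
        ring

/-! ### Means of boundary functions with respect to tent weights. -/

/-- A tent weight of height `3 s` centred at `y`. -/
noncomputable def wker (s : ℝ) (y x : Vec n) : ℝ := max 0 (3 * s - dist x y)

/-- The total mass of the tent weight. -/
noncomputable def wmass (σ : Measure (Vec n)) (s : ℝ) (y : Vec n) : ℝ := ∫ x, wker s y x ∂σ

/-- The mean of `h` with respect to the tent weight. -/
noncomputable def wmean (σ : Measure (Vec n)) (h : Vec n → ℝ) (s : ℝ) (y : Vec n) : ℝ :=
  (∫ x, h x * wker s y x ∂σ) / wmass σ s y

/-- Two-sided `(n-1)`-dimensional density bounds for `σ` on `Γ`, up to scale `R`. -/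
structure SurfRegular (σ : Measure (Vec n)) (Γ : Set (Vec n)) (R c C : ℝ) : Prop where
  cpos : 0 < c
  Cpos : 0 < C
  lower : ∀ x ∈ Γ, ∀ ρ ∈ Ioc 0 R, ENNReal.ofReal (c * ρ ^ (n - 1)) ≤ σ (Metric.ball x ρ)
  upper : ∀ x, ∀ ρ > 0, σ (Metric.ball x ρ) ≤ ENNReal.ofReal (C * ρ ^ (n - 1))

section
variable {s s' : ℝ} {y y' x : Vec n}

lemma wker_nonneg : 0 ≤ wker s y x := le_max_left _ _

lemma wker_le (hs : 0 ≤ s) : wker s y x ≤ 3 * s :=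
  max_le (by positivity) (by linarith [dist_nonneg (x := x) (y := y)])

lemma wker_eq_zero (h : 3 * s ≤ dist x y) : wker s y x = 0 := max_eq_left (by linarith)

lemma abs_wker_sub_le : |wker s y x - wker s' y' x| ≤ 3 * |s - s'| + dist y y' := by
  have h1 := abs_max_sub_max_le_abs (3 * s - dist x y) (3 * s' - dist x y') 0
  rw [max_comm, max_comm _ (0 : ℝ)] at h1
  refine h1.trans ?_
  have h2 := abs_dist_sub_le y' y x
  rw [dist_comm y' x, dist_comm y x, dist_comm y' y] at h2
  have : 3 * s - dist x y - (3 * s' - dist x y') = 3 * (s - s') + (dist x y' - dist x y) := by ring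
  rw [this]
  refine (abs_add_le _ _).trans ?_
  rw [abs_mul, abs_of_pos (by norm_num : (0 : ℝ) < 3)]
  linarith

lemma continuous_wker : Continuous (wker s y) := by unfold wker; fun_prop

variable {σ : Measure (Vec n)} [IsFiniteMeasure σ] {Γ : Set (Vec n)} {R c C : ℝ} {h : Vec n → ℝ}

omit [IsFiniteMeasure σ] in
lemma integrable_mul_wker (hs : 0 ≤ s) {f : Vec n → ℝ} (hf : Integrable f σ) :
    Integrable (fun x => f x * wker s y x) σ :=
  hf.mul_bdd (c := 3 * s) continuous_wker.aestronglyMeasurable (Eventually.of_forall fun x => by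
    rw [Real.norm_of_nonneg wker_nonneg]; exact wker_le hs)

lemma integrable_wker (hs : 0 ≤ s) : Integrable (wker s y) σ := by
  simpa using integrable_mul_wker (σ := σ) (y := y) hs (integrable_const (1 : ℝ))

/-- Points of `B (x₀, s)` lie within `2 s` of `y`, so the tent is at least `s` on this ball, whose
mass is at least `c s^(n-1)`. -/
lemma wmass_ge (hn : 1 ≤ n) (hσ : SurfRegular σ Γ R c C) (hs : s ∈ Ioc 0 R)
    (hy : ∃ x₀ ∈ Γ, dist y x₀ ≤ s) : c * s ^ n ≤ wmass σ s y := by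
  obtain ⟨x₀, hx₀, hd⟩ := hy
  have hs0 := hs.1
  have hc := hσ.cpos
  have h1 : c * s ^ (n - 1) ≤ σ.real (Metric.ball x₀ s) :=
    (ENNReal.ofReal_le_iff_le_toReal (measure_ne_top _ _)).1 (hσ.lower x₀ hx₀ s hs)
  have h2 : ∫ x in Metric.ball x₀ s, s ∂σ ≤ ∫ x in Metric.ball x₀ s, wker s y x ∂σ := by
    refine setIntegral_mono_on (by simp) (integrable_wker hs0.le).integrableOn
      measurableSet_ball fun x hx => le_max_of_le_right ?_
    have := dist_triangle_right x y x₀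
    rw [Metric.mem_ball] at hx
    linarith
  have h3 : ∫ x in Metric.ball x₀ s, wker s y x ∂σ ≤ wmass σ s y :=
    setIntegral_le_integral (integrable_wker hs0.le) (Eventually.of_forall fun x => wker_nonneg)
  rw [setIntegral_const, smul_eq_mul] at h2
  have hpow : s ^ n = s ^ (n - 1) * s := by rw [← pow_succ]; congr 1; omega
  rw [hpow]
  nlinarith

lemma wmass_pos (hn : 1 ≤ n) (hσ : SurfRegular σ Γ R c C) (hs : s ∈ Ioc 0 R)
    (hy : ∃ x₀ ∈ Γ, dist y x₀ ≤ s) : 0 < wmass σ s y :=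
  lt_of_lt_of_le (mul_pos hσ.cpos (pow_pos hs.1 n)) (wmass_ge hn hσ hs hy)

lemma wmean_sub (hs : 0 ≤ s) (hh : Integrable h σ) (hm : 0 < wmass σ s y) (a : ℝ) :
    wmean σ h s y - a = (∫ x, (h x - a) * wker s y x ∂σ) / wmass σ s y := by
  simp only [sub_mul]
  rw [integral_sub (integrable_mul_wker hs hh) (integrable_mul_wker hs (integrable_const a)),
    integral_const_mul, sub_div]
  congr 1
  exact (mul_div_cancel_right₀ a hm.ne').symm

lemma enorm_wmean_sub_le (hn : 1 ≤ n) (hσ : SurfRegular σ Γ R c C) (hs : s ∈ Ioc 0 R)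
    (hy : ∃ x₀ ∈ Γ, dist y x₀ ≤ s) (hh : Integrable h σ) (a : ℝ) :
    ‖wmean σ h s y - a‖ₑ ≤ ENNReal.ofReal (3 / (c * s ^ (n - 1))) *
      ∫⁻ x in Metric.ball y (3 * s), ‖h x - a‖ₑ ∂σ := by
  have hs0 := hs.1
  have hc := hσ.cpos
  have hm := wmass_pos hn hσ hs hy
  have hm' := wmass_ge hn hσ hs hy
  rw [wmean_sub hs0.le hh hm, div_eq_inv_mul, enorm_mul]
  have h1 : ‖∫ x, (h x - a) * wker s y x ∂σ‖ₑ ≤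
      ENNReal.ofReal (3 * s) * ∫⁻ x in Metric.ball y (3 * s), ‖h x - a‖ₑ ∂σ := by
    refine (enorm_integral_le_lintegral_enorm _).trans ?_
    rw [← lintegral_const_mul' _ _ ENNReal.ofReal_ne_top, ← lintegral_indicator measurableSet_ball]
    refine lintegral_mono fun x => ?_
    by_cases hx : x ∈ Metric.ball y (3 * s)
    · rw [indicator_of_mem hx, enorm_mul, mul_comm]
      gcongr
      rw [Real.enorm_of_nonneg wker_nonneg]
      exact ENNReal.ofReal_le_ofReal (wker_le hs0.le)
    · rw [wker_eq_zero (not_lt.1 hx)]; simp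
  calc ‖(wmass σ s y)⁻¹‖ₑ * ‖∫ x, (h x - a) * wker s y x ∂σ‖ₑ
      ≤ ENNReal.ofReal ((c * s ^ n)⁻¹) *
        (ENNReal.ofReal (3 * s) * ∫⁻ x in Metric.ball y (3 * s), ‖h x - a‖ₑ ∂σ) := by
        gcongr
        rw [Real.enorm_of_nonneg (by positivity)]
        refine ENNReal.ofReal_le_ofReal ?_
        gcongr
    _ = _ := by
        rw [← mul_assoc, ← ENNReal.ofReal_mul (by positivity)]
        congr 2
        have hpow : s ^ n = s ^ (n - 1) * s := by rw [← pow_succ]; congr 1; omega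
        rw [hpow]
        field_simp

/-- Hölder on the ball of radius `3 s`, whose mass is at most `C (3 s)^(n-1)`; the powers of `s`
collapse to `s^(1-n)`, the weight of `lintegral_ball_potential_le`. -/
lemma enorm_wmean_sub_rpow_le (hn : 1 ≤ n) (hσ : SurfRegular σ Γ R c C) (hs : s ∈ Ioc 0 R)
    (hy : ∃ x₀ ∈ Γ, dist y x₀ ≤ s) (hh : Integrable h σ) (a : ℝ) {q : ℝ} (hq : 1 < q) :
    ‖wmean σ h s y - a‖ₑ ^ q ≤ ENNReal.ofReal ((3 / c) ^ q * (C * 3 ^ (n - 1)) ^ (q - 1)) *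
      (ENNReal.ofReal ((s ^ (n - 1))⁻¹) * ∫⁻ x in Metric.ball y (3 * s), ‖h x - a‖ₑ ^ q ∂σ) := by
  have hs0 := hs.1
  have hc := hσ.cpos
  have hC := hσ.Cpos
  have h1 := lintegral_rpow_le (μ := σ.restrict (Metric.ball y (3 * s))) (f := fun x => ‖h x - a‖ₑ)
    ((hh.aestronglyMeasurable.sub aestronglyMeasurable_const).enorm.mono_measure
      Measure.restrict_le_self) hq
  rw [Measure.restrict_apply_univ] at h1
  have h2 := hσ.upper y (3 * s) (by positivity)
  set t := s ^ (n - 1) with ht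
  have ht0 : 0 < t := pow_pos hs0 _
  have hq1 : 0 < q - 1 := by linarith
  calc ‖wmean σ h s y - a‖ₑ ^ q
      ≤ (ENNReal.ofReal (3 / (c * t)) * ∫⁻ x in Metric.ball y (3 * s), ‖h x - a‖ₑ ∂σ) ^ q := by
        gcongr; exact enorm_wmean_sub_le hn hσ hs hy hh a
    _ = ENNReal.ofReal (3 / (c * t)) ^ q * (∫⁻ x in Metric.ball y (3 * s), ‖h x - a‖ₑ ∂σ) ^ q :=
        ENNReal.mul_rpow_of_nonneg _ _ (by linarith)
    _ ≤ ENNReal.ofReal (3 / (c * t)) ^ q * (ENNReal.ofReal (C * (3 * s) ^ (n - 1)) ^ (q - 1) *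
          ∫⁻ x in Metric.ball y (3 * s), ‖h x - a‖ₑ ^ q ∂σ) := by
        gcongr
        exact h1.trans (by gcongr)
    _ = _ := by
        rw [← mul_assoc, ← mul_assoc, ENNReal.ofReal_rpow_of_pos (by positivity),
          ENNReal.ofReal_rpow_of_pos (by positivity), ← ENNReal.ofReal_mul (by positivity),
          ← ENNReal.ofReal_mul (by positivity)]
        congr 2
        rw [mul_pow, ← ht, ← mul_assoc C, Real.mul_rpow (by positivity) ht0.le,
          show 3 / (c * t) = 3 / c * t⁻¹ by field_simp, Real.mul_rpow (by positivity) (by positivity),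
          Real.inv_rpow ht0.le, Real.rpow_sub_one ht0.ne']
        have : t ^ q ≠ 0 := (Real.rpow_pos_of_pos ht0 q).ne'
        field_simp

/-- Let `a` be the second mean. Then `h - a` has integral zero against the second tent, so the
difference of the means sees only the difference of the two tents, which is at most `4 dist y y'`.
Moreover `h x - a` is itself a mean of differences `h x - h x'`, whence the double integral. The
conditions on `s` and `s'` keep both tents inside `B (y, 4 s)`. -/
lemma enorm_wmean_sub_wmean_le (hn : 1 ≤ n) (hσ : SurfRegular σ Γ R c C) (hs : s ∈ Ioc 0 R)
    (hs' : s' ∈ Ioc 0 R) (hy : ∃ x₀ ∈ Γ, dist y x₀ ≤ s) (hy' : ∃ x₀ ∈ Γ, dist y' x₀ ≤ s')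
    (hh : Integrable h σ) (hss : 3 * s ≤ 4 * s') (hb : 3 * s' + dist y y' ≤ 4 * s)
    (hst : |s - s'| ≤ dist y y') :
    ‖wmean σ h s y - wmean σ h s' y'‖ₑ ≤ ENNReal.ofReal (dist y y') *
      (ENNReal.ofReal (12 * (4 / 3) ^ (n - 1) / c ^ 2 / (s ^ n * s ^ (n - 1))) *
      ∫⁻ x in Metric.ball y (4 * s), ∫⁻ x' in Metric.ball y (4 * s), ‖h x' - h x‖ₑ ∂σ ∂σ) := by
  have hs0 := hs.1
  have hs0' := hs'.1
  have hc := hσ.cpos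
  have hm := wmass_pos hn hσ hs hy
  have hm' := wmass_ge hn hσ hs hy
  have hM := wmass_pos hn hσ hs' hy'
  set a := wmean σ h s' y' with ha
  have h0 : ∫ x, (h x - a) * wker s' y' x ∂σ = 0 := by
    have := wmean_sub hs0'.le hh hM a
    rw [← ha, sub_self, eq_comm, div_eq_zero_iff] at this
    exact this.resolve_right hM.ne'
  have hai : Integrable (fun x => h x - a) σ := hh.sub (integrable_const a)
  have h1 : wmean σ h s y - a =
      (wmass σ s y)⁻¹ * ∫ x, (h x - a) * (wker s y x - wker s' y' x) ∂σ := by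
    simp only [mul_sub]
    rw [integral_sub (integrable_mul_wker hs0.le hai) (integrable_mul_wker hs0'.le hai), h0, sub_zero,
      wmean_sub hs0.le hh hm, div_eq_inv_mul]
  have hcoef : ∀ x, ‖h x - a‖ₑ ≤ ENNReal.ofReal (3 / (c * s' ^ (n - 1))) *
      ∫⁻ x' in Metric.ball y (4 * s), ‖h x' - h x‖ₑ ∂σ := by
    intro x
    rw [← enorm_neg, neg_sub]
    refine (enorm_wmean_sub_le hn hσ hs' hy' hh (h x)).trans ?_
    gcongr
    intro z hz
    rw [Metric.mem_ball] at *
    linarith [dist_triangle z y' y, dist_comm y y']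
  have h2 : ‖∫ x, (h x - a) * (wker s y x - wker s' y' x) ∂σ‖ₑ ≤
      ENNReal.ofReal (4 * dist y y') * (ENNReal.ofReal (3 / (c * s' ^ (n - 1))) *
        ∫⁻ x in Metric.ball y (4 * s), ∫⁻ x' in Metric.ball y (4 * s), ‖h x' - h x‖ₑ ∂σ ∂σ) := by
    refine (enorm_integral_le_lintegral_enorm _).trans ?_
    rw [← lintegral_const_mul' _ _ ENNReal.ofReal_ne_top, ← lintegral_const_mul' _ _ ENNReal.ofReal_ne_top,
      ← lintegral_indicator measurableSet_ball]
    refine lintegral_mono fun x => ?_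
    by_cases hx : x ∈ Metric.ball y (4 * s)
    · rw [indicator_of_mem hx, enorm_mul, mul_comm]
      refine mul_le_mul' ?_ (hcoef x)
      rw [Real.enorm_eq_ofReal_abs]
      refine ENNReal.ofReal_le_ofReal (abs_wker_sub_le.trans ?_)
      linarith
    · rw [Metric.mem_ball, not_lt] at hx
      rw [wker_eq_zero (s := s) (by linarith), wker_eq_zero (s := s')
        (by linarith [dist_triangle_right x y y', dist_triangle x y' y, dist_comm y y'])]
      simp
  rw [h1, enorm_mul]
  calc ‖(wmass σ s y)⁻¹‖ₑ * ‖∫ x, (h x - a) * (wker s y x - wker s' y' x) ∂σ‖ₑ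
      ≤ ENNReal.ofReal ((c * s ^ n)⁻¹) * (ENNReal.ofReal (4 * dist y y') *
        (ENNReal.ofReal (3 / (c * (3 / 4 * s) ^ (n - 1))) *
        ∫⁻ x in Metric.ball y (4 * s), ∫⁻ x' in Metric.ball y (4 * s), ‖h x' - h x‖ₑ ∂σ ∂σ)) := by
        gcongr ?_ * ?_
        · rw [Real.enorm_of_nonneg (by positivity)]
          refine ENNReal.ofReal_le_ofReal ?_
          gcongr
        · refine h2.trans ?_
          gcongr
          linarith
    _ = _ := by
        rw [← mul_assoc, ← mul_assoc, ← mul_assoc, ← ENNReal.ofReal_mul (by positivity),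
          ← ENNReal.ofReal_mul (by positivity), ← ENNReal.ofReal_mul (by positivity)]
        congr 2
        rw [mul_pow, show (4 / 3 : ℝ) ^ (n - 1) = ((3 / 4 : ℝ) ^ (n - 1))⁻¹ by
          rw [← inv_pow]; norm_num]
        field_simp
        ring

/-- Hölder in each of the two variables; the powers of `s` combine to the weight of
`lintegral_ball_gagliardo_le`. -/
lemma enorm_wmean_grad_rpow_le (hn : 1 ≤ n) (hσ : SurfRegular σ Γ R c C) (hs : 0 < s)
    (hh : Measurable h) {q : ℝ} (hq : 1 < q) {A : ℝ} (hA : 0 < A) :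
    (ENNReal.ofReal (A / (s ^ n * s ^ (n - 1))) *
      ∫⁻ x in Metric.ball y (4 * s), ∫⁻ x' in Metric.ball y (4 * s), ‖h x' - h x‖ₑ ∂σ ∂σ) ^ q ≤
    ENNReal.ofReal (A ^ q * ((C * 4 ^ (n - 1)) ^ (q - 1)) ^ 2) *
      (ENNReal.ofReal (s ^ (-(q + 2 * n - 2))) * ∫⁻ x in Metric.ball y (4 * s),
        ∫⁻ x' in Metric.ball y (4 * s), ‖h x' - h x‖ₑ ^ q ∂σ ∂σ) := by
  have hC := hσ.Cpos
  set B := Metric.ball y (4 * s) with hB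
  have hq1 : 0 < q - 1 := by linarith
  set m := ENNReal.ofReal (C * (4 * s) ^ (n - 1)) ^ (q - 1) with hm
  have hup : σ B ^ (q - 1) ≤ m := by
    rw [hm]; gcongr; exact hσ.upper y (4 * s) (by positivity)
  have hmeas : Measurable fun z : Vec n × Vec n => ‖h z.2 - h z.1‖ₑ :=
    ((hh.comp measurable_snd).sub (hh.comp measurable_fst)).enorm
  have h1 : ∀ x, (∫⁻ x' in B, ‖h x' - h x‖ₑ ∂σ) ^ q ≤ m * ∫⁻ x' in B, ‖h x' - h x‖ₑ ^ q ∂σ := by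
    intro x
    have := lintegral_rpow_le (μ := σ.restrict B) (f := fun x' => ‖h x' - h x‖ₑ)
      (hh.sub measurable_const).enorm.aemeasurable hq
    rw [Measure.restrict_apply_univ] at this
    exact this.trans (by gcongr)
  have h2 : (∫⁻ x in B, ∫⁻ x' in B, ‖h x' - h x‖ₑ ∂σ ∂σ) ^ q ≤
      m * (m * ∫⁻ x in B, ∫⁻ x' in B, ‖h x' - h x‖ₑ ^ q ∂σ ∂σ) := by
    have h3 := lintegral_rpow_le (μ := σ.restrict B) (f := fun x => ∫⁻ x' in B, ‖h x' - h x‖ₑ ∂σ)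
      (Measurable.lintegral_prod_right' hmeas).aemeasurable hq
    rw [Measure.restrict_apply_univ] at h3
    refine h3.trans ?_
    rw [← lintegral_const_mul m (Measurable.lintegral_prod_right' (hmeas.pow_const q))]
    gcongr with x
    exact h1 x
  rw [ENNReal.mul_rpow_of_nonneg _ _ (by linarith)]
  calc _ ≤ ENNReal.ofReal (A / (s ^ n * s ^ (n - 1))) ^ q *
        (m * (m * ∫⁻ x in B, ∫⁻ x' in B, ‖h x' - h x‖ₑ ^ q ∂σ ∂σ)) := by gcongr
    _ = _ := by
      rw [hm, ENNReal.ofReal_rpow_of_pos (by positivity), ENNReal.ofReal_rpow_of_pos (by positivity),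
        ← mul_assoc, ← mul_assoc, ← mul_assoc, ← ENNReal.ofReal_mul (by positivity),
        ← ENNReal.ofReal_mul (by positivity), ← ENNReal.ofReal_mul (by positivity)]
      congr 2
      set t := s ^ (n - 1) with ht
      have ht0 : 0 < t := pow_pos hs _
      have hpow : s ^ n = t * s := by rw [ht, ← pow_succ]; congr 1; omega
      have e1 : s ^ (-(q + 2 * n - 2)) = (t ^ 2 * s ^ q)⁻¹ := by
        rw [ht, ← pow_mul, ← Real.rpow_natCast, ← Real.rpow_add hs, ← Real.rpow_neg hs.le]
        congr 1
        push_cast [Nat.cast_sub hn]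
        ring
      rw [e1, hpow, mul_pow, ← ht, ← mul_assoc C, Real.mul_rpow (by positivity) ht0.le,
        Real.div_rpow hA.le (by positivity), Real.mul_rpow (by positivity) ht0.le,
        Real.mul_rpow ht0.le hs.le, Real.rpow_sub_one ht0.ne']
      have : t ^ q ≠ 0 := (Real.rpow_pos_of_pos ht0 q).ne'
      have : s ^ q ≠ 0 := (Real.rpow_pos_of_pos hs q).ne'
      field_simp

lemma enorm_lineDeriv_le {f : Vec n → ℝ} {v : Vec n} (hv : ‖v‖ = 1) {M : ℝ≥0∞} (hM : M ≠ ⊤)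
    (hf : ∀ᶠ z in 𝓝 y, ‖f z - f y‖ₑ ≤ ENNReal.ofReal (dist y z) * M) :
    ‖lineDeriv ℝ f y v‖ₑ ≤ M := by
  have h1 : ‖lineDeriv ℝ f y v‖ ≤ M.toReal := by
    refine norm_deriv_le_of_lip' ENNReal.toReal_nonneg ?_
    have hc : Tendsto (fun t : ℝ => y + t • v) (𝓝 0) (𝓝 y) := by
      have : Continuous fun t : ℝ => y + t • v := by fun_prop
      simpa using this.tendsto 0
    filter_upwards [hc.eventually hf] with t ht
    have h2 := ENNReal.toReal_mono (ENNReal.mul_ne_top ENNReal.ofReal_ne_top hM) ht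
    rw [toReal_enorm, ENNReal.toReal_mul, ENNReal.toReal_ofReal dist_nonneg] at h2
    simp only [zero_smul, add_zero, sub_zero]
    refine h2.trans (le_of_eq ?_)
    rw [dist_eq_norm, mul_comm, sub_add_cancel_left, norm_neg, norm_smul, hv, mul_one]
  rw [← ofReal_norm]
  exact (ENNReal.ofReal_le_ofReal h1).trans (ENNReal.ofReal_toReal hM).le

end

/-! ### Limits of weakly differentiable functions modified on small sets -/

lemma eq_zero_tendsto_of_rpow {α : Type*} {l : Filter α} {f : α → ℝ≥0∞} {q : ℝ} (hq : 0 < q)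
    (h : Tendsto (fun a => f a ^ q) l (𝓝 0)) : Tendsto f l (𝓝 0) := by
  have h1 := h.ennrpow_const (1 / q)
  simp only [← ENNReal.rpow_mul] at h1
  rw [ENNReal.zero_rpow_of_pos (by positivity)] at h1
  refine h1.congr fun a => ?_
  rw [mul_one_div_cancel hq.ne', ENNReal.rpow_one]

section
variable {O : Set (Vec n)}

/-- Fatou's lemma: almost everywhere the sequence is eventually constant, so the uniform bound
passes to the limit. -/
lemma memLp_of_eventually_eq {q : ℝ} (hq : 1 < q) {f : ℕ → Vec n → ℝ} {u : Vec n → ℝ}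
    (hf : ∀ k, Measurable (f k)) {Q : ℝ≥0∞} (hQ : Q ≠ ⊤)
    (hfQ : ∀ k, ∫⁻ y in O, ‖f k y‖ₑ ^ q ≤ Q)
    (h : ∀ᵐ y ∂(volume.restrict O), ∀ᶠ k in atTop, f k y = u y) :
    MemLp u (ENNReal.ofReal q) (volume.restrict O) ∧ ∫⁻ y in O, ‖u y‖ₑ ^ q ≤ Q := by
  have hq0 : 0 < q := by linarith
  have hm : AEStronglyMeasurable u (volume.restrict O) := by
    refine aestronglyMeasurable_of_tendsto_ae atTop (fun k => (hf k).aestronglyMeasurable) ?_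
    filter_upwards [h] with y hy
    exact tendsto_const_nhds.congr' (hy.mono fun k hk => hk.symm)
  have hb : ∫⁻ y in O, ‖u y‖ₑ ^ q ≤ Q := by
    calc ∫⁻ y in O, ‖u y‖ₑ ^ q ≤ ∫⁻ y in O, liminf (fun k => ‖f k y‖ₑ ^ q) atTop := by
          refine lintegral_mono_ae ?_
          filter_upwards [h] with y hy
          refine le_of_eq (Tendsto.liminf_eq ?_).symm
          exact tendsto_const_nhds.congr' (hy.mono fun k hk => by simp only [hk])
      _ ≤ liminf (fun k => ∫⁻ y in O, ‖f k y‖ₑ ^ q) atTop :=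
          lintegral_liminf_le fun k => (hf k).enorm.pow_const q
      _ ≤ Q := by
          refine (liminf_le_liminf (Eventually.of_forall hfQ)).trans (le_of_eq ?_)
          simp
  refine ⟨⟨hm, ?_⟩, hb⟩
  rw [eLpNorm_lt_top_iff_lintegral_rpow_enorm_lt_top (by simpa using hq0) ENNReal.ofReal_ne_top,
    ENNReal.toReal_ofReal hq0.le]
  exact hb.trans_lt hQ.lt_top

/-- Bounds in `L^q` with `q > 1` give equi-integrability: by Hölder, the `L¹` norm over `S k` is
controlled by a positive power of its volume. -/
lemma tendsto_eLpNorm_of_eq_off {q : ℝ} (hq : 1 < q) (hO : IsOpen O) {f : ℕ → Vec n → ℝ}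
    {u : Vec n → ℝ} (hf : ∀ k, Measurable (f k)) {Q : ℝ≥0∞} (hQ : Q ≠ ⊤)
    (hfQ : ∀ k, ∫⁻ y in O, ‖f k y‖ₑ ^ q ≤ Q) (hu : AEStronglyMeasurable u (volume.restrict O))
    (huQ : ∫⁻ y in O, ‖u y‖ₑ ^ q ≤ Q) {S : ℕ → Set (Vec n)} (hS : ∀ k, MeasurableSet (S k))
    (hSv : Tendsto (fun k => volume (S k ∩ O)) atTop (𝓝 0))
    (he : ∀ k, ∀ y ∈ O, y ∉ S k → f k y = u y) :
    Tendsto (fun k => eLpNorm (fun y => f k y - u y) 1 (volume.restrict O)) atTop (𝓝 0) := by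
  have hq0 : 0 < q := by linarith
  have key : ∀ {g : Vec n → ℝ} (k : ℕ), AEStronglyMeasurable g (volume.restrict O) →
      ∫⁻ y in O, ‖g y‖ₑ ^ q ≤ Q →
      (∫⁻ y in S k ∩ O, ‖g y‖ₑ) ^ q ≤ volume (S k ∩ O) ^ (q - 1) * Q := by
    intro g k hg hgQ
    have h1 := lintegral_rpow_le (μ := volume.restrict (S k ∩ O)) (f := fun y => ‖g y‖ₑ)
      (hg.mono_measure (Measure.restrict_mono_set _ inter_subset_right)).enorm hq
    rw [Measure.restrict_apply_univ] at h1
    refine h1.trans ?_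
    gcongr
    exact (lintegral_mono_set inter_subset_right).trans hgQ
  have hlim : Tendsto (fun k => volume (S k ∩ O) ^ (q - 1) * Q) atTop (𝓝 0) := by
    have h1 := hSv.ennrpow_const (q - 1)
    rw [ENNReal.zero_rpow_of_pos (by linarith)] at h1
    simpa using ENNReal.Tendsto.mul_const h1 (Or.inr hQ)
  have l1 : Tendsto (fun k => ∫⁻ y in S k ∩ O, ‖f k y‖ₑ) atTop (𝓝 0) :=
    eq_zero_tendsto_of_rpow hq0 (tendsto_of_tendsto_of_tendsto_of_le_of_le tendsto_const_nhds hlim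
      (fun _ => zero_le) fun k => key k (hf k).aestronglyMeasurable (hfQ k))
  have l2 : Tendsto (fun k => ∫⁻ y in S k ∩ O, ‖u y‖ₑ) atTop (𝓝 0) :=
    eq_zero_tendsto_of_rpow hq0 (tendsto_of_tendsto_of_tendsto_of_le_of_le tendsto_const_nhds hlim
      (fun _ => zero_le) fun k => key k hu huQ)
  have l3 := l1.add l2
  rw [add_zero] at l3
  refine tendsto_of_tendsto_of_tendsto_of_le_of_le tendsto_const_nhds l3 (fun _ => zero_le)
    fun k => ?_
  simp only
  rw [eLpNorm_one_eq_lintegral_enorm, ← lintegral_add_left (hf k).enorm, ← Measure.restrict_restrict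
    (hS k), ← lintegral_indicator (hS k)]
  refine lintegral_mono_ae ?_
  filter_upwards [ae_restrict_mem hO.measurableSet] with y hy
  by_cases hyS : y ∈ S k
  · rw [indicator_of_mem hyS]; exact enorm_sub_le
  · rw [he k y hy hyS]; simp

/-- Weak derivatives pass to limits of `L^q`-bounded sequences which are eventually constant off
shrinking sets. -/
lemma WD.of_eq_off {q : ℝ} (hq : 1 < q) (hO : IsOpen O) (hOv : volume O ≠ ⊤) {j : Fin n}
    {f g : ℕ → Vec n → ℝ} {u w : Vec n → ℝ} (hf : ∀ k, Measurable (f k))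
    (hg : ∀ k, Measurable (g k)) (hfg : ∀ k, WD O j (f k) (g k)) {Q : ℝ≥0∞} (hQ : Q ≠ ⊤)
    (hfQ : ∀ k, ∫⁻ y in O, ‖f k y‖ₑ ^ q ≤ Q) (hgQ : ∀ k, ∫⁻ y in O, ‖g k y‖ₑ ^ q ≤ Q)
    {S : ℕ → Set (Vec n)} (hS : ∀ k, MeasurableSet (S k)) (hSa : Antitone S)
    (hSv : volume (⋂ k, S k) = 0) (hfu : ∀ k, ∀ y ∈ O, y ∉ S k → f k y = u y)
    (hgw : ∀ k, ∀ y ∈ O, y ∉ S k → g k y = w y) :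
    MemLp u (ENNReal.ofReal q) (volume.restrict O) ∧
      MemLp w (ENNReal.ofReal q) (volume.restrict O) ∧ WD O j u w := by
  have : IsFiniteMeasure (volume.restrict O) := ⟨by simpa using hOv.lt_top⟩
  have hae : ∀ᵐ y ∂(volume.restrict O), y ∈ O ∧ ∃ k₀, ∀ k ≥ k₀, y ∉ S k := by
    have h1 : ∀ᵐ y : Vec n, y ∉ ⋂ k, S k := measure_eq_zero_iff_ae_notMem.1 hSv
    filter_upwards [ae_restrict_of_ae h1, ae_restrict_mem hO.measurableSet] with y hy hyO
    rw [mem_iInter, not_forall] at hy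
    obtain ⟨k₀, hk⟩ := hy
    exact ⟨hyO, k₀, fun k hkk h => hk (hSa hkk h)⟩
  obtain ⟨hu, huQ⟩ := memLp_of_eventually_eq hq hf hQ hfQ (u := u) (by
    filter_upwards [hae] with y ⟨hy, k₀, hk⟩
    exact eventually_atTop.2 ⟨k₀, fun k h => hfu k y hy (hk k h)⟩)
  obtain ⟨hw, hwQ⟩ := memLp_of_eventually_eq hq hg hQ hgQ (u := w) (by
    filter_upwards [hae] with y ⟨hy, k₀, hk⟩
    exact eventually_atTop.2 ⟨k₀, fun k h => hgw k y hy (hk k h)⟩)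
  have hSv' : Tendsto (fun k => volume (S k ∩ O)) atTop (𝓝 0) := by
    have h1 := tendsto_measure_iInter_atTop (μ := volume.restrict O)
      (fun k => (hS k).nullMeasurableSet) hSa ⟨0, measure_ne_top _ _⟩
    have h2 : (volume.restrict O) (⋂ k, S k) = 0 :=
      le_antisymm ((Measure.restrict_le_self _).trans hSv.le) zero_le
    rw [h2] at h1
    exact h1.congr fun k => Measure.restrict_apply (hS k)
  have hint : ∀ {v : Vec n → ℝ}, MemLp v (ENNReal.ofReal q) (volume.restrict O) →
      Integrable v (volume.restrict O) := fun hv =>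
    hv.integrable (by simpa using hq.le)
  have hmem : ∀ {v : Vec n → ℝ}, Measurable v → ∫⁻ y in O, ‖v y‖ₑ ^ q ≤ Q →
      Integrable v (volume.restrict O) := by
    intro v hv hvQ
    refine hint ⟨hv.aestronglyMeasurable, ?_⟩
    rw [eLpNorm_lt_top_iff_lintegral_rpow_enorm_lt_top (by simpa using by linarith)
      ENNReal.ofReal_ne_top, ENNReal.toReal_ofReal (by linarith)]
    exact hvQ.trans_lt hQ.lt_top
  refine ⟨hu, hw, (show IntegrableOn u O volume from hint hu).locallyIntegrableOn,
    (show IntegrableOn w O volume from hint hw).locallyIntegrableOn, fun φ hφ => ?_⟩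
  obtain ⟨C, hC⟩ := hφ.2.1.exists_bound_of_continuous hφ.continuous
  obtain ⟨C', hC'⟩ := (hφ.pderiv j).2.1.exists_bound_of_continuous (hφ.pderiv j).continuous
  have l1 := tendsto_integral_mul_of_eLpNorm_one (fun k => hmem (hf k) (hfQ k)) (hint hu)
    (tendsto_eLpNorm_of_eq_off hq hO hf hQ hfQ hu.1 huQ hS hSv' hfu)
    (hφ.pderiv j).continuous.aestronglyMeasurable hC'
  have l2 := tendsto_integral_mul_of_eLpNorm_one (fun k => hmem (hg k) (hgQ k)) (hint hw)
    (tendsto_eLpNorm_of_eq_off hq hO hg hQ hgQ hw.1 hwQ hS hSv' hgw)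
    hφ.continuous.aestronglyMeasurable hC
  simp only [(hφ.pderiv j).setIntegral_mul, hφ.setIntegral_mul] at l1 l2
  exact tendsto_nhds_unique l1 (l2.neg.congr fun k => ((hfg k).parts φ hφ).symm)

end

/-! ### The averaged extension -/

/-- The distance to `Γ`, cut off from below at `δ`. -/
noncomputable def cdist (Γ : Set (Vec n)) (δ : ℝ) (y : Vec n) : ℝ := max (Metric.infDist y Γ) δ

section
variable {Γ : Set (Vec n)} {δ R c C : ℝ} {σ : Measure (Vec n)} {h : Vec n → ℝ} {y y' : Vec n}

lemma cdist_sub_le : |cdist Γ δ y - cdist Γ δ y'| ≤ dist y y' := by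
  have h1 := abs_max_sub_max_le_abs (Metric.infDist y Γ) (Metric.infDist y' Γ) δ
  have h2 := (Metric.lipschitz_infDist_pt Γ).dist_le_mul y y'
  rw [Real.dist_eq, NNReal.coe_one, one_mul] at h2
  exact h1.trans h2

lemma measurable_cdist : Measurable (cdist Γ δ) :=
  ((Metric.continuous_infDist_pt Γ).max continuous_const).measurable

lemma cdist_near (hΓ : IsCompact Γ) (hne : Γ.Nonempty) : ∃ x₀ ∈ Γ, dist y x₀ ≤ cdist Γ δ y := by
  obtain ⟨x₀, hx₀, hd⟩ := hΓ.exists_infDist_eq_dist hne y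
  exact ⟨x₀, hx₀, hd ▸ le_max_left _ _⟩

lemma measurable_wmean [SFinite σ] (hm : Measurable h) {s : Vec n → ℝ} (hs : Measurable s) :
    Measurable fun y => wmean σ h (s y) y := by
  have hw : Measurable fun z : Vec n × Vec n => wker (s z.1) z.1 z.2 :=
    measurable_const.max (((hs.comp measurable_fst).const_mul 3).sub
      (measurable_snd.dist measurable_fst))
  exact (((hm.comp measurable_snd).mul hw).stronglyMeasurable.integral_prod_right'.measurable).div
    hw.stronglyMeasurable.integral_prod_right'.measurable

/-- The pointwise bound for the gradient of the averaged extension. -/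
noncomputable def wgrad (σ : Measure (Vec n)) (h : Vec n → ℝ) (c s : ℝ) (y : Vec n) : ℝ≥0∞ :=
  ENNReal.ofReal (12 * (4 / 3) ^ (n - 1) / c ^ 2 / (s ^ n * s ^ (n - 1))) *
    ∫⁻ x in Metric.ball y (4 * s), ∫⁻ x' in Metric.ball y (4 * s), ‖h x' - h x‖ₑ ∂σ ∂σ

variable [IsFiniteMeasure σ]

lemma lintegral_lintegral_enorm_sub_lt_top (hh : Integrable h σ) :
    ∫⁻ x, ∫⁻ x', ‖h x' - h x‖ₑ ∂σ ∂σ < ⊤ := by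
  have hh' : ∫⁻ x, ‖h x‖ₑ ∂σ < ⊤ := hh.2
  calc ∫⁻ x, ∫⁻ x', ‖h x' - h x‖ₑ ∂σ ∂σ ≤ ∫⁻ x, ∫⁻ x', (‖h x'‖ₑ + ‖h x‖ₑ) ∂σ ∂σ := by
        gcongr; exact enorm_sub_le
    _ = ∫⁻ x, ((∫⁻ x', ‖h x'‖ₑ ∂σ) + ‖h x‖ₑ * σ univ) ∂σ := by
        congr 1; ext x
        rw [lintegral_add_right' _ aemeasurable_const, lintegral_const]
    _ = (∫⁻ x', ‖h x'‖ₑ ∂σ) * σ univ + (∫⁻ x, ‖h x‖ₑ ∂σ) * σ univ := by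
        rw [lintegral_add_left' aemeasurable_const, lintegral_const,
          lintegral_mul_const' _ _ (measure_ne_top _ _)]
    _ < ⊤ := ENNReal.add_lt_top.2 ⟨ENNReal.mul_lt_top hh' (measure_lt_top _ _),
        ENNReal.mul_lt_top hh' (measure_lt_top _ _)⟩

omit [IsFiniteMeasure σ] in
lemma wgrad_le (s : ℝ) : wgrad σ h c s y ≤
    ENNReal.ofReal (12 * (4 / 3) ^ (n - 1) / c ^ 2 / (s ^ n * s ^ (n - 1))) *
    ∫⁻ x, ∫⁻ x', ‖h x' - h x‖ₑ ∂σ ∂σ := by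
  rw [wgrad]
  gcongr
  · exact Measure.restrict_le_self
  · exact Measure.restrict_le_self

lemma wgrad_ne_top (hh : Integrable h σ) (s : ℝ) : wgrad σ h c s y ≠ ⊤ :=
  ((wgrad_le s).trans_lt (ENNReal.mul_lt_top ENNReal.ofReal_lt_top
    (lintegral_lintegral_enorm_sub_lt_top hh))).ne

/-- The cut-off distance is `1`-Lipschitz, so for points closer than a quarter of the scale the two
scales are comparable in the way the tent estimate demands. -/
lemma enorm_wmean_cdist_sub_le (hn : 1 ≤ n) (hσ : SurfRegular σ Γ R c C) (hΓ : IsCompact Γ)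
    (hne : Γ.Nonempty) (hh : Integrable h σ) (hs : cdist Γ δ y ∈ Ioc 0 R)
    (hs' : cdist Γ δ y' ∈ Ioc 0 R) (hd : 4 * dist y y' ≤ cdist Γ δ y) :
    ‖wmean σ h (cdist Γ δ y) y - wmean σ h (cdist Γ δ y') y'‖ₑ ≤
      ENNReal.ofReal (dist y y') * wgrad σ h c (cdist Γ δ y) y := by
  have h1 := abs_le.1 (cdist_sub_le (Γ := Γ) (δ := δ) (y := y) (y' := y'))
  exact enorm_wmean_sub_wmean_le hn hσ hs hs' (cdist_near hΓ hne) (cdist_near hΓ hne) hh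
    (by linarith) (by linarith) cdist_sub_le

/-- The averaging scale never drops below `δ`. For points closer than a quarter of the scale the
local estimate has a uniform constant; for all others the distance exceeds `δ / 4` and boundedness
of the means suffices. -/
lemma lipschitzOn_wmean_cdist (hn : 1 ≤ n) (hσ : SurfRegular σ Γ R c C) (hΓ : IsCompact Γ)
    (hne : Γ.Nonempty) (hh : Integrable h σ) (hδ : δ ∈ Ioc 0 R) {B : Set (Vec n)}
    (hB : ∀ y ∈ B, Metric.infDist y Γ ≤ R) :
    ∃ K, LipschitzOnWith K (fun y => wmean σ h (cdist Γ δ y) y) B := by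
  have hδ0 := hδ.1
  have hc := hσ.cpos
  have hsδ : ∀ y, δ ≤ cdist Γ δ y := fun y => le_max_right _ _
  have hsR : ∀ y ∈ B, cdist Γ δ y ∈ Ioc 0 R := fun y hy =>
    ⟨hδ0.trans_le (hsδ y), max_le (hB y hy) hδ.2⟩
  set Q₁ : ℝ≥0∞ := ENNReal.ofReal (12 * (4 / 3) ^ (n - 1) / c ^ 2 / (δ ^ n * δ ^ (n - 1))) *
    ∫⁻ x, ∫⁻ x', ‖h x' - h x‖ₑ ∂σ ∂σ with hQ₁
  have hQ₁t : Q₁ ≠ ⊤ := (ENNReal.mul_lt_top ENNReal.ofReal_lt_top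
    (lintegral_lintegral_enorm_sub_lt_top hh)).ne
  set Q₂ : ℝ≥0∞ := ENNReal.ofReal (3 / (c * δ ^ (n - 1))) * ∫⁻ x, ‖h x‖ₑ ∂σ with hQ₂
  have hQ₂t : Q₂ ≠ ⊤ := (ENNReal.mul_lt_top ENNReal.ofReal_lt_top hh.2).ne
  have hb : ∀ y ∈ B, |wmean σ h (cdist Γ δ y) y| ≤ Q₂.toReal := by
    intro y hy
    have h1 := enorm_wmean_sub_le hn hσ (hsR y hy) (cdist_near hΓ hne) hh 0
    simp only [sub_zero] at h1
    have h2 : ‖wmean σ h (cdist Γ δ y) y‖ₑ ≤ Q₂ := by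
      refine h1.trans ?_
      rw [hQ₂]
      have := hsδ y
      gcongr
      exact Measure.restrict_le_self
    have := ENNReal.toReal_mono hQ₂t h2
    rwa [toReal_enorm] at this
  refine ⟨(Q₁.toReal + 8 / δ * Q₂.toReal).toNNReal, LipschitzOnWith.of_dist_le_mul fun y hy y' hy' => ?_⟩
  rw [Real.coe_toNNReal _ (by positivity), Real.dist_eq]
  have hd0 := dist_nonneg (x := y) (y := y')
  have hQ10 : 0 ≤ Q₁.toReal := ENNReal.toReal_nonneg
  have hQ20 : 0 ≤ Q₂.toReal := ENNReal.toReal_nonneg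
  by_cases hd : 4 * dist y y' ≤ cdist Γ δ y
  · have h1 := enorm_wmean_cdist_sub_le hn hσ hΓ hne hh (hsR y hy) (hsR y' hy') hd
    have h2 : wgrad σ h c (cdist Γ δ y) y ≤ Q₁ := by
      refine (wgrad_le _).trans ?_
      rw [hQ₁]
      have := hsδ y
      have := hδ0.trans_le this
      gcongr
    have h3 := ENNReal.toReal_mono (ENNReal.mul_ne_top ENNReal.ofReal_ne_top hQ₁t)
      (h1.trans (mul_le_mul_right h2 _))
    rw [toReal_enorm, ENNReal.toReal_mul, ENNReal.toReal_ofReal hd0] at h3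
    refine h3.trans ?_
    have : 0 ≤ 8 / δ * Q₂.toReal * dist y y' := by positivity
    nlinarith
  · have h1 := hb y hy
    have h2 := hb y' hy'
    have h3 := hsδ y
    have h4 : 1 ≤ 4 / δ * dist y y' := by
      rw [div_mul_eq_mul_div, le_div_iff₀ hδ0]; linarith
    have h5 := abs_sub (wmean σ h (cdist Γ δ y) y) (wmean σ h (cdist Γ δ y') y')
    have h6 : 2 * Q₂.toReal ≤ 8 / δ * Q₂.toReal * dist y y' := by
      calc 2 * Q₂.toReal = 2 * Q₂.toReal * 1 := by ring
        _ ≤ 2 * Q₂.toReal * (4 / δ * dist y y') := by gcongr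
        _ = _ := by ring
    have h7 : 0 ≤ Q₁.toReal * dist y y' := by positivity
    linarith

end

/-! ### Density constants of Lipschitz domains and the trace of the averaged extension. -/

section
variable {Ω : Set (Vec n)}

lemma IsLipDomain.frontier_nonempty (hΩ : IsLipDomain Ω) : (frontier Ω).Nonempty :=
  frontier_nonempty' hΩ.one_le hΩ.nonempty hΩ.bdd

lemma IsLipDomain.isFiniteMeasure (hΩ : IsLipDomain Ω) : IsFiniteMeasure (surfaceMeasure Ω) :=
  surfaceMeasure_finite hΩ.one_le hΩ.isOpen hΩ.bdd hΩ.lip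

lemma IsLipDomain.surfRegular (hΩ : IsLipDomain Ω) {R : ℝ} (hR : 0 < R) : ∃ c C,
    SurfRegular (surfaceMeasure Ω) (frontier Ω) R c C ∧
      ∀ x ∈ frontier Ω, ∀ ρ ∈ Ioc 0 R, ENNReal.ofReal (c * ρ ^ n) ≤ volume (Metric.ball x ρ ∩ Ω) := by
  obtain ⟨c, C, hc, hC, h1, h2⟩ := boundary_regular hΩ.one_le hΩ.isOpen hΩ.bdd hΩ.lip hR
  exact ⟨c, C, ⟨hc, hC, fun x hx ρ hρ => (h1 x hx ρ hρ).1, h2⟩, fun x hx ρ hρ => (h1 x hx ρ hρ).2⟩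

lemma IsLipDomain.infDist_pos (hΩ : IsLipDomain Ω) {y : Vec n} (hy : y ∉ frontier Ω) :
    0 < Metric.infDist y (frontier Ω) :=
  (isClosed_frontier.notMem_iff_infDist_pos hΩ.frontier_nonempty).1 hy

/-- The integral of `|wmean - h x₀|^q` over `B_r(x₀) ∩ Ω` is at most a multiple of `r` times the
integral of `|h - h x₀|^q` over `B_{4r}(x₀)`, hence of `r · r^(n+q-2)` times the finite Gagliardo
integral at `x₀`. Dividing by the volume, which is at least `c r^n`, leaves `r^(q-1)`, and `q > 1`.
-/
lemma tendsto_setLAverage_wmean (hΩ : IsLipDomain Ω) {h : Vec n → ℝ} (hm : Measurable h)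
    (hh : Integrable h (surfaceMeasure Ω)) {q : ℝ} (hq : 1 < q) {x₀ : Vec n}
    (hx₀ : x₀ ∈ frontier Ω) (hH : ∫⁻ x, ‖h x - h x₀‖ₑ ^ q / edist x₀ x ^ ((n : ℝ) + q - 2)
      ∂(surfaceMeasure Ω) < ⊤) :
    Tendsto (fun r : ℝ => ⨍⁻ y in Metric.ball x₀ r ∩ Ω,
      ‖wmean (surfaceMeasure Ω) h (Metric.infDist y (frontier Ω)) y - h x₀‖ₑ ∂volume)
      (𝓝[>] 0) (𝓝 0) := by
  have hn := hΩ.one_le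
  have hn' : (1 : ℝ) ≤ n := by exact_mod_cast hn
  have := hΩ.isFiniteMeasure
  set σ := surfaceMeasure Ω
  set Γ := frontier Ω
  obtain ⟨c, C, hσ, hvol⟩ := hΩ.surfRegular one_pos
  obtain ⟨A₂, hA₂, hpot⟩ := lintegral_ball_potential_le hn
  have hc := hσ.cpos
  have hC := hσ.Cpos
  set A₁ : ℝ := (3 / c) ^ q * (C * 3 ^ (n - 1)) ^ (q - 1) with hA₁
  have hA₁0 : 0 ≤ A₁ := by positivity
  set H := ∫⁻ x, ‖h x - h x₀‖ₑ ^ q / edist x₀ x ^ ((n : ℝ) + q - 2) ∂σ with hHdef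
  set d : Vec n → ℝ := fun y => Metric.infDist y Γ with hd
  have hΓc : IsCompact Γ := isCompact_frontier' hΩ.bdd
  have hdisj : ∀ y ∈ Ω, 0 < d y := fun y hy => hΩ.infDist_pos fun hy' => by
    have : y ∈ frontier Ω := hy'
    rw [hΩ.isOpen.frontier_eq] at this
    exact this.2 hy
  have hq0 : 0 < q := by linarith
  have he0 : 0 ≤ (n : ℝ) + q - 2 := by linarith
  refine eq_zero_tendsto_of_rpow hq0 ?_
  have hlim : Tendsto (fun r : ℝ => ENNReal.ofReal (A₁ * A₂ * 4 ^ ((n : ℝ) + q - 2) / c * r ^ (q - 1)) * H)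
      (𝓝[>] 0) (𝓝 0) := by
    have h1 : Tendsto (fun r : ℝ => A₁ * A₂ * 4 ^ ((n : ℝ) + q - 2) / c * r ^ (q - 1)) (𝓝 0) (𝓝 0) := by
      have := ((Real.continuous_rpow_const (show 0 ≤ q - 1 by linarith)).const_mul
        (A₁ * A₂ * 4 ^ ((n : ℝ) + q - 2) / c)).tendsto 0
      rwa [Real.zero_rpow (by linarith), mul_zero] at this
    have h2 := ENNReal.tendsto_ofReal (h1.mono_left (nhdsWithin_le_nhds (s := Ioi 0)))
    simpa using ENNReal.Tendsto.mul_const h2 (Or.inr hH.ne)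
  refine tendsto_of_tendsto_of_tendsto_of_le_of_le' tendsto_const_nhds hlim
    (Eventually.of_forall fun _ => zero_le) ?_
  filter_upwards [Ioc_mem_nhdsGT one_pos] with r hr
  have hr0 := hr.1
  set S := Metric.ball x₀ r ∩ Ω with hS
  have hSm : MeasurableSet S := measurableSet_ball.inter hΩ.isOpen.measurableSet
  have hdS : ∀ y ∈ S, 0 < d y ∧ d y ≤ r := fun y hy =>
    ⟨hdisj y hy.2, (Metric.infDist_le_dist_of_mem hx₀).trans (le_of_lt hy.1)⟩
  have hSpos := hvol x₀ hx₀ r hr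
  have hSfin : volume S ≠ ⊤ := ((measure_mono inter_subset_left).trans_lt measure_ball_lt_top).ne
  have hSne : volume S ≠ 0 := (lt_of_lt_of_le (by simp; positivity) hSpos).ne'
  set F : Vec n → ℝ≥0∞ := (Metric.ball x₀ (4 * r)).indicator fun x => ‖h x - h x₀‖ₑ ^ q with hF
  have hFm : Measurable F := ((hm.sub measurable_const).enorm.pow_const q).indicator measurableSet_ball
  have hwm : Measurable fun y => wmean σ h (d y) y :=
    measurable_wmean hm (Metric.continuous_infDist_pt Γ).measurable
  have hFint : ∫⁻ x, F x ∂σ ≤ ENNReal.ofReal ((4 * r) ^ ((n : ℝ) + q - 2)) * H := by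
    rw [hHdef, ← lintegral_const_mul' _ _ ENNReal.ofReal_ne_top]
    refine lintegral_mono fun x => ?_
    by_cases hx : x ∈ Metric.ball x₀ (4 * r)
    · rw [hF, indicator_of_mem hx]
      rcases eq_or_ne x x₀ with rfl | hne
      · simp [ENNReal.zero_rpow_of_pos hq0]
      · have hd0 : 0 < dist x₀ x := dist_pos.2 hne.symm
        have h1 : edist x₀ x ^ ((n : ℝ) + q - 2) ≤ ENNReal.ofReal ((4 * r) ^ ((n : ℝ) + q - 2)) := by
          rw [← ENNReal.ofReal_rpow_of_nonneg (by positivity) he0, edist_dist]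
          gcongr
          rw [dist_comm]; exact le_of_lt hx
        have h2 : edist x₀ x ^ ((n : ℝ) + q - 2) ≠ 0 := by
          rw [edist_dist, ENNReal.ofReal_rpow_of_pos hd0]
          simp only [ne_eq, ENNReal.ofReal_eq_zero, not_le]
          positivity
        calc ‖h x - h x₀‖ₑ ^ q = edist x₀ x ^ ((n : ℝ) + q - 2) *
              (‖h x - h x₀‖ₑ ^ q / edist x₀ x ^ ((n : ℝ) + q - 2)) := by
              rw [ENNReal.mul_div_cancel h2 (ENNReal.rpow_ne_top_of_nonneg he0 (edist_ne_top _ _))]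
          _ ≤ _ := by gcongr
    · rw [hF, indicator_of_notMem hx]; exact zero_le
  have hmain : ∫⁻ y in S, ‖wmean σ h (d y) y - h x₀‖ₑ ^ q ≤
      ENNReal.ofReal A₁ * (ENNReal.ofReal (A₂ * r) * (ENNReal.ofReal ((4 * r) ^ ((n : ℝ) + q - 2)) * H)) := by
    calc ∫⁻ y in S, ‖wmean σ h (d y) y - h x₀‖ₑ ^ q
        ≤ ∫⁻ y in S, ENNReal.ofReal A₁ * (ENNReal.ofReal ((d y ^ (n - 1))⁻¹) *
            ∫⁻ x in Metric.ball y (3 * d y), F x ∂σ) := by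
          refine setLIntegral_mono' hSm fun y hy => ?_
          have h1 := enorm_wmean_sub_rpow_le hn hσ (s := d y) (y := y)
            ⟨(hdS y hy).1, (hdS y hy).2.trans hr.2⟩
            (by obtain ⟨z, hz, hz'⟩ := hΓc.exists_infDist_eq_dist ⟨x₀, hx₀⟩ y
                exact ⟨z, hz, hz'.symm.le⟩) hh (h x₀) hq
          refine h1.trans ?_
          refine mul_le_mul_right (mul_le_mul_right (le_of_eq
            (setLIntegral_congr_fun measurableSet_ball fun x hx => ?_)) _) _
          have hx4 : x ∈ Metric.ball x₀ (4 * r) := by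
            have h3 := hy.1
            have h4 : dist x y < 3 * d y := hx
            rw [Metric.mem_ball] at *
            linarith [dist_triangle x y x₀, (hdS y hy).2]
          simp only [hF]
          rw [indicator_of_mem hx4]
      _ = ENNReal.ofReal A₁ * ∫⁻ y in S, ENNReal.ofReal ((d y ^ (n - 1))⁻¹) *
            ∫⁻ x in Metric.ball y (3 * d y), F x ∂σ := lintegral_const_mul' _ _ ENNReal.ofReal_ne_top
      _ ≤ ENNReal.ofReal A₁ * (ENNReal.ofReal (A₂ * r) * ∫⁻ x, F x ∂σ) := by
          gcongr
          exact hpot σ F hFm d (Metric.continuous_infDist_pt Γ).measurable S hSm r hr0 hdS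
      _ ≤ _ := by gcongr
  rw [setLAverage_eq]
  have hjen := lintegral_rpow_le (μ := volume.restrict S)
    (f := fun y => ‖wmean σ h (d y) y - h x₀‖ₑ)
    (hwm.sub measurable_const).enorm.aemeasurable hq
  rw [Measure.restrict_apply_univ] at hjen
  calc ((∫⁻ y in S, ‖wmean σ h (d y) y - h x₀‖ₑ) / volume S) ^ q
      ≤ (volume S ^ (q - 1) * ∫⁻ y in S, ‖wmean σ h (d y) y - h x₀‖ₑ ^ q) / volume S ^ q := by
        rw [ENNReal.div_rpow_of_nonneg _ _ hq0.le]
        gcongr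
    _ = (volume S)⁻¹ * ∫⁻ y in S, ‖wmean σ h (d y) y - h x₀‖ₑ ^ q := by
        rw [ENNReal.div_eq_inv_mul, ← mul_assoc, ← ENNReal.rpow_neg, ← ENNReal.rpow_add _ _ hSne hSfin,
          show -q + (q - 1) = -1 by ring, ENNReal.rpow_neg_one]
    _ ≤ (ENNReal.ofReal (c * r ^ n))⁻¹ * (ENNReal.ofReal A₁ * (ENNReal.ofReal (A₂ * r) *
          (ENNReal.ofReal ((4 * r) ^ ((n : ℝ) + q - 2)) * H))) := by gcongr
    _ = _ := by
        rw [← ENNReal.ofReal_inv_of_pos (by positivity), ← mul_assoc, ← mul_assoc, ← mul_assoc,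
          ← ENNReal.ofReal_mul (by positivity), ← ENNReal.ofReal_mul (by positivity),
          ← ENNReal.ofReal_mul (by positivity)]
        congr 2
        rw [Real.mul_rpow (by norm_num) hr0.le,
          show (n : ℝ) + q - 2 = (n : ℝ) + q - 2 from rfl]
        have e1 : r ^ ((n : ℝ) + q - 2) = r ^ n * r ^ (q - 1) / r := by
          rw [← Real.rpow_natCast r n, ← Real.rpow_add hr0, ← Real.rpow_sub_one hr0.ne']
          congr 1; ring
        rw [e1]
        field_simp

end

section
variable {Ω : Set (Vec n)}

/-- Functions in `W^{1-1/q,q}(∂Ω)`, `q > 1`, are traces of functions in `W^{1,q}` of a ball. -/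
lemma exists_extension_scalar (hΩ : IsLipDomain Ω) {h : Vec n → ℝ} (hm : Measurable h) {q : ℝ}
    (hq : 1 < q) (hh : MemLp h (ENNReal.ofReal q) (surfaceMeasure Ω))
    (hG : ∫⁻ x, ∫⁻ x', ‖h x' - h x‖ₑ ^ q / edist x x' ^ ((n : ℝ) + q - 2)
      ∂(surfaceMeasure Ω) ∂(surfaceMeasure Ω) < ⊤) (R₀ : ℝ) :
    ∃ (u : Vec n → ℝ) (w : Fin n → Vec n → ℝ),
      MemLp u (ENNReal.ofReal q) (volume.restrict (Metric.ball 0 R₀)) ∧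
      (∀ j, MemLp (w j) (ENNReal.ofReal q) (volume.restrict (Metric.ball 0 R₀)) ∧
        WD (Metric.ball 0 R₀) j u (w j)) ∧
      ∀ᵐ x ∂(surfaceMeasure Ω), Tendsto (fun r : ℝ => ⨍⁻ y in Metric.ball x r ∩ Ω,
        ‖u y - h x‖ₑ ∂volume) (𝓝[>] 0) (𝓝 0) := by
  have hn := hΩ.one_le
  have hn' : (1 : ℝ) ≤ n := by exact_mod_cast hn
  have := hΩ.isFiniteMeasure
  have hq0 : 0 < q := by linarith
  have hΓ : IsCompact (frontier Ω) := isCompact_frontier' hΩ.bdd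
  have hne := hΩ.frontier_nonempty
  have hvΓ := hΩ.volume_frontier
  have htr := fun (x₀ : Vec n) hx₀ hH => tendsto_setLAverage_wmean hΩ hm
    (hh.integrable (by simpa using hq.le)) hq (x₀ := x₀) hx₀ hH
  have hfr : ∀ᵐ x ∂(surfaceMeasure Ω), x ∈ frontier Ω :=
    ae_restrict_mem isClosed_frontier.measurableSet
  have hmG : Measurable fun z : Vec n × Vec n => ‖h z.2 - h z.1‖ₑ ^ q :=
    ((hm.comp measurable_snd).sub (hm.comp measurable_fst)).enorm.pow_const q
  have hmQ : Measurable fun z : Vec n × Vec n =>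
      ‖h z.2 - h z.1‖ₑ ^ q / edist z.1 z.2 ^ ((n : ℝ) + q - 2) :=
    hmG.div ((measurable_fst.edist measurable_snd).pow_const _)
  have htrace : ∀ᵐ x ∂(surfaceMeasure Ω), Tendsto (fun r : ℝ => ⨍⁻ y in Metric.ball x r ∩ Ω,
      ‖wmean (surfaceMeasure Ω) h (Metric.infDist y (frontier Ω)) y - h x‖ₑ ∂volume)
      (𝓝[>] 0) (𝓝 0) := by
    filter_upwards [hfr, ae_lt_top (Measurable.lintegral_prod_right' hmQ) hG.ne] with x hx hx'
    exact htr x hx hx'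
  have hhi : Integrable h (surfaceMeasure Ω) := hh.integrable (by simpa using hq.le)
  have hhq : ∫⁻ x, ‖h x‖ₑ ^ q ∂(surfaceMeasure Ω) < ⊤ := by
    have := hh.2
    rwa [eLpNorm_lt_top_iff_lintegral_rpow_enorm_lt_top (by simpa using hq0) ENNReal.ofReal_ne_top,
      ENNReal.toReal_ofReal hq0.le] at this
  set Γ := frontier Ω with hΓdef
  generalize hσdef : surfaceMeasure Ω = σ at *
  set B := Metric.ball (0 : Vec n) R₀ with hB
  obtain ⟨R, hR0, hR⟩ : ∃ R > 0, ∀ y ∈ B, Metric.infDist y Γ ≤ R := by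
    obtain ⟨x₀, hx₀⟩ := hne
    refine ⟨|R₀| + ‖x₀‖ + 1, by positivity, fun y hy => ?_⟩
    refine (Metric.infDist_le_dist_of_mem hx₀).trans ?_
    rw [hB, mem_ball_zero_iff] at hy
    have := norm_sub_le y x₀
    rw [dist_eq_norm]
    linarith [le_abs_self R₀]
  obtain ⟨c, C, hσ, -⟩ := hΩ.surfRegular hR0
  rw [hσdef, ← hΓdef] at hσ
  have hc := hσ.cpos
  have hC := hσ.Cpos
  -- Averaging at the scale of the distance itself need not be Lipschitz up to the boundary. Cutting
  -- the scale off at `δ k` gives Lipschitz functions which agree with the extension off the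
  -- shrinking strips `S k` and obey `L^q` bounds independent of `k`; `WD.of_eq_off` passes to the
  -- limit.
  set δ : ℕ → ℝ := fun k => R / ((k : ℝ) + 1) with hδ
  have hδR : ∀ k, δ k ∈ Ioc 0 R := fun k => by
    refine ⟨by positivity, div_le_self hR0.le ?_⟩
    have : (0 : ℝ) ≤ k := by positivity
    linarith
  have hδa : Antitone δ := fun k l hkl => by
    simp only [hδ]
    gcongr
  have hδ0 : Tendsto δ atTop (𝓝 0) :=
    tendsto_const_nhds.div_atTop (tendsto_atTop_add_const_right _ _ tendsto_natCast_atTop_atTop)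
  choose K hK using fun k => lipschitzOn_wmean_cdist hn hσ hΓ hne hhi (hδR k) hR
  -- `WD.of_lipschitz` asks for functions Lipschitz on the whole space; the values off the ball are
  -- irrelevant.
  choose f hfK hfe using fun k => (hK k).extend_real
  have hfe' : ∀ k, ∀ y ∈ B, f k y = wmean σ h (cdist Γ (δ k) y) y := fun k y hy => (hfe k hy).symm
  set u : Vec n → ℝ := fun y => wmean σ h (Metric.infDist y Γ) y with hu
  set e : Fin n → Vec n := fun j => EuclideanSpace.single j 1 with he
  have hsR : ∀ k, ∀ y ∈ B, cdist Γ (δ k) y ∈ Ioc 0 R := fun k y hy =>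
    ⟨(hδR k).1.trans_le (le_max_right _ _), max_le (hR y hy) (hδR k).2⟩
  set S : ℕ → Set (Vec n) := fun k => {y | Metric.infDist y Γ ≤ δ k} with hS
  have hSm : ∀ k, MeasurableSet (S k) := fun k =>
    (isClosed_le (Metric.continuous_infDist_pt Γ) continuous_const).measurableSet
  have hSa : Antitone S := fun k l hkl y hy => le_trans (show Metric.infDist y Γ ≤ δ l from hy) (hδa hkl)
  have hSi : (⋂ k, S k) ⊆ Γ := by
    intro y hy
    rw [mem_iInter] at hy
    by_contra hyΓ
    have h1 := hΩ.infDist_pos hyΓ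
    have h2 : Metric.infDist y Γ ≤ 0 := ge_of_tendsto hδ0 (Eventually.of_forall hy)
    exact absurd h1 (not_lt.2 h2)
  have hSv : volume (⋂ k, S k) = 0 := measure_mono_null hSi hvΓ
  have hloc : ∀ k, ∀ y ∈ B, y ∉ S k → f k =ᶠ[𝓝 y] u := by
    intro k y hy hyS
    have ho : IsOpen (S k)ᶜ :=
      (isClosed_le (Metric.continuous_infDist_pt Γ) continuous_const).isOpen_compl
    filter_upwards [ho.mem_nhds hyS, Metric.isOpen_ball.mem_nhds hy] with z hz hzB
    have : cdist Γ (δ k) z = Metric.infDist z Γ := max_eq_left (le_of_lt (not_le.1 hz))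
    rw [hfe' k z hzB, this]
  obtain ⟨A₂, hA₂, hpot⟩ := lintegral_ball_potential_le hn
  obtain ⟨A₃, hA₃, hgag⟩ := lintegral_ball_gagliardo_le hn hq
  set A₁ := (3 / c) ^ q * (C * 3 ^ (n - 1)) ^ (q - 1) with hA₁
  set Q₁ := ENNReal.ofReal A₁ * (ENNReal.ofReal (A₂ * R) * ∫⁻ x, ‖h x‖ₑ ^ q ∂σ) with hQ₁
  have hfQ : ∀ k, ∫⁻ y in B, ‖f k y‖ₑ ^ q ≤ Q₁ := by
    intro k
    calc ∫⁻ y in B, ‖f k y‖ₑ ^ q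
        ≤ ∫⁻ y in B, ENNReal.ofReal A₁ * (ENNReal.ofReal ((cdist Γ (δ k) y ^ (n - 1))⁻¹) *
            ∫⁻ x in Metric.ball y (3 * cdist Γ (δ k) y), ‖h x‖ₑ ^ q ∂σ) := by
          refine setLIntegral_mono' measurableSet_ball fun y hy => ?_
          have h1 := enorm_wmean_sub_rpow_le hn hσ (hsR k y hy) (cdist_near hΓ hne) hhi 0 hq
          simp only [sub_zero] at h1
          rw [hfe' k y hy]
          exact h1
      _ = ENNReal.ofReal A₁ * ∫⁻ y in B, ENNReal.ofReal ((cdist Γ (δ k) y ^ (n - 1))⁻¹) *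
            ∫⁻ x in Metric.ball y (3 * cdist Γ (δ k) y), ‖h x‖ₑ ^ q ∂σ :=
          lintegral_const_mul' _ _ ENNReal.ofReal_ne_top
      _ ≤ Q₁ := by
          rw [hQ₁]
          gcongr
          exact hpot σ _ (hm.enorm.pow_const q) _ measurable_cdist B measurableSet_ball R hR0 (hsR k)
  set A₅ : ℝ := 12 * (4 / 3) ^ (n - 1) / c ^ 2 with hA₅
  set A₄ := A₅ ^ q * ((C * 4 ^ (n - 1)) ^ (q - 1)) ^ 2 with hA₄
  set Q₂ := ENNReal.ofReal A₄ * (ENNReal.ofReal A₃ *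
    ∫⁻ x, ∫⁻ x', ‖h x' - h x‖ₑ ^ q / edist x x' ^ ((n : ℝ) + q - 2) ∂σ ∂σ) with hQ₂
  have hgQ : ∀ j k, ∫⁻ y in B, ‖lineDeriv ℝ (f k) y (e j)‖ₑ ^ q ≤ Q₂ := by
    intro j k
    calc ∫⁻ y in B, ‖lineDeriv ℝ (f k) y (e j)‖ₑ ^ q
        ≤ ∫⁻ y in B, ENNReal.ofReal A₄ * (ENNReal.ofReal (cdist Γ (δ k) y ^ (-(q + 2 * n - 2))) *
            ∫⁻ x in Metric.ball y (4 * cdist Γ (δ k) y), ∫⁻ x' in Metric.ball y (4 * cdist Γ (δ k) y),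
              ‖h x' - h x‖ₑ ^ q ∂σ ∂σ) := by
          refine setLIntegral_mono' measurableSet_ball fun y hy => ?_
          have hs := hsR k y hy
          have h1 : ‖lineDeriv ℝ (f k) y (e j)‖ₑ ≤ wgrad σ h c (cdist Γ (δ k) y) y := by
            refine enorm_lineDeriv_le (by simp [he]) (wgrad_ne_top hhi _) ?_
            filter_upwards [Metric.isOpen_ball.mem_nhds hy,
              Metric.ball_mem_nhds y (show 0 < cdist Γ (δ k) y / 4 by linarith [hs.1])] with z hz hz'
            rw [hfe' k y hy, hfe' k z hz, ← enorm_neg, neg_sub]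
            refine enorm_wmean_cdist_sub_le hn hσ hΓ hne hhi hs (hsR k z hz) ?_
            rw [Metric.mem_ball, dist_comm] at hz'
            linarith
          refine (ENNReal.rpow_le_rpow h1 hq0.le).trans ?_
          exact enorm_wmean_grad_rpow_le hn hσ hs.1 hm hq (by positivity)
      _ = ENNReal.ofReal A₄ * ∫⁻ y in B, (ENNReal.ofReal (cdist Γ (δ k) y ^ (-(q + 2 * n - 2))) *
            ∫⁻ x in Metric.ball y (4 * cdist Γ (δ k) y), ∫⁻ x' in Metric.ball y (4 * cdist Γ (δ k) y),
              ‖h x' - h x‖ₑ ^ q ∂σ ∂σ) := lintegral_const_mul' _ _ ENNReal.ofReal_ne_top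
      _ ≤ Q₂ := by
          rw [hQ₂]
          gcongr
          exact hgag σ (fun z => ‖h z.2 - h z.1‖ₑ ^ q) hmG
            (fun x => by simp [ENNReal.zero_rpow_of_pos hq0]) _ measurable_cdist B measurableSet_ball
            fun y hy => (hsR k y hy).1
  have hQ : max Q₁ Q₂ ≠ ⊤ := by
    refine (max_lt ?_ ?_).ne
    · exact ENNReal.mul_lt_top ENNReal.ofReal_lt_top (ENNReal.mul_lt_top ENNReal.ofReal_lt_top hhq)
    · exact ENNReal.mul_lt_top ENNReal.ofReal_lt_top (ENNReal.mul_lt_top ENNReal.ofReal_lt_top hG)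
  have main := fun j => WD.of_eq_off hq Metric.isOpen_ball (O := B) measure_ball_lt_top.ne (j := j)
    (f := f) (g := fun k y => lineDeriv ℝ (f k) y (e j)) (u := u)
    (w := fun y => lineDeriv ℝ u y (e j)) (fun k => (hfK k).continuous.measurable)
    (fun k => measurable_lineDeriv (hfK k).continuous)
    (fun k => (WD.of_lipschitz (hfK k) j).mono (subset_univ _)) hQ
    (fun k => (hfQ k).trans (le_max_left _ _)) (fun k => (hgQ j k).trans (le_max_right _ _))
    hSm hSa hSv (fun k y hy hyS => (hloc k y hy hyS).self_of_nhds)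
    (fun k y hy hyS => (hloc k y hy hyS).lineDeriv_eq)
  exact ⟨u, fun j y => lineDeriv ℝ u y (e j), (main ⟨0, hn⟩).1, fun j => (main j).2, htrace⟩

lemma hasTrace_of_coord {u g : Vec n → Vec N} (hu : ∀ i, AEStronglyMeasurable (fun y => u y i)
    (volume.restrict Ω)) (h : ∀ i, ∀ᵐ x ∂(surfaceMeasure Ω), Tendsto (fun r : ℝ =>
      ⨍⁻ y in Metric.ball x r ∩ Ω, ‖u y i - g x i‖ₑ ∂volume) (𝓝[>] 0) (𝓝 0)) : HasTrace Ω u g := by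
  filter_upwards [ae_all_iff.2 h] with x hx
  have hsum := tendsto_finsetSum Finset.univ fun i _ => hx i
  rw [Finset.sum_const_zero] at hsum
  refine tendsto_of_tendsto_of_tendsto_of_le_of_le tendsto_const_nhds hsum (fun _ => zero_le)
    fun r => ?_
  have hmr : ∀ i, AEMeasurable (fun y => ‖u y i - g x i‖ₑ)
      (volume.restrict (Metric.ball x r ∩ Ω)) := fun i =>
    (((hu i).mono_measure (Measure.restrict_mono_set _ inter_subset_right)).sub
      aestronglyMeasurable_const).enorm
  simp only [setLAverage_eq]
  simp only [div_eq_mul_inv]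
  rw [← Finset.sum_mul, ← lintegral_finsetSum' _ fun i _ => hmr i]
  gcongr with y
  have h1 : ‖u y - g x‖ ≤ ∑ i, ‖u y i - g x i‖ := by
    have : u y - g x = ∑ i, (u y i - g x i) • EuclideanSpace.basisFun (Fin N) ℝ i := by
      simpa using ((EuclideanSpace.basisFun (Fin N) ℝ).sum_repr (u y - g x)).symm
    rw [this]
    refine (norm_sum_le _ _).trans (le_of_eq ?_)
    simp [norm_smul]
  rw [← ofReal_norm]
  refine (ENNReal.ofReal_le_ofReal h1).trans ?_
  rw [ENNReal.ofReal_sum_of_nonneg fun i _ => norm_nonneg _]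
  simp only [ofReal_norm, le_refl]

lemma exists_extension_of_one_lt (hΩ : IsLipDomain Ω) {q : ℝ} (hq : 1 < q) {g : Vec n → Vec N}
    (hg : MemTraceSpace q Ω g) (R₀ : ℝ) (hR₀ : Ω ⊆ Metric.ball 0 R₀) :
    ∃ u : Vec n → Vec N, MemW1 q (Metric.ball 0 R₀) u ∧ HasTrace Ω u g := by
  have := hΩ.isFiniteMeasure
  obtain ⟨hgL, hgG⟩ := hg
  -- The scalar extension needs measurable boundary data. The Gagliardo integral and the trace
  -- condition do not see changes on null sets of the boundary.
  obtain ⟨g', hg'm, hgg'⟩ := hgL.1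
  have hgL' := hgL.ae_eq hgg'
  have hP1 : 1 ≤ ENNReal.ofReal q := by simpa using hq.le
  have hgG' := hgG hq
  have hex : (n : ℝ) - 1 + (1 - 1 / q) * q = (n : ℝ) + q - 2 := by
    field_simp; ring
  have hG : ∀ i, ∫⁻ x, ∫⁻ x', ‖g' x' i - g' x i‖ₑ ^ q / edist x x' ^ ((n : ℝ) + q - 2)
      ∂(surfaceMeasure Ω) ∂(surfaceMeasure Ω) < ⊤ := by
    intro i
    refine lt_of_le_of_lt ?_ hgG'
    refine lintegral_mono_ae ?_
    filter_upwards [hgg'] with x hx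
    refine lintegral_mono_ae ?_
    filter_upwards [hgg'] with x' hx'
    rw [hx, hx', hex]
    gcongr
    rw [← enorm_neg, neg_sub, ← ofReal_norm, ← ofReal_norm]
    exact ENNReal.ofReal_le_ofReal (PiLp.norm_apply_le (g' x - g' x') i)
  have hmi : ∀ i, Measurable fun x => g' x i := fun i => by
    have := hg'm.measurable
    fun_prop
  choose u w hu hw ht using fun i => exists_extension_scalar hΩ (hmi i) hq
    ⟨(hmi i).aestronglyMeasurable, (eLpNorm_coord_le g' i _).trans_lt hgL'.2⟩ (hG i) R₀
  refine ⟨fun y => WithLp.toLp 2 fun i => u i y, ⟨?_, fun y => WithLp.toLp 2 fun ij => w ij.1 ij.2 y,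
    HasWeakGrad.of_WD ?_ fun i j => (hw i j).2, ?_⟩, ?_⟩
  · exact memLp_piLp_iff.2 hu
  · exact locallyIntegrableOn_coord.2 fun i => by
      have hi : IntegrableOn (u i) (Metric.ball 0 R₀) := by
        have : IsFiniteMeasure (volume.restrict (Metric.ball (0 : Vec n) R₀)) :=
          ⟨by simpa using measure_ball_lt_top⟩
        exact (hu i).integrable hP1
      exact hi.locallyIntegrableOn
  · exact memLp_piLp_iff.2 fun ij => (hw ij.1 ij.2).1
  · have h1 : HasTrace Ω (fun y => WithLp.toLp 2 fun i => u i y : Vec n → Vec N) g' :=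
      hasTrace_of_coord (fun i => (hu i).1.mono_measure (Measure.restrict_mono_set _ hR₀)) ht
    exact h1.congr_right hgg'.symm

end

/-! ### Extension of integrable boundary functions. -/

/-- A continuous cutoff, equal to one for `s ≤ t` and to zero for `s ≥ 2 t`. -/
noncomputable def collar (t s : ℝ) : ℝ := max 0 (min 1 (2 - s / t))

lemma collar_mem (t s : ℝ) : 0 ≤ collar t s ∧ collar t s ≤ 1 :=
  ⟨le_max_left _ _, max_le zero_le_one (min_le_left _ _)⟩

lemma collar_zero (t : ℝ) : collar t 0 = 1 := by simp [collar]

lemma collar_eq_zero {t s : ℝ} (ht : 0 < t) (h : 2 * t ≤ s) : collar t s = 0 := by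
  refine max_eq_left ((min_le_right _ _).trans ?_)
  rw [sub_nonpos, le_div_iff₀ ht]; exact h

lemma lipschitz_collar {t : ℝ} (ht : 0 < t) :
    LipschitzWith (Real.toNNReal (1 / t)) (collar t) := by
  have h1 : LipschitzWith (Real.toNNReal (1 / t)) (fun s : ℝ => 2 - s / t) := by
    refine LipschitzWith.of_dist_le_mul fun a b => le_of_eq ?_
    simp only [Real.dist_eq]
    rw [show 2 - a / t - (2 - b / t) = -((1 / t) * (a - b)) by ring, abs_neg, abs_mul,
      abs_of_pos (show (0 : ℝ) < 1 / t by positivity), Real.coe_toNNReal _ (by positivity)]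
  exact (h1.const_min 1).const_max 0

section
variable {Ω : Set (Vec n)}

/-- Extension of smooth boundary data to a thin collar around the boundary. -/
lemma exists_collar_extension (hΩ : IsLipDomain Ω) : ∃ A : ℝ, ∀ h : Vec n → ℝ,
    HasCompactSupport h → ContDiff ℝ ∞ h → ∀ ε : ℝ, 0 < ε →
    ∃ (u : Vec n → ℝ) (w : Fin n → Vec n → ℝ), Continuous u ∧
      (∀ j, Measurable (w j) ∧ WD univ j u (w j)) ∧ (∀ x ∈ frontier Ω, u x = h x) ∧
      (∀ y, 3 * ε ≤ Metric.infDist y (frontier Ω) → u y = 0) ∧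
      ∫⁻ y, ‖u y‖ₑ ≤ ENNReal.ofReal ε ∧
      (∀ j, ∫⁻ y, ‖w j y‖ₑ ≤ ENNReal.ofReal A * (∫⁻ x, ‖h x‖ₑ ∂(surfaceMeasure Ω)) +
        ENNReal.ofReal ε) ∧
      ∀ x ∈ frontier Ω, ∀ r ∈ Ioc (0 : ℝ) 1,
        ⨍⁻ y in Metric.ball x r ∩ Ω, ‖u y‖ₑ ∂volume ≤ ‖h x‖ₑ + ENNReal.ofReal ε := by
  have hn := hΩ.one_le
  have := hΩ.isFiniteMeasure
  obtain ⟨c, C, hσ, hvol⟩ := hΩ.surfRegular one_pos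
  obtain ⟨Av, hAv, hstrip⟩ := strip_volume_le hn hΩ.nonempty hΩ.isOpen hΩ.bdd hΩ.lip one_pos
  have hc := hσ.cpos
  have hne := hΩ.frontier_nonempty
  set Γ := frontier Ω with hΓ
  set σ := surfaceMeasure Ω with hσdef
  set b := (volume (Metric.ball (0 : Vec n) 1)).toReal with hb
  have hb0 : 0 ≤ b := ENNReal.toReal_nonneg
  have hbt : volume (Metric.ball (0 : Vec n) 1) = ENNReal.ofReal b :=
    (ENNReal.ofReal_toReal measure_ball_lt_top.ne).symm
  set sm := (σ univ).toReal with hsm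
  have hsm0 : 0 ≤ sm := ENNReal.toReal_nonneg
  have hst : σ univ = ENNReal.ofReal sm := (ENNReal.ofReal_toReal (measure_ne_top _ _)).symm
  -- The cutoff has derivative of size `1 / t` on a strip over which the integral of `|h|` is at
  -- most `A₀ t ∫ |h|` up to a small error. It matters that `A₀` depends on `Ω` only; everything
  -- depending on `h` is absorbed by making the collar thin.
  set A₀ : ℝ := 6 ^ n * b / (c * 3 ^ (n - 1)) with hA₀
  have hA₀0 : 0 ≤ A₀ := by positivity
  refine ⟨A₀, fun h hhc hhs ε hε => ?_⟩
  have htest : IsTest univ h := ⟨hhs, hhc, subset_univ _⟩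
  obtain ⟨L, hL⟩ := htest.lipschitz
  obtain ⟨M, hM⟩ := hhc.exists_bound_of_continuous hhs.continuous
  have hM0 : 0 ≤ M := (norm_nonneg _).trans (hM 0)
  have hL0 : (0 : ℝ) ≤ L := L.2
  -- For radii up to `ρ` the Lipschitz bound keeps `|h|` below `|h x| + ε`. For larger radii the
  -- `L¹` smallness of `u` is divided by a volume of at least `c ρ^n`.
  set ρ : ℝ := ε / (L + 1) with hρ
  have hρ0 : 0 < ρ := by positivity
  -- Each error is a constant times the width `t`. `E` dominates all these constants, so the single
  -- condition `E t ≤ ε` settles them.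
  set E : ℝ := 1 + A₀ * (6 * L * sm) + 3 * L * Av + 3 * M * Av + 3 * M * Av / (c * ρ ^ n) with hE
  have hE0 : 0 < E := by positivity
  obtain ⟨t, ht0, ht1, htε, htE⟩ : ∃ t : ℝ, 0 < t ∧ 3 * t ≤ 1 ∧ t ≤ ε ∧ E * t ≤ ε := by
    refine ⟨min (1 / 3) (min ε (ε / E)), by positivity, ?_, ?_, ?_⟩
    · linarith [min_le_left (1 / 3 : ℝ) (min ε (ε / E))]
    · exact (min_le_right _ _).trans (min_le_left _ _)
    · rw [mul_comm, ← le_div_iff₀ hE0]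
      exact (min_le_right _ _).trans (min_le_right _ _)
  have hle : ∀ {a : ℝ}, a ≤ E → a * t ≤ ε := fun ha =>
    (mul_le_mul_of_nonneg_right ha ht0.le).trans htE
  set d : Vec n → ℝ := fun y => Metric.infDist y Γ with hd
  have hdl : LipschitzWith 1 d := Metric.lipschitz_infDist_pt _
  set θ : Vec n → ℝ := fun y => collar t (d y) with hθ
  have hθl : LipschitzWith (Real.toNNReal (1 / t)) θ := by
    have := (lipschitz_collar ht0).comp hdl
    rw [mul_one] at this
    exact this
  set T := {y | Metric.infDist y Γ < 3 * t} with hT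
  have hTm : MeasurableSet T :=
    measurableSet_lt (Metric.continuous_infDist_pt _).measurable measurable_const
  have hTv : volume T ≤ ENNReal.ofReal (Av * (3 * t)) := hstrip (3 * t) ⟨by linarith, ht1⟩
  set e : Fin n → Vec n := fun j => EuclideanSpace.single j 1 with he
  set u : Vec n → ℝ := fun y => h y * θ y with hu
  set w : Fin n → Vec n → ℝ := fun j y => h y * lineDeriv ℝ θ y (e j) + pderiv j h y * θ y with hw
  have hθ1 : ∀ y, ‖θ y‖ₑ ≤ 1 := fun y => by
    rw [Real.enorm_of_nonneg (collar_mem _ _).1]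
    exact ENNReal.ofReal_le_one.2 (collar_mem _ _).2
  have huh : ∀ y, ‖u y‖ₑ ≤ ‖h y‖ₑ := fun y => by
    rw [hu, enorm_mul]
    exact mul_le_of_le_one_right' (hθ1 y)
  have huT : ∀ y ∉ T, u y = 0 := fun y hy => by
    have : 3 * t ≤ d y := not_lt.1 hy
    simp only [hu, hθ]
    rw [collar_eq_zero ht0 (by linarith), mul_zero]
  have hwT : ∀ j, ∀ y ∉ T, w j y = 0 := fun j y hy => by
    have h1 : 3 * t ≤ d y := not_lt.1 hy
    have h2 : θ =ᶠ[𝓝 y] fun _ => 0 := by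
      have ho : IsOpen {z | 2 * t < d z} := isOpen_lt continuous_const hdl.continuous
      filter_upwards [ho.mem_nhds (show 2 * t < d y by linarith)] with z hz
      exact collar_eq_zero ht0 (le_of_lt hz)
    simp only [hw]
    rw [h2.lineDeriv_eq, h2.self_of_nhds]
    simp [lineDeriv]
  have hhM : ∀ y, ‖h y‖ₑ ≤ ENNReal.ofReal M := fun y => by
    rw [← ofReal_norm]; exact ENNReal.ofReal_le_ofReal (hM y)
  have hhL : ∀ x y, ‖h y‖ₑ ≤ ‖h x‖ₑ + ENNReal.ofReal (L * dist y x) := fun x y => by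
    have h1 := hL.dist_le_mul y x
    calc ‖h y‖ₑ = ‖h x + (h y - h x)‖ₑ := by congr 1; ring
      _ ≤ ‖h x‖ₑ + ‖h y - h x‖ₑ := enorm_add_le _ _
      _ ≤ _ := by
        gcongr
        rw [← ofReal_norm, ← dist_eq_norm]
        exact ENNReal.ofReal_le_ofReal h1
  have huI : ∫⁻ y, ‖u y‖ₑ ≤ ENNReal.ofReal (3 * M * Av * t) := by
    calc ∫⁻ y, ‖u y‖ₑ ≤ ∫⁻ y, T.indicator (fun _ => ENNReal.ofReal M) y := by
          refine lintegral_mono fun y => ?_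
          by_cases hy : y ∈ T
          · rw [indicator_of_mem hy]; exact (huh y).trans (hhM y)
          · simp [huT y hy]
      _ = ENNReal.ofReal M * volume T := by rw [lintegral_indicator hTm, setLIntegral_const]
      _ ≤ ENNReal.ofReal M * ENNReal.ofReal (Av * (3 * t)) := by gcongr
      _ = _ := by rw [← ENNReal.ofReal_mul hM0]; congr 1; ring
  have hstripI : (ENNReal.ofReal t)⁻¹ * ∫⁻ y in T, ‖h y‖ₑ ≤
      ENNReal.ofReal A₀ * (∫⁻ x, ‖h x‖ₑ ∂σ) + ENNReal.ofReal (A₀ * (6 * L * sm) * t) := by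
    have h1 := strip_lintegral_le hne (t := 3 * t) (fun x hx => hσ.lower x hx (3 * t) ⟨by linarith, ht1⟩)
      hhs.continuous.measurable.enorm MeasurableSet.univ
    simp only [inter_univ] at h1
    have h2 : ∀ x, ∫⁻ y in Metric.ball x (2 * (3 * t)), ‖h y‖ₑ ≤
        (‖h x‖ₑ + ENNReal.ofReal (6 * L * t)) * ENNReal.ofReal ((6 * t) ^ n * b) := by
      intro x
      rw [ENNReal.ofReal_mul (p := (6 * t) ^ n) (by positivity), ← hbt, ← vol_ball x (by positivity : 0 < 6 * t),
        ← setLIntegral_const, show 2 * (3 * t) = 6 * t by ring]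
      refine setLIntegral_mono' measurableSet_ball fun y hy => ?_
      refine (hhL x y).trans (add_le_add le_rfl (ENNReal.ofReal_le_ofReal ?_))
      rw [Metric.mem_ball] at hy
      nlinarith
    have h3 : ENNReal.ofReal (c * (3 * t) ^ (n - 1)) * ∫⁻ y in T, ‖h y‖ₑ ≤
        ((∫⁻ x, ‖h x‖ₑ ∂σ) + ENNReal.ofReal (6 * L * t) * ENNReal.ofReal sm) *
          ENNReal.ofReal ((6 * t) ^ n * b) := by
      refine h1.trans ((lintegral_mono h2).trans (le_of_eq ?_))
      rw [lintegral_mul_const' _ _ ENNReal.ofReal_ne_top, lintegral_add_right _ measurable_const,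
        lintegral_const, hst]
    have hct : 0 < c * (3 * t) ^ (n - 1) := by positivity
    have h4 : ∫⁻ y in T, ‖h y‖ₑ ≤
        ((∫⁻ x, ‖h x‖ₑ ∂σ) + ENNReal.ofReal (6 * L * t) * ENNReal.ofReal sm) *
          ENNReal.ofReal ((6 * t) ^ n * b) / ENNReal.ofReal (c * (3 * t) ^ (n - 1)) := by
      rw [ENNReal.le_div_iff_mul_le (Or.inl (by simpa using hct)) (Or.inl ENNReal.ofReal_ne_top),
        mul_comm]
      exact h3
    have hpow : t ^ n = t ^ (n - 1) * t := by rw [← pow_succ]; congr 1; omega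
    calc (ENNReal.ofReal t)⁻¹ * ∫⁻ y in T, ‖h y‖ₑ ≤ (ENNReal.ofReal t)⁻¹ *
          (((∫⁻ x, ‖h x‖ₑ ∂σ) + ENNReal.ofReal (6 * L * t) * ENNReal.ofReal sm) *
          ENNReal.ofReal ((6 * t) ^ n * b) / ENNReal.ofReal (c * (3 * t) ^ (n - 1))) := by gcongr
      _ = (ENNReal.ofReal (t⁻¹ * ((6 * t) ^ n * b) / (c * (3 * t) ^ (n - 1)))) *
          ((∫⁻ x, ‖h x‖ₑ ∂σ) + ENNReal.ofReal (6 * L * t) * ENNReal.ofReal sm) := by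
          rw [ENNReal.ofReal_div_of_pos hct, ENNReal.ofReal_mul (p := t⁻¹) (by positivity),
            ENNReal.ofReal_inv_of_pos ht0, div_eq_mul_inv, div_eq_mul_inv]
          ring
      _ = ENNReal.ofReal A₀ *
          ((∫⁻ x, ‖h x‖ₑ ∂σ) + ENNReal.ofReal (6 * L * t) * ENNReal.ofReal sm) := by
          congr 2
          rw [hA₀, mul_pow, mul_pow, hpow]
          field_simp
      _ = _ := by
          rw [mul_add, ← ENNReal.ofReal_mul (by positivity), ← ENNReal.ofReal_mul (by positivity)]
          congr 2; ring
  refine ⟨u, w, hhs.continuous.mul hθl.continuous, fun j => ⟨?_, ?_⟩, fun x hx => ?_, fun y hy => ?_,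
    huI.trans (ENNReal.ofReal_le_ofReal (hle ?_)), fun j => ?_, fun x hx r hr => ?_⟩
  · exact (hhs.continuous.measurable.mul (measurable_lineDeriv hθl.continuous)).add
      ((htest.pderiv j).continuous.measurable.mul hθl.continuous.measurable)
  · exact (WD.of_lipschitz hθl j).smooth_mul hhs
  · simp only [hu, hθ, hd]
    rw [Metric.infDist_zero_of_mem hx, collar_zero, mul_one]
  · refine huT y fun h' => ?_
    have : d y < 3 * t := h'
    have h'' : 3 * ε ≤ d y := hy
    linarith
  · have h1 : 0 ≤ A₀ * (6 * L * sm) := by positivity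
    have h2 : 0 ≤ 3 * L * Av := by positivity
    have h3 : 0 ≤ 3 * M * Av / (c * ρ ^ n) := by positivity
    linarith
  · calc ∫⁻ y, ‖w j y‖ₑ ≤ ∫⁻ y, T.indicator (fun y => (ENNReal.ofReal t)⁻¹ * ‖h y‖ₑ +
          ENNReal.ofReal L) y := by
          refine lintegral_mono fun y => ?_
          by_cases hy : y ∈ T
          · rw [indicator_of_mem hy]
            refine (enorm_add_le _ _).trans (add_le_add ?_ ?_)
            · rw [enorm_mul, mul_comm]
              gcongr
              rw [← ENNReal.ofReal_inv_of_pos ht0, ← ofReal_norm]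
              refine ENNReal.ofReal_le_ofReal ((norm_lineDeriv_le_of_lipschitz ℝ hθl).trans ?_)
              simp [he, ht0.le]
            · rw [enorm_mul]
              refine (mul_le_of_le_one_right' (hθ1 y)).trans ?_
              rw [← ofReal_norm]
              exact ENNReal.ofReal_le_ofReal (abs_pderiv_le hL j y)
          · simp [hwT j y hy]
      _ = (ENNReal.ofReal t)⁻¹ * (∫⁻ y in T, ‖h y‖ₑ) + ENNReal.ofReal L * volume T := by
          rw [lintegral_indicator hTm, lintegral_add_right _ measurable_const, setLIntegral_const,
            lintegral_const_mul' _ _ (by simpa using ht0)]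
      _ ≤ (ENNReal.ofReal A₀ * (∫⁻ x, ‖h x‖ₑ ∂σ) + ENNReal.ofReal (A₀ * (6 * L * sm) * t)) +
          ENNReal.ofReal L * ENNReal.ofReal (Av * (3 * t)) := by gcongr
      _ = ENNReal.ofReal A₀ * (∫⁻ x, ‖h x‖ₑ ∂σ) +
          ENNReal.ofReal ((A₀ * (6 * L * sm) + 3 * L * Av) * t) := by
          rw [← ENNReal.ofReal_mul hL0, add_assoc, ← ENNReal.ofReal_add (by positivity) (by positivity)]
          congr 2; ring
      _ ≤ _ := by
          gcongr
          refine hle ?_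
          have h2 : 0 ≤ 3 * M * Av := by positivity
          have h3 : 0 ≤ 3 * M * Av / (c * ρ ^ n) := by positivity
          linarith
  · have hfin : volume (Metric.ball x r ∩ Ω) ≠ ⊤ :=
      ((measure_mono inter_subset_left).trans_lt measure_ball_lt_top).ne
    have hpos : volume (Metric.ball x r ∩ Ω) ≠ 0 := by
      have h1 := hvol x hx r hr
      have h2 : 0 < ENNReal.ofReal (c * r ^ n) := by
        have := hr.1
        rw [ENNReal.ofReal_pos]; positivity
      exact (h2.trans_le h1).ne'
    rcases le_or_gt r ρ with hrρ | hrρ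
    · rw [← setLAverage_const hpos hfin (‖h x‖ₑ + ENNReal.ofReal ε), setLAverage_eq, setLAverage_eq]
      gcongr 1
      refine setLIntegral_mono' (measurableSet_ball.inter hΩ.isOpen.measurableSet) fun y hy => ?_
      refine (huh y).trans ((hhL x y).trans ?_)
      gcongr
      have h1 : dist y x < r := hy.1
      calc (L : ℝ) * dist y x ≤ L * ρ := by gcongr; linarith
        _ ≤ (L + 1) * ρ := by nlinarith
        _ = ε := by rw [hρ]; field_simp
    · refine le_trans ?_ le_add_self
      rw [setLAverage_eq]
      have h1 : ENNReal.ofReal (c * ρ ^ n) ≤ volume (Metric.ball x r ∩ Ω) :=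
        (hvol x hx ρ ⟨hρ0, hrρ.le.trans hr.2⟩).trans (by gcongr)
      calc (∫⁻ y in Metric.ball x r ∩ Ω, ‖u y‖ₑ) / volume (Metric.ball x r ∩ Ω)
          ≤ ENNReal.ofReal (3 * M * Av * t) / ENNReal.ofReal (c * ρ ^ n) := by
            gcongr
            exact (setLIntegral_le_lintegral _ _).trans huI
        _ = ENNReal.ofReal (3 * M * Av / (c * ρ ^ n) * t) := by
            rw [← ENNReal.ofReal_div_of_pos (by positivity)]
            congr 1; ring
        _ ≤ _ := by
            refine ENNReal.ofReal_le_ofReal (hle ?_)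
            have h1 : 0 ≤ A₀ * (6 * L * sm) := by positivity
            have h2 : 0 ≤ 3 * L * Av := by positivity
            have h3 : 0 ≤ 3 * M * Av := by positivity
            linarith

/-- Summable `L¹` norms permit exchanging sum and integral on both sides of the integration by parts
formula. -/
lemma WD.tsum {O : Set (Vec n)} {j : Fin n} {u w : ℕ → Vec n → ℝ} (h : ∀ k, WD O j (u k) (w k))
    (hum : ∀ k, Measurable (u k)) (hwm : ∀ k, Measurable (w k))
    (hu : ∑' k, ∫⁻ x, ‖u k x‖ₑ ≠ ⊤) (hw : ∑' k, ∫⁻ x, ‖w k x‖ₑ ≠ ⊤) :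
    Integrable (fun x => ∑' k, u k x) ∧ Integrable (fun x => ∑' k, w k x) ∧
      WD O j (fun x => ∑' k, u k x) (fun x => ∑' k, w k x) := by
  have hsum : ∀ {f : ℕ → Vec n → ℝ}, (∀ k, Measurable (f k)) → ∑' k, ∫⁻ x, ‖f k x‖ₑ ≠ ⊤ →
      (∀ᵐ x, Summable fun k => f k x) ∧ Integrable (fun x => ∑' k, f k x) := by
    intro f hf hs
    have h1 : ∀ᵐ x, Summable fun k => ‖f k x‖ := by
      refine summable_norm_of_tsum_eLpNorm_ne_top le_rfl (fun k => (hf k).aestronglyMeasurable) ?_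
      simpa only [eLpNorm_one_eq_lintegral_enorm] using hs
    have h2 : ∀ᵐ x, Summable fun k => f k x := h1.mono fun x hx => hx.of_norm
    refine ⟨h2, ?_, ?_⟩
    · refine aestronglyMeasurable_of_tendsto_ae atTop (f := fun K x => ∑ k ∈ Finset.range K, f k x)
        (fun K => (Finset.measurable_fun_sum _ fun k _ => hf k).aestronglyMeasurable) ?_
      exact h2.mono fun x hx => hx.hasSum.tendsto_sum_nat
    · calc ∫⁻ x, ‖∑' k, f k x‖ₑ ≤ ∫⁻ x, ∑' k, ‖f k x‖ₑ :=
            lintegral_mono fun x => enorm_tsum_le_tsum_enorm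
        _ = ∑' k, ∫⁻ x, ‖f k x‖ₑ := lintegral_tsum fun k => (hf k).enorm.aemeasurable
        _ < ⊤ := hs.lt_top
  have hint : ∀ {f : ℕ → Vec n → ℝ} {ψ : Vec n → ℝ}, (∀ k, Measurable (f k)) →
      ∑' k, ∫⁻ x, ‖f k x‖ₑ ≠ ⊤ → IsTest O ψ →
      ∫ x, (∑' k, f k x) * ψ x = ∑' k, ∫ x, f k x * ψ x := by
    intro f ψ hf hs hψ
    obtain ⟨C, hC⟩ := hψ.2.1.exists_bound_of_continuous hψ.continuous
    simp only [← tsum_mul_right]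
    refine integral_tsum (fun k => ((hf k).mul hψ.continuous.measurable).aestronglyMeasurable) ?_
    refine (lt_of_le_of_lt (b := (∑' k, ∫⁻ x, ‖f k x‖ₑ) * ENNReal.ofReal C) ?_
      (ENNReal.mul_lt_top hs.lt_top ENNReal.ofReal_lt_top)).ne
    rw [← ENNReal.tsum_mul_right]
    refine ENNReal.tsum_le_tsum fun k => ?_
    rw [← lintegral_mul_const _ (hf k).enorm]
    refine lintegral_mono fun x => ?_
    rw [enorm_mul]
    gcongr
    rw [← ofReal_norm]
    exact ENNReal.ofReal_le_ofReal (hC x)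
  refine ⟨(hsum hum hu).2, (hsum hwm hw).2, (hsum hum hu).2.locallyIntegrable.locallyIntegrableOn _,
    (hsum hwm hw).2.locallyIntegrable.locallyIntegrableOn _, fun φ hφ => ?_⟩
  rw [hint hum hu (hφ.pderiv j), hint hwm hw hφ, ← tsum_neg]
  exact tsum_congr fun k => (h k).parts φ hφ

/-- Integrable functions on the boundary are traces of `W^{1,1}` functions. -/
lemma exists_extension_scalar_one (hΩ : IsLipDomain Ω) {h : Vec n → ℝ}
    (hh : Integrable h (surfaceMeasure Ω)) :
    ∃ (u : Vec n → ℝ) (w : Fin n → Vec n → ℝ), Integrable u ∧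
      (∀ j, Integrable (w j) ∧ WD univ j u (w j)) ∧
      ∀ᵐ x ∂(surfaceMeasure Ω), Tendsto (fun r : ℝ => ⨍⁻ y in Metric.ball x r ∩ Ω,
        ‖u y - h x‖ₑ ∂volume) (𝓝[>] 0) (𝓝 0) := by
  have := hΩ.isFiniteMeasure
  obtain ⟨A, hA⟩ := exists_collar_extension hΩ
  set ε : ℕ → ℝ := fun k => (1 / 2) ^ k with hε
  have hε0 : ∀ k, 0 < ε k := fun k => by positivity
  have hεs : ∑' k, ENNReal.ofReal (ε k) ≠ ⊤ := by
    rw [← ENNReal.ofReal_tsum_of_nonneg (fun k => (hε0 k).le) summable_geometric_two]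
    exact ENNReal.ofReal_ne_top
  -- Smooth functions approximate `h` in `L¹` of the boundary with errors `2^(-k)`. With zero placed
  -- in front, the differences `H k` telescope to `h` and have summable norms, so the collar
  -- extensions of the `H k` have summable gradients.
  choose G₀ hG₀c hG₀s hG₀ using fun k =>
    (memLp_one_iff_integrable.2 hh).exist_eLpNorm_sub_le (by simp) le_rfl (hε0 k)
  set G : ℕ → Vec n → ℝ := fun k => Nat.casesOn k (fun _ => 0) G₀ with hG
  have hGc : ∀ k, HasCompactSupport (G k) := by
    rintro (_ | k)
    · exact HasCompactSupport.zero
    · exact hG₀c k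
  have hGs : ∀ k, ContDiff ℝ ∞ (G k) := by
    rintro (_ | k)
    · exact contDiff_const
    · exact hG₀s k
  have hGh : ∑' k, ∫⁻ x, ‖h x - G k x‖ₑ ∂(surfaceMeasure Ω) ≠ ⊤ := by
    rw [tsum_eq_zero_add' ENNReal.summable]
    refine ENNReal.add_ne_top.2 ⟨by simpa [hG] using hh.2.ne, ?_⟩
    refine (lt_of_le_of_lt (ENNReal.tsum_le_tsum fun k => ?_) hεs.lt_top).ne
    have := hG₀ k
    rw [eLpNorm_one_eq_lintegral_enorm] at this
    exact this
  set H : ℕ → Vec n → ℝ := fun k x => G (k + 1) x - G k x with hH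
  have hHI : ∑' k, ∫⁻ x, ‖H k x‖ₑ ∂(surfaceMeasure Ω) ≠ ⊤ := by
    have hm : ∀ k, AEMeasurable (fun x => ‖h x - G k x‖ₑ) (surfaceMeasure Ω) := fun k =>
      (hh.aestronglyMeasurable.sub (hGs k).continuous.aestronglyMeasurable).enorm
    refine (lt_of_le_of_lt (b := ∑' k, ((∫⁻ x, ‖h x - G k x‖ₑ ∂(surfaceMeasure Ω)) +
      ∫⁻ x, ‖h x - G (k + 1) x‖ₑ ∂(surfaceMeasure Ω))) (ENNReal.tsum_le_tsum fun k => ?_) ?_).ne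
    · rw [← lintegral_add_left' (hm k)]
      refine lintegral_mono fun x => ?_
      have : H k x = (h x - G k x) - (h x - G (k + 1) x) := by simp only [hH]; ring
      rw [this]
      exact enorm_sub_le
    · rw [ENNReal.tsum_add]
      refine ENNReal.add_lt_top.2 ⟨hGh.lt_top, lt_of_le_of_lt ?_ hGh.lt_top⟩
      exact ENNReal.tsum_comp_le_tsum_of_injective (add_left_injective 1)
        fun k => ∫⁻ x, ‖h x - G k x‖ₑ ∂(surfaceMeasure Ω)
  choose u w huc hw hu1 hu2 hu3 hw1 hu4 using fun k => hA (H k)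
    (by have := (hGc (k + 1)).add (hGc k).neg
        rw [← sub_eq_add_neg] at this
        exact this) ((hGs (k + 1)).sub (hGs k)) (ε k) (hε0 k)
  have hus : ∑' k, ∫⁻ y, ‖u k y‖ₑ ≠ ⊤ :=
    (lt_of_le_of_lt (ENNReal.tsum_le_tsum hu3) hεs.lt_top).ne
  have hws : ∀ j, ∑' k, ∫⁻ y, ‖w k j y‖ₑ ≠ ⊤ := by
    intro j
    refine (lt_of_le_of_lt (ENNReal.tsum_le_tsum fun k => hw1 k j) ?_).ne
    rw [ENNReal.tsum_add, ENNReal.tsum_mul_left]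
    exact ENNReal.add_lt_top.2 ⟨ENNReal.mul_lt_top ENNReal.ofReal_lt_top hHI.lt_top, hεs.lt_top⟩
  have main := fun j => WD.tsum (fun k => (hw k j).2) (fun k => (huc k).measurable)
    (fun k => (hw k j).1) hus (hws j)
  refine ⟨fun y => ∑' k, u k y, fun j y => ∑' k, w k j y, (main ⟨0, hΩ.one_le⟩).1,
    fun j => (main j).2, ?_⟩
  have hfr : ∀ᵐ x ∂(surfaceMeasure Ω), x ∈ frontier Ω :=
    ae_restrict_mem isClosed_frontier.measurableSet
  have a1 : ∀ᵐ x ∂(surfaceMeasure Ω), Summable fun k => ‖h x - G k x‖ := by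
    refine summable_norm_of_tsum_eLpNorm_ne_top le_rfl (fun k =>
      hh.aestronglyMeasurable.sub (hGs k).continuous.aestronglyMeasurable) ?_
    simpa only [eLpNorm_one_eq_lintegral_enorm] using hGh
  have a2 : ∀ᵐ x ∂(surfaceMeasure Ω), Summable fun k => ‖H k x‖ := by
    refine summable_norm_of_tsum_eLpNorm_ne_top le_rfl (fun k =>
      ((hGs (k + 1)).sub (hGs k)).continuous.aestronglyMeasurable) ?_
    simpa only [eLpNorm_one_eq_lintegral_enorm] using hHI
  filter_upwards [hfr, a1, a2] with x hx hx1 hx2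
  have hHs : HasSum (fun k => H k x) (h x) := by
    rw [hx2.of_norm.hasSum_iff_tendsto_nat]
    have e : ∀ K, ∑ k ∈ Finset.range K, H k x = G K x := fun K => by
      rw [Finset.sum_range_sub (fun k => G k x)]
      simp [hG]
    simp only [e]
    have h0 := (hx1.of_norm.tendsto_atTop_zero).const_sub (h x)
    simpa using h0
  have hHne : ∑' k, ‖H k x‖ₑ ≠ ⊤ := tsum_enorm_ne_top_iff_summable_norm.2 hx2
  -- Each mean vanishes because `u k` is continuous with boundary value `H k x`. The sum follows by
  -- dominated convergence for the counting measure; the summable majorant comes from the uniform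
  -- bound on means in the collar extension.
  have hlim : Tendsto (fun r : ℝ => ∑' k, ⨍⁻ y in Metric.ball x r ∩ Ω, ‖u k y - H k x‖ₑ ∂volume)
      (𝓝[>] 0) (𝓝 0) := by
    simp only [← lintegral_count]
    have h0 : (0 : ℝ≥0∞) = ∫⁻ k : ℕ, 0 ∂Measure.count := by simp
    rw [h0]
    refine tendsto_lintegral_filter_of_dominated_convergence
      (fun k => ‖H k x‖ₑ + ENNReal.ofReal (ε k) + ‖H k x‖ₑ)
      (Eventually.of_forall fun r => measurable_of_countable _) ?_ ?_ ?_
    · filter_upwards [Ioc_mem_nhdsGT one_pos] with r hr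
      refine Eventually.of_forall fun k => ?_
      refine (setLAverage_mono_fun fun y => enorm_sub_le).trans ?_
      rw [setLAverage_add_le (huc k).measurable.enorm.aemeasurable]
      refine add_le_add (hu4 k x hx r hr) ?_
      rw [setLAverage_eq, setLIntegral_const]
      exact ENNReal.div_le_of_le_mul le_rfl
    · rw [lintegral_count, ENNReal.tsum_add, ENNReal.tsum_add]
      exact ENNReal.add_ne_top.2 ⟨ENNReal.add_ne_top.2 ⟨hHne, hεs⟩, hHne⟩
    · refine Eventually.of_forall fun k => ?_
      rw [ENNReal.tendsto_nhds_zero]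
      intro η hη
      have hc : Tendsto (fun y => ‖u k y - H k x‖ₑ) (𝓝 x) (𝓝 0) := by
        have := (Continuous.sub (huc k) (continuous_const : Continuous fun _ => H k x)).enorm.tendsto x
        simpa [hu1 k x hx] using this
      obtain ⟨r₀, hr₀, hb⟩ := Metric.eventually_nhds_iff_ball.1 (ENNReal.tendsto_nhds_zero.1 hc η hη)
      filter_upwards [Ioc_mem_nhdsGT hr₀] with r hr
      rw [setLAverage_eq]
      refine ENNReal.div_le_of_le_mul ?_
      rw [← setLIntegral_const]
      refine setLIntegral_mono' (measurableSet_ball.inter hΩ.isOpen.measurableSet) fun y hy => ?_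
      exact hb y (Metric.ball_subset_ball hr.2 hy.1)
  refine tendsto_of_tendsto_of_tendsto_of_le_of_le tendsto_const_nhds hlim (fun _ => zero_le)
    fun r => ?_
  simp only [setLAverage_eq, div_eq_mul_inv]
  rw [ENNReal.tsum_mul_right, ← lintegral_tsum (f := fun k y => ‖u k y - H k x‖ₑ) fun k =>
    ((huc k).sub continuous_const).measurable.enorm.aemeasurable]
  gcongr 1
  refine setLIntegral_mono' (measurableSet_ball.inter hΩ.isOpen.measurableSet) fun y hy => ?_
  have hd : 0 < Metric.infDist y (frontier Ω) := hΩ.infDist_pos fun hy' => by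
    rw [hΩ.isOpen.frontier_eq] at hy'
    exact hy'.2 hy.2
  -- At a point off the boundary only finitely many terms are non-zero, the collars being eventually
  -- thinner than the distance to the boundary.
  have hys : Summable fun k => u k y := by
    have hε' : Tendsto (fun k => 3 * ε k) atTop (𝓝 (3 * 0)) :=
      (tendsto_pow_atTop_nhds_zero_of_lt_one (by norm_num) (by norm_num)).const_mul 3
    rw [mul_zero] at hε'
    obtain ⟨k₀, hk₀⟩ := eventually_atTop.1 (hε'.eventually_lt_const hd)
    refine summable_of_ne_finset_zero (s := Finset.range k₀) fun k hk => hu2 k y (hk₀ k ?_).le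
    simpa using hk
  have : (∑' k, u k y) - h x = ∑' k, (u k y - H k x) := by
    rw [hys.tsum_sub hx2.of_norm, hHs.tsum_eq]
  rw [this]
  exact enorm_tsum_le_tsum_enorm

lemma exists_extension_one (hΩ : IsLipDomain Ω) {g : Vec n → Vec N} (hg : MemTraceSpace 1 Ω g) :
    ∃ u : Vec n → Vec N, MemW1 1 univ u ∧ HasTrace Ω u g := by
  have hgI : ∀ i, Integrable (fun x => g x i) (surfaceMeasure Ω) := by
    have := hg.1
    rw [ENNReal.ofReal_one, memLp_one_iff_integrable] at this
    exact integrable_piLp_iff.1 this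
  choose u w hu hw ht using fun i => exists_extension_scalar_one hΩ (hgI i)
  refine ⟨fun y => WithLp.toLp 2 fun i => u i y, ⟨?_, fun y => WithLp.toLp 2 fun ij => w ij.1 ij.2 y,
    HasWeakGrad.of_WD ?_ fun i j => (hw i j).2, ?_⟩, ?_⟩
  · rw [ENNReal.ofReal_one, memLp_one_iff_integrable, Measure.restrict_univ]
    exact integrable_piLp_iff.2 hu
  · exact locallyIntegrableOn_coord.2 fun i => (hu i).locallyIntegrable.locallyIntegrableOn _
  · rw [ENNReal.ofReal_one, memLp_one_iff_integrable, Measure.restrict_univ]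
    exact integrable_piLp_iff.2 fun ij => (hw ij.1 ij.2).1
  · exact hasTrace_of_coord (fun i => (hu i).aestronglyMeasurable.restrict) ht

/-- The averaged extension serves `q > 1` and the series of collar extensions serves `q = 1`. The
outer domain is chosen to be a centred ball, on which quasiconvexity can later be tested. -/
lemma exists_solidDatum (hΩ : IsLipDomain Ω) {q : ℝ} (hq : 1 ≤ q) {v : Vec n → Vec N}
    (hv : TraceMem q Ω v) :
    ∃ R₀ u₀, 0 < R₀ ∧ IsSolidDatum q Ω v (Metric.ball 0 R₀) u₀ := by
  obtain ⟨g, hvg, hg⟩ := hv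
  obtain ⟨R₀, hR₀, hR⟩ := hΩ.bdd.closure.subset_ball_lt 0 0
  have : ∃ u₀ : Vec n → Vec N, MemW1 q (Metric.ball 0 R₀) u₀ ∧ HasTrace Ω u₀ g := by
    rcases hq.eq_or_lt with rfl | hq
    · obtain ⟨u, hu, ht⟩ := exists_extension_one hΩ hg
      exact ⟨u, hu.mono (subset_univ _), ht⟩
    · exact exists_extension_of_one_lt hΩ hq hg R₀ (subset_closure.trans hR)
  obtain ⟨u₀, hu, ht⟩ := this
  exact ⟨R₀, u₀, hR₀, Metric.isOpen_ball, Metric.isBounded_ball, hR, hu, g, ht, hvg⟩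

end

/-! ### Functions of bounded variation -/

section BV
variable {O O' : Set (Vec n)} {u u' : Vec n → Vec N} {φ ψ : Vec n → Mat N n}

lemma rowDiv_apply (h : IsTest O φ) (x : Vec n) (i : Fin N) :
    rowDiv φ x i = ∑ j, pderiv j (fun y => φ y (i, j)) x := by
  show ∑ j, pderiv j φ x (i, j) = _
  exact Finset.sum_congr rfl fun j _ => pderiv_coord (h.differentiable x) j (i, j)

lemma IsTest.isTest_rowDiv (h : IsTest O φ) : IsTest O (rowDiv φ) :=
  isTest_of_coord fun i => IsTest.sum Finset.univ fun j _ => (h.pderiv j).isTest_coord (i, j)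

lemma rowDiv_add (h : IsTest O φ) (h' : IsTest O ψ) :
    rowDiv (fun x => φ x + ψ x) = fun x => rowDiv φ x + rowDiv ψ x := by
  ext x i
  simp [rowDiv, pderiv, fderiv_fun_add (h.differentiable x) (h'.differentiable x),
    Finset.sum_add_distrib]

lemma rowDiv_const_smul (h : IsTest O φ) (c : ℝ) :
    rowDiv (fun x => c • φ x) = fun x => c • rowDiv φ x := by
  ext x i
  simp [rowDiv, pderiv, fderiv_fun_const_smul (h.differentiable x), Finset.mul_sum]

lemma IsTest.exists_bound {V : Type*} [NormedAddCommGroup V] [NormedSpace ℝ V] {φ : Vec n → V}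
    (h : IsTest O φ) : ∃ C, ∀ x, ‖φ x‖ ≤ C :=
  h.continuous.bounded_above_of_compact_support h.2.1

lemma integrable_inner_test (hu : IntegrableOn u O) {f : Vec n → Vec N} (hf : IsTest O' f) :
    IntegrableOn (fun x => inner ℝ (u x) (f x)) O := by
  obtain ⟨C, hC⟩ := hf.exists_bound
  refine Integrable.mono' (hu.norm.mul_const C) (hu.1.inner hf.continuous.aestronglyMeasurable)
    (Eventually.of_forall fun x => (norm_inner_le_norm _ _).trans ?_)
  gcongr
  exact hC x

lemma integral_rowDiv_le (hV : totalVar O u ≠ ⊤) (h : IsTest O φ) {c : ℝ}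
    (hc : ∀ x, ‖φ x‖ ≤ c) : ∫ x in O, inner ℝ (u x) (rowDiv φ x) ≤ c * (totalVar O u).toReal := by
  have hc0 : 0 ≤ c := (norm_nonneg _).trans (hc 0)
  rcases hc0.eq_or_lt with rfl | hc0
  · have : φ = fun _ => 0 := funext fun x => norm_le_zero_iff.1 (hc x)
    have e : rowDiv φ = fun x => (0 : ℝ) • rowDiv φ x := by
      rw [← rowDiv_const_smul h, this]; simp
    rw [e]
    simp
  · have h1 : ENNReal.ofReal (∫ x in O, inner ℝ (u x) (rowDiv (fun x => c⁻¹ • φ x) x)) ≤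
        totalVar O u := by
      refine le_iSup₂_of_le (fun x => c⁻¹ • φ x) (h.const_smul _) (le_iSup_of_le (fun x => ?_) le_rfl)
      rw [norm_smul, norm_inv, Real.norm_of_nonneg hc0.le, inv_mul_le_iff₀ hc0, mul_one]
      exact hc x
    rw [ENNReal.ofReal_le_iff_le_toReal hV, rowDiv_const_smul h] at h1
    simp only [inner_smul_right, integral_const_mul] at h1
    rwa [inv_mul_le_iff₀ hc0] at h1

lemma abs_integral_rowDiv_le (hV : totalVar O u ≠ ⊤) (h : IsTest O φ) {c : ℝ}
    (hc : ∀ x, ‖φ x‖ ≤ c) : |∫ x in O, inner ℝ (u x) (rowDiv φ x)| ≤ c * (totalVar O u).toReal := by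
  refine abs_le.2 ⟨?_, integral_rowDiv_le hV h hc⟩
  have := integral_rowDiv_le hV (h.const_smul (-1)) (c := c) (by simpa using hc)
  rw [rowDiv_const_smul h] at this
  simp only [inner_smul_right, integral_const_mul] at this
  linarith

lemma totalVar_add_le (hu : IntegrableOn u O) (hu' : IntegrableOn u' O) :
    totalVar O (u + u') ≤ totalVar O u + totalVar O u' := by
  refine iSup₂_le fun φ hφ => iSup_le fun h1 => ?_
  simp only [Pi.add_apply, inner_add_left]
  rw [integral_add (integrable_inner_test hu hφ.isTest_rowDiv)
    (integrable_inner_test hu' hφ.isTest_rowDiv)]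
  exact ENNReal.ofReal_add_le.trans (add_le_add
    (le_iSup₂_of_le φ hφ (le_iSup_of_le h1 le_rfl)) (le_iSup₂_of_le φ hφ (le_iSup_of_le h1 le_rfl)))

lemma totalVar_neg (O : Set (Vec n)) (u : Vec n → Vec N) : totalVar O (-u) ≤ totalVar O u := by
  refine iSup₂_le fun φ hφ => iSup_le fun h1 => ?_
  refine le_iSup₂_of_le (fun x => (-1 : ℝ) • φ x) (hφ.const_smul _)
    (le_iSup_of_le (by simpa using h1) ?_)
  rw [rowDiv_const_smul hφ]
  simp

lemma totalVar_sub_le (hu : IntegrableOn u O) (hu' : IntegrableOn u' O) :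
    totalVar O (u - u') ≤ totalVar O u + totalVar O u' := by
  rw [sub_eq_add_neg]
  exact (totalVar_add_le hu hu'.neg).trans (add_le_add_right (totalVar_neg _ _) _)

lemma totalVar_congr (h : u =ᵐ[volume.restrict O] u') : totalVar O u = totalVar O u' := by
  have e : ∀ f : Vec n → Vec N, ∫ x in O, inner ℝ (u x) (f x) = ∫ x in O, inner ℝ (u' x) (f x) :=
    fun f => integral_congr_ae (h.mono fun x hx => by simp only [hx])
  simp only [totalVar, e]

lemma setIntegral_inner_test (hOO : O ⊆ O') (hO' : MeasurableSet O') {f : Vec n → Vec N}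
    (hf : IsTest O f) : ∫ x in O', inner ℝ (u x) (f x) = ∫ x in O, inner ℝ (u x) (f x) := by
  refine setIntegral_eq_of_subset_of_forall_sdiff_eq_zero hO' hOO fun x hx => ?_
  simp [hf.eq_zero hx.2]

lemma totalVar_mono (hOO : O ⊆ O') (hO' : MeasurableSet O') : totalVar O u ≤ totalVar O' u := by
  refine iSup₂_le fun φ hφ => iSup_le fun h1 => ?_
  refine le_iSup₂_of_le φ (hφ.mono hOO) (le_iSup_of_le h1 ?_)
  rw [setIntegral_inner_test hOO hO' hφ.isTest_rowDiv]

lemma MemBV.integrableOn (h : MemBV O u) : IntegrableOn u O := memLp_one_iff_integrable.1 h.1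

lemma MemBV.mono (h : MemBV O' u) (hOO : O ⊆ O') (hO' : MeasurableSet O') : MemBV O u :=
  ⟨h.1.mono_measure (Measure.restrict_mono_set _ hOO), (totalVar_mono hOO hO').trans_lt h.2⟩

/-- A function vanishing off a compact subset of `O` has the same total variation in a larger
set. -/
lemma totalVar_le_of_eq_zero (hO : IsOpen O) {K : Set (Vec n)} (hK : IsCompact K) (hKO : K ⊆ O)
    (hu : ∀ x ∉ K, u x = 0) : totalVar O' u ≤ totalVar O u := by
  -- Multiplying a test map by `χ` makes it admissible in `O`, keeps it bounded by one, and leaves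
  -- its divergence on `K` unchanged.
  obtain ⟨χ, hχ, hχ1, hχ2⟩ := exists_cutoff hK hO hKO
  refine iSup₂_le fun φ hφ => iSup_le fun h1 => ?_
  have ht : IsTest O fun x => χ x • φ x :=
    ⟨hχ.1.smul hφ.1, hχ.2.1.smul_right, (tsupport_smul_subset_left χ φ).trans hχ.2.2⟩
  refine le_iSup₂_of_le (fun x => χ x • φ x) ht (le_iSup_of_le (fun x => ?_) (le_of_eq ?_))
  · rw [norm_smul, Real.norm_of_nonneg (hχ2 x).1]
    exact mul_le_one₀ (hχ2 x).2 (norm_nonneg _) (h1 x)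
  · have h0 : ∀ f : Vec n → Vec N, ∀ S : Set (Vec n), IsTest S f → 
        ∫ x in S, inner ℝ (u x) (f x) = ∫ x in K, inner ℝ (u x) (f x) := by
      intro f S hf
      rw [setIntegral_eq_integral_of_forall_compl_eq_zero fun x hx => by simp [hf.eq_zero hx],
        setIntegral_eq_integral_of_forall_compl_eq_zero fun x hx => by simp [hu x hx]]
    rw [h0 _ _ hφ.isTest_rowDiv, h0 _ _ ht.isTest_rowDiv]
    congr 1
    refine setIntegral_congr_fun hK.measurableSet fun x hx => ?_
    have : (fun y => χ y • φ y) =ᶠ[𝓝 x] φ := by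
      filter_upwards [eventually_nhdsSet_iff_forall.1 hχ1 x hx] with y hy
      simp [hy]
    have e : rowDiv (fun y => χ y • φ y) x = rowDiv φ x := by
      ext i
      simp [rowDiv, pderiv, this.fderiv_eq]
    simp only [e]

/-- Integration by parts in each component turns the functional into `-∫ ⟨U, φ⟩`, which is estimated
pointwise. -/
lemma HasWeakGrad.totalVar_le {U : Vec n → Mat N n} (h : HasWeakGrad O u U)
    (hU : IntegrableOn U O) : totalVar O u ≤ ∫⁻ x in O, ‖U x‖ₑ := by
  refine iSup₂_le fun φ hφ => iSup_le fun h1 => ?_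
  have e : ∫ x in O, inner ℝ (u x) (rowDiv φ x) = - ∫ x in O, inner ℝ (U x) (φ x) := by
    have e1 : ∀ x, inner ℝ (u x) (rowDiv φ x) =
        ∑ i, ∑ j, u x i * pderiv j (fun y => φ y (i, j)) x := fun x => by
      rw [PiLp.inner_apply]
      refine Finset.sum_congr rfl fun i _ => ?_
      rw [rowDiv_apply hφ]
      simp [Finset.mul_sum, mul_comm]
    have e2 : ∀ x, inner ℝ (U x) (φ x) = ∑ i, ∑ j, U x (i, j) * φ x (i, j) := fun x => by
      rw [PiLp.inner_apply, Fintype.sum_prod_type]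
      simp [mul_comm]
    have hφij := fun i j => hφ.isTest_coord (i, j)
    simp only [e1, e2]
    rw [integral_finsetSum _ fun i _ => integrable_finsetSum _ fun j _ =>
      (((hφij i j).pderiv j).integrable_mul (h.wd i j).locL).restrict,
      integral_finsetSum _ fun i _ => integrable_finsetSum _ fun j _ =>
      ((hφij i j).integrable_mul (h.wd i j).locR).restrict, ← Finset.sum_neg_distrib]
    refine Finset.sum_congr rfl fun i _ => ?_
    rw [integral_finsetSum _ fun j _ =>
      (((hφij i j).pderiv j).integrable_mul (h.wd i j).locL).restrict,
      integral_finsetSum _ fun j _ =>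
      ((hφij i j).integrable_mul (h.wd i j).locR).restrict, ← Finset.sum_neg_distrib]
    exact Finset.sum_congr rfl fun j _ => h.2.2 _ (hφij i j) i j
  rw [e, ← integral_neg]
  refine (ENNReal.ofReal_le_ofReal ((Real.le_norm_self _).trans
    (norm_integral_le_integral_norm _))).trans ?_
  rw [← ofReal_integral_norm_eq_lintegral_enorm hU]
  refine ENNReal.ofReal_le_ofReal (integral_mono_of_nonneg (Eventually.of_forall fun x =>
    norm_nonneg _) hU.norm (Eventually.of_forall fun x => ?_))
  simp only [norm_neg]
  exact (norm_inner_le_norm _ _).trans (mul_le_of_le_one_right (norm_nonneg _) (h1 x))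

lemma MemW1.memBV (hO : IsOpen O) (h : MemW1 1 O u) : MemBV O u := by
  have h1 := h.memLp_weakGrad hO
  rw [ENNReal.ofReal_one, memLp_one_iff_integrable] at h1
  refine ⟨by simpa using h.1, (h.hasWeakGrad.totalVar_le h1).trans_lt h1.2⟩

lemma tendsto_integral_inner_test {w : ℕ → Vec n → Vec N} (hw : ∀ k, IntegrableOn (w k) O)
    (hu : IntegrableOn u O) (h : Tendsto (fun k => eLpNorm (w k - u) 1 (volume.restrict O)) atTop (𝓝 0))
    {f : Vec n → Vec N} (hf : IsTest O' f) :
    Tendsto (fun k => ∫ x in O, inner ℝ (w k x) (f x)) atTop (𝓝 (∫ x in O, inner ℝ (u x) (f x))) := by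
  obtain ⟨C, hC⟩ := hf.exists_bound
  refine tendsto_integral_of_L1 _ (integrable_inner_test hu hf).1
    (Eventually.of_forall fun k => integrable_inner_test (hw k) hf) ?_
  have h2 := ENNReal.Tendsto.const_mul (a := ENNReal.ofReal C) h (Or.inr ENNReal.ofReal_ne_top)
  rw [mul_zero] at h2
  refine tendsto_of_tendsto_of_tendsto_of_le_of_le tendsto_const_nhds h2 (fun _ => zero_le)
    fun k => ?_
  simp only [eLpNorm_one_eq_lintegral_enorm]
  rw [← lintegral_const_mul' _ _ ENNReal.ofReal_ne_top]
  refine lintegral_mono fun x => ?_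
  rw [← inner_sub_left, ← ofReal_norm, ← ofReal_norm, mul_comm,
    ← ENNReal.ofReal_mul (norm_nonneg _)]
  refine ENNReal.ofReal_le_ofReal ((norm_inner_le_norm _ _).trans ?_)
  rw [Pi.sub_apply]
  gcongr
  exact hC x

/-- The variation is a supremum of functionals continuous in `L¹`, hence lower semicontinuous. -/
lemma totalVar_le_of_tendsto {w : ℕ → Vec n → Vec N} (hw : ∀ k, IntegrableOn (w k) O)
    (hu : IntegrableOn u O) (h : Tendsto (fun k => eLpNorm (w k - u) 1 (volume.restrict O)) atTop (𝓝 0))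
    {M : ℝ≥0∞} (hM : ∀ k, totalVar O (w k) ≤ M) : totalVar O u ≤ M := by
  refine iSup₂_le fun φ hφ => iSup_le fun h1 => ?_
  refine le_of_tendsto ((ENNReal.continuous_ofReal.tendsto _).comp
    (tendsto_integral_inner_test hw hu h hφ.isTest_rowDiv)) (Eventually.of_forall fun k => ?_)
  refine le_trans ?_ (hM k)
  exact le_iSup₂_of_le φ hφ (le_iSup_of_le h1 (le_refl (ENNReal.ofReal _)))

end BV

/-! ### Gradient measures and weak* convergence -/

section GradMeasure
variable {O : Set (Vec n)} {u : Vec n → Vec N}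

open Classical in
/-- Extension by zero of a continuous map on `O`. -/
noncomputable def extendZero (ψ : C₀(O, Mat N n)) (x : Vec n) : Mat N n :=
  if h : x ∈ O then ψ ⟨x, h⟩ else 0

lemma extendZero_coe (ψ : C₀(O, Mat N n)) (x : O) : extendZero ψ x = ψ x := by
  simp [extendZero]

lemma extendZero_eq {φ : Vec n → Mat N n} (hφ : IsTest O φ) {ψ : C₀(O, Mat N n)}
    (h : ∀ x : O, ψ x = φ x) : extendZero ψ = φ := by
  ext1 x
  by_cases hx : x ∈ O
  · rw [← h ⟨x, hx⟩, ← extendZero_coe]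
  · simp [extendZero, hx, hφ.eq_zero hx]

lemma norm_extendZero_le (ψ : C₀(O, Mat N n)) (x : Vec n) : ‖extendZero ψ x‖ ≤ ‖ψ‖ := by
  by_cases hx : x ∈ O
  · simpa [extendZero, hx] using ψ.toBCF.norm_coe_le_norm ⟨x, hx⟩
  · simp [extendZero, hx]

/-- A test map as a continuous map vanishing at infinity. -/
noncomputable def IsTest.toZeroAtInfty {φ : Vec n → Mat N n} (hφ : IsTest O φ) : C₀(O, Mat N n) where
  toFun x := φ x
  continuous_toFun := hφ.continuous.comp continuous_subtype_val
  zero_at_infty' := by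
    have hK : IsCompact ((↑) ⁻¹' tsupport φ : Set O) := by
      rw [Subtype.isCompact_iff, Subtype.image_preimage_coe, inter_eq_self_of_subset_right hφ.2.2]
      exact hφ.2.1
    refine tendsto_const_nhds.congr' ?_
    filter_upwards [hK.compl_mem_cocompact] with x hx
    exact (image_eq_zero_of_notMem_tsupport hx).symm

/-- Cut `ψ` off outside a compact set where it is already small, then approximate the resulting
continuous map smoothly without enlarging its support. -/
lemma exists_test_approx (hO : IsOpen O) (ψ : C₀(O, Mat N n)) {ε : ℝ} (hε : 0 < ε) :
    ∃ (φ : Vec n → Mat N n) (hφ : IsTest O φ), ‖ψ - hφ.toZeroAtInfty‖ ≤ ε := by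
  have h0 : Tendsto (fun x => ‖ψ x‖) (cocompact O) (𝓝 0) := by
    simpa using ψ.zero_at_infty'.norm
  obtain ⟨K, hK, hKψ⟩ := mem_cocompact.1 (h0.eventually_lt_const (half_pos hε))
  obtain ⟨χ, hχ, hχ1, hχ2⟩ := exists_cutoff (K := (↑) '' K) (hK.image continuous_subtype_val) hO
    (by rintro _ ⟨x, -, rfl⟩; exact x.2)
  set f : Vec n → Mat N n := fun x => χ x • extendZero ψ x with hf
  have hfs : tsupport f ⊆ tsupport χ := tsupport_smul_subset_left χ _
  have hfc : Continuous f := by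
    refine continuous_of_tsupport fun x hx => ?_
    have hxO := hχ.2.2 (hfs hx)
    refine hχ.continuous.continuousAt.smul ?_
    have : ContinuousOn (extendZero ψ) O := by
      rw [continuousOn_iff_continuous_domRestrict]
      exact ψ.continuous.congr fun y => (extendZero_coe ψ y).symm
    exact this.continuousAt (hO.mem_nhds hxO)
  obtain ⟨g, hg1, hg2, hg3⟩ := hfc.exists_contDiff_approx ⊤ (ε := fun _ => ε / 2) continuous_const
    fun _ => half_pos hε
  have hgs : tsupport g ⊆ tsupport χ := (closure_mono hg3).trans hfs
  have hgt : IsTest O g := ⟨hg1, hχ.2.1.of_isClosed_subset (isClosed_tsupport _) hgs,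
    hgs.trans hχ.2.2⟩
  refine ⟨g, hgt, ?_⟩
  rw [← ZeroAtInftyContinuousMap.norm_toBCF_eq_norm, BoundedContinuousFunction.norm_le hε.le]
  intro x
  have e1 : ‖ψ x - f x‖ ≤ ε / 2 := by
    simp only [hf, extendZero_coe]
    by_cases hx : x ∈ K
    · have : χ x = 1 := (eventually_nhdsSet_iff_forall.1 hχ1 x ⟨x, hx, rfl⟩).self_of_nhds
      simp [this, (half_pos hε).le]
    · have h1 : ‖ψ x‖ < ε / 2 := hKψ hx
      have : ψ x - χ x • ψ x = (1 - χ x) • ψ x := by rw [sub_smul, one_smul]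
      rw [this, norm_smul, Real.norm_of_nonneg (by linarith [(hχ2 x).2])]
      nlinarith [(hχ2 x).1, norm_nonneg (ψ x), h1]
  have e2 := (hg2 x).le
  rw [dist_comm, dist_eq_norm] at e2
  calc ‖ψ x - g x‖ = ‖(ψ x - f x) + (f x - g x)‖ := by congr 1; abel
    _ ≤ ε / 2 + ε / 2 := norm_add_le_of_le e1 e2
    _ = ε := by ring

lemma extendZero_add (ψ ψ' : C₀(O, Mat N n)) :
    extendZero (ψ + ψ') = fun x => extendZero ψ x + extendZero ψ' x := by
  ext1 x
  by_cases hx : x ∈ O <;> simp [extendZero, hx]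

lemma extendZero_smul (c : ℝ) (ψ : C₀(O, Mat N n)) :
    extendZero (c • ψ) = fun x => c • extendZero ψ x := by
  ext1 x
  by_cases hx : x ∈ O <;> simp [extendZero, hx]

/-- Test maps as a subspace of the continuous maps vanishing at infinity. -/
noncomputable def testSubmodule (O : Set (Vec n)) (N : ℕ) : Submodule ℝ C₀(O, Mat N n) where
  carrier := {ψ | IsTest O (extendZero ψ)}
  add_mem' {a b} ha hb := by
    simp only [mem_ofPred_eq] at ha hb ⊢
    rw [extendZero_add]; exact ha.add hb
  zero_mem' := by
    simp only [mem_ofPred_eq]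
    have : extendZero (0 : C₀(O, Mat N n)) = fun _ => 0 := by
      ext1 x; by_cases hx : x ∈ O <;> simp [extendZero, hx]
    rw [this]; exact isTest_zero
  smul_mem' c ψ hψ := by
    simp only [mem_ofPred_eq] at hψ ⊢
    rw [extendZero_smul]; exact hψ.const_smul c

/-- The distributional gradient as a functional on test maps. -/
noncomputable def gradFunctional (h : IntegrableOn u O) : testSubmodule O N →ₗ[ℝ] ℝ where
  toFun ψ := -∫ x in O, inner ℝ (u x) (rowDiv (extendZero ψ.1) x)
  map_add' ψ ψ' := by
    have h1 : IsTest O (extendZero ψ.1) := ψ.2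
    have h2 : IsTest O (extendZero ψ'.1) := ψ'.2
    simp only [Submodule.coe_add, extendZero_add, rowDiv_add h1 h2, inner_add_right]
    rw [integral_add (integrable_inner_test h h1.isTest_rowDiv)
      (integrable_inner_test h h2.isTest_rowDiv)]
    ring
  map_smul' c ψ := by
    have h1 : IsTest O (extendZero ψ.1) := ψ.2
    simp only [Submodule.coe_smul, extendZero_smul, rowDiv_const_smul h1, inner_smul_right,
      integral_const_mul]
    simp

lemma norm_gradFunctional_le (h : MemBV O u) (ψ : testSubmodule O N) :
    ‖gradFunctional h.integrableOn ψ‖ ≤ (totalVar O u).toReal * ‖ψ‖ := by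
  have h1 : IsTest O (extendZero ψ.1) := ψ.2
  have h2 := abs_integral_rowDiv_le h.2.ne h1 (norm_extendZero_le ψ.1)
  rw [← abs_neg, mul_comm] at h2
  exact h2

/-- On test maps the distributional gradient is bounded by the total variation in the supremum norm,
and Hahn–Banach extends it with the same norm. No integral representation of the functional is
needed. -/
lemma exists_isGradMeasure (h : MemBV O u) : ∃ T : C₀(O, Mat N n) →L[ℝ] ℝ,
    IsGradMeasure O u T ∧ ‖T‖ ≤ (totalVar O u).toReal := by
  obtain ⟨T, hT1, hT2⟩ := exists_extension_norm_eq (testSubmodule O N)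
    ((gradFunctional h.integrableOn).mkContinuous _ (norm_gradFunctional_le h))
  refine ⟨T, fun φ hφ ψ hψ => ?_,
    hT2.trans_le (LinearMap.mkContinuous_norm_le _ ENNReal.toReal_nonneg _)⟩
  have e := extendZero_eq hφ hψ
  have hD : ψ ∈ testSubmodule O N := by show IsTest O (extendZero ψ); rw [e]; exact hφ
  have h3 : T ψ = -∫ x in O, inner ℝ (u x) (rowDiv (extendZero ψ) x) := hT1 ⟨ψ, hD⟩
  rw [h3, e]

/-- Banach–Steinhaus bounds the norms of the pointwise convergent gradient functionals. The
variation is recovered by testing with `-φ`, in view of the sign in `IsGradMeasure`. -/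
lemma WeakStarTendstoBV.exists_bound {w : ℕ → Vec n → Vec N} (h : WeakStarTendstoBV O w u) :
    ∃ M : ℝ≥0∞, M ≠ ⊤ ∧ ∀ k, totalVar O (w k) ≤ M := by
  obtain ⟨-, -, -, S, T, hS, -, hST⟩ := h
  obtain ⟨C, hC⟩ := banach_steinhaus (g := S) fun ψ => by
    obtain ⟨C, hC⟩ := (hST ψ).norm.bddAbove_range
    exact ⟨C, fun k => hC ⟨k, rfl⟩⟩
  refine ⟨ENNReal.ofReal C, ENNReal.ofReal_ne_top, fun k => ?_⟩
  refine iSup₂_le fun φ hφ => iSup_le fun h1 => ENNReal.ofReal_le_ofReal ?_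
  have e := hS k _ (hφ.const_smul (-1)) (hφ.const_smul (-1)).toZeroAtInfty fun _ => rfl
  rw [rowDiv_const_smul hφ] at e
  simp only [inner_smul_right, integral_const_mul] at e
  have hn : ‖(hφ.const_smul (-1)).toZeroAtInfty‖ ≤ 1 := by
    rw [← ZeroAtInftyContinuousMap.norm_toBCF_eq_norm, BoundedContinuousFunction.norm_le zero_le_one]
    intro x
    simpa [IsTest.toZeroAtInfty] using h1 x
  have h2 := (S k).le_opNorm (hφ.const_smul (-1)).toZeroAtInfty
  rw [e] at h2
  have h3 : ‖S k‖ * ‖(hφ.const_smul (-1)).toZeroAtInfty‖ ≤ C :=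
    (mul_le_of_le_one_right (norm_nonneg _) hn).trans (hC k)
  have h4 := (le_abs_self _).trans (h2.trans h3)
  linarith

/-- On test maps the gradients converge by `L¹` convergence alone; test maps are dense in `C₀` and
the functionals are bounded, so they converge on all of `C₀`. In this form weak* convergence is
carried from one outer domain to another and verified for minimizing sequences. -/
lemma weakStarTendstoBV_of_bound (hO : IsOpen O) {w : ℕ → Vec n → Vec N}
    (hw : ∀ k, IntegrableOn (w k) O) (hu : IntegrableOn u O)
    (h : Tendsto (fun k => eLpNorm (w k - u) 1 (volume.restrict O)) atTop (𝓝 0))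
    {M : ℝ≥0∞} (hM : M ≠ ⊤) (hwM : ∀ k, totalVar O (w k) ≤ M) : WeakStarTendstoBV O w u := by
  have hwB : ∀ k, MemBV O (w k) := fun k =>
    ⟨memLp_one_iff_integrable.2 (hw k), (hwM k).trans_lt hM.lt_top⟩
  have huM := totalVar_le_of_tendsto hw hu h hwM
  have huB : MemBV O u := ⟨memLp_one_iff_integrable.2 hu, huM.trans_lt hM.lt_top⟩
  choose S hS1 hS2 using fun k => exists_isGradMeasure (hwB k)
  obtain ⟨T, hT1, hT2⟩ := exists_isGradMeasure huB
  refine ⟨hwB, huB, h, S, T, hS1, hT1, fun ψ => ?_⟩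
  have hS3 : ∀ k, ‖S k‖ ≤ M.toReal := fun k => (hS2 k).trans (ENNReal.toReal_mono hM (hwM k))
  have hT3 : ‖T‖ ≤ M.toReal := hT2.trans (ENNReal.toReal_mono hM huM)
  rw [Metric.tendsto_atTop]
  intro ε hε
  set δ := ε / (4 * (M.toReal + 1)) with hδ
  have hM0 : 0 ≤ M.toReal := ENNReal.toReal_nonneg
  have hδ0 : 0 < δ := by positivity
  have hδM : M.toReal * δ ≤ ε / 4 := by
    rw [hδ, mul_div_assoc', div_le_div_iff₀ (by positivity) (by positivity)]
    nlinarith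
  obtain ⟨φ, hφ, hφψ⟩ := exists_test_approx hO ψ hδ0
  have hc : Tendsto (fun k => S k hφ.toZeroAtInfty) atTop (𝓝 (T hφ.toZeroAtInfty)) := by
    rw [hT1 φ hφ _ fun _ => rfl]
    simp only [fun k => hS1 k φ hφ hφ.toZeroAtInfty fun _ => rfl]
    exact (tendsto_integral_inner_test hw hu h hφ.isTest_rowDiv).neg
  obtain ⟨k₀, hk₀⟩ := Metric.tendsto_atTop.1 hc (ε / 4) (by positivity)
  refine ⟨k₀, fun k hk => ?_⟩
  have h1 := hk₀ k hk
  rw [Real.dist_eq] at h1 ⊢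
  have b : ∀ A : C₀(O, Mat N n) →L[ℝ] ℝ, ‖A‖ ≤ M.toReal →
      |A ψ - A hφ.toZeroAtInfty| ≤ ε / 4 := fun A hA => by
    rw [← map_sub]
    exact (A.le_opNorm _).trans ((mul_le_mul hA hφψ (norm_nonneg _) hM0).trans hδM)
  have b1 := abs_le.1 (b (S k) (hS3 k))
  have b2 := abs_le.1 (b T hT3)
  rw [abs_lt] at h1 ⊢
  constructor <;> linarith [b1.1, b1.2, b2.1, b2.2, h1.1, h1.2]

end GradMeasure

/-! ### Translations of Sobolev maps and the Poincaré inequality -/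

lemma eLpNorm_rpow {α E : Type*} [NormedAddCommGroup E] {m : MeasurableSpace α} {μ : Measure α}
    {p : ℝ} (hp : 0 < p) (f : α → E) :
    eLpNorm f (ENNReal.ofReal p) μ ^ p = ∫⁻ x, ‖f x‖ₑ ^ p ∂μ := by
  rw [eLpNorm_eq_lintegral_rpow_enorm_toReal (by simpa using hp) ENNReal.ofReal_ne_top,
    ENNReal.toReal_ofReal hp.le, ← ENNReal.rpow_mul, one_div_mul_cancel hp.ne', ENNReal.rpow_one]

/-- Cauchy–Schwarz in each row: the operator norm is at most the Hilbert–Schmidt norm. -/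
lemma norm_fderiv_apply_le (φ : Vec n → Vec N) (x t : Vec n) :
    ‖fderiv ℝ φ x t‖ ≤ ‖t‖ * ‖grad φ x‖ := by
  have ht : t = ∑ j, t j • EuclideanSpace.single j (1 : ℝ) := by
    simpa using ((EuclideanSpace.basisFun (Fin n) ℝ).sum_repr t).symm
  have e : ∀ i, fderiv ℝ φ x t i = ∑ j, t j * grad φ x (i, j) := fun i => by
    conv_lhs => rw [ht]
    simp [map_sum, grad, pderiv]
  refine le_of_sq_le_sq ?_ (by positivity)
  rw [mul_pow, EuclideanSpace.norm_sq_eq, EuclideanSpace.norm_sq_eq t,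
    EuclideanSpace.norm_sq_eq (grad φ x), Fintype.sum_prod_type, Finset.mul_sum]
  refine Finset.sum_le_sum fun i _ => ?_
  rw [e]
  simp only [Real.norm_eq_abs, sq_abs]
  exact Finset.sum_mul_sq_le_sq_mul_sq _ _ _

/-- Fundamental theorem of calculus along the segment from `x` to `x - t`, Jensen on the unit
interval, Tonelli, and translation invariance of Lebesgue measure. -/
lemma IsTest.eLpNorm_translate_le {O : Set (Vec n)} {φ : Vec n → Vec N} (h : IsTest O φ) {p : ℝ}
    (hp : 1 ≤ p) (t : Vec n) : eLpNorm (fun x => φ (x - t) - φ x) (ENNReal.ofReal p) ≤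
      ‖t‖ₑ * eLpNorm (grad φ) (ENNReal.ofReal p) := by
  have hp0 : 0 < p := by linarith
  have hgc : Continuous (grad φ) := h.isTest_grad.continuous
  rw [← ENNReal.rpow_le_rpow_iff hp0, ENNReal.mul_rpow_of_nonneg _ _ hp0.le, eLpNorm_rpow hp0,
    eLpNorm_rpow hp0]
  have key : ∀ x, ‖φ (x - t) - φ x‖ₑ ^ p ≤
      ∫⁻ s in Ioc (0 : ℝ) 1, ‖t‖ₑ ^ p * ‖grad φ (x - s • t)‖ₑ ^ p := by
    intro x
    have hd : ∀ s : ℝ, HasDerivAt (fun s : ℝ => φ (x - s • t)) (fderiv ℝ φ (x - s • t) (-t)) s :=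
      fun s => by
        have h1 : HasDerivAt (fun s : ℝ => x - s • t) (-t) s := by
          simpa using ((hasDerivAt_id s).smul_const t).const_sub x
        exact (h.differentiable (x - s • t)).hasFDerivAt.comp_hasDerivAt s h1
    have hc : Continuous fun s : ℝ => fderiv ℝ φ (x - s • t) (-t) := by
      have := h.1.continuous_fderiv (by simp)
      fun_prop
    have hFTC := intervalIntegral.integral_eq_sub_of_hasDerivAt (a := 0) (b := 1)
      (fun s _ => hd s) (hc.intervalIntegrable _ _)
    rw [intervalIntegral.integral_of_le zero_le_one] at hFTC
    simp only [one_smul, zero_smul, sub_zero] at hFTC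
    have h2 : ‖φ (x - t) - φ x‖ₑ ≤ ∫⁻ s in Ioc (0 : ℝ) 1, ‖t‖ₑ * ‖grad φ (x - s • t)‖ₑ := by
      rw [← hFTC]
      refine (enorm_integral_le_lintegral_enorm _).trans (lintegral_mono fun s => ?_)
      rw [← ofReal_norm, ← ofReal_norm, ← ofReal_norm, ← ENNReal.ofReal_mul (norm_nonneg _)]
      refine ENNReal.ofReal_le_ofReal ?_
      simpa using norm_fderiv_apply_le φ (x - s • t) (-t)
    refine (ENNReal.rpow_le_rpow h2 hp0.le).trans ?_
    simp only [← ENNReal.mul_rpow_of_nonneg _ _ hp0.le]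
    rcases hp.eq_or_lt with rfl | hp1
    · simp
    · have hm : Continuous fun s : ℝ => grad φ (x - s • t) := by fun_prop
      simpa using lintegral_rpow_le (μ := volume.restrict (Ioc (0 : ℝ) 1))
        (hm.enorm.measurable.const_mul ‖t‖ₑ).aemeasurable hp1
  calc ∫⁻ x, ‖φ (x - t) - φ x‖ₑ ^ p
      ≤ ∫⁻ x, ∫⁻ s in Ioc (0 : ℝ) 1, ‖t‖ₑ ^ p * ‖grad φ (x - s • t)‖ₑ ^ p := lintegral_mono key
    _ = ∫⁻ s in Ioc (0 : ℝ) 1, (∫⁻ x, ‖t‖ₑ ^ p * ‖grad φ (x - s • t)‖ₑ ^ p) := by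
        refine lintegral_lintegral_swap (Measurable.aemeasurable ?_)
        have hm : Continuous fun z : Vec n × ℝ => grad φ (z.1 - z.2 • t) := by fun_prop
        exact (hm.enorm.measurable.pow_const p).const_mul _
    _ = ∫⁻ s in Ioc (0 : ℝ) 1, ‖t‖ₑ ^ p * ∫⁻ x, ‖grad φ x‖ₑ ^ p := by
        refine lintegral_congr fun s => ?_
        rw [lintegral_const_mul _ (by
          have hm : Continuous fun x : Vec n => grad φ (x - s • t) := by fun_prop
          exact hm.enorm.measurable.pow_const p)]
        rw [lintegral_sub_right_eq_self fun x => ‖grad φ x‖ₑ ^ p]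
    _ = ‖t‖ₑ ^ p * ∫⁻ x, ‖grad φ x‖ₑ ^ p := by simp

/-- Approximate by test maps; both sides of the smooth estimate are continuous under `L^p`
convergence of maps and gradients. -/
lemma HasWeakGrad.eLpNorm_translate_le {p : ℝ} (hp : 1 ≤ p) {K : Set (Vec n)} (hK : IsCompact K)
    {z : Vec n → Vec N} {Z : Vec n → Mat N n} (hg : HasWeakGrad univ z Z)
    (hz : MemLp z (ENNReal.ofReal p)) (hZ : MemLp Z (ENNReal.ofReal p)) (h0 : ∀ x ∉ K, z x = 0)
    (t : Vec n) : eLpNorm (fun x => z (x - t) - z x) (ENNReal.ofReal p) ≤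
      ‖t‖ₑ * eLpNorm Z (ENNReal.ofReal p) := by
  have hP1 : 1 ≤ ENNReal.ofReal p := by simpa using hp
  obtain ⟨φ, hφ, h1, h2⟩ := exists_test_seq hp isOpen_univ hK (subset_univ _) hz hZ hg h0
  have hlim : Tendsto (fun k => eLpNorm (φ k - z) (ENNReal.ofReal p) +
      ‖t‖ₑ * (eLpNorm (grad (φ k) - Z) (ENNReal.ofReal p) + eLpNorm Z (ENNReal.ofReal p)) +
      eLpNorm (φ k - z) (ENNReal.ofReal p)) atTop
      (𝓝 (0 + ‖t‖ₑ * (0 + eLpNorm Z (ENNReal.ofReal p)) + 0)) :=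
    (h1.add (ENNReal.Tendsto.const_mul (h2.add_const _) (Or.inr (by simp)))).add h1
  rw [zero_add, zero_add, add_zero] at hlim
  refine ge_of_tendsto hlim (Eventually.of_forall fun k => ?_)
  have hm : AEStronglyMeasurable (φ k - z) volume :=
    (hφ k).continuous.aestronglyMeasurable.sub hz.1
  have hmp := measurePreserving_sub_right (volume : Measure (Vec n)) t
  have e1 : eLpNorm ((φ k - z) ∘ fun x => x - t) (ENNReal.ofReal p) =
      eLpNorm (φ k - z) (ENNReal.ofReal p) := eLpNorm_comp_measurePreserving hm hmp
  have hmt : AEStronglyMeasurable ((φ k - z) ∘ fun x => x - t) volume :=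
    hm.comp_measurePreserving hmp
  have hc : Continuous fun x => φ k (x - t) - φ k x := by
    have := (hφ k).continuous
    fun_prop
  have e2 : (fun x => z (x - t) - z x) =
      (fun x => φ k (x - t) - φ k x) - ((φ k - z) ∘ fun x => x - t) + (φ k - z) := by
    ext1 x; simp
  have e3 : grad (φ k) = (grad (φ k) - Z) + Z := by simp
  rw [e2]
  refine (eLpNorm_add_le (hc.aestronglyMeasurable.sub hmt) hm hP1).trans ?_
  gcongr
  refine (eLpNorm_sub_le hc.aestronglyMeasurable hmt hP1).trans ?_
  rw [e1, add_comm]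
  gcongr
  refine ((hφ k).eLpNorm_translate_le hp t).trans ?_
  gcongr
  conv_lhs => rw [e3]
  exact eLpNorm_add_le ((hφ k).isTest_grad.continuous.aestronglyMeasurable.sub hZ.1) hZ.1 hP1

/-- The Poincaré inequality for maps vanishing outside a ball. -/
lemma HasWeakGrad.poincare (hn : 1 ≤ n) {p : ℝ} (hp : 1 ≤ p) {R : ℝ} (hR : 0 < R)
    {z : Vec n → Vec N} {Z : Vec n → Mat N n} (hg : HasWeakGrad univ z Z)
    (hz : MemLp z (ENNReal.ofReal p)) (hZ : MemLp Z (ENNReal.ofReal p))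
    (h0 : ∀ x ∉ Metric.ball 0 R, z x = 0) :
    eLpNorm z (ENNReal.ofReal p) ≤ ENNReal.ofReal (2 * R) * eLpNorm Z (ENNReal.ofReal p) := by
  -- A translation of length `2 R` moves the ball off itself, so on the ball `z (x - t) - z x` is
  -- just `-z x` and the translation estimate becomes the Poincaré inequality.
  set t : Vec n := EuclideanSpace.single ⟨0, hn⟩ (2 * R) with ht
  have htn : ‖t‖ = 2 * R := by simp [ht, abs_of_pos hR]
  have h := hg.eLpNorm_translate_le hp (isCompact_closedBall (0 : Vec n) R) hz hZ
    (fun x hx => h0 x fun h' => hx (Metric.ball_subset_closedBall h')) t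
  rw [← ofReal_norm, htn] at h
  refine le_trans (eLpNorm_mono fun x => ?_) h
  by_cases hx : x ∈ Metric.ball (0 : Vec n) R
  · rw [h0 (x - t), zero_sub, norm_neg]
    intro h'
    rw [mem_ball_zero_iff] at hx h'
    have := norm_sub_le x (x - t)
    rw [sub_sub_cancel, htn] at this
    linarith
  · simp [h0 x hx]

/-! ### Strong compactness -/

lemma eLpNorm_moll_sub_le' (k : ℕ) {p : ℝ} (hp : 1 ≤ p) {f : Vec n → ℝ}
    (hf : LocallyIntegrable f) {ε : ℝ≥0∞} (hε : ∀ t : Vec n, ‖t‖ < 1 / ((k : ℝ) + 1) →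
      eLpNorm (fun x => f (x - t) - f x) (ENNReal.ofReal p) ≤ ε) :
    eLpNorm (fun x => moll k f x - f x) (ENNReal.ofReal p) ≤ ε := by
  obtain ⟨g, hgm, hfg⟩ := hf.aestronglyMeasurable.aemeasurable
  have e : (fun x => moll k f x - f x) =ᵐ[volume] fun x => moll k g x - g x := by
    filter_upwards [hfg] with x hx
    rw [hx, moll_congr_ae k hfg]
  rw [eLpNorm_congr_ae e]
  refine eLpNorm_moll_sub_le k hp hgm ((hf.locallyIntegrableOn univ).congr
    (by simpa using hfg) |> locallyIntegrableOn_univ.1) fun t ht => ?_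
  refine le_trans (le_of_eq (eLpNorm_congr_ae ?_)) (hε t ht)
  filter_upwards [hfg, (measurePreserving_sub_right (volume : Measure (Vec n)) t).quasiMeasurePreserving.ae hfg] with x h1 h2
  rw [h1, h2]

/-- At a fixed scale the kernel is bounded and Lipschitz, so mollification turns an `L¹` bound into
a uniform bound and equi-Lipschitz continuity. -/
lemma exists_moll_bound (n m : ℕ) (M : ℝ) : ∃ C : ℝ, 0 ≤ C ∧ ∀ f : Vec n → ℝ, Integrable f →
    ∫ x, |f x| ≤ M → ∀ x, |moll m f x| ≤ C ∧ ∀ y, |moll m f x - moll m f y| ≤ C * dist x y := by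
  have hker : IsTest (V := ℝ) univ (ker n m) := ⟨ker_contDiff m, ker_compact m, subset_univ _⟩
  obtain ⟨C₁, hC₁⟩ := hker.exists_bound
  obtain ⟨C₂, hC₂⟩ := hker.lipschitz
  have hC₁0 : 0 ≤ C₁ := (norm_nonneg _).trans (hC₁ 0)
  refine ⟨(C₁ + C₂) * |M|, by positivity, fun f hf hfM x => ?_⟩
  have hi : ∀ x, Integrable fun t => f t * ker n m (x - t) := fun x =>
    hf.mul_bdd (c := C₁) ((ker_continuous m).comp (continuous_const.sub continuous_id)).aestronglyMeasurable
      (Eventually.of_forall fun t => hC₁ _)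
  have hM : M ≤ |M| := le_abs_self M
  have b : ∀ (g : Vec n → ℝ) (c : ℝ), 0 ≤ c → (∀ t, |g t| ≤ c) → |∫ t, f t * g t| ≤ c * |M| := by
    intro g c hc hg
    calc ‖∫ t, f t * g t‖ ≤ ∫ t, c * |f t| := by
          refine norm_integral_le_of_norm_le (hf.abs.const_mul c) (Eventually.of_forall fun t => ?_)
          rw [norm_mul, mul_comm]
          exact mul_le_mul_of_nonneg_right (hg t) (abs_nonneg _)
      _ ≤ c * |M| := by
          rw [integral_const_mul]
          gcongr
          exact hfM.trans hM
  refine ⟨?_, fun y => ?_⟩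
  · rw [moll_apply']
    refine (b _ C₁ hC₁0 fun t => hC₁ _).trans ?_
    gcongr
    simp
  · rw [moll_apply', moll_apply', ← integral_sub (hi x) (hi y)]
    simp only [← mul_sub]
    refine (b _ (C₂ * dist x y) (by positivity) fun t => ?_).trans ?_
    · have := hC₂.dist_le_mul (x - t) (y - t)
      rwa [dist_sub_right, Real.dist_eq] at this
    · have : 0 ≤ C₁ * |M| * dist x y := by positivity
      nlinarith

/-- The Fréchet–Kolmogorov theorem for functions with a common bounded support. -/
lemma exists_subseq_tendsto_eLpNorm {ι : Type*} [Fintype ι] {p : ℝ} (hp : 1 ≤ p)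
    {z : ℕ → ι → Vec n → ℝ} {R M : ℝ} (hz : ∀ k i, MemLp (z k i) (ENNReal.ofReal p))
    (h0 : ∀ k i, ∀ x ∉ Metric.ball 0 R, z k i x = 0)
    (hM : ∀ k i, eLpNorm (z k i) (ENNReal.ofReal p) ≤ ENNReal.ofReal M)
    (hT : ∀ k i t, eLpNorm (fun x => z k i (x - t) - z k i x) (ENNReal.ofReal p) ≤
      ‖t‖ₑ * ENNReal.ofReal M) :
    ∃ φ : ℕ → ℕ, StrictMono φ ∧ ∀ i, ∃ g, MemLp g (ENNReal.ofReal p) ∧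
      Tendsto (fun k => eLpNorm (z (φ k) i - g) (ENNReal.ofReal p)) atTop (𝓝 0) := by
  have hp0 : 0 < p := by linarith
  have hP1 : 1 ≤ ENNReal.ofReal p := by simpa using hp
  set B := Metric.ball (0 : Vec n) R with hB
  have : IsFiniteMeasure (volume.restrict B) := ⟨by simpa [hB] using measure_ball_lt_top⟩
  have hzi' : ∀ k i, IntegrableOn (z k i) B := fun k i => (hz k i).restrict B |>.integrable hP1
  have hzi : ∀ k i, Integrable (z k i) := fun k i =>
    (integrableOn_iff_integrable_of_support_subset fun x hx => by
      by_contra h; exact hx (h0 k i x h)).1 (hzi' k i)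
  set M₁ := (ENNReal.ofReal M * (volume.restrict B) univ ^
    (1 / (1 : ℝ≥0∞).toReal - 1 / (ENNReal.ofReal p).toReal)) with hM₁
  have hM₁t : M₁ ≠ ⊤ := by
    refine ENNReal.mul_ne_top ENNReal.ofReal_ne_top (ENNReal.rpow_ne_top_of_nonneg ?_ (measure_ne_top _ _))
    rw [ENNReal.toReal_ofReal hp0.le]
    simp only [ENNReal.toReal_one, sub_nonneg]
    rw [div_le_div_iff₀ hp0 one_pos]; linarith
  have hz1 : ∀ k i, ∫ x, |z k i x| ≤ M₁.toReal := by
    intro k i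
    have e : ∫ x, |z k i x| = ∫ x in B, |z k i x| :=
      (setIntegral_eq_integral_of_forall_compl_eq_zero fun x hx => by simp [h0 k i x hx]).symm
    have h1 := eLpNorm_le_eLpNorm_mul_rpow_measure_univ hP1 (hzi' k i).1
    rw [e, ← ENNReal.ofReal_le_iff_le_toReal hM₁t]
    refine le_trans (le_of_eq ?_) (h1.trans (mul_le_mul_left (α := ℝ≥0∞)
      ((eLpNorm_mono_measure _ Measure.restrict_le_self).trans (hM k i)) _))
    rw [eLpNorm_one_eq_lintegral_enorm]
    exact ofReal_integral_norm_eq_lintegral_enorm (hzi' k i)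
  choose C hC0 hC using fun m => exists_moll_bound n m M₁.toReal
  -- The values for all scales, all components and all points of a countable dense set lie in one
  -- compact product of intervals; a convergent subsequence there replaces the diagonal argument.
  let X : ℕ → (ℕ × ι × ℕ → ℝ) := fun k a => moll a.1 (z k a.2.1) (TopologicalSpace.denseSeq (Vec n) a.2.2)
  have hX : ∀ k, X k ∈ pi univ fun a : ℕ × ι × ℕ => Icc (-C a.1) (C a.1) := fun k a _ =>
    abs_le.1 (hC a.1 _ (hzi k a.2.1) (hz1 k a.2.1) _).1
  obtain ⟨Y, -, φ, hφ, hY⟩ := (isCompact_univ_pi fun a : ℕ × ι × ℕ =>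
    isCompact_Icc (a := -C a.1) (b := C a.1)).isSeqCompact hX
  refine ⟨φ, hφ, fun i => ?_⟩
  -- Equi-Lipschitz continuity upgrades convergence on the dense set to convergence at every point.
  have hptw : ∀ m x, ∃ l, Tendsto (fun k => moll m (z (φ k) i) x) atTop (𝓝 l) := by
    intro m x
    refine cauchySeq_tendsto_of_complete (Metric.cauchySeq_iff'.2 fun ε hε => ?_)
    obtain ⟨j, hj⟩ := (TopologicalSpace.denseRange_denseSeq (Vec n)).exists_dist_lt x
      (show 0 < ε / (3 * (C m + 1)) by have := hC0 m; positivity)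
    set y := TopologicalSpace.denseSeq (Vec n) j
    have hy : Tendsto (fun k => moll m (z (φ k) i) y) atTop (𝓝 (Y (m, i, j))) :=
      tendsto_pi_nhds.1 hY (m, i, j)
    obtain ⟨k₀, hk₀⟩ := Metric.cauchySeq_iff'.1 hy.cauchySeq (ε / 3) (by positivity)
    refine ⟨k₀, fun k hk => ?_⟩
    have h1 := hk₀ k hk
    have hCd : C m * dist x y ≤ ε / 3 := by
      have hc := hC0 m
      have : C m * dist x y ≤ C m * (ε / (3 * (C m + 1))) := by gcongr
      refine this.trans ?_
      rw [mul_div_assoc', div_le_div_iff₀ (by positivity) (by positivity)]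
      nlinarith
    have b := fun k => ((hC m _ (hzi (φ k) i) (hz1 (φ k) i) x).2 y).trans hCd
    have b1 := abs_le.1 (b k)
    have b2 := abs_le.1 (b k₀)
    rw [Real.dist_eq, abs_lt] at h1 ⊢
    constructor <;> linarith [b1.1, b1.2, b2.1, b2.2, h1.1, h1.2]
  choose a ha using hptw
  have hmollm : ∀ m k, Continuous (moll m (z k i)) := fun m k =>
    (moll_contDiff m (hzi k i).locallyIntegrable).continuous
  have ham : ∀ m, Measurable (a m) := fun m =>
    measurable_of_tendsto_metrizable (fun k => (hmollm m (φ k)).measurable) (tendsto_pi_nhds.2 (ha m))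
  have hmoll0 : ∀ m k, ∀ x ∉ Metric.ball (0 : Vec n) (R + 1), moll m (z k i) x = 0 := by
    intro m k x hx
    refine moll_eq_zero fun y hy => h0 k i y fun hy' => hx ?_
    have h3 : 1 / ((m : ℝ) + 1) ≤ 1 := by
      rw [div_le_one (by positivity)]; linarith [show (0 : ℝ) ≤ m by positivity]
    rw [mem_ball_zero_iff] at hy' ⊢
    have := norm_sub_le y (y - x)
    rw [sub_sub_cancel] at this
    linarith
  have hconv : ∀ m, Tendsto (fun k => eLpNorm (fun x => moll m (z (φ k) i) x - a m x)
      (ENNReal.ofReal p)) atTop (𝓝 0) := by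
    intro m
    refine eq_zero_tendsto_of_rpow hp0 ?_
    simp only [eLpNorm_rpow hp0]
    have hc0 := hC0 m
    have := tendsto_lintegral_of_dominated_convergence (μ := (volume : Measure (Vec n)))
      (F := fun k x => ‖moll m (z (φ k) i) x - a m x‖ₑ ^ p) (f := fun _ => 0)
      ((Metric.ball (0 : Vec n) (R + 1)).indicator fun _ => ENNReal.ofReal (2 * C m) ^ p)
      (fun k => (((hmollm m (φ k)).measurable.sub (ham m)).enorm.pow_const p))
      (fun k => Eventually.of_forall fun x => ?_) ?_ (Eventually.of_forall fun x => ?_)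
    · simpa using this
    · by_cases hx : x ∈ Metric.ball (0 : Vec n) (R + 1)
      · rw [indicator_of_mem hx]
        refine ENNReal.rpow_le_rpow ?_ hp0.le
        rw [← ofReal_norm]
        refine ENNReal.ofReal_le_ofReal ((norm_sub_le _ _).trans ?_)
        have h1 := fun k => (hC m _ (hzi k i) (hz1 k i) x).1
        have h2 : |a m x| ≤ C m := le_of_tendsto (ha m x).abs (Eventually.of_forall fun k => h1 (φ k))
        rw [Real.norm_eq_abs, Real.norm_eq_abs]
        linarith [h1 (φ k)]
      · have : a m x = 0 := tendsto_nhds_unique (ha m x)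
          (by simpa only [hmoll0 m _ x hx] using tendsto_const_nhds)
        simp [hmoll0 m (φ k) x hx, this, ENNReal.zero_rpow_of_pos hp0]
    · rw [lintegral_indicator_const measurableSet_ball]
      exact ENNReal.mul_ne_top (ENNReal.rpow_ne_top_of_nonneg hp0.le ENNReal.ofReal_ne_top)
        measure_ball_lt_top.ne
    · have h1 : Tendsto (fun k => moll m (z (φ k) i) x - a m x) atTop (𝓝 0) := by
        simpa using (ha m x).sub_const (a m x)
      have h2 := (h1.enorm).ennrpow_const p
      simpa [ENNReal.zero_rpow_of_pos hp0] using h2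
  have hmerr : ∀ m k, eLpNorm (fun x => moll m (z k i) x - z k i x) (ENNReal.ofReal p) ≤
      ENNReal.ofReal (1 / ((m : ℝ) + 1)) * ENNReal.ofReal M := by
    intro m k
    refine eLpNorm_moll_sub_le' m hp (hzi k i).locallyIntegrable fun t ht => (hT k i t).trans ?_
    gcongr
    rw [← ofReal_norm]
    exact ENNReal.ofReal_le_ofReal ht.le
  have hmerr0 : Tendsto (fun m : ℕ => ENNReal.ofReal (1 / ((m : ℝ) + 1)) * ENNReal.ofReal M) atTop
      (𝓝 0) := by
    have := ENNReal.Tendsto.mul_const (b := ENNReal.ofReal M) ((ENNReal.continuous_ofReal.tendsto _).comp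
      (tendsto_one_div_add_atTop_nhds_zero_nat (𝕜 := ℝ))) (Or.inr ENNReal.ofReal_ne_top)
    simpa using this
  have : Fact (1 ≤ ENNReal.ofReal p) := ⟨hP1⟩
  -- At a fixed scale `m` the mollifications converge in `L^p`, and the mollification error is small
  -- uniformly in `k` by the translation bound. Four contributions of `ε / 4` arise.
  have hcauchy : CauchySeq fun k => (hz (φ k) i).toLp := by
    rw [Lp.cauchySeq_Lp_iff_cauchySeq_eLpNorm, ENNReal.tendsto_nhds_zero]
    intro ε hε
    have hε4 : 0 < ε / 4 := ENNReal.div_pos hε.ne' (by simp)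
    obtain ⟨m, hm⟩ := ((ENNReal.tendsto_nhds_zero.1 hmerr0) (ε / 4) hε4).exists
    have hk := (ENNReal.tendsto_nhds_zero.1 (hconv m)) (ε / 4) hε4
    rw [← prod_atTop_atTop_eq]
    filter_upwards [hk.prod_mk hk] with ⟨k, l⟩ hkl
    have e : (((hz (φ k) i).toLp : Vec n → ℝ) - ((hz (φ l) i).toLp : Vec n → ℝ)) =ᵐ[volume]
        ((fun x => moll m (z (φ k) i) x - a m x) - (fun x => moll m (z (φ k) i) x - z (φ k) i x)) -
        ((fun x => moll m (z (φ l) i) x - a m x) - (fun x => moll m (z (φ l) i) x - z (φ l) i x)) := by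
      filter_upwards [(hz (φ k) i).coeFn_toLp, (hz (φ l) i).coeFn_toLp] with x h1 h2
      simp [h1, h2]
    rw [eLpNorm_congr_ae e]
    have hm1 : ∀ k, AEStronglyMeasurable (fun x => moll m (z k i) x - a m x) volume := fun k =>
      ((hmollm m k).measurable.sub (ham m)).aestronglyMeasurable
    have hm2 : ∀ k, AEStronglyMeasurable (fun x => moll m (z k i) x - z k i x) volume := fun k =>
      (hmollm m k).aestronglyMeasurable.sub (hz k i).1
    refine (eLpNorm_sub_le ((hm1 _).sub (hm2 _)) ((hm1 _).sub (hm2 _)) hP1).trans ?_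
    refine (add_le_add (eLpNorm_sub_le (hm1 _) (hm2 _) hP1)
      (eLpNorm_sub_le (hm1 _) (hm2 _) hP1)).trans ?_
    refine (add_le_add (add_le_add hkl.1 ((hmerr m _).trans hm))
      (add_le_add hkl.2 ((hmerr m _).trans hm))).trans (le_of_eq ?_)
    rw [← ENNReal.add_div, ← ENNReal.add_div, ← two_mul, ← two_mul, ← mul_assoc]
    norm_num
    rw [mul_comm, ENNReal.mul_div_cancel_right (by simp) (by simp)]
  obtain ⟨g, hg⟩ := cauchySeq_tendsto_of_complete hcauchy
  refine ⟨g, Lp.memLp g, ?_⟩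
  rw [Lp.tendsto_Lp_iff_tendsto_eLpNorm'] at hg
  refine hg.congr fun k => eLpNorm_congr_ae ?_
  filter_upwards [(hz (φ k) i).coeFn_toLp] with x h1
  simp [h1]

/-! ### Weak compactness in `L^p` -/

section Weak
variable {α : Type*} {mα : MeasurableSpace α} {μ : Measure α} {p : ℝ}

lemma lintegral_enorm_mul_le (hp : 1 < p) {f h : α → ℝ} (hf : AEStronglyMeasurable f μ)
    (hh : AEStronglyMeasurable h μ) : ∫⁻ x, ‖f x * h x‖ₑ ∂μ ≤
      eLpNorm f (ENNReal.ofReal p) μ * eLpNorm h (ENNReal.ofReal (p / (p - 1))) μ := by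
  have hpq : p.HolderConjugate (p / (p - 1)) := Real.HolderConjugate.conjExponent hp
  have h1 := ENNReal.lintegral_mul_le_Lp_mul_Lq μ hpq hf.enorm hh.enorm
  simp only [Pi.mul_apply, ← enorm_mul] at h1
  rwa [eLpNorm_eq_lintegral_rpow_enorm_toReal (by simpa using hpq.pos) ENNReal.ofReal_ne_top,
    eLpNorm_eq_lintegral_rpow_enorm_toReal (by simpa using hpq.symm.pos) ENNReal.ofReal_ne_top,
    ENNReal.toReal_ofReal hpq.pos.le, ENNReal.toReal_ofReal hpq.symm.pos.le]

lemma integrable_mul_conj (hp : 1 < p) {f h : α → ℝ} (hf : MemLp f (ENNReal.ofReal p) μ)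
    (hh : MemLp h (ENNReal.ofReal (p / (p - 1))) μ) : Integrable (fun x => f x * h x) μ :=
  ⟨hf.1.mul hh.1, (lintegral_enorm_mul_le hp hf.1 hh.1).trans_lt (ENNReal.mul_lt_top hf.2 hh.2)⟩

lemma abs_integral_mul_le (hp : 1 < p) {f h : α → ℝ} (hf : AEStronglyMeasurable f μ)
    (hh : MemLp h (ENNReal.ofReal (p / (p - 1))) μ) {M : ℝ} (hM0 : 0 ≤ M)
    (hM : eLpNorm f (ENNReal.ofReal p) μ ≤ ENNReal.ofReal M) :
    |∫ x, f x * h x ∂μ| ≤ M * (eLpNorm h (ENNReal.ofReal (p / (p - 1))) μ).toReal := by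
  have h1 := (enorm_integral_le_lintegral_enorm fun x => f x * h x).trans
    (lintegral_enorm_mul_le hp hf hh.1)
  have h2 := h1.trans (mul_le_mul_left hM _)
  rw [← ENNReal.ofReal_toReal hh.2.ne, ← ENNReal.ofReal_mul hM0, ← ofReal_norm] at h2
  exact (ENNReal.ofReal_le_ofReal_iff (by positivity)).1 h2

/-- With an `L^p` bound it is enough to treat test functions close to `h` in the dual norm. A
general filter is allowed so that pairs of indices can be used for Cauchy sequences. -/
lemma tendsto_integral_mul_zero (hp : 1 < p) {ι : Type*} {l : Filter ι} {F : ι → α → ℝ}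
    (hF : ∀ i, MemLp (F i) (ENNReal.ofReal p) μ) {M : ℝ} (hM0 : 0 ≤ M)
    (hM : ∀ i, eLpNorm (F i) (ENNReal.ofReal p) μ ≤ ENNReal.ofReal M) {h : α → ℝ}
    (hh : MemLp h (ENNReal.ofReal (p / (p - 1))) μ)
    (H : ∀ ε : ℝ≥0∞, ε ≠ 0 → ∃ s, MemLp s (ENNReal.ofReal (p / (p - 1))) μ ∧
      eLpNorm (h - s) (ENNReal.ofReal (p / (p - 1))) μ ≤ ε ∧
      Tendsto (fun i => ∫ x, F i x * s x ∂μ) l (𝓝 0)) :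
    Tendsto (fun i => ∫ x, F i x * h x ∂μ) l (𝓝 0) := by
  rw [Metric.tendsto_nhds]
  intro ε hε
  obtain ⟨s, hs, hs1, hs2⟩ := H (ENNReal.ofReal (ε / (2 * (M + 1)))) (by
    simp only [ne_eq, ENNReal.ofReal_eq_zero, not_le]; positivity)
  filter_upwards [(Metric.tendsto_nhds.1 hs2) (ε / 2) (by positivity)] with i hi
  rw [Real.dist_eq, sub_zero] at hi ⊢
  have e : ∫ x, F i x * h x ∂μ = ∫ x, F i x * (h - s) x ∂μ + ∫ x, F i x * s x ∂μ := by
    rw [← integral_add (integrable_mul_conj hp (hF i) (hh.sub hs)) (integrable_mul_conj hp (hF i) hs)]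
    simp only [Pi.sub_apply]
    congr 1; ext x; ring
  have b := abs_integral_mul_le hp (hF i).1 (hh.sub hs) hM0 (hM i)
  have b2 : (eLpNorm (h - s) (ENNReal.ofReal (p / (p - 1))) μ).toReal ≤ ε / (2 * (M + 1)) :=
    ENNReal.toReal_le_of_le_ofReal (by positivity) hs1
  have b3 : M * (ε / (2 * (M + 1))) ≤ ε / 2 := by
    rw [mul_div_assoc', div_le_div_iff₀ (by positivity) (by positivity)]
    nlinarith
  rw [e]
  refine (abs_add_le _ _).trans_lt ?_
  have := mul_le_mul_of_nonneg_left b2 hM0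
  linarith

/-- Functions built from indicators by addition are dense in the dual space, and the convergence is
additive in the test function. -/
lemma tendsto_integral_mul_of_sets [IsFiniteMeasure μ] (hp : 1 < p) {f : ℕ → α → ℝ} {g : α → ℝ}
    (hf : ∀ k, MemLp (f k) (ENNReal.ofReal p) μ) {M : ℝ} (hM0 : 0 ≤ M)
    (hM : ∀ k, eLpNorm (f k) (ENNReal.ofReal p) μ ≤ ENNReal.ofReal M)
    (hg : MemLp g (ENNReal.ofReal p) μ)
    (hl : ∀ A, MeasurableSet A → Tendsto (fun k => ∫ x in A, f k x ∂μ) atTop (𝓝 (∫ x in A, g x ∂μ)))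
    {h : α → ℝ} (hh : MemLp h (ENNReal.ofReal (p / (p - 1))) μ) :
    Tendsto (fun k => ∫ x, f k x * h x ∂μ) atTop (𝓝 (∫ x, g x * h x ∂μ)) := by
  have hP1 : 1 ≤ ENNReal.ofReal p := by simpa using hp.le
  have key : Tendsto (fun k => ∫ x, (f k - g) x * h x ∂μ) atTop (𝓝 0) := by
    refine tendsto_integral_mul_zero hp (F := fun k => f k - g) (fun k => (hf k).sub hg)
      (M := M + (eLpNorm g (ENNReal.ofReal p) μ).toReal) (by positivity) (fun k => ?_) hh fun ε hε => ?_
    · refine (eLpNorm_sub_le (hf k).1 hg.1 hP1).trans ?_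
      rw [ENNReal.ofReal_add hM0 ENNReal.toReal_nonneg, ENNReal.ofReal_toReal hg.2.ne]
      gcongr
      exact hM k
    · have := hh.induction_dense ENNReal.ofReal_ne_top
        (fun s => MemLp s (ENNReal.ofReal (p / (p - 1))) μ ∧
          Tendsto (fun k => ∫ x, (f k - g) x * s x ∂μ) atTop (𝓝 0))
        (fun c A hA _ η _ => ⟨A.indicator fun _ => c, by simp,
          memLp_indicator_const _ hA c (Or.inr (measure_ne_top _ _)), ?_⟩)
        (fun s t hs ht => ⟨hs.1.add ht.1, ?_⟩) (fun s hs => hs.1.1) hε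
      · obtain ⟨s, h1, h2, h3⟩ := this
        exact ⟨s, h2, h1, h3⟩
      · have e : ∀ k, ∫ x, (f k - g) x * A.indicator (fun _ => c) x ∂μ =
            (∫ x in A, f k x ∂μ - ∫ x in A, g x ∂μ) * c := fun k => by
          have : ∀ x, (f k - g) x * A.indicator (fun _ => c) x =
              A.indicator (fun x => (f k x - g x) * c) x := fun x => by
            by_cases hx : x ∈ A <;> simp [hx]
          simp only [this]
          rw [integral_indicator hA, integral_mul_const, integral_sub
            ((hf k).integrable hP1).integrableOn (hg.integrable hP1).integrableOn]
        simp only [e]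
        simpa using ((hl A hA).sub_const (∫ x in A, g x ∂μ)).mul_const c
      · have := hs.2.add ht.2
        rw [add_zero] at this
        refine this.congr fun k => ?_
        rw [← integral_add (integrable_mul_conj hp ((hf k).sub hg) hs.1)
          (integrable_mul_conj hp ((hf k).sub hg) ht.1)]
        simp only [Pi.add_apply, mul_add]
  have := key.add_const (∫ x, g x * h x ∂μ)
  rw [zero_add] at this
  refine this.congr fun k => ?_
  rw [← integral_add (integrable_mul_conj hp ((hf k).sub hg) hh) (integrable_mul_conj hp hg hh)]
  simp only [Pi.sub_apply]
  congr 1; ext x; ring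

/-- Weak lower semicontinuity of the `L^p` norm. -/
lemma eLpNorm_le_of_weak (hp : 1 < p) {f : ℕ → α → ℝ} {g : α → ℝ}
    (hf : ∀ k, MemLp (f k) (ENNReal.ofReal p) μ) {M : ℝ} (hM0 : 0 ≤ M)
    (hM : ∀ k, eLpNorm (f k) (ENNReal.ofReal p) μ ≤ ENNReal.ofReal M)
    (hg : MemLp g (ENNReal.ofReal p) μ)
    (hw : ∀ h, MemLp h (ENNReal.ofReal (p / (p - 1))) μ →
      Tendsto (fun k => ∫ x, f k x * h x ∂μ) atTop (𝓝 (∫ x, g x * h x ∂μ))) :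
    eLpNorm g (ENNReal.ofReal p) μ ≤ ENNReal.ofReal M := by
  have hpq : p.HolderConjugate (p / (p - 1)) := Real.HolderConjugate.conjExponent hp
  set q := p / (p - 1) with hq
  have hp0 := hpq.pos
  have hq0 := hpq.symm.pos
  have hpq1 : (p - 1) * q = p := by rw [hq]; field_simp [show p - 1 ≠ 0 by linarith]
  -- The extremal function of Hölder's inequality: `g h = |g|^p`, and the dual norm of `h` is the
  -- `(p-1)`-th power of the norm of `g`. Testing with it yields `G^p ≤ M G^(p-1)`.
  set h : α → ℝ := fun x => SignType.sign (g x) * |g x| ^ (p - 1) with hh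
  have hhm : AEStronglyMeasurable h μ := by
    have h1 : AEMeasurable g μ := hg.1.aemeasurable
    have h2 : Measurable fun t : ℝ => (SignType.sign t : ℝ) * |t| ^ (p - 1) := by
      have : (fun t : ℝ => (SignType.sign t : ℝ)) = fun t => if 0 < t then 1 else if t < 0 then -1 else 0 := by
        ext t; rw [sign_apply]; split_ifs <;> simp
      refine Measurable.mul ?_ (by fun_prop)
      rw [this]
      exact Measurable.ite measurableSet_Ioi measurable_const
        (Measurable.ite measurableSet_Iio measurable_const measurable_const)
    exact (h2.comp_aemeasurable h1).aestronglyMeasurable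
  have hnorm : ∀ x, ‖h x‖ₑ ^ q = ‖g x‖ₑ ^ p := by
    intro x
    rcases eq_or_ne (g x) 0 with h0 | h0
    · simp [hh, h0, ENNReal.zero_rpow_of_pos hp0, ENNReal.zero_rpow_of_pos hq0]
    · have e : ‖h x‖ = ‖g x‖ ^ (p - 1) := by
        simp only [hh, norm_mul, Real.norm_eq_abs, abs_of_nonneg (Real.rpow_nonneg (abs_nonneg (g x)) _)]
        rcases lt_or_gt_of_ne h0 with h0 | h0 <;> simp [h0]
      rw [← ofReal_norm, ← ofReal_norm, e, ENNReal.ofReal_rpow_of_nonneg (by positivity) hq0.le,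
        ENNReal.ofReal_rpow_of_nonneg (by positivity) hp0.le, ← Real.rpow_mul (norm_nonneg _), hpq1]
  have hhq : eLpNorm h (ENNReal.ofReal q) μ ^ q = eLpNorm g (ENNReal.ofReal p) μ ^ p := by
    rw [eLpNorm_rpow hq0, eLpNorm_rpow hp0]
    exact lintegral_congr hnorm
  have hhL : MemLp h (ENNReal.ofReal q) μ := by
    refine ⟨hhm, ?_⟩
    by_contra hcon
    rw [not_lt, top_le_iff] at hcon
    rw [hcon, ENNReal.top_rpow_of_pos hq0] at hhq
    exact (ENNReal.rpow_lt_top_of_nonneg hp0.le hg.2.ne).ne hhq.symm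
  set G := (eLpNorm g (ENNReal.ofReal p) μ).toReal with hG
  have hG0 : 0 ≤ G := ENNReal.toReal_nonneg
  have e1 : ∫ x, g x * h x ∂μ = G ^ p := by
    have : ∀ x, g x * h x = ‖g x‖ ^ p := fun x => by
      rcases eq_or_ne (g x) 0 with h0 | h0
      · simp [hh, h0, Real.zero_rpow hp0.ne']
      · have : ‖g x‖ ^ p = ‖g x‖ * ‖g x‖ ^ (p - 1) := by
          rw [Real.rpow_sub_one (by simpa using h0)]
          field_simp [show ‖g x‖ ≠ 0 by simpa using h0]
        rw [this]
        simp only [hh, Real.norm_eq_abs, ← mul_assoc, self_mul_sign]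
    simp only [this]
    have h2 := ofReal_integral_eq_lintegral_ofReal (hg.integrable_norm_rpow (by simpa using hp0)
      ENNReal.ofReal_ne_top) (Eventually.of_forall fun x => Real.rpow_nonneg (norm_nonneg _) _)
    rw [ENNReal.toReal_ofReal hp0.le] at h2
    simp only [← ENNReal.ofReal_rpow_of_nonneg (norm_nonneg _) hp0.le, ofReal_norm] at h2
    rw [← eLpNorm_rpow hp0] at h2
    have h3 := congrArg ENNReal.toReal h2
    rw [← ENNReal.toReal_rpow, ENNReal.toReal_ofReal (integral_nonneg fun x => by positivity)] at h3
    exact h3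
  have e2 : (eLpNorm h (ENNReal.ofReal q) μ).toReal = G ^ (p - 1) := by
    have h3 := congrArg ENNReal.toReal hhq
    rw [← ENNReal.toReal_rpow, ← ENNReal.toReal_rpow] at h3
    have h4 := congrArg (fun t : ℝ => t ^ (1 / q)) h3
    simp only [← Real.rpow_mul ENNReal.toReal_nonneg] at h4
    rw [mul_one_div_cancel hq0.ne', Real.rpow_one] at h4
    rw [h4]
    congr 1
    field_simp
    linarith
  have hle : G ^ p ≤ M * G ^ (p - 1) := by
    rw [← e1, ← e2]
    exact le_of_tendsto (hw h hhL) (Eventually.of_forall fun k =>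
      (le_abs_self _).trans (abs_integral_mul_le hp (hf k).1 hhL hM0 (hM k)))
  rw [← ENNReal.ofReal_toReal hg.2.ne]
  refine ENNReal.ofReal_le_ofReal ?_
  rcases hG0.eq_or_lt with h0 | h0
  · rw [← hG, ← h0]; exact hM0
  · have : G ^ p = G * G ^ (p - 1) := by
      rw [Real.rpow_sub_one h0.ne']; field_simp
    rw [this] at hle
    exact le_of_mul_le_mul_right hle (Real.rpow_pos_of_pos h0 _)

/-- A set function which is a limit of the integrals of a bounded sequence in `L^p` is a signed
measure. -/
lemma exists_signedMeasure [IsFiniteMeasure μ] (hp : 1 < p) {f : ℕ → α → ℝ}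
    (hf : ∀ k, MemLp (f k) (ENNReal.ofReal p) μ) {M : ℝ} (hM0 : 0 ≤ M)
    (hM : ∀ k, eLpNorm (f k) (ENNReal.ofReal p) μ ≤ ENNReal.ofReal M)
    (hl : ∀ A, MeasurableSet A → ∃ l, Tendsto (fun k => ∫ x in A, f k x ∂μ) atTop (𝓝 l)) :
    ∃ ν : SignedMeasure α, (∀ A, MeasurableSet A →
      Tendsto (fun k => ∫ x in A, f k x ∂μ) atTop (𝓝 (ν A))) ∧ ∀ A, μ A = 0 → ν A = 0 := by
  classical
  have hpq : p.HolderConjugate (p / (p - 1)) := Real.HolderConjugate.conjExponent hp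
  set q := p / (p - 1) with hq
  have hq0 := hpq.symm.pos
  have hP1 : 1 ≤ ENNReal.ofReal p := by simpa using hp.le
  have hfi : ∀ k, Integrable (f k) μ := fun k => (hf k).integrable hP1
  choose! ℓ hℓ using hl
  -- Hölder with an indicator survives the limit. This bound gives absolute continuity, and
  -- countable additivity because the tails of a disjoint union have small measure.
  have hb : ∀ A, MeasurableSet A → |ℓ A| ≤ M * ((μ A) ^ (1 / q)).toReal := by
    intro A hA
    refine le_of_tendsto (hℓ A hA).abs (Eventually.of_forall fun k => ?_)
    have h1 := abs_integral_mul_le hp (hf k).1 (memLp_indicator_const (ENNReal.ofReal q) hA (1 : ℝ)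
      (Or.inr (measure_ne_top μ A))) hM0 (hM k)
    rw [← hq, eLpNorm_indicator_const hA (by simpa using hq0) ENNReal.ofReal_ne_top,
      ENNReal.toReal_ofReal hq0.le, enorm_one, one_mul] at h1
    refine le_trans (le_of_eq ?_) h1
    congr 1
    rw [← integral_indicator hA]
    congr 1; ext x
    by_cases hx : x ∈ A <;> simp [hx]
  have hem : ℓ ∅ = 0 := by simpa [ENNReal.zero_rpow_of_pos (inv_pos.2 hq0)] using hb ∅ MeasurableSet.empty
  have hadd : ∀ A B, MeasurableSet A → MeasurableSet B → Disjoint A B → ℓ (A ∪ B) = ℓ A + ℓ B := by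
    intro A B hA hB hAB
    refine tendsto_nhds_unique (hℓ _ (hA.union hB)) (((hℓ A hA).add (hℓ B hB)).congr fun k => ?_)
    rw [setIntegral_union hAB hB (hfi k).integrableOn (hfi k).integrableOn]
  have hfin : ∀ (A : ℕ → Set α), (∀ i, MeasurableSet (A i)) → Pairwise (Function.onFun Disjoint A) →
      ∀ s : Finset ℕ, ℓ (⋃ i ∈ s, A i) = ∑ i ∈ s, ℓ (A i) := by
    intro A hA hd s
    induction s using Finset.induction_on with
    | empty => simp [hem]
    | insert a s ha ih =>
      rw [Finset.set_biUnion_insert, hadd _ _ (hA a) (Finset.measurableSet_biUnion _ fun i _ => hA i),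
        ih, Finset.sum_insert ha]
      rw [disjoint_iUnion₂_right]
      exact fun i hi => hd fun h => ha (h ▸ hi)
  let ν : SignedMeasure α :=
    { measureOf' := fun A => if MeasurableSet A then ℓ A else 0
      empty' := by simp [hem]
      not_measurable' := fun A hA => if_neg hA
      m_iUnion' := fun A hA hd => by
        simp only [hA, if_true, MeasurableSet.iUnion hA]
        have htail : Tendsto (fun s : Finset ℕ => M * ((∑' i : { x // x ∉ s }, μ (A i)) ^ (1 / q)).toReal)
            atTop (𝓝 0) := by
          have hs : ∑' i, μ (A i) ≠ ⊤ := by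
            rw [← measure_iUnion hd hA]; exact measure_ne_top _ _
          have h1 := (ENNReal.tendsto_tsum_compl_atTop_zero hs).ennrpow_const (1 / q)
          rw [ENNReal.zero_rpow_of_pos (by positivity)] at h1
          have h2 := (ENNReal.tendsto_toReal ENNReal.zero_ne_top).comp h1
          simpa using h2.const_mul M
        refine tendsto_iff_norm_sub_tendsto_zero.2 (squeeze_zero (fun _ => norm_nonneg _) (fun s => ?_) htail)
        set B := ⋃ i : { x // x ∉ s }, A i with hB
        have hBm : MeasurableSet B := MeasurableSet.iUnion fun i => hA i
        have hsm : MeasurableSet (⋃ i ∈ s, A i) := Finset.measurableSet_biUnion _ fun i _ => hA i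
        have hU : (⋃ i, A i) = (⋃ i ∈ s, A i) ∪ B := by
          ext x
          simp only [hB, mem_iUnion, mem_union, Subtype.exists, exists_prop]
          constructor
          · rintro ⟨i, hi⟩
            by_cases his : i ∈ s
            · exact Or.inl ⟨i, his, hi⟩
            · exact Or.inr ⟨i, his, hi⟩
          · rintro (⟨i, -, hi⟩ | ⟨i, -, hi⟩) <;> exact ⟨i, hi⟩
        have hdB : Disjoint (⋃ i ∈ s, A i) B := by
          rw [disjoint_iUnion₂_left]
          intro i hi
          rw [hB, disjoint_iUnion_right]
          exact fun j => hd fun h => j.2 (h ▸ hi)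
        rw [hU, hadd _ _ hsm hBm hdB, hfin A hA hd s, sub_add_cancel_left, norm_neg]
        refine (hb B hBm).trans ?_
        have hs : ∑' i : { x // x ∉ s }, μ (A i) ≠ ⊤ := by
          refine ((ENNReal.tsum_comp_le_tsum_of_injective Subtype.val_injective
            fun i => μ (A i)).trans_lt ?_).ne
          rw [← measure_iUnion hd hA]; exact measure_lt_top _ _
        gcongr
        · exact ENNReal.rpow_ne_top_of_nonneg (by positivity) hs
        · exact measure_iUnion_le _ }
  have hν : ∀ A, MeasurableSet A → ν A = ℓ A := fun A hA => if_pos hA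
  refine ⟨ν, fun A hA => by rw [hν A hA]; exact hℓ A hA, fun A hA => ?_⟩
  by_cases hAm : MeasurableSet A
  · rw [hν A hAm]
    simpa [hA, ENNReal.zero_rpow_of_pos (inv_pos.2 hq0)] using hb A hAm
  · exact ν.not_measurable hAm

/-- The limits of the integrals over sets form a signed measure, and `g` is its Radon–Nikodym
density with respect to `μ`. A priori `g` is only integrable. Restricted to `{|g| ≤ T}` it is the
weak limit of the restricted sequence, so its norm there is at most `M`, and Fatou lets `T → ∞`. -/
lemma exists_weak_limit [IsFiniteMeasure μ] (hp : 1 < p) {f : ℕ → α → ℝ}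
    (hf : ∀ k, MemLp (f k) (ENNReal.ofReal p) μ) {M : ℝ} (hM0 : 0 ≤ M)
    (hM : ∀ k, eLpNorm (f k) (ENNReal.ofReal p) μ ≤ ENNReal.ofReal M)
    (hl : ∀ A, MeasurableSet A → ∃ l, Tendsto (fun k => ∫ x in A, f k x ∂μ) atTop (𝓝 l)) :
    ∃ g, MemLp g (ENNReal.ofReal p) μ ∧ ∀ h, MemLp h (ENNReal.ofReal (p / (p - 1))) μ →
      Tendsto (fun k => ∫ x, f k x * h x ∂μ) atTop (𝓝 (∫ x, g x * h x ∂μ)) := by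
  have hp0 : 0 < p := by linarith
  obtain ⟨ν, hν, hν0⟩ := exists_signedMeasure hp hf hM0 hM hl
  set g := ν.rnDeriv μ with hg
  have hgm : Measurable g := SignedMeasure.measurable_rnDeriv ν μ
  have hgi : Integrable g μ := SignedMeasure.integrable_rnDeriv ν μ
  have hgν : ∀ A, MeasurableSet A → ∫ x in A, g x ∂μ = ν A := fun A hA => by
    have hac : VectorMeasure.AbsolutelyContinuous ν μ.toENNRealVectorMeasure :=
      VectorMeasure.AbsolutelyContinuous.mk fun B hB hB0 => by
        rw [Measure.toENNRealVectorMeasure_apply_measurable hB] at hB0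
        exact hν0 B hB0
    have := (SignedMeasure.absolutelyContinuous_iff_withDensityᵥ_rnDeriv_eq ν μ).1 hac
    rw [← withDensityᵥ_apply hgi hA, this]
  have hl' : ∀ A, MeasurableSet A → Tendsto (fun k => ∫ x in A, f k x ∂μ) atTop
      (𝓝 (∫ x in A, g x ∂μ)) := fun A hA => by rw [hgν A hA]; exact hν A hA
  have htr : ∀ T : ℕ, eLpNorm ({x | |g x| ≤ T}.indicator g) (ENNReal.ofReal p) μ ≤ ENNReal.ofReal M := by
    intro T
    set S := {x | |g x| ≤ T} with hS
    have hSm : MeasurableSet S := measurableSet_le hgm.abs measurable_const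
    have hgT : MemLp (S.indicator g) (ENNReal.ofReal p) μ := by
      refine MemLp.of_bound (hgm.indicator hSm).aestronglyMeasurable T (Eventually.of_forall fun x => ?_)
      by_cases hx : x ∈ S
      · rw [indicator_of_mem hx]
        exact hx
      · simp [hx]
    have hfT : ∀ k, MemLp (S.indicator (f k)) (ENNReal.ofReal p) μ := fun k => (hf k).indicator hSm
    have hMT : ∀ k, eLpNorm (S.indicator (f k)) (ENNReal.ofReal p) μ ≤ ENNReal.ofReal M := fun k =>
      (eLpNorm_indicator_le _).trans (hM k)
    refine eLpNorm_le_of_weak hp hfT hM0 hMT hgT fun h hh => ?_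
    refine tendsto_integral_mul_of_sets hp hfT hM0 hMT hgT (fun A hA => ?_) hh
    simp only [setIntegral_indicator hSm]
    exact hl' _ (hA.inter hSm)
  have hgL : MemLp g (ENNReal.ofReal p) μ := by
    refine ⟨hgm.aestronglyMeasurable, lt_of_le_of_lt ?_ (ENNReal.ofReal_lt_top (r := M))⟩
    rw [← ENNReal.rpow_le_rpow_iff hp0, eLpNorm_rpow hp0]
    calc ∫⁻ x, ‖g x‖ₑ ^ p ∂μ
        ≤ ∫⁻ x, liminf (fun T : ℕ => ‖{x | |g x| ≤ T}.indicator g x‖ₑ ^ p) atTop ∂μ := by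
          refine lintegral_mono fun x => ?_
          refine (Tendsto.liminf_eq ?_).ge
          refine tendsto_const_nhds.congr' ?_
          obtain ⟨T₀, hT₀⟩ := exists_nat_ge |g x|
          filter_upwards [eventually_ge_atTop T₀] with T hT
          rw [indicator_of_mem (show x ∈ {x | |g x| ≤ T} from hT₀.trans (by exact_mod_cast hT))]
      _ ≤ liminf (fun T : ℕ => ∫⁻ x, ‖{x | |g x| ≤ T}.indicator g x‖ₑ ^ p ∂μ) atTop :=
          lintegral_liminf_le fun T => ((hgm.indicator
            (measurableSet_le hgm.abs measurable_const)).enorm.pow_const p)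
      _ ≤ ENNReal.ofReal M ^ p := by
          refine liminf_le_of_le ?_ fun b hb => ?_
          · isBoundedDefault
          · obtain ⟨T, hT⟩ := hb.exists
            refine hT.trans ?_
            rw [← eLpNorm_rpow hp0]
            exact ENNReal.rpow_le_rpow (htr T) hp0.le
  exact ⟨g, hgL, fun h hh => tendsto_integral_mul_of_sets hp hf hM0 hM hgL hl' hh⟩

end Weak

/-! ### Compactness of bounded sequences of Sobolev maps -/

section WeakVec
variable {α : Type*} {mα : MeasurableSpace α} {μ : Measure α} {p : ℝ}

lemma tendsto_integral_mul_of_eLpNorm (hp : 1 < p) {f : ℕ → α → ℝ} {g h : α → ℝ}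
    (hf : ∀ k, MemLp (f k) (ENNReal.ofReal p) μ) (hg : MemLp g (ENNReal.ofReal p) μ)
    (hfg : Tendsto (fun k => eLpNorm (f k - g) (ENNReal.ofReal p) μ) atTop (𝓝 0))
    (hh : MemLp h (ENNReal.ofReal (p / (p - 1))) μ) :
    Tendsto (fun k => ∫ x, f k x * h x ∂μ) atTop (𝓝 (∫ x, g x * h x ∂μ)) := by
  rw [tendsto_iff_norm_sub_tendsto_zero]
  have h1 := ((ENNReal.tendsto_toReal ENNReal.zero_ne_top).comp hfg).mul_const
    (eLpNorm h (ENNReal.ofReal (p / (p - 1))) μ).toReal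
  rw [ENNReal.toReal_zero, zero_mul] at h1
  refine squeeze_zero (fun _ => norm_nonneg _) (fun k => ?_) h1
  rw [← integral_sub (integrable_mul_conj hp (hf k) hh) (integrable_mul_conj hp hg hh)]
  simp only [← sub_mul]
  exact abs_integral_mul_le hp ((hf k).sub hg).1 hh ENNReal.toReal_nonneg
    (ENNReal.ofReal_toReal ((hf k).sub hg).2.ne).ge

lemma tendsto_integral_inner_of_coord (hp : 1 < p) {ι : Type*} [Fintype ι]
    {f : ℕ → α → EuclideanSpace ℝ ι} {g : α → EuclideanSpace ℝ ι}
    (hf : ∀ k, MemLp (f k) (ENNReal.ofReal p) μ) (hg : MemLp g (ENNReal.ofReal p) μ)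
    (hfg : ∀ i h, MemLp h (ENNReal.ofReal (p / (p - 1))) μ →
      Tendsto (fun k => ∫ x, f k x i * h x ∂μ) atTop (𝓝 (∫ x, g x i * h x ∂μ)))
    {G : α → EuclideanSpace ℝ ι} (hG : MemLp G (ENNReal.ofReal (p / (p - 1))) μ) :
    Tendsto (fun k => ∫ x, inner ℝ (G x) (f k x) ∂μ) atTop (𝓝 (∫ x, inner ℝ (G x) (g x) ∂μ)) := by
  have hGi := memLp_piLp_iff.1 hG
  have e : ∀ {f : α → EuclideanSpace ℝ ι}, MemLp f (ENNReal.ofReal p) μ →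
      ∫ x, inner ℝ (G x) (f x) ∂μ = ∑ i, ∫ x, f x i * G x i ∂μ := by
    intro f hf
    rw [← integral_finsetSum _ fun i _ => integrable_mul_conj hp (memLp_piLp_iff.1 hf i) (hGi i)]
    refine integral_congr_ae (Eventually.of_forall fun x => ?_)
    simp [PiLp.inner_apply]
  simp only [e hg, fun k => e (hf k)]
  exact tendsto_finsetSum _ fun i _ => hfg i _ (hGi i)

end WeakVec

section Sobolev
variable {p R M : ℝ} {z : ℕ → Vec n → Vec N} {Z : ℕ → Vec n → Mat N n}

/-- The Rellich–Kondrachov theorem for maps vanishing outside a ball. -/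
lemma exists_subseq_sobolev (hn : 1 ≤ n) (hp : 1 ≤ p) (hR : 0 < R) (hM : 0 ≤ M)
    (hg : ∀ k, HasWeakGrad univ (z k) (Z k)) (hz : ∀ k, MemLp (z k) (ENNReal.ofReal p))
    (hZ : ∀ k, MemLp (Z k) (ENNReal.ofReal p)) (h0 : ∀ k, ∀ x ∉ Metric.ball 0 R, z k x = 0)
    (hZM : ∀ k, eLpNorm (Z k) (ENNReal.ofReal p) ≤ ENNReal.ofReal M) :
    ∃ φ : ℕ → ℕ, StrictMono φ ∧ ∃ g : Vec n → Vec N, MemLp g (ENNReal.ofReal p) ∧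
      Tendsto (fun k => eLpNorm (z (φ k) - g) (ENNReal.ofReal p)) atTop (𝓝 0) := by
  have hP1 : 1 ≤ ENNReal.ofReal p := by simpa using hp
  have hMM : M ≤ (2 * R + 1) * M := by nlinarith
  obtain ⟨φ, hφ, h⟩ := exists_subseq_tendsto_eLpNorm hp (z := fun k i x => z k x i) (R := R)
    (M := (2 * R + 1) * M) (fun k i => memLp_piLp_iff.1 (hz k) i)
    (fun k i x hx => by simp [h0 k x hx])
    (fun k i => by
      refine (eLpNorm_coord_le (z k) i _).trans (((hg k).poincare hn hp hR (hz k) (hZ k) (h0 k)).trans ?_)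
      refine (mul_le_mul_right (hZM k) _).trans ?_
      rw [← ENNReal.ofReal_mul (by positivity)]
      exact ENNReal.ofReal_le_ofReal (by nlinarith))
    (fun k i t => by
      refine (eLpNorm_coord_le (fun x => z k (x - t) - z k x) i _).trans ?_
      refine ((hg k).eLpNorm_translate_le hp (isCompact_closedBall (0 : Vec n) R) (hz k) (hZ k)
        (fun x hx => h0 k x fun h' => hx (Metric.ball_subset_closedBall h')) t).trans ?_
      gcongr
      exact (hZM k).trans (ENNReal.ofReal_le_ofReal hMM))
  choose g hg1 hg2 using h
  refine ⟨φ, hφ, fun x => WithLp.toLp 2 fun i => g i x, memLp_piLp_iff.2 hg1, ?_⟩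
  have hsum := tendsto_finsetSum Finset.univ fun i _ => hg2 i
  rw [Finset.sum_const_zero] at hsum
  refine tendsto_of_tendsto_of_tendsto_of_le_of_le tendsto_const_nhds hsum (fun _ => zero_le)
    fun k => ?_
  exact eLpNorm_euclidean_le (fun i => (memLp_piLp_iff.1 (hz (φ k)) i).1.sub (hg1 i).1) hP1

lemma exists_test_eLpNorm_sub_le {q : ℝ} (hq : 1 ≤ q) {A : Set (Vec n)} (hA : MeasurableSet A)
    (hb : Bornology.IsBounded A) {ε : ℝ≥0∞} (hε : ε ≠ 0) :
    ∃ s : Vec n → ℝ, IsTest univ s ∧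
      eLpNorm (fun x => s x - A.indicator (fun _ => 1) x) (ENNReal.ofReal q) ≤ ε := by
  have hL : ∀ q, MemLp (A.indicator fun _ => (1 : ℝ)) q (volume : Measure (Vec n)) := fun q =>
    memLp_indicator_const q hA 1 (Or.inr hb.measure_lt_top.ne)
  have h1 := isTest_moll (f := A.indicator fun _ => (1 : ℝ)) (K := closure A) (O := univ)
    (memLp_one_iff_integrable.1 (hL 1)).locallyIntegrable hb.isCompact_closure isOpen_univ (subset_univ _)
    fun x hx => indicator_of_notMem (fun h => hx (subset_closure h)) _
  obtain ⟨k, h2, h3⟩ := (h1.and ((ENNReal.tendsto_nhds_zero.1 (tendsto_moll hq (hL _))) ε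
    hε.bot_lt)).exists
  exact ⟨_, h2, h3⟩

/-- Rellich gives strong convergence of the maps, so gradients tested with smooth functions converge
after integration by parts. Indicators are limits of test functions in the dual norm, hence the
integrals of the gradients over measurable sets converge and `exists_weak_limit` applies. The limit
is the weak gradient because both sides of the integration by parts formula converge. -/
lemma exists_subseq_sobolev_weak (hn : 1 ≤ n) (hp : 1 < p) (hR : 0 < R) (hM : 0 ≤ M)
    (hg : ∀ k, HasWeakGrad univ (z k) (Z k)) (hz : ∀ k, MemLp (z k) (ENNReal.ofReal p))
    (hZ : ∀ k, MemLp (Z k) (ENNReal.ofReal p)) (h0 : ∀ k, ∀ x ∉ Metric.ball 0 R, z k x = 0)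
    (hZM : ∀ k, eLpNorm (Z k) (ENNReal.ofReal p) ≤ ENNReal.ofReal M) :
    ∃ φ : ℕ → ℕ, StrictMono φ ∧ ∃ (g : Vec n → Vec N) (G : Vec n → Mat N n),
      MemLp g (ENNReal.ofReal p) ∧ MemLp G (ENNReal.ofReal p) (volume.restrict (Metric.ball 0 R)) ∧
      HasWeakGrad (Metric.ball 0 R) g G ∧
      Tendsto (fun k => eLpNorm (z (φ k) - g) (ENNReal.ofReal p)) atTop (𝓝 0) ∧
      (∀ i h, MemLp h (ENNReal.ofReal (p / (p - 1))) (volume.restrict (Metric.ball 0 R)) →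
        Tendsto (fun k => ∫ x in Metric.ball 0 R, z (φ k) x i * h x) atTop
          (𝓝 (∫ x in Metric.ball 0 R, g x i * h x))) ∧
      ∀ ij h, MemLp h (ENNReal.ofReal (p / (p - 1))) (volume.restrict (Metric.ball 0 R)) →
        Tendsto (fun k => ∫ x in Metric.ball 0 R, Z (φ k) x ij * h x) atTop
          (𝓝 (∫ x in Metric.ball 0 R, G x ij * h x)) := by
  have hpq : p.HolderConjugate (p / (p - 1)) := Real.HolderConjugate.conjExponent hp
  have hP1 : 1 ≤ ENNReal.ofReal p := by simpa using hp.le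
  obtain ⟨φ, hφ, g, hgL, hgz⟩ := exists_subseq_sobolev hn hp.le hR hM hg hz hZ h0 hZM
  set B := Metric.ball (0 : Vec n) R with hB
  have hfin : IsFiniteMeasure (volume.restrict B) := ⟨by simpa [hB] using measure_ball_lt_top⟩
  have hzi : ∀ i {μ : Measure (Vec n)}, μ ≤ volume → ∀ h, MemLp h (ENNReal.ofReal (p / (p - 1))) μ →
      Tendsto (fun k => ∫ x, z (φ k) x i * h x ∂μ) atTop (𝓝 (∫ x, g x i * h x ∂μ)) := by
    intro i μ hμ h hh
    refine tendsto_integral_mul_of_eLpNorm hp (fun k => (memLp_piLp_iff.1 (hz (φ k)) i).mono_measure hμ)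
      ((memLp_piLp_iff.1 hgL i).mono_measure hμ) ?_ hh
    refine tendsto_of_tendsto_of_tendsto_of_le_of_le tendsto_const_nhds hgz (fun _ => zero_le)
      fun k => ?_
    exact (eLpNorm_mono_measure _ hμ).trans (eLpNorm_coord_le (z (φ k) - g) i _)
  have hZi : ∀ k ij, MemLp (fun x => Z k x ij) (ENNReal.ofReal p) := fun k => memLp_piLp_iff.1 (hZ k)
  have hZiM : ∀ k ij {μ : Measure (Vec n)}, μ ≤ volume →
      eLpNorm (fun x => Z k x ij) (ENNReal.ofReal p) μ ≤ ENNReal.ofReal M := fun k ij μ hμ =>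
    (eLpNorm_mono_measure _ hμ).trans ((eLpNorm_coord_le (Z k) ij _).trans (hZM k))
  have htest : ∀ (ij : Fin N × Fin n) (s : Vec n → ℝ), IsTest univ s →
      Tendsto (fun k => ∫ x, Z (φ k) x ij * s x) atTop (𝓝 (-∫ x, g x ij.1 * pderiv ij.2 s x)) := by
    intro ij s hs
    refine (hzi ij.1 le_rfl _ ((hs.pderiv ij.2).memLp _)).neg.congr fun k => ?_
    rw [((hg (φ k)).wd ij.1 ij.2).parts s hs, neg_neg]
  have hset : ∀ (ij : Fin N × Fin n) (A : Set (Vec n)), MeasurableSet A →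
      ∃ l, Tendsto (fun k => ∫ x in A, Z (φ k) x ij ∂(volume.restrict B)) atTop (𝓝 l) := by
    intro ij A hA
    refine cauchySeq_tendsto_of_complete (cauchySeq_iff_tendsto_dist_atTop_0.2 ?_)
    have hAB : MeasurableSet (A ∩ B) := hA.inter measurableSet_ball
    have hABb : Bornology.IsBounded (A ∩ B) := Metric.isBounded_ball.subset inter_subset_right
    -- The limit is not yet known, so the Cauchy property is proved by working with differences
    -- indexed by pairs.
    have hz0 := tendsto_integral_mul_zero (μ := (volume : Measure (Vec n))) hp (l := atTop)
      (F := fun (a : ℕ × ℕ) x => Z (φ a.1) x ij - Z (φ a.2) x ij) (fun a => (hZi _ ij).sub (hZi _ ij))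
      (M := M + M) (by positivity) (fun a => (eLpNorm_sub_le (hZi _ ij).1 (hZi _ ij).1 hP1).trans (by
        rw [ENNReal.ofReal_add hM hM]
        exact add_le_add (hZiM _ ij le_rfl) (hZiM _ ij le_rfl)))
      (h := (A ∩ B).indicator fun _ => 1)
      (memLp_indicator_const _ hAB 1 (Or.inr hABb.measure_lt_top.ne)) fun ε hε => by
        obtain ⟨s, hs1, hs2⟩ := exists_test_eLpNorm_sub_le hpq.symm.lt.le hAB hABb hε
        refine ⟨s, hs1.memLp _, ?_, ?_⟩
        · rw [eLpNorm_sub_comm]; exact hs2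
        · have h3 := cauchySeq_iff_tendsto_dist_atTop_0.1 (htest ij s hs1).cauchySeq
          refine (tendsto_zero_iff_norm_tendsto_zero.2 (h3.congr fun a => ?_))
          rw [Real.dist_eq, ← integral_sub (integrable_mul_conj hp (hZi _ ij) (hs1.memLp _))
            (integrable_mul_conj hp (hZi _ ij) (hs1.memLp _))]
          simp only [sub_mul, Real.norm_eq_abs]
    refine (tendsto_zero_iff_norm_tendsto_zero.1 hz0).congr fun a => ?_
    rw [Real.dist_eq, ← integral_sub (((hZi _ ij).restrict B).integrable hP1).integrableOn
      (((hZi _ ij).restrict B).integrable hP1).integrableOn, Real.norm_eq_abs,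
      Measure.restrict_restrict hA, ← integral_indicator hAB]
    congr 2
    ext x
    by_cases hx : x ∈ A ∩ B
    · rw [indicator_of_mem hx, indicator_of_mem hx, mul_one]
    · rw [indicator_of_notMem hx, indicator_of_notMem hx, mul_zero]
  choose G hG1 hG2 using fun ij => exists_weak_limit hp (fun k => (hZi (φ k) ij).restrict B) hM
    (fun k => hZiM (φ k) ij Measure.restrict_le_self) (hset ij)
  have hGL : MemLp (fun x => WithLp.toLp 2 fun ij => G ij x : Vec n → Mat N n) (ENNReal.ofReal p)
      (volume.restrict B) := memLp_piLp_iff.2 hG1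
  refine ⟨φ, hφ, g, fun x => WithLp.toLp 2 fun ij => G ij x, hgL, hGL, ?_,
    hgz, fun i => hzi i Measure.restrict_le_self, hG2⟩
  refine ⟨(hgL.locallyIntegrable hP1).locallyIntegrableOn _,
    IntegrableOn.locallyIntegrableOn (hGL.integrable hP1), fun s hs i j => ?_⟩
  have h1 := hzi i (μ := volume.restrict B) Measure.restrict_le_self _ ((hs.pderiv j).memLp _ |>.restrict B)
  have h2 := (hG2 (i, j) s ((hs.memLp _).restrict B)).neg
  refine tendsto_nhds_unique h1 (h2.congr fun k => ?_)
  rw [((hg (φ k)).mono (subset_univ B)).2.2 s hs i j]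

end Sobolev

/-! ### Coercivity -/

section Integrand

lemma refV_nonneg {p : ℝ} (hp : 0 ≤ p) (z : Mat N n) : 0 ≤ refV p z := by
  have : 1 ≤ (1 + ‖z‖ ^ 2) ^ (p / 2) := Real.one_le_rpow (by nlinarith [sq_nonneg ‖z‖]) (by positivity)
  unfold refV; linarith

lemma rpow_le_refV {p : ℝ} (hp : 0 ≤ p) (z : Mat N n) : ‖z‖ ^ p - 1 ≤ refV p z := by
  have h1 : ‖z‖ ^ p = (‖z‖ ^ 2) ^ (p / 2) := by
    rw [← Real.rpow_natCast, ← Real.rpow_mul (norm_nonneg _)]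
    congr 1; push_cast; ring
  have : (‖z‖ ^ 2) ^ (p / 2) ≤ (1 + ‖z‖ ^ 2) ^ (p / 2) := by gcongr; linarith
  unfold refV; linarith

/-- Because `p ≤ q`, the integrand `F - ℓ V_p` still has `q`-growth, so its quasiconvexity
inequality extends to `W^{1,q}` maps. -/
lemma refV_le {p q : ℝ} (hp : 0 ≤ p) (hpq : p ≤ q) (z : Mat N n) :
    refV p z ≤ 2 ^ (q / 2) * (1 + ‖z‖ ^ q) := by
  have hq : 0 ≤ q := hp.trans hpq
  have h0 : (1 + ‖z‖ ^ 2) ^ (p / 2) ≤ (1 + ‖z‖ ^ 2) ^ (q / 2) :=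
    Real.rpow_le_rpow_of_exponent_le (by nlinarith [sq_nonneg ‖z‖]) (by linarith)
  have h1 : ‖z‖ ^ q = (‖z‖ ^ 2) ^ (q / 2) := by
    rw [← Real.rpow_natCast, ← Real.rpow_mul (norm_nonneg _)]
    congr 1; push_cast; ring
  have h2 : (1 + ‖z‖ ^ 2) ^ (q / 2) ≤ 2 ^ (q / 2) * (1 + ‖z‖ ^ q) := by
    rcases le_total (‖z‖ ^ 2) 1 with h | h
    · have : (1 + ‖z‖ ^ 2) ^ (q / 2) ≤ 2 ^ (q / 2) := by gcongr; linarith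
      have h3 : 0 ≤ ‖z‖ ^ q := by positivity
      have h4 : (0 : ℝ) ≤ 2 ^ (q / 2) := by positivity
      nlinarith
    · have : (1 + ‖z‖ ^ 2) ^ (q / 2) ≤ (2 * ‖z‖ ^ 2) ^ (q / 2) := by gcongr; linarith
      rw [Real.mul_rpow (by norm_num) (by positivity), ← h1] at this
      have h4 : (0 : ℝ) ≤ 2 ^ (q / 2) := by positivity
      nlinarith
  unfold refV; linarith

lemma continuous_refV (p : ℝ) : Continuous (refV p : Mat N n → ℝ) := by
  unfold refV
  refine Continuous.sub (Continuous.rpow_const (by fun_prop) fun z => Or.inl ?_) continuous_const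
  positivity

lemma norm_add_rpow_le {E : Type*} [NormedAddCommGroup E] {q : ℝ} (hq : 0 ≤ q) (a b : E) :
    ‖a + b‖ ^ q ≤ 2 ^ q * (‖a‖ ^ q + ‖b‖ ^ q) := by
  have h1 : ‖a + b‖ ≤ 2 * max ‖a‖ ‖b‖ := by
    linarith [norm_add_le a b, le_max_left ‖a‖ ‖b‖, le_max_right ‖a‖ ‖b‖]
  calc ‖a + b‖ ^ q ≤ (2 * max ‖a‖ ‖b‖) ^ q := by gcongr
    _ = 2 ^ q * (max ‖a‖ ‖b‖) ^ q := Real.mul_rpow (by norm_num) (by positivity)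
    _ ≤ 2 ^ q * (‖a‖ ^ q + ‖b‖ ^ q) := by
      gcongr
      have h1 : 0 ≤ ‖a‖ ^ q := by positivity
      have h2 : 0 ≤ ‖b‖ ^ q := by positivity
      rcases max_choice ‖a‖ ‖b‖ with h | h <;> rw [h] <;> linarith

lemma integrable_norm_rpow_of_memLp {α E : Type*} [NormedAddCommGroup E] {m : MeasurableSpace α}
    {μ : Measure α} {q : ℝ} (hq : 0 < q) {Z : α → E} (hZ : MemLp Z (ENNReal.ofReal q) μ) :
    Integrable (fun x => ‖Z x‖ ^ q) μ := by
  simpa [ENNReal.toReal_ofReal hq.le] using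
    hZ.integrable_norm_rpow (by simpa using hq) ENNReal.ofReal_ne_top

lemma lintegral_rpow_eq_ofReal {α E : Type*} [NormedAddCommGroup E] {m : MeasurableSpace α}
    {μ : Measure α} {q : ℝ} (hq : 0 < q) {Z : α → E} (hZ : MemLp Z (ENNReal.ofReal q) μ) :
    ∫⁻ x, ‖Z x‖ₑ ^ q ∂μ = ENNReal.ofReal (∫ x, ‖Z x‖ ^ q ∂μ) := by
  rw [ofReal_integral_eq_lintegral_ofReal (integrable_norm_rpow_of_memLp hq hZ)
    (Eventually.of_forall fun x => Real.rpow_nonneg (norm_nonneg _) _)]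
  simp only [← ENNReal.ofReal_rpow_of_nonneg (norm_nonneg _) hq.le, ofReal_norm]

lemma integrable_comp_of_growth {α : Type*} {m : MeasurableSpace α} {μ : Measure α}
    [IsFiniteMeasure μ] {q L : ℝ} (hq : 0 < q) {F : Mat N n → ℝ} (hF : Continuous F)
    (hL : ∀ z, |F z| ≤ L * (1 + ‖z‖ ^ q)) {Z : α → Mat N n} (hZ : MemLp Z (ENNReal.ofReal q) μ) :
    Integrable (fun x => F (Z x)) μ :=
  Integrable.mono' (((integrable_const 1).add (integrable_norm_rpow_of_memLp hq hZ)).const_mul L)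
    (hF.comp_aestronglyMeasurable hZ.1) (Eventually.of_forall fun x => hL (Z x))

/-- This rescaling preserves the values of the gradient, which carries quasiconvexity from the unit
ball to centred balls of any radius. -/
lemma IsTest.rescale {R : ℝ} (hR : 0 < R) {φ : Vec n → Vec N} (h : IsTest (Metric.ball 0 R) φ) :
    IsTest (Metric.ball 0 1) (fun x => R⁻¹ • φ (R • x)) := by
  have hs : tsupport (fun x => R⁻¹ • φ (R • x)) ⊆ (fun x => R • x) ⁻¹' tsupport φ := by
    refine closure_minimal (fun x hx => subset_tsupport _ ?_)
      ((isClosed_tsupport φ).preimage (continuous_const_smul R))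
    intro h'
    exact hx (by simp [h'])
  have hb : tsupport (fun x => R⁻¹ • φ (R • x)) ⊆ Metric.ball 0 1 := fun x hx => by
    have := h.2.2 (hs hx)
    rw [mem_ball_zero_iff, norm_smul, Real.norm_of_nonneg hR.le] at this
    rw [mem_ball_zero_iff]
    by_contra hc
    nlinarith
  have hc : ContDiff ℝ ∞ fun x => R⁻¹ • φ (R • x) := by
    have := h.1
    fun_prop
  refine ⟨hc, ?_, hb⟩
  exact (isCompact_closedBall (0 : Vec n) 1).of_isClosed_subset (isClosed_tsupport _)
    (hb.trans Metric.ball_subset_closedBall)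

lemma grad_rescale {R : ℝ} (hR : 0 < R) {φ : Vec n → Vec N} (h : Differentiable ℝ φ) (x : Vec n) :
    grad (fun x => R⁻¹ • φ (R • x)) x = grad φ (R • x) := by
  have h1 : HasFDerivAt (fun x => R⁻¹ • φ (R • x)) (R⁻¹ • (fderiv ℝ φ (R • x)).comp
      (R • ContinuousLinearMap.id ℝ (Vec n))) x :=
    ((h (R • x)).hasFDerivAt.comp x ((hasFDerivAt_id x).const_smul R)).const_smul R⁻¹
  ext ij
  simp only [grad, pderiv, h1.fderiv]
  simp [hR.ne']

lemma QuasiconvexAt.le_integral_test {G : Mat N n → ℝ} (h : QuasiconvexAt G 0) {R : ℝ} (hR : 0 < R)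
    {φ : Vec n → Vec N} (hφ : IsTest (Metric.ball 0 R) φ) :
    volume.real (Metric.ball (0 : Vec n) R) * G 0 ≤ ∫ x in Metric.ball (0 : Vec n) R, G (grad φ x) := by
  have h1 := h _ (hφ.rescale hR)
  simp only [grad_rescale hR hφ.differentiable, zero_add] at h1
  rw [setAverage_eq, Measure.setIntegral_comp_smul_of_pos volume (fun x => G (grad φ x)) _ hR,
    smul_unitBall_of_pos hR, smul_smul] at h1
  have hv : volume.real (Metric.ball (0 : Vec n) R) =
      R ^ (Module.finrank ℝ (Vec n)) * volume.real (Metric.ball (0 : Vec n) 1) := by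
    rw [Measure.real, Measure.addHaar_ball_of_pos _ _ hR, ENNReal.toReal_mul,
      ENNReal.toReal_ofReal (by positivity), Measure.real]
  have hv1 : 0 < volume.real (Metric.ball (0 : Vec n) 1) :=
    ENNReal.toReal_pos (Metric.measure_ball_pos volume _ one_pos).ne' measure_ball_lt_top.ne
  rw [← mul_inv, mul_comm (volume.real _), ← hv, smul_eq_mul, inv_mul_eq_div] at h1
  rw [le_div_iff₀ (by rw [hv]; positivity)] at h1
  linarith

/-- Test maps `φ_k` approximate `(z, Z)` in `W^{1,q}`. By the growth bound, `C + c |Z|^q + c |∇φ_k -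
Z|^q - G(∇φ_k)` is nonnegative; Fatou along an almost everywhere convergent subsequence bounds `∫
G(Z)` from below, which is the direction required. -/
lemma QuasiconvexAt.le_integral {G : Mat N n → ℝ} (h : QuasiconvexAt G 0) (hGc : Continuous G)
    {q C : ℝ} (hq : 1 ≤ q) (hC : ∀ z, |G z| ≤ C * (1 + ‖z‖ ^ q)) {R : ℝ} (hR : 0 < R)
    {K : Set (Vec n)} (hK : IsCompact K) (hKB : K ⊆ Metric.ball 0 R) {z : Vec n → Vec N}
    {Z : Vec n → Mat N n} (hz : MemLp z (ENNReal.ofReal q)) (hZ : MemLp Z (ENNReal.ofReal q))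
    (hg : HasWeakGrad univ z Z) (h0 : ∀ x ∉ K, z x = 0) :
    volume.real (Metric.ball (0 : Vec n) R) * G 0 ≤ ∫ x in Metric.ball (0 : Vec n) R, G (Z x) := by
  have hq0 : 0 < q := by linarith
  set B := Metric.ball (0 : Vec n) R with hB
  have hfin : IsFiniteMeasure (volume.restrict B) := ⟨by simpa [hB] using measure_ball_lt_top⟩
  have hC0 : 0 ≤ C := by
    have := (abs_nonneg _).trans (hC 0)
    rw [norm_zero, Real.zero_rpow hq0.ne'] at this
    linarith
  obtain ⟨φ, hφ, -, hφZ⟩ := exists_test_seq hq Metric.isOpen_ball hK hKB hz hZ hg h0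
  have hgL : ∀ k, MemLp (grad (φ k)) (ENNReal.ofReal q) := fun k => (hφ k).isTest_grad.memLp _
  obtain ⟨σ, hσ, hσZ⟩ := (tendstoInMeasure_of_tendsto_eLpNorm (by simpa using hq0)
    (fun k => (hgL k).1) hZ.1 hφZ).exists_seq_tendsto_ae
  set c : ℝ := C * 2 ^ q with hc
  set D : ℕ → Vec n → ℝ := fun k x => ‖(grad (φ (σ k)) - Z) x‖ ^ q with hD
  have hDi : ∀ k, IntegrableOn (D k) B := fun k =>
    (integrable_norm_rpow_of_memLp hq0 ((hgL _).sub hZ)).integrableOn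
  have hZi : IntegrableOn (fun x => ‖Z x‖ ^ q) B := (integrable_norm_rpow_of_memLp hq0 hZ).integrableOn
  set H : Vec n → ℝ := fun x => C + c * ‖Z x‖ ^ q with hH
  have hHi : IntegrableOn H B := (integrable_const C).add (hZi.const_mul c)
  have hGi : ∀ k, IntegrableOn (fun x => G (grad (φ (σ k)) x)) B := fun k =>
    integrable_comp_of_growth hq0 hGc hC ((hgL _).restrict B)
  have hGZ : IntegrableOn (fun x => G (Z x)) B := integrable_comp_of_growth hq0 hGc hC (hZ.restrict B)
  have hpt : ∀ a b : Mat N n, ‖a‖ ^ q ≤ 2 ^ q * (‖b‖ ^ q + ‖a - b‖ ^ q) := fun a b => by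
    simpa using norm_add_rpow_le hq0.le b (a - b)
  have hnn : ∀ (a : Mat N n) x, 0 ≤ H x + c * ‖a - Z x‖ ^ q - G a := fun a x => by
    have h1 := le_of_abs_le (hC a)
    have h2 := mul_le_mul_of_nonneg_left (hpt a (Z x)) hC0
    simp only [hH, hc]
    nlinarith
  have hDt : Tendsto (fun k => ∫ x in B, D k x) atTop (𝓝 0) := by
    have h1 : Tendsto (fun k => ENNReal.ofReal (∫ x in B, D k x)) atTop (𝓝 0) := by
      have h2 := ((hφZ.comp hσ.tendsto_atTop)).ennrpow_const q
      rw [ENNReal.zero_rpow_of_pos hq0] at h2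
      refine tendsto_of_tendsto_of_tendsto_of_le_of_le tendsto_const_nhds h2 (fun _ => zero_le)
        fun k => ?_
      rw [← lintegral_rpow_eq_ofReal hq0 (((hgL (σ k)).sub hZ).restrict B), ← eLpNorm_rpow hq0]
      exact ENNReal.rpow_le_rpow (eLpNorm_mono_measure _ Measure.restrict_le_self) hq0.le
    have h3 := (ENNReal.tendsto_toReal ENNReal.zero_ne_top).comp h1
    refine h3.congr fun k => ?_
    exact ENNReal.toReal_ofReal (integral_nonneg fun x => Real.rpow_nonneg (norm_nonneg _) _)
  have hmain : ∫ x in B, (H x - G (Z x)) ≤ (∫ x in B, H x) - volume.real B * G 0 := by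
    have hlim : Tendsto (fun k => (∫ x in B, H x) + c * (∫ x in B, D k x) - volume.real B * G 0) atTop
        (𝓝 ((∫ x in B, H x) - volume.real B * G 0)) := by
      simpa using ((hDt.const_mul c).const_add (∫ x in B, H x)).sub_const (volume.real B * G 0)
    have hint : ∀ k, ∫ x in B, (H x + c * D k x - G (grad (φ (σ k)) x)) ≤
        (∫ x in B, H x) + c * (∫ x in B, D k x) - volume.real B * G 0 := fun k => by
      rw [integral_sub (f := fun x => H x + c * D k x) (hHi.add ((hDi k).const_mul c)) (hGi k), integral_add hHi ((hDi k).const_mul c),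
        integral_const_mul]
      linarith [h.le_integral_test hR (hφ (σ k))]
    have h0' : 0 ≤ (∫ x in B, H x) - volume.real B * G 0 := ge_of_tendsto hlim
      (Eventually.of_forall fun k => le_trans (integral_nonneg fun x => hnn _ x) (hint k))
    rw [← ENNReal.ofReal_le_ofReal_iff h0',
      ofReal_integral_eq_lintegral_ofReal (f := fun x => H x - G (Z x)) (hHi.sub hGZ) (Eventually.of_forall fun x => by
        simpa [Real.zero_rpow hq0.ne'] using hnn (Z x) x)]
    calc ∫⁻ x in B, ENNReal.ofReal (H x - G (Z x))
        ≤ ∫⁻ x in B, liminf (fun k => ENNReal.ofReal (H x + c * D k x - G (grad (φ (σ k)) x))) atTop := by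
          refine lintegral_mono_ae ((ae_restrict_of_ae hσZ).mono fun x hx => ?_)
          refine (Tendsto.liminf_eq ?_).ge
          refine (ENNReal.continuous_ofReal.tendsto _).comp ?_
          have hd : Tendsto (fun k => D k x) atTop (𝓝 0) := by
            have h1 : Tendsto (fun k => grad (φ (σ k)) x - Z x) atTop (𝓝 0) := by
              simpa using hx.sub_const (Z x)
            have h2 := (h1.norm).rpow_const (p := q) (Or.inr hq0.le)
            rw [norm_zero, Real.zero_rpow hq0.ne'] at h2
            exact h2
          have h2 := (tendsto_const_nhds (x := H x)).add (hd.const_mul c)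
          rw [mul_zero, add_zero] at h2
          exact h2.sub ((hGc.tendsto _).comp hx)
      _ ≤ liminf (fun k => ∫⁻ x in B, ENNReal.ofReal (H x + c * D k x - G (grad (φ (σ k)) x))) atTop :=
          lintegral_liminf_le' fun k =>
            ((hHi.add ((hDi k).const_mul c)).sub (hGi k)).1.aemeasurable.ennreal_ofReal
      _ ≤ liminf (fun k => ENNReal.ofReal
            ((∫ x in B, H x) + c * (∫ x in B, D k x) - volume.real B * G 0)) atTop := by
          refine liminf_le_liminf (Eventually.of_forall fun k => ?_)
          rw [← ofReal_integral_eq_lintegral_ofReal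
            (f := fun x => H x + c * D k x - G (grad (φ (σ k)) x)) ((hHi.add ((hDi k).const_mul c)).sub (hGi k))
            (Eventually.of_forall fun x => hnn _ x)]
          exact ENNReal.ofReal_le_ofReal (hint k)
      _ = ENNReal.ofReal ((∫ x in B, H x) - volume.real B * G 0) :=
          ((ENNReal.continuous_ofReal.tendsto _).comp hlim).liminf_eq
  rw [integral_sub hHi hGZ] at hmain
  linarith

end Integrand

/-! ### Solid boundary values -/

section Solid
variable {Ω O O₁ O₂ : Set (Vec n)} {u u' u₀ u₁ u₂ v w : Vec n → Vec N} {U U' W : Vec n → Mat N n}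

lemma IsLipDomain.ae_of_parts (hΩ : IsLipDomain Ω) {P : Vec n → Prop}
    (h1 : ∀ᵐ x ∂(volume.restrict Ω), P x) (h2 : ∀ᵐ x ∂(volume.restrict (O \ closure Ω)), P x) :
    ∀ᵐ x ∂(volume.restrict O), P x := by
  have h3 : ∀ᵐ x ∂(volume.restrict (frontier Ω)), P x := by
    rw [Measure.restrict_eq_zero.2 hΩ.volume_frontier]; simp
  have h4 : ∀ᵐ x ∂(volume.restrict ((Ω ∪ O \ closure Ω) ∪ frontier Ω)), P x :=
    ae_restrict_union_iff _ _ P |>.2 ⟨ae_restrict_union_iff _ _ P |>.2 ⟨h1, h2⟩, h3⟩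
  refine ae_restrict_of_ae_restrict_of_subset (fun x hx => ?_) h4
  by_cases hxc : x ∈ closure Ω
  · by_cases hxΩ : x ∈ Ω
    · exact Or.inl (Or.inl hxΩ)
    · exact Or.inr (by rw [hΩ.isOpen.frontier_eq]; exact ⟨hxc, hxΩ⟩)
  · exact Or.inl (Or.inr ⟨hx, hxc⟩)

lemma IsLipDomain.setIntegral_split (hΩ : IsLipDomain Ω) (hO : IsOpen O) (hcl : closure Ω ⊆ O)
    {f : Vec n → ℝ} (hf : IntegrableOn f O) :
    (∫ x in O, f x) = (∫ x in Ω, f x) + ∫ x in O \ closure Ω, f x := by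
  have hd : Disjoint Ω (O \ closure Ω) := disjoint_left.2 fun x hx hx' => hx'.2 (subset_closure hx)
  rw [← setIntegral_union hd (hO.measurableSet.diff isClosed_closure.measurableSet)
    (hf.mono_set (subset_closure.trans hcl)) (hf.mono_set sdiff_subset)]
  refine setIntegral_congr_set ?_
  have hs : Ω ∪ O \ closure Ω ⊆ O := union_subset (subset_closure.trans hcl) sdiff_subset
  refine (hs.eventuallyLE.antisymm ?_).symm
  refine ae_le_set.2 (measure_mono_null (fun x hx => ?_) hΩ.volume_frontier)
  rw [hΩ.isOpen.frontier_eq]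
  refine ⟨?_, fun h => hx.2 (Or.inl h)⟩
  by_contra h
  exact hx.2 (Or.inr ⟨hx.1, h⟩)

lemma HasWeakGrad.ae_eq_of_subset (h : HasWeakGrad O₁ u U) (h' : HasWeakGrad O₂ u' U')
    (hO : IsOpen O) (h1 : O ⊆ O₁) (h2 : O ⊆ O₂) (hu : u =ᵐ[volume.restrict O] u') :
    U =ᵐ[volume.restrict O] U' :=
  (h.mono h1).unique' (h'.mono h2) hO hu

/-- A weakly differentiable map on `O ⊇ closure Ω`, vanishing off `closure Ω`, may be extended by
zero. -/
lemma HasWeakGrad.extend_zero (hΩ : IsLipDomain Ω) (hO : IsOpen O) (hcl : closure Ω ⊆ O)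
    (h : HasWeakGrad O w W) (h0 : w =ᵐ[volume.restrict (O \ closure Ω)] 0) :
    HasWeakGrad univ (Ω.indicator w) (Ω.indicator W) := by
  have hOc : IsOpen (O \ closure Ω) := hO.sdiff isClosed_closure
  have ind : ∀ {E : Type _} [NormedAddCommGroup E] {f : Vec n → E},
      f =ᵐ[volume.restrict (O \ closure Ω)] 0 → f =ᵐ[volume.restrict O] Ω.indicator f := by
    intro E _ f hf
    refine hΩ.ae_of_parts ((ae_restrict_mem hΩ.isOpen.measurableSet).mono fun x hx => ?_) ?_
    · rw [indicator_of_mem hx]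
    · filter_upwards [hf, ae_restrict_mem hOc.measurableSet] with x hx hx'
      rw [hx, indicator_of_notMem fun h => hx'.2 (subset_closure h)]; rfl
  have h1 := h.congr (ind h0) (ind ((h.mono sdiff_subset).zero_of_zero hOc h0))
  have hK : IsCompact (closure Ω) := hΩ.bdd.isCompact_closure
  have hz : ∀ x ∉ closure Ω, x ∉ Ω := fun x hx h => hx (subset_closure h)
  have hwd := fun i j => (h1.wd i j).extend_zero hO hK hcl (fun x hx => by simp [hz x hx])
    (fun x hx => by simp [hz x hx])
  exact .of_WD (locallyIntegrableOn_coord.2 fun i => by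
    by_cases hn : Nonempty (Fin n)
    · exact (hwd i hn.some).locL
    · exact absurd ⟨⟨0, hΩ.one_le⟩⟩ hn) hwd

lemma glue_apply_mem {x : Vec n} (hx : x ∈ Ω) : glue Ω u u' x = u x := by
  classical
  simp [glue, hx]

lemma glue_apply_notMem {x : Vec n} (hx : x ∉ Ω) : glue Ω u u' x = u' x := by
  classical
  simp [glue, hx]

lemma glue_ae_eq (hΩ : MeasurableSet Ω) : glue Ω u u' =ᵐ[volume.restrict Ω] u :=
  (ae_restrict_mem hΩ).mono fun _ hx => glue_apply_mem hx

lemma glue_ae_eq_diff (hO : MeasurableSet O) :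
    glue Ω u u' =ᵐ[volume.restrict (O \ closure Ω)] u' :=
  (ae_restrict_mem (hO.diff isClosed_closure.measurableSet)).mono fun _ hx =>
    glue_apply_notMem fun h => hx.2 (subset_closure h)

lemma MemW1.integrableOn {p : ℝ} (hp : 1 ≤ p) (hO : volume O ≠ ⊤) (h : MemW1 p O u) :
    IntegrableOn u O := by
  have : IsFiniteMeasure (volume.restrict O) := ⟨by simpa using hO.lt_top⟩
  exact h.1.integrable (by simpa using hp)

lemma MemW1.integrableOn_weakGrad {p : ℝ} (hp : 1 ≤ p) (hO : IsOpen O) (hO' : volume O ≠ ⊤)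
    (h : MemW1 p O u) : IntegrableOn (weakGrad O u) O := by
  have : IsFiniteMeasure (volume.restrict O) := ⟨by simpa using hO'.lt_top⟩
  exact (h.memLp_weakGrad hO).integrable (by simpa using hp)

/-- A map with the trace of zero may be extended by zero. -/
lemma MemW1.extend_of_zeroTrace (hΩ : IsLipDomain Ω) {p : ℝ} (hp : 1 ≤ p) (h : MemW1 p Ω u)
    (ht : ZeroTrace Ω u) : HasWeakGrad univ (Ω.indicator u) (Ω.indicator (weakGrad Ω u)) :=
  h.hasWeakGrad.zero_trace hΩ (h.integrableOn hp hΩ.volume_ne_top)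
    (h.integrableOn_weakGrad hp hΩ.isOpen hΩ.volume_ne_top) ht

lemma memW1_of_extend (hΩ : MeasurableSet Ω) {p : ℝ} (hu : MemLp u (ENNReal.ofReal p) (volume.restrict Ω))
    (hU : MemLp U (ENNReal.ofReal p) (volume.restrict Ω))
    (h : HasWeakGrad univ (Ω.indicator u) (Ω.indicator U)) : MemW1 p O (Ω.indicator u) :=
  ⟨((memLp_indicator_iff_restrict hΩ).2 hu).restrict _, _, h.mono (subset_univ _),
    ((memLp_indicator_iff_restrict hΩ).2 hU).restrict _⟩

/-- Maps with different solid boundary values of the same trace may be interchanged. -/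
lemma memW1_glue (hΩ : IsLipDomain Ω) {p : ℝ} (hp : 1 ≤ p) (hO₁ : IsOpen O₁)
    (hcl₁ : closure Ω ⊆ O₁) (hcl₂ : closure Ω ⊆ O₂) (hw : MemW1 p O₁ w) (hu₁ : MemW1 p O₁ u₁)
    (hu₂ : MemW1 p O₂ u₂) (h0 : w =ᵐ[volume.restrict (O₁ \ closure Ω)] u₁)
    (ht : ZeroTrace Ω (u₁ - u₂)) : MemW1 p O₂ (glue Ω w u₂) := by
  have hΩ₁ : Ω ⊆ O₁ := subset_closure.trans hcl₁
  have hΩ₂ : Ω ⊆ O₂ := subset_closure.trans hcl₂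
  have hm := hΩ.isOpen.measurableSet
  -- The second summand extends by zero because `w = u₁` off the closure of `Ω`; the third because
  -- `u₁ - u₂` has zero trace.
  have e : glue Ω w u₂ = u₂ + Ω.indicator (w - u₁) + Ω.indicator (u₁ - u₂) := by
    ext1 x
    by_cases hx : x ∈ Ω
    · simp [glue_apply_mem hx, hx]
      abel
    · simp [glue_apply_notMem hx, hx]
  rw [e]
  refine (hu₂.add ?_).add ?_
  · have h1 := (hw.sub hu₁).hasWeakGrad.extend_zero hΩ hO₁ hcl₁ (h0.mono fun x hx => by simp [hx])
    exact memW1_of_extend hm ((hw.sub hu₁).mono hΩ₁).1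
      (((hw.sub hu₁).memLp_weakGrad hO₁).mono_measure (Measure.restrict_mono_set _ hΩ₁)) h1
  · have h2 := (hu₁.mono hΩ₁).sub (hu₂.mono hΩ₂)
    exact memW1_of_extend hm h2.1 (h2.memLp_weakGrad hΩ.isOpen) (h2.extend_of_zeroTrace hΩ hp ht)

lemma SolidClass.transfer (hΩ : IsLipDomain Ω) {q : ℝ} (hq : 1 ≤ q) {v : Vec n → Vec N}
    (hv : AEStronglyMeasurable v (volume.restrict Ω)) (h₁ : IsSolidDatum q Ω v O₁ u₁)
    (h₂ : IsSolidDatum q Ω v O₂ u₂) (hw : SolidClass q Ω O₁ u₁ w) :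
    SolidClass q Ω O₂ u₂ (glue Ω w u₂) :=
  ⟨memW1_glue hΩ hq h₁.1 h₁.2.2.1 h₂.2.2.1 hw.1 h₁.2.2.2.1 h₂.2.2.2.1 hw.2
    (h₁.2.2.2.2.zeroTrace hΩ (h₁.2.2.2.1.1.1.mono_measure (Measure.restrict_mono_set _
      (subset_closure.trans h₁.2.2.1))) hv h₂.2.2.2.2), glue_ae_eq_diff h₂.1.measurableSet⟩

lemma energy_eq_of_ae_eq {F : Mat N n → ℝ} (hO : IsOpen O) (h : HasWeakGrad O u U)
    (h' : HasWeakGrad O u' U') (hu : u =ᵐ[volume.restrict O] u') : energy F u O = energy F u' O := by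
  refine integral_congr_ae ?_
  filter_upwards [(hasWeakGrad_weakGrad h).unique' (hasWeakGrad_weakGrad h') hO hu] with x hx
  rw [hx]

lemma MemW1.integrableOn_comp_weakGrad {q L : ℝ} (hq : 0 < q) {F : Mat N n → ℝ} (hF : Continuous F)
    (hL : ∀ z, |F z| ≤ L * (1 + ‖z‖ ^ q)) (hO : IsOpen O) (hO' : volume O ≠ ⊤) (h : MemW1 q O w) :
    IntegrableOn (fun x => F (weakGrad O w x)) O := by
  have : IsFiniteMeasure (volume.restrict O) := ⟨by simpa using hO'.lt_top⟩
  exact integrable_comp_of_growth hq hF hL (h.memLp_weakGrad hO)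

/-- The energy on `O` splits into the energy on `Ω` and the energy of the boundary values. -/
lemma SolidClass.energy_split (hΩ : IsLipDomain Ω) {q L : ℝ} (hq : 0 < q) {F : Mat N n → ℝ}
    (hF : Continuous F) (hL : ∀ z, |F z| ≤ L * (1 + ‖z‖ ^ q)) (hO : IsOpen O)
    (hO' : volume O ≠ ⊤) (hcl : closure Ω ⊆ O) (hu₀ : MemW1 q O u₀)
    (hw : SolidClass q Ω O u₀ w) :
    energy F w O = energy F w Ω + energy F u₀ (O \ closure Ω) := by
  have hΩO : Ω ⊆ O := subset_closure.trans hcl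
  have hOc : IsOpen (O \ closure Ω) := hO.sdiff isClosed_closure
  rw [energy, hΩ.setIntegral_split hO hcl (hw.1.integrableOn_comp_weakGrad hq hF hL hO hO')]
  congr 1
  · refine integral_congr_ae ?_
    filter_upwards [hw.1.hasWeakGrad.ae_eq_of_subset (hw.1.mono hΩO).hasWeakGrad hΩ.isOpen hΩO
      subset_rfl EventuallyEq.rfl] with x hx
    rw [hx]
  · refine integral_congr_ae ?_
    filter_upwards [hw.1.hasWeakGrad.ae_eq_of_subset (hu₀.mono sdiff_subset).hasWeakGrad hOc
      sdiff_subset subset_rfl hw.2] with x hx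
    rw [hx]

/-- The product of a Sobolev map with a test function, extended by zero. -/
lemma MemW1.smul_test {q : ℝ} (hO : IsOpen O) (hu₀ : MemW1 q O u₀) {χ : Vec n → ℝ}
    (hχ : IsTest O χ) : MemLp (fun x => χ x • u₀ x) (ENNReal.ofReal q) ∧
      ∃ D : Vec n → Mat N n, MemLp D (ENNReal.ofReal q) ∧
        HasWeakGrad univ (fun x => χ x • u₀ x) D := by
  set U := weakGrad O u₀ with hU
  have hg := hu₀.hasWeakGrad
  have hUL := hu₀.memLp_weakGrad hO
  have hχ0 : ∀ x ∉ tsupport χ, χ x = 0 := fun x hx => image_eq_zero_of_notMem_tsupport hx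
  have hdχ0 : ∀ j, ∀ x ∉ tsupport χ, pderiv j χ x = 0 := fun j x hx =>
    image_eq_zero_of_notMem_tsupport fun h => hx (tsupport_pderiv_subset j χ h)
  have hmul : ∀ {χ' f : Vec n → ℝ}, IsTest O χ' → MemLp f (ENNReal.ofReal q) (volume.restrict O) →
      MemLp (fun x => χ' x * f x) (ENNReal.ofReal q) := by
    intro χ' f h1 h2
    obtain ⟨C, hC⟩ := h1.exists_bound
    have e : (fun x => χ' x * f x) = O.indicator fun x => χ' x * f x := by
      ext1 x
      by_cases hx : x ∈ O
      · rw [indicator_of_mem hx]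
      · rw [indicator_of_notMem hx, h1.eq_zero hx, zero_mul]
    rw [e, memLp_indicator_iff_restrict hO.measurableSet]
    refine MemLp.of_le_mul h2 (h1.continuous.aestronglyMeasurable.mul h2.1)
      (Eventually.of_forall fun x => ?_) (c := C)
    rw [norm_mul]
    gcongr
    exact hC x
  have hwd : ∀ i j, WD univ j (fun x => χ x * u₀ x i)
      (fun x => χ x * U x (i, j) + pderiv j χ x * u₀ x i) := fun i j =>
    ((hg.wd i j).smooth_mul hχ.1).extend_zero hO hχ.2.1 hχ.2.2 (fun x hx => by simp [hχ0 x hx])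
      (fun x hx => by simp [hχ0 x hx, hdχ0 j x hx])
  refine ⟨memLp_piLp_iff.2 fun i => hmul hχ (memLp_piLp_iff.1 hu₀.1 i),
    fun x => WithLp.toLp 2 fun ij => χ x * U x ij + pderiv ij.2 χ x * u₀ x ij.1,
    memLp_piLp_iff.2 fun ij => ?_, .of_WD ?_ hwd⟩
  · exact (hmul hχ (memLp_piLp_iff.1 hUL ij)).add (hmul (hχ.pderiv ij.2) (memLp_piLp_iff.1 hu₀.1 ij.1))
  · have h1 : IntegrableOn (fun x => χ x • u₀ x) (tsupport χ) := by
      have h2 := hg.1.integrableOn_compact_subset hχ.2.2 hχ.2.1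
      exact h2.continuousOn_smul hχ.continuous.continuousOn hχ.2.1
    exact ((integrableOn_iff_integrable_of_support_subset fun x hx => by
      by_contra h; exact hx (by simp [hχ0 x h])).1 h1).locallyIntegrable.locallyIntegrableOn _

/-- Quasiconvexity is tested with compactly supported maps only; a cutoff equal to one near the
closure of `Ω` makes the boundary values such a map. -/
lemma MemW1.exists_cutoff_extension {q : ℝ} (hO : IsOpen O) (hK : IsCompact (closure Ω))
    (hcl : closure Ω ⊆ O) (hu₀ : MemW1 q O u₀) : ∃ (u' : Vec n → Vec N) (D : Vec n → Mat N n)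
      (K : Set (Vec n)), IsCompact K ∧ K ⊆ O ∧ MemLp u' (ENNReal.ofReal q) ∧
      MemLp D (ENNReal.ofReal q) ∧ HasWeakGrad univ u' D ∧ (∀ x ∉ K, u' x = 0) ∧
      ∀ x ∈ closure Ω, u' x = u₀ x := by
  obtain ⟨χ, hχ, hχ1, hχ2⟩ := exists_cutoff hK hO hcl
  obtain ⟨h1, D, h2, h3⟩ := hu₀.smul_test hO hχ
  refine ⟨_, D, tsupport χ, hχ.2.1, hχ.2.2, h1, h2, h3,
    fun x hx => by simp [image_eq_zero_of_notMem_tsupport hx], fun x hx => ?_⟩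
  have : χ x = 1 := (eventually_nhdsSet_iff_forall.1 hχ1 x hx).self_of_nhds
  simp [this]

/-- Strong quasiconvexity implies coercivity in Dirichlet classes. -/
lemma StronglyQuasiconvex.coercive (hΩ : IsLipDomain Ω) {p q L : ℝ} (hp : 1 ≤ p) (hpq : p ≤ q)
    {F : Mat N n → ℝ} (hF : Continuous F) (hL : ∀ z, |F z| ≤ L * (1 + ‖z‖ ^ q))
    (hQ : StronglyQuasiconvex p F) {R : ℝ} (hR : 0 < R) (hcl : closure Ω ⊆ Metric.ball 0 R)
    (hu₀ : MemW1 q (Metric.ball 0 R) u₀) : ∃ a b : ℝ, 0 < a ∧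
      ∀ w, SolidClass q Ω (Metric.ball 0 R) u₀ w →
        (∫ x in Ω, ‖weakGrad (Metric.ball 0 R) w x - weakGrad (Metric.ball 0 R) u₀ x‖ ^ p) ≤
          a * energy F w (Metric.ball 0 R) + b := by
  have hq : 1 ≤ q := hp.trans hpq
  have hq0 : 0 < q := by linarith
  have hp0 : 0 < p := by linarith
  have hP1 : 1 ≤ ENNReal.ofReal q := by simpa using hq
  have hPQ : ENNReal.ofReal p ≤ ENNReal.ofReal q := ENNReal.ofReal_le_ofReal hpq
  set B := Metric.ball (0 : Vec n) R with hB
  have hBo : IsOpen B := Metric.isOpen_ball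
  have hBt : volume B ≠ ⊤ := measure_ball_lt_top.ne
  have hfin : IsFiniteMeasure (volume.restrict B) := ⟨by simpa using hBt.lt_top⟩
  have hfin' : IsFiniteMeasure (volume.restrict Ω) := ⟨by simpa using hΩ.volume_ne_top.lt_top⟩
  have hΩB : Ω ⊆ B := subset_closure.trans hcl
  have hm := hΩ.isOpen.measurableSet
  -- Only the point `z₀ = 0` is used, so any positive `m` would do.
  obtain ⟨l, hl, hQl⟩ := hQ 1 one_pos
  have hq1 := hQl 0 (by simp)
  obtain ⟨u', D, K, hK, hKB, hu'L, hDL, hu'g, hu'0, hu'1⟩ :=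
    hu₀.exists_cutoff_extension hBo hΩ.bdd.isCompact_closure hcl
  set U := weakGrad B u₀ with hU
  have hUL : MemLp U (ENNReal.ofReal q) (volume.restrict B) := hu₀.memLp_weakGrad hBo
  have hDU : D =ᵐ[volume.restrict Ω] U := hu'g.ae_eq_of_subset hu₀.hasWeakGrad hΩ.isOpen
    (subset_univ _) hΩB ((ae_restrict_mem hm).mono fun x hx => hu'1 x (subset_closure hx))
  set cD := ∫ x in B \ closure Ω, F (D x)
  set cU := energy F u₀ (B \ closure Ω)
  set cV := ∫ x in Ω, ‖U x‖ ^ p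
  set vB := volume.real B
  -- The constants result from solving the quasiconvexity inequality for `∫ V_p`, using `|z|^p ≤ 1 +
  -- V_p(z)`, and splitting `|W - U|^p ≤ 2^p (|W|^p + |U|^p)`.
  refine ⟨2 ^ p / l, 2 ^ p * (vB + (cD - cU - vB * F 0) / l + cV), by positivity, fun w hw => ?_⟩
  set W := weakGrad B w with hW
  have hWL : MemLp W (ENNReal.ofReal q) (volume.restrict B) := hw.1.memLp_weakGrad hBo
  have hwu := hw.1.sub hu₀
  have hz := (hw.1.hasWeakGrad.sub hu₀.hasWeakGrad).extend_zero hΩ hBo hcl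
    (hw.2.mono fun x hx => by simp [hx])
  have hzL : MemLp (Ω.indicator (w - u₀)) (ENNReal.ofReal q) :=
    (memLp_indicator_iff_restrict hm).2 (hwu.mono hΩB).1
  have hZL : MemLp (Ω.indicator (W - U)) (ENNReal.ofReal q) :=
    (memLp_indicator_iff_restrict hm).2 ((hWL.sub hUL).mono_measure (Measure.restrict_mono_set _ hΩB))
  -- `Y` is the gradient of the test map: it equals the gradient of `w` in `Ω` and the fixed field
  -- `D` off the closure. Its energy is therefore that of `w` up to constants independent of `w`.
  set Y := D + Ω.indicator (W - U) with hY
  have hYL : MemLp Y (ENNReal.ofReal q) := hDL.add hZL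
  have hYW : Y =ᵐ[volume.restrict Ω] W := by
    filter_upwards [hDU, ae_restrict_mem hm] with x h1 h2
    simp [hY, h1, h2]
  have hmain := hq1.le_integral (C := L + l * 2 ^ (q / 2))
    (hF.sub ((continuous_refV p).const_mul l)) hq (fun z => by
      have h1 := hL z
      have h2 := refV_nonneg hp0.le z
      have h3 := refV_le hp0.le hpq z
      have h4 := mul_le_mul_of_nonneg_left h3 hl.le
      have h5 := mul_nonneg hl.le h2
      rw [abs_le] at h1 ⊢
      constructor <;> nlinarith) hR (K := K ∪ closure Ω) (hK.union hΩ.bdd.isCompact_closure)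
    (union_subset hKB hcl) (hu'L.add hzL) hYL (hu'g.add hz) (fun x hx => by
      have h1 : x ∉ Ω := fun h => hx (Or.inr (subset_closure h))
      simp [hu'0 x fun h => hx (Or.inl h), h1])
  have hF0 : F 0 - l * refV p (0 : Mat N n) = F 0 := by simp [refV]
  have hFY : IntegrableOn (fun x => F (Y x)) B := integrable_comp_of_growth hq0 hF hL (hYL.restrict B)
  have hVY : IntegrableOn (fun x => refV p (Y x)) B :=
    integrable_comp_of_growth hq0 (continuous_refV p) (L := 2 ^ (q / 2)) (fun z => by
      rw [abs_of_nonneg (refV_nonneg hp0.le z)]; exact refV_le hp0.le hpq z) (hYL.restrict B)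
  rw [hF0, integral_sub hFY (hVY.const_mul l), integral_const_mul, hΩ.setIntegral_split hBo hcl hFY] at hmain
  have e1 : (∫ x in Ω, F (Y x)) = energy F w Ω := by
    refine integral_congr_ae ?_
    filter_upwards [hYW, hw.1.hasWeakGrad.ae_eq_of_subset (hw.1.mono hΩB).hasWeakGrad hΩ.isOpen hΩB
      subset_rfl EventuallyEq.rfl] with x hx hx'
    rw [hx, hW, hx']
  have e2 : (∫ x in B \ closure Ω, F (Y x)) = cD := by
    refine setIntegral_congr_fun (hBo.sdiff isClosed_closure).measurableSet fun x hx => ?_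
    simp only [hY, Pi.add_apply, indicator_of_notMem fun h => hx.2 (subset_closure h), add_zero]
  have e3 := hw.energy_split hΩ hq0 hF hL hBo hBt hcl hu₀
  have hVp : (∫ x in Ω, ‖Y x‖ ^ p) ≤ vB + ∫ x in B, refV p (Y x) := by
    have hYp : IntegrableOn (fun x => ‖Y x‖ ^ p) B :=
      integrable_norm_rpow_of_memLp hp0 ((hYL.restrict B).mono_exponent hPQ)
    calc (∫ x in Ω, ‖Y x‖ ^ p) ≤ ∫ x in B, ‖Y x‖ ^ p :=
          setIntegral_mono_set hYp (Eventually.of_forall fun x => Real.rpow_nonneg (norm_nonneg _) _)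
            hΩB.eventuallyLE
      _ ≤ ∫ x in B, (1 + refV p (Y x)) := by
          refine integral_mono hYp ((integrable_const 1).add hVY) fun x => ?_
          have := rpow_le_refV hp0.le (Y x)
          simp only
          linarith
      _ = vB + ∫ x in B, refV p (Y x) := by
          rw [integral_add (integrable_const 1) hVY]; simp [vB]
  have hWU : (∫ x in Ω, ‖W x - U x‖ ^ p) ≤ 2 ^ p * ((∫ x in Ω, ‖Y x‖ ^ p) + cV) := by
    have hYp : IntegrableOn (fun x => ‖Y x‖ ^ p) Ω :=
      integrable_norm_rpow_of_memLp hp0 ((hYL.restrict Ω).mono_exponent hPQ)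
    have hUp : IntegrableOn (fun x => ‖U x‖ ^ p) Ω := integrable_norm_rpow_of_memLp hp0
      ((hUL.mono_measure (Measure.restrict_mono_set _ hΩB)).mono_exponent hPQ)
    rw [← integral_add hYp hUp, ← integral_const_mul]
    refine integral_mono_of_nonneg (Eventually.of_forall fun x => Real.rpow_nonneg (norm_nonneg _) _)
      ((hYp.add hUp).const_mul _) ?_
    filter_upwards [hYW] with x hx
    rw [← hx]
    simpa [sub_eq_add_neg] using norm_add_rpow_le hp0.le (Y x) (-U x)
  refine hWU.trans ?_
  have hV : (∫ x in B, refV p (Y x)) ≤ (energy F w B - cU + cD - vB * F 0) / l := by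
    rw [le_div_iff₀ hl]
    rw [e1, e2] at hmain
    linarith
  calc 2 ^ p * ((∫ x in Ω, ‖Y x‖ ^ p) + cV)
      ≤ 2 ^ p * (vB + (energy F w B - cU + cD - vB * F 0) / l + cV) := by
        gcongr
        exact hVp.trans (add_le_add_right hV _)
    _ = 2 ^ p / l * energy F w B + 2 ^ p * (vB + (cD - cU - vB * F 0) / l + cV) := by
        field_simp
        ring

end Solid

/-! ### Independence of the solid boundary values -/

lemma ereal_liminf_add_const (e : ℕ → ℝ) (c : ℝ) :
    liminf (fun k => ((e k + c : ℝ) : EReal)) atTop =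
      liminf (fun k => (e k : EReal)) atTop + (c : EReal) := by
  have hm : Monotone fun x : EReal => x + (c : EReal) := fun x y h => add_le_add_left h _
  have hc : ContinuousAt (fun x : EReal => x + (c : EReal))
      (liminf (fun k => (e k : EReal)) atTop) :=
    (EReal.continuousAt_add (Or.inr (EReal.coe_ne_bot c)) (Or.inr (EReal.coe_ne_top c))).comp
      (continuousAt_id.prodMk continuousAt_const)
  rw [hm.map_liminf_of_continuousAt _ hc]
  simp [Function.comp_def]

/-- Shifting by a real constant commutes with the lower limit, so mapping admissible energy
sequences to admissible ones compares the normalised infima. Infinite infima are harmless since only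
real numbers are subtracted. -/
lemma ereal_sub_le_sub_of_shift {A₁ A₂ : (ℕ → ℝ) → Prop} {c₁ c₂ : ℝ}
    (h : ∀ e, A₁ e → A₂ fun k => e k + (c₂ - c₁)) :
    sInf {x | ∃ e, A₂ e ∧ x = liminf (fun k => (e k : EReal)) atTop} - (c₂ : EReal) ≤
      sInf {x | ∃ e, A₁ e ∧ x = liminf (fun k => (e k : EReal)) atTop} - (c₁ : EReal) := by
  have h1 : sInf {x | ∃ e, A₂ e ∧ x = liminf (fun k => (e k : EReal)) atTop} ≤
      sInf {x | ∃ e, A₁ e ∧ x = liminf (fun k => (e k : EReal)) atTop} + ((c₂ - c₁ : ℝ) : EReal) := by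
    rw [← EReal.sub_le_iff_le_add (Or.inl (EReal.coe_ne_bot _)) (Or.inl (EReal.coe_ne_top _))]
    refine le_sInf ?_
    rintro _ ⟨e, he, rfl⟩
    rw [EReal.sub_le_iff_le_add (Or.inl (EReal.coe_ne_bot _)) (Or.inl (EReal.coe_ne_top _)),
      ← ereal_liminf_add_const]
    exact sInf_le ⟨_, h e he, rfl⟩
  rw [EReal.sub_le_iff_le_add (Or.inl (EReal.coe_ne_bot _)) (Or.inl (EReal.coe_ne_top _))]
  refine h1.trans (le_of_eq ?_)
  rw [sub_eq_add_neg (_ : EReal), add_assoc, add_comm (-(c₁ : EReal)), ← sub_eq_add_neg,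
    EReal.coe_sub]

section Transfer
variable {Ω O O₁ O₂ : Set (Vec n)} {u u' u₀ u₁ u₂ v : Vec n → Vec N} {w : ℕ → Vec n → Vec N}
  {p q : ℝ}

lemma IsSolidDatum.volume_ne_top (h : IsSolidDatum q Ω v O u₀) : volume O ≠ ⊤ :=
  h.2.1.measure_lt_top.ne

lemma IsSolidDatum.zeroTrace (hΩ : IsLipDomain Ω) (hv : AEStronglyMeasurable v (volume.restrict Ω))
    (h₁ : IsSolidDatum q Ω v O₁ u₁) (h₂ : IsSolidDatum q Ω v O₂ u₂) : ZeroTrace Ω (u₁ - u₂) :=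
  h₁.2.2.2.2.zeroTrace hΩ (h₁.2.2.2.1.1.1.mono_measure (Measure.restrict_mono_set _
    (subset_closure.trans h₁.2.2.1))) hv h₂.2.2.2.2

lemma glue_sub_glue : glue Ω u u₀ - glue Ω u' u₀ = Ω.indicator (u - u') := by
  ext1 x
  by_cases hx : x ∈ Ω
  · simp [glue_apply_mem hx, hx]
  · simp [glue_apply_notMem hx, hx]

/-- The energy changes by a constant under a change of the solid boundary values. -/
lemma SolidClass.energy_glue (hΩ : IsLipDomain Ω) (hq : 1 ≤ q) {L : ℝ} {F : Mat N n → ℝ}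
    (hF : Continuous F) (hL : ∀ z, |F z| ≤ L * (1 + ‖z‖ ^ q))
    (hv : AEStronglyMeasurable v (volume.restrict Ω)) (h₁ : IsSolidDatum q Ω v O₁ u₁)
    (h₂ : IsSolidDatum q Ω v O₂ u₂) {w : Vec n → Vec N} (hw : SolidClass q Ω O₁ u₁ w) :
    energy F (glue Ω w u₂) O₂ =
      energy F w O₁ + (energy F u₂ (O₂ \ closure Ω) - energy F u₁ (O₁ \ closure Ω)) := by
  have hw' := hw.transfer hΩ hq hv h₁ h₂
  rw [hw.energy_split hΩ (by linarith) hF hL h₁.1 h₁.volume_ne_top h₁.2.2.1 h₁.2.2.2.1,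
    hw'.energy_split hΩ (by linarith) hF hL h₂.1 h₂.volume_ne_top h₂.2.2.1 h₂.2.2.2.1,
    energy_eq_of_ae_eq hΩ.isOpen (hw'.1.mono (subset_closure.trans h₂.2.2.1)).hasWeakGrad
      (hw.1.mono (subset_closure.trans h₁.2.2.1)).hasWeakGrad
      (glue_ae_eq hΩ.isOpen.measurableSet)]
  ring

/-- It suffices to transfer `L¹` convergence and a bound on the variations. The glued maps differ
from the fixed map `glue Ω u₁ u₂` by `w k - u₁` extended by zero; this difference vanishes off the
compact closure of `Ω`, so its variation in `O₂` is at most that in `O₁`. -/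
lemma WeakStarTendstoBV.transfer (hΩ : IsLipDomain Ω) (hq : 1 ≤ q)
    (hv : AEStronglyMeasurable v (volume.restrict Ω)) (h₁ : IsSolidDatum q Ω v O₁ u₁)
    (h₂ : IsSolidDatum q Ω v O₂ u₂) (hw : ∀ k, SolidClass q Ω O₁ u₁ (w k))
    (h : WeakStarTendstoBV O₁ w (glue Ω u u₁)) :
    WeakStarTendstoBV O₂ (fun k => glue Ω (w k) u₂) (glue Ω u u₂) := by
  have hΩ₁ : Ω ⊆ O₁ := subset_closure.trans h₁.2.2.1
  have hΩ₂ : Ω ⊆ O₂ := subset_closure.trans h₂.2.2.1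
  have hm := hΩ.isOpen.measurableSet
  have hbv : ∀ {O : Set (Vec n)} {f : Vec n → Vec N}, IsOpen O → volume O ≠ ⊤ → MemW1 q O f → MemBV O f := fun hO hO' hf =>
    (hf.mono_exponent hq hO').memBV hO
  have hb₁ : MemBV O₁ u₁ := hbv h₁.1 h₁.volume_ne_top h₁.2.2.2.1
  have hu₁ : SolidClass q Ω O₁ u₁ u₁ := ⟨h₁.2.2.2.1, EventuallyEq.rfl⟩
  have hg : ∀ {f : Vec n → Vec N}, SolidClass q Ω O₁ u₁ f → MemBV O₂ (glue Ω f u₂) := fun hf =>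
    hbv h₂.1 h₂.volume_ne_top (hf.transfer hΩ hq hv h₁ h₂).1
  obtain ⟨M, hM, hMw⟩ := h.exists_bound
  have hind : ∀ {f : Vec n → Vec N}, IntegrableOn f O₁ → IntegrableOn (Ω.indicator f) O₂ :=
    fun hf => ((integrable_indicator_iff hm).2 (hf.mono_set hΩ₁)).integrableOn
  have hu : IntegrableOn (glue Ω u u₂) O₂ := by
    have e : glue Ω u u₂ = glue Ω (w 0) u₂ + Ω.indicator (glue Ω u u₁ - w 0) := by
      ext1 x
      by_cases hx : x ∈ Ω
      · simp [glue_apply_mem hx, hx]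
      · simp [glue_apply_notMem hx, hx]
    rw [e]
    exact (hg (hw 0)).integrableOn.add (hind (h.2.1.integrableOn.sub (h.1 0).integrableOn))
  refine weakStarTendstoBV_of_bound h₂.1 (fun k => (hg (hw k)).integrableOn) hu ?_
    (M := totalVar O₂ (glue Ω u₁ u₂) + (M + totalVar O₁ u₁)) ?_ fun k => ?_
  · refine tendsto_of_tendsto_of_tendsto_of_le_of_le tendsto_const_nhds h.2.2.1
      (fun _ => zero_le) fun k => ?_
    have e : glue Ω (w k) u₂ - glue Ω u u₂ = Ω.indicator (w k - glue Ω u u₁) := by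
      rw [glue_sub_glue]
      refine indicator_congr fun x hx => ?_
      simp [glue_apply_mem hx]
    simp only [e]
    calc eLpNorm (Ω.indicator (w k - glue Ω u u₁)) 1 (volume.restrict O₂)
        ≤ eLpNorm (Ω.indicator (w k - glue Ω u u₁)) 1 volume :=
          eLpNorm_mono_measure _ Measure.restrict_le_self
      _ = eLpNorm (w k - glue Ω u u₁) 1 (volume.restrict Ω) := eLpNorm_indicator_eq_eLpNorm_restrict hm
      _ ≤ _ := eLpNorm_mono_measure _ (Measure.restrict_mono_set _ hΩ₁)
  · exact ENNReal.add_ne_top.2 ⟨(hg hu₁).2.ne, ENNReal.add_ne_top.2 ⟨hM, hb₁.2.ne⟩⟩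
  · have e : glue Ω (w k) u₂ = glue Ω u₁ u₂ + Ω.indicator (w k - u₁) := by
      rw [← glue_sub_glue (u₀ := u₂)]
      abel
    have hd := (h.1 k).integrableOn.sub hb₁.integrableOn
    rw [e]
    refine (totalVar_add_le (hg hu₁).integrableOn (hind hd)).trans ?_
    gcongr
    have e2 : Ω.indicator (w k - u₁) =ᵐ[volume.restrict O₁] w k - u₁ := by
      refine hΩ.ae_of_parts ((ae_restrict_mem hm).mono fun x hx => by rw [indicator_of_mem hx]) ?_
      filter_upwards [(hw k).2, ae_restrict_mem (h₁.1.sdiff isClosed_closure).measurableSet] with x h3 h4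
      rw [indicator_of_notMem fun h => h4.2 (subset_closure h)]
      simp [h3]
    calc totalVar O₂ (Ω.indicator (w k - u₁)) ≤ totalVar O₁ (Ω.indicator (w k - u₁)) :=
          totalVar_le_of_eq_zero h₁.1 hΩ.bdd.isCompact_closure h₁.2.2.1 fun x hx =>
            indicator_of_notMem (fun h => hx (subset_closure h)) _
      _ = totalVar O₁ (w k - u₁) := totalVar_congr e2
      _ ≤ totalVar O₁ (w k) + totalVar O₁ u₁ := totalVar_sub_le (h.1 k).integrableOn hb₁.integrableOn
      _ ≤ M + totalVar O₁ u₁ := by gcongr; exact hMw k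

lemma integrable_inner_conj {α V : Type*} [MeasurableSpace α] {μ : Measure α} [NormedAddCommGroup V]
    [InnerProductSpace ℝ V] (hp : 1 < p) {f g : α → V} (hf : MemLp f (ENNReal.ofReal (p / (p - 1))) μ)
    (hg : MemLp g (ENNReal.ofReal p) μ) : Integrable (fun x => inner ℝ (f x) (g x)) μ :=
  (integrable_mul_conj hp hg.norm hf.norm).mono' (hf.1.inner hg.1) (Eventually.of_forall fun x => by
    simpa [mul_comm] using norm_inner_le_norm (𝕜 := ℝ) (f x) (g x))

/-- In `Ω` the test field, extended by zero, is admissible on `O₁`; off the closure all maps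
coincide with the limit, so that contribution is constant. -/
lemma IsLipDomain.tendsto_integral_inner (hΩ : IsLipDomain Ω) (hp : 1 < p) (hO₂ : IsOpen O₂)
    (hcl₁ : closure Ω ⊆ O₁) (hcl₂ : closure Ω ⊆ O₂) {V : Type*} [NormedAddCommGroup V]
    [InnerProductSpace ℝ V] {f : ℕ → Vec n → V} {f' : ℕ → Vec n → V} {g g' : Vec n → V}
    (hf' : ∀ k, MemLp (f' k) (ENNReal.ofReal p) (volume.restrict O₂))
    (hg' : MemLp g' (ENNReal.ofReal p) (volume.restrict O₂))
    (hff : ∀ k, f' k =ᵐ[volume.restrict Ω] f k) (hgg : g' =ᵐ[volume.restrict Ω] g)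
    (hfg : ∀ k, f' k =ᵐ[volume.restrict (O₂ \ closure Ω)] g')
    (h : ∀ G : Vec n → V, MemLp G (ENNReal.ofReal (p / (p - 1))) (volume.restrict O₁) →
      Tendsto (fun k => ∫ x in O₁, inner ℝ (G x) (f k x)) atTop (𝓝 (∫ x in O₁, inner ℝ (G x) (g x))))
    {G : Vec n → V} (hG : MemLp G (ENNReal.ofReal (p / (p - 1))) (volume.restrict O₂)) :
    Tendsto (fun k => ∫ x in O₂, inner ℝ (G x) (f' k x)) atTop
      (𝓝 (∫ x in O₂, inner ℝ (G x) (g' x))) := by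
  have hm := hΩ.isOpen.measurableSet
  have hΩ₁ : Ω ⊆ O₁ := subset_closure.trans hcl₁
  have hΩ₂ : Ω ⊆ O₂ := subset_closure.trans hcl₂
  have hG₁ : MemLp (Ω.indicator G) (ENNReal.ofReal (p / (p - 1))) (volume.restrict O₁) :=
    ((memLp_indicator_iff_restrict hm).2
      (hG.mono_measure (Measure.restrict_mono_set _ hΩ₂))).restrict _
  have key : ∀ {a a' : Vec n → V}, MemLp a' (ENNReal.ofReal p) (volume.restrict O₂) →
      a' =ᵐ[volume.restrict Ω] a → a' =ᵐ[volume.restrict (O₂ \ closure Ω)] g' →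
      (∫ x in O₂, inner ℝ (G x) (a' x)) = (∫ x in O₁, inner ℝ (Ω.indicator G x) (a x)) +
        ∫ x in O₂ \ closure Ω, inner ℝ (G x) (g' x) := by
    intro a a' ha' h1 h2
    rw [hΩ.setIntegral_split hO₂ hcl₂ (integrable_inner_conj hp hG ha')]
    congr 1
    · have e : (fun x => inner ℝ (Ω.indicator G x) (a x)) =
          Ω.indicator fun x => inner ℝ (G x) (a x) := by
        ext1 x
        by_cases hx : x ∈ Ω <;> simp [hx]
      rw [e, setIntegral_indicator hm, inter_eq_right.2 hΩ₁]
      exact integral_congr_ae (h1.mono fun x hx => by simp only [hx])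
    · exact integral_congr_ae (h2.mono fun x hx => by simp only [hx])
  simp only [key (hf' _) (hff _) (hfg _), key hg' hgg EventuallyEq.rfl]
  exact (h _ hG₁).add_const _

lemma WeakTendstoW1.transfer (hΩ : IsLipDomain Ω) (hp : 1 < p) (hpq : p ≤ q)
    (hv : AEStronglyMeasurable v (volume.restrict Ω)) (h₁ : IsSolidDatum q Ω v O₁ u₁)
    (h₂ : IsSolidDatum q Ω v O₂ u₂) (hw : ∀ k, SolidClass q Ω O₁ u₁ (w k))
    (h : WeakTendstoW1 p O₁ w (glue Ω u u₁)) :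
    WeakTendstoW1 p O₂ (fun k => glue Ω (w k) u₂) (glue Ω u u₂) := by
  have hΩ₁ : Ω ⊆ O₁ := subset_closure.trans h₁.2.2.1
  have hΩ₂ : Ω ⊆ O₂ := subset_closure.trans h₂.2.2.1
  have hm := hΩ.isOpen.measurableSet
  have hq : 1 ≤ q := hp.le.trans hpq
  have hOc : IsOpen (O₂ \ closure Ω) := h₂.1.sdiff isClosed_closure
  have h1 : ∀ k, MemW1 p O₂ (glue Ω (w k) u₂) := fun k =>
    ((hw k).transfer hΩ hq hv h₁ h₂).1.mono_exponent hpq h₂.volume_ne_top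
  have h2 : MemW1 p O₂ (glue Ω u u₂) := by
    -- The limit is only known to be in `W^{1,p}`, so the gluing lemma is applied with exponent `p`
    -- to the limit map on `O₁`.
    have e : glue Ω u u₂ = glue Ω (glue Ω u u₁) u₂ := by
      ext1 x
      by_cases hx : x ∈ Ω
      · simp [glue_apply_mem hx]
      · simp [glue_apply_notMem hx]
    rw [e]
    exact memW1_glue hΩ hp.le h₁.1 h₁.2.2.1 h₂.2.2.1 h.2.1
      (h₁.2.2.2.1.mono_exponent hpq h₁.volume_ne_top) (h₂.2.2.2.1.mono_exponent hpq h₂.volume_ne_top)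
      (glue_ae_eq_diff h₁.1.measurableSet) (h₁.zeroTrace hΩ hv h₂)
  have e1 : ∀ k, glue Ω (w k) u₂ =ᵐ[volume.restrict Ω] w k := fun k => glue_ae_eq hm
  have e2 : glue Ω u u₂ =ᵐ[volume.restrict Ω] glue Ω u u₁ :=
    (glue_ae_eq hm).trans (glue_ae_eq hm).symm
  have e3 : ∀ k, glue Ω (w k) u₂ =ᵐ[volume.restrict (O₂ \ closure Ω)] glue Ω u u₂ := fun k =>
    (glue_ae_eq_diff h₂.1.measurableSet).trans (glue_ae_eq_diff h₂.1.measurableSet).symm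
  refine ⟨h1, h2, fun G hG => ?_, fun G hG => ?_⟩
  · exact hΩ.tendsto_integral_inner hp h₂.1 h₁.2.2.1 h₂.2.2.1 (fun k => (h1 k).1) h2.1 e1 e2 e3 h.2.2.1 hG
  · exact hΩ.tendsto_integral_inner hp h₂.1 h₁.2.2.1 h₂.2.2.1
      (fun k => (h1 k).memLp_weakGrad h₂.1) (h2.memLp_weakGrad h₂.1)
      (fun k => (h1 k).hasWeakGrad.ae_eq_of_subset (h.1 k).hasWeakGrad hΩ.isOpen hΩ₂ hΩ₁ (e1 k))
      (h2.hasWeakGrad.ae_eq_of_subset h.2.1.hasWeakGrad hΩ.isOpen hΩ₂ hΩ₁ e2)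
      (fun k => (h1 k).hasWeakGrad.ae_eq_of_subset h2.hasWeakGrad hOc sdiff_subset sdiff_subset (e3 k))
      h.2.2.2 hG

/-- The relaxed functional on `BV` does not depend on the solid boundary values. -/
lemma solidRelaxedBV_sub_eq (hΩ : IsLipDomain Ω) (hq : 1 ≤ q) {L : ℝ} {F : Mat N n → ℝ}
    (hF : Continuous F) (hL : ∀ z, |F z| ≤ L * (1 + ‖z‖ ^ q))
    (hv : AEStronglyMeasurable v (volume.restrict Ω)) (h₁ : IsSolidDatum q Ω v O₁ u₁)
    (h₂ : IsSolidDatum q Ω v O₂ u₂) (u : Vec n → Vec N) :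
    solidRelaxedBV q F u₁ (glue Ω u u₁) Ω O₁ - (energy F u₁ (O₁ \ closure Ω) : EReal) =
      solidRelaxedBV q F u₂ (glue Ω u u₂) Ω O₂ - (energy F u₂ (O₂ \ closure Ω) : EReal) := by
  have key : ∀ {O₁ O₂ : Set (Vec n)} {u₁ u₂ : Vec n → Vec N}, IsSolidDatum q Ω v O₁ u₁ →
      IsSolidDatum q Ω v O₂ u₂ →
      solidRelaxedBV q F u₂ (glue Ω u u₂) Ω O₂ - (energy F u₂ (O₂ \ closure Ω) : EReal) ≤
      solidRelaxedBV q F u₁ (glue Ω u u₁) Ω O₁ - (energy F u₁ (O₁ \ closure Ω) : EReal) := by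
    intro O₁ O₂ u₁ u₂ h₁ h₂
    have e : ∀ (O : Set (Vec n)) (u₀ : Vec n → Vec N), solidRelaxedBV q F u₀ (glue Ω u u₀) Ω O =
        sInf {x | ∃ e : ℕ → ℝ, (∃ w : ℕ → Vec n → Vec N, (∀ k, SolidClass q Ω O u₀ (w k)) ∧
          WeakStarTendstoBV O w (glue Ω u u₀) ∧ e = fun k => energy F (w k) O) ∧
          x = liminf (fun k => (e k : EReal)) atTop} := fun O u₀ => by
      refine congrArg sInf (Set.ext fun x => ⟨?_, ?_⟩)
      · rintro ⟨w, h1, h2, rfl⟩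
        exact ⟨_, ⟨w, h1, h2, rfl⟩, rfl⟩
      · rintro ⟨_, ⟨w, h1, h2, rfl⟩, rfl⟩
        exact ⟨w, h1, h2, rfl⟩
    rw [e, e]
    refine ereal_sub_le_sub_of_shift ?_
    rintro _ ⟨w, hw, h, rfl⟩
    exact ⟨_, fun k => (hw k).transfer hΩ hq hv h₁ h₂, h.transfer hΩ hq hv h₁ h₂ hw,
      funext fun k => ((hw k).energy_glue hΩ hq hF hL hv h₁ h₂).symm⟩
  exact (key h₂ h₁).antisymm (key h₁ h₂)

/-- The relaxed functional on `W^{1,p}` does not depend on the solid boundary values. -/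
lemma solidRelaxedW1_sub_eq (hΩ : IsLipDomain Ω) (hp : 1 < p) (hpq : p ≤ q) {L : ℝ}
    {F : Mat N n → ℝ} (hF : Continuous F) (hL : ∀ z, |F z| ≤ L * (1 + ‖z‖ ^ q))
    (hv : AEStronglyMeasurable v (volume.restrict Ω)) (h₁ : IsSolidDatum q Ω v O₁ u₁)
    (h₂ : IsSolidDatum q Ω v O₂ u₂) (u : Vec n → Vec N) :
    solidRelaxedW1 p q F u₁ (glue Ω u u₁) Ω O₁ - (energy F u₁ (O₁ \ closure Ω) : EReal) =
      solidRelaxedW1 p q F u₂ (glue Ω u u₂) Ω O₂ - (energy F u₂ (O₂ \ closure Ω) : EReal) := by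
  have hq : 1 ≤ q := hp.le.trans hpq
  have key : ∀ {O₁ O₂ : Set (Vec n)} {u₁ u₂ : Vec n → Vec N}, IsSolidDatum q Ω v O₁ u₁ →
      IsSolidDatum q Ω v O₂ u₂ →
      solidRelaxedW1 p q F u₂ (glue Ω u u₂) Ω O₂ - (energy F u₂ (O₂ \ closure Ω) : EReal) ≤
      solidRelaxedW1 p q F u₁ (glue Ω u u₁) Ω O₁ - (energy F u₁ (O₁ \ closure Ω) : EReal) := by
    intro O₁ O₂ u₁ u₂ h₁ h₂
    have e : ∀ (O : Set (Vec n)) (u₀ : Vec n → Vec N), solidRelaxedW1 p q F u₀ (glue Ω u u₀) Ω O =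
        sInf {x | ∃ e : ℕ → ℝ, (∃ w : ℕ → Vec n → Vec N, (∀ k, SolidClass q Ω O u₀ (w k)) ∧
          WeakTendstoW1 p O w (glue Ω u u₀) ∧ e = fun k => energy F (w k) O) ∧
          x = liminf (fun k => (e k : EReal)) atTop} := fun O u₀ => by
      refine congrArg sInf (Set.ext fun x => ⟨?_, ?_⟩)
      · rintro ⟨w, h1, h2, rfl⟩
        exact ⟨_, ⟨w, h1, h2, rfl⟩, rfl⟩
      · rintro ⟨_, ⟨w, h1, h2, rfl⟩, rfl⟩
        exact ⟨w, h1, h2, rfl⟩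
    rw [e, e]
    refine ereal_sub_le_sub_of_shift ?_
    rintro _ ⟨w, hw, h, rfl⟩
    exact ⟨_, fun k => (hw k).transfer hΩ hq hv h₁ h₂, h.transfer hΩ hp hpq hv h₁ h₂ hw,
      funext fun k => ((hw k).energy_glue hΩ hq hF hL hv h₁ h₂).symm⟩
  exact (key h₂ h₁).antisymm (key h₁ h₂)

/-- The infimum over admissible data is taken over a set with a single value. -/
lemma relaxedBV_eq (hΩ : IsLipDomain Ω) (hq : 1 ≤ q) {L : ℝ} {F : Mat N n → ℝ}
    (hF : Continuous F) (hL : ∀ z, |F z| ≤ L * (1 + ‖z‖ ^ q))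
    (hv : AEStronglyMeasurable v (volume.restrict Ω)) (h : IsSolidDatum q Ω v O u₀)
    (u : Vec n → Vec N) : relaxedBV q F v u Ω =
      solidRelaxedBV q F u₀ (glue Ω u u₀) Ω O - (energy F u₀ (O \ closure Ω) : EReal) := by
  refine le_antisymm (sInf_le ⟨O, u₀, h, rfl⟩) (le_sInf ?_)
  rintro _ ⟨O', u₀', h', rfl⟩
  exact (solidRelaxedBV_sub_eq hΩ hq hF hL hv h h' u).le

lemma relaxedW1_eq (hΩ : IsLipDomain Ω) (hp : 1 < p) (hpq : p ≤ q) {L : ℝ} {F : Mat N n → ℝ}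
    (hF : Continuous F) (hL : ∀ z, |F z| ≤ L * (1 + ‖z‖ ^ q))
    (hv : AEStronglyMeasurable v (volume.restrict Ω)) (h : IsSolidDatum q Ω v O u₀)
    (u : Vec n → Vec N) : relaxedW1 p q F v u Ω =
      solidRelaxedW1 p q F u₀ (glue Ω u u₀) Ω O - (energy F u₀ (O \ closure Ω) : EReal) := by
  refine le_antisymm (sInf_le ⟨O, u₀, h, rfl⟩) (le_sInf ?_)
  rintro _ ⟨O', u₀', h', rfl⟩
  exact (solidRelaxedW1_sub_eq hΩ hp hpq hF hL hv h h' u).le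

end Transfer

/-! ### Sobolev maps vanishing on the boundary -/

section Closure
variable {Ω O : Set (Vec n)} {p : ℝ} {z z' : Vec n → Vec N} {Z Z' : Vec n → Mat N n}

lemma IsTest.comp_sub {V : Type*} [NormedAddCommGroup V] [NormedSpace ℝ V] {φ : Vec n → V}
    (h : IsTest univ φ) (a : Vec n) : IsTest univ fun x => φ (x - a) :=
  ⟨h.1.comp (contDiff_id.sub contDiff_const),
    h.2.1.comp_homeomorph (Homeomorph.subRight a), subset_univ _⟩

lemma WD.translate {j : Fin n} {u w : Vec n → ℝ} (h : WD univ j u w) (a : Vec n) :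
    WD univ j (fun x => u (x - a)) (fun x => w (x - a)) := by
  have loc : ∀ {f : Vec n → ℝ}, LocallyIntegrableOn f univ →
      LocallyIntegrableOn (fun x => f (x - a)) univ := by
    intro f hf
    rw [locallyIntegrableOn_univ] at hf ⊢
    intro x
    obtain ⟨s, hs, hi⟩ := hf (x - a)
    refine ⟨(fun x => x - a) ⁻¹' s, (continuous_sub_right a).continuousAt.preimage_mem_nhds hs, ?_⟩
    exact ((measurePreserving_sub_right (volume : Measure (Vec n)) a).integrableOn_comp_preimage
      (Homeomorph.subRight a).measurableEmbedding).2 hi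
  refine ⟨loc h.locL, loc h.locR, fun φ hφ => ?_⟩
  have e := h.parts (fun x => φ (x - -a)) (hφ.comp_sub _)
  have hd : ∀ x, pderiv j (fun x => φ (x - -a)) x = pderiv j φ (x - -a) := fun x => by
    simp only [pderiv, fderiv_comp_sub]
  simp only [hd] at e
  rw [← integral_sub_right_eq_self (fun x => u x * pderiv j φ (x - -a)) a,
    ← integral_sub_right_eq_self (fun x => w x * φ (x - -a)) a] at e
  simpa using e

lemma HasWeakGrad.translate (h : HasWeakGrad univ z Z) (a : Vec n) :
    HasWeakGrad univ (fun x => z (x - a)) (fun x => Z (x - a)) := by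
  have loc := fun i j => (h.wd i j).translate a
  refine .of_WD ?_ loc
  have hf := h.1
  rw [locallyIntegrableOn_univ] at hf ⊢
  intro x
  obtain ⟨s, hs, hi⟩ := hf (x - a)
  refine ⟨(fun x => x - a) ⁻¹' s, (continuous_sub_right a).continuousAt.preimage_mem_nhds hs, ?_⟩
  exact ((measurePreserving_sub_right (volume : Measure (Vec n)) a).integrableOn_comp_preimage
    (Homeomorph.subRight a).measurableEmbedding).2 hi

lemma grad_add {φ ψ : Vec n → Vec N} (hφ : IsTest O φ) (hψ : IsTest O ψ) :
    grad (fun x => φ x + ψ x) = grad φ + grad ψ := by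
  ext x ij
  simp [grad, pderiv, fderiv_fun_add (hφ.differentiable x) (hψ.differentiable x)]

/-- `(z, Z)` belongs to the closure of `{(φ, ∇φ) : φ ∈ C_c^∞(Ω)}` in `L^p`. -/
def TestApprox (p : ℝ) (Ω : Set (Vec n)) (z : Vec n → Vec N) (Z : Vec n → Mat N n) : Prop :=
  ∀ ε : ℝ≥0∞, 0 < ε → ∃ φ : Vec n → Vec N, IsTest Ω φ ∧
    eLpNorm (φ - z) (ENNReal.ofReal p) ≤ ε ∧ eLpNorm (grad φ - Z) (ENNReal.ofReal p) ≤ ε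

lemma TestApprox.add (hp : 1 ≤ p) (h : TestApprox p Ω z Z) (h' : TestApprox p Ω z' Z')
    (hz : AEStronglyMeasurable z) (hZ : AEStronglyMeasurable Z) (hz' : AEStronglyMeasurable z')
    (hZ' : AEStronglyMeasurable Z') : TestApprox p Ω (z + z') (Z + Z') := by
  have hP1 : 1 ≤ ENNReal.ofReal p := by simpa using hp
  intro ε hε
  obtain ⟨φ, h1, h2, h3⟩ := h (ε / 2) (ENNReal.half_pos hε.ne')
  obtain ⟨ψ, h4, h5, h6⟩ := h' (ε / 2) (ENNReal.half_pos hε.ne')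
  have hm := h1.continuous.aestronglyMeasurable (μ := (volume : Measure (Vec n)))
  have hm' := h4.continuous.aestronglyMeasurable (μ := (volume : Measure (Vec n)))
  have hg := h1.isTest_grad.continuous.aestronglyMeasurable (μ := (volume : Measure (Vec n)))
  have hg' := h4.isTest_grad.continuous.aestronglyMeasurable (μ := (volume : Measure (Vec n)))
  refine ⟨fun x => φ x + ψ x, h1.add h4, ?_, ?_⟩
  · have e : (fun x => φ x + ψ x) - (z + z') = (φ - z) + (ψ - z') := by ext1 x; simp; abel
    rw [e, ← ENNReal.add_halves ε]
    exact (eLpNorm_add_le (hm.sub hz) (hm'.sub hz') hP1).trans (add_le_add h2 h5)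
  · have e : grad φ + grad ψ - (Z + Z') = (grad φ - Z) + (grad ψ - Z') := by abel
    rw [grad_add h1 h4, e, ← ENNReal.add_halves ε]
    exact (eLpNorm_add_le (hg.sub hZ) (hg'.sub hZ') hP1).trans (add_le_add h3 h6)

lemma testApprox_of_compact (hp : 1 ≤ p) (hO : IsOpen O) {K : Set (Vec n)} (hK : IsCompact K)
    (hKO : K ⊆ O) (hz : MemLp z (ENNReal.ofReal p)) (hZ : MemLp Z (ENNReal.ofReal p))
    (hg : HasWeakGrad univ z Z) (h0 : ∀ x ∉ K, z x = 0) : TestApprox p O z Z := by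
  intro ε hε
  obtain ⟨φ, h1, h2, h3⟩ := exists_test_seq hp hO hK hKO hz hZ hg h0
  obtain ⟨k, hk, hk'⟩ := ((h2.eventually_lt_const hε).and (h3.eventually_lt_const hε)).exists
  exact ⟨φ k, h1 k, hk.le, hk'.le⟩

/-- A small translation along `ν` moves the support into a compact subset of `Ω`, where
mollification applies; translations are continuous in `L^p` for both the map and its gradient. -/
lemma testApprox_of_chart (hp : 1 ≤ p) (hΩ : IsOpen Ω) {x₀ ν : Vec n} {r : ℝ} (hr : 0 < r)
    (hch : ∀ y ∈ Metric.ball x₀ r, y ∈ closure Ω → ∀ t : ℝ, 0 < t → t < r → y + t • ν ∈ Ω)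
    {K : Set (Vec n)} (hK : IsCompact K) (hKr : K ⊆ Metric.ball x₀ r)
    (hz : MemLp z (ENNReal.ofReal p)) (hZ : MemLp Z (ENNReal.ofReal p))
    (hg : HasWeakGrad univ z Z) (h0 : ∀ x ∉ K ∩ closure Ω, z x = 0) : TestApprox p Ω z Z := by
  have hP1 : 1 ≤ ENNReal.ofReal p := by simpa using hp
  intro ε hε
  have hε2 := ENNReal.half_pos hε.ne'
  have hlim : Tendsto (fun t : ℝ => t • ν) (𝓝[>] 0) (𝓝 0) := by
    have : Tendsto (fun t : ℝ => t • ν) (𝓝 0) (𝓝 ((0 : ℝ) • ν)) :=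
      (continuous_id.smul continuous_const).tendsto 0
    rw [zero_smul] at this
    exact this.mono_left nhdsWithin_le_nhds
  obtain ⟨t, ⟨⟨h1, h2⟩, h3⟩⟩ :=
    ((((tendsto_eLpNorm_translate hP1 ENNReal.ofReal_ne_top hz).comp hlim).eventually_lt_const
      hε2).and (((tendsto_eLpNorm_translate hP1 ENNReal.ofReal_ne_top hZ).comp
      hlim).eventually_lt_const hε2) |>.and (Ioo_mem_nhdsGT hr)).exists
  have hmp := measurePreserving_sub_right (volume : Measure (Vec n)) (t • ν)
  have hzt : MemLp (fun x => z (x - t • ν)) (ENNReal.ofReal p) := hz.comp_measurePreserving hmp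
  have hZt : MemLp (fun x => Z (x - t • ν)) (ENNReal.ofReal p) := hZ.comp_measurePreserving hmp
  obtain ⟨φ, h4, h5, h6⟩ := testApprox_of_compact hp hΩ
    ((hK.inter_right isClosed_closure).image (continuous_add_const (t • ν))) (by
      rintro _ ⟨y, hy, rfl⟩
      exact hch y (hKr hy.1) hy.2 t h3.1 h3.2) hzt hZt (hg.translate (t • ν)) (fun x hx =>
      h0 _ fun h => hx ⟨_, h, by simp⟩) (ε / 2) hε2
  have hm := h4.continuous.aestronglyMeasurable (μ := (volume : Measure (Vec n)))
  have hgm := h4.isTest_grad.continuous.aestronglyMeasurable (μ := (volume : Measure (Vec n)))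
  refine ⟨φ, h4, ?_, ?_⟩
  · have e : φ - z = (φ - fun x => z (x - t • ν)) + fun x => z (x - t • ν) - z x := by
      ext1 x; simp
    rw [e, ← ENNReal.add_halves ε]
    exact (eLpNorm_add_le (hm.sub hzt.1) (hzt.1.sub hz.1) hP1).trans (add_le_add h5 h1.le)
  · have e : grad φ - Z = (grad φ - fun x => Z (x - t • ν)) + fun x => Z (x - t • ν) - Z x := by
      ext1 x; simp
    rw [e, ← ENNReal.add_halves ε]
    exact (eLpNorm_add_le (hgm.sub hZt.1) (hZt.1.sub hZ.1) hP1).trans (add_le_add h6 h2.le)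

/-- A Sobolev map on the whole space vanishing off `Ω` is a limit of test maps on `Ω`. -/
lemma IsLipDomain.testApprox (hΩ : IsLipDomain Ω) (hp : 1 ≤ p) (hz : MemLp z (ENNReal.ofReal p))
    (hZ : MemLp Z (ENNReal.ofReal p)) (hg : HasWeakGrad univ z Z) (h0 : ∀ x ∉ closure Ω, z x = 0) :
    TestApprox p Ω z Z := by
  -- Stated for all maps supported in a compact part of an open set `V`, the claim lends itself to
  -- induction over compact sets, adding one chart at a time.
  have hind : ∃ V, IsOpen V ∧ closure Ω ⊆ V ∧ ∀ (z : Vec n → Vec N) (Z : Vec n → Mat N n)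
      (K : Set (Vec n)), IsCompact K → K ⊆ V → MemLp z (ENNReal.ofReal p) →
      MemLp Z (ENNReal.ofReal p) → HasWeakGrad univ z Z → (∀ x ∉ K ∩ closure Ω, z x = 0) →
      TestApprox p Ω z Z := by
    refine IsCompact.induction_on (p := fun S => ∃ V, IsOpen V ∧ S ⊆ V ∧
      ∀ (z : Vec n → Vec N) (Z : Vec n → Mat N n)
      (K : Set (Vec n)), IsCompact K → K ⊆ V → MemLp z (ENNReal.ofReal p) →
      MemLp Z (ENNReal.ofReal p) → HasWeakGrad univ z Z → (∀ x ∉ K ∩ closure Ω, z x = 0) →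
      TestApprox p Ω z Z) hΩ.bdd.isCompact_closure ?_ ?_ ?_ ?_
    · exact ⟨Ω, hΩ.isOpen, empty_subset _, fun z Z K hK hKV hz hZ hg h0 =>
        testApprox_of_compact hp hΩ.isOpen hK hKV hz hZ hg fun x hx => h0 x fun h => hx h.1⟩
    · rintro s t hst ⟨V, h1, h2, h3⟩
      exact ⟨V, h1, hst.trans h2, h3⟩
    · rintro s t ⟨V, h1, h2, h3⟩ ⟨V', h1', h2', h3'⟩
      refine ⟨V ∪ V', h1.union h1', union_subset_union h2 h2', fun z Z K hK hKV hz hZ hg h0 => ?_⟩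
      -- A partition of unity for two sets: `χ` is supported in `V` and equals one near `K \ V'`, so
      -- `χ z` is supported in `V` and `z - χ z` in `V'`.
      obtain ⟨χ, hχ, hχ1, -⟩ := exists_cutoff (hK.diff h1') h1 (sdiff_subset_iff.2 (by
        rwa [union_comm]))
      obtain ⟨W, hW, hKW, hWχ⟩ := mem_nhdsSet_iff_exists.1 hχ1
      obtain ⟨hy, D, hD, hgD⟩ := MemW1.smul_test isOpen_univ
        ⟨by simpa using hz, Z, hg, by simpa using hZ⟩ (hχ.mono (subset_univ _))
      have a1 := h3 _ D (K ∩ tsupport χ) (hK.inter_right (isClosed_tsupport _))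
        (inter_subset_right.trans hχ.2.2) hy hD hgD (fun x hx => by
          by_cases hx1 : x ∈ tsupport χ
          · simp [h0 x fun h => hx ⟨⟨h.1, hx1⟩, h.2⟩]
          · simp [image_eq_zero_of_notMem_tsupport hx1])
      have a2 := h3' (z - fun x => χ x • z x) (Z - D) (K \ W) (hK.diff hW)
        (sdiff_subset_iff.2 fun x hx => by
          by_cases h : x ∈ V'
          · exact Or.inr h
          · exact Or.inl (hKW ⟨hx, h⟩)) (hz.sub hy) (hZ.sub hD) (hg.sub hgD) (fun x hx => by
          by_cases hx1 : x ∈ W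
          · have : χ x = 1 := hWχ hx1
            simp [this]
          · simp [h0 x fun h => hx ⟨⟨h.1, hx1⟩, h.2⟩])
      have := a1.add hp a2 hy.1 hD.1 (hz.sub hy).1 (hZ.sub hD).1
      simpa using this
    · intro x hx
      by_cases hxΩ : x ∈ Ω
      · exact ⟨Ω, mem_nhdsWithin_of_mem_nhds (hΩ.isOpen.mem_nhds hxΩ), Ω, hΩ.isOpen, subset_rfl,
          fun z Z K hK hKV hz hZ hg h0 => testApprox_of_compact hp hΩ.isOpen hK hKV hz hZ hg
            fun x hx => h0 x fun h => hx h.1⟩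
      · obtain ⟨ν, r, K', γ, hν, hr, hγ, hc⟩ := hΩ.lip x
          (by rw [hΩ.isOpen.frontier_eq]; exact ⟨hx, hxΩ⟩)
        refine ⟨Metric.ball x (r / 2), mem_nhdsWithin_of_mem_nhds (Metric.ball_mem_nhds x
          (half_pos hr)), _, Metric.isOpen_ball, subset_rfl, fun z Z K hK hKV hz hZ hg h0 => ?_⟩
        exact testApprox_of_chart hp hΩ.isOpen (half_pos hr) (fun y hy hy' t ht ht' =>
          chart_translate hν hγ hc hy hy' ht ht') hK hKV hz hZ hg h0
  obtain ⟨V, -, h2, h3⟩ := hind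
  exact h3 z Z _ hΩ.bdd.isCompact_closure h2 hz hZ hg (by simpa using h0)

lemma MemW1.memW10 (hΩ : IsLipDomain Ω) (hp : 1 ≤ p) (hz : MemW1 p Ω z)
    (h : HasWeakGrad univ (Ω.indicator z) (Ω.indicator (weakGrad Ω z))) : MemW10 p Ω z := by
  have hm := hΩ.isOpen.measurableSet
  refine ⟨hz, fun ε hε => ?_⟩
  obtain ⟨φ, h1, h2, h3⟩ := hΩ.testApprox hp ((memLp_indicator_iff_restrict hm).2 hz.1)
    ((memLp_indicator_iff_restrict hm).2 (hz.memLp_weakGrad hΩ.isOpen)) h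
    (fun x hx => indicator_of_notMem (fun h => hx (subset_closure h)) _) ε hε
  refine ⟨φ, h1, ?_, ?_⟩
  · refine le_trans ?_ ((eLpNorm_mono_measure _ (Measure.restrict_le_self (s := Ω))).trans h2)
    rw [eLpNorm_sub_comm]
    exact (eLpNorm_congr_ae ((ae_restrict_mem hm).mono fun x hx => by simp [hx])).le
  · refine le_trans ?_ ((eLpNorm_mono_measure _ (Measure.restrict_le_self (s := Ω))).trans h3)
    rw [eLpNorm_sub_comm]
    exact (eLpNorm_congr_ae ((ae_restrict_mem hm).mono fun x hx => by simp [hx])).le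

end Closure

/-! ### Existence of minimizers -/

section Existence
variable {Ω B : Set (Vec n)} {p q : ℝ} {u₀ v : Vec n → Vec N} {F : Mat N n → ℝ}

/-- The difference to the boundary values, extended by zero. -/
lemma SolidClass.hasWeakGrad_indicator_sub (hΩ : IsLipDomain Ω) (hB : IsOpen B)
    (hcl : closure Ω ⊆ B) (hu₀ : MemW1 q B u₀) {w : Vec n → Vec N} (hw : SolidClass q Ω B u₀ w) :
    HasWeakGrad univ (Ω.indicator (w - u₀)) (Ω.indicator (weakGrad B w - weakGrad B u₀)) :=
  (hw.1.hasWeakGrad.sub hu₀.hasWeakGrad).extend_zero hΩ hB hcl (hw.2.mono fun x hx => by simp [hx])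

lemma SolidClass.memLp_indicator_sub (hΩ : IsLipDomain Ω) (hpq : p ≤ q) (hB : IsOpen B)
    (hcl : closure Ω ⊆ B) (hu₀ : MemW1 q B u₀) {w : Vec n → Vec N} (hw : SolidClass q Ω B u₀ w) :
    MemLp (Ω.indicator (w - u₀)) (ENNReal.ofReal p) ∧
      MemLp (Ω.indicator (weakGrad B w - weakGrad B u₀)) (ENNReal.ofReal p) := by
  have hm := hΩ.isOpen.measurableSet
  have hfin : IsFiniteMeasure (volume.restrict Ω) := ⟨by simpa using hΩ.volume_ne_top.lt_top⟩
  have hPQ : ENNReal.ofReal p ≤ ENNReal.ofReal q := ENNReal.ofReal_le_ofReal hpq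
  have hle := Measure.restrict_mono_set (volume : Measure (Vec n)) (subset_closure.trans hcl)
  exact ⟨(memLp_indicator_iff_restrict hm).2
      (((hw.1.1.sub hu₀.1).mono_measure hle).mono_exponent hPQ),
    (memLp_indicator_iff_restrict hm).2
      ((((hw.1.memLp_weakGrad hB).sub (hu₀.memLp_weakGrad hB)).mono_measure hle).mono_exponent hPQ)⟩

lemma SolidClass.ae_eq_add_indicator (hΩ : IsLipDomain Ω) (hB : IsOpen B)
    {w : Vec n → Vec N} (hw : SolidClass q Ω B u₀ w) :
    w =ᵐ[volume.restrict B] u₀ + Ω.indicator (w - u₀) := by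
  refine hΩ.ae_of_parts ((ae_restrict_mem hΩ.isOpen.measurableSet).mono fun x hx => by simp [hx]) ?_
  filter_upwards [hw.2, ae_restrict_mem (hB.sdiff isClosed_closure).measurableSet] with x h1 h2
  have : x ∉ Ω := fun h => h2.2 (subset_closure h)
  simp [this, h1]

lemma glue_add : glue Ω (u₀ + v) u₀ = u₀ + Ω.indicator v := by
  ext1 x
  by_cases hx : x ∈ Ω
  · simp [glue_apply_mem hx, hx]
  · simp [glue_apply_notMem hx, hx]

/-- Minimizing sequences exist and are bounded. -/
lemma StronglyQuasiconvex.exists_minimizing_seq (hΩ : IsLipDomain Ω) {L : ℝ} (hp : 1 ≤ p)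
    (hpq : p ≤ q) (hF : Continuous F) (hL : ∀ z, |F z| ≤ L * (1 + ‖z‖ ^ q))
    (hQ : StronglyQuasiconvex p F) {R : ℝ} (hR : 0 < R) (hcl : closure Ω ⊆ Metric.ball 0 R)
    (hu₀ : MemW1 q (Metric.ball 0 R) u₀) : ∃ (m : ℝ) (w : ℕ → Vec n → Vec N) (M : ℝ),
      (∀ w, SolidClass q Ω (Metric.ball 0 R) u₀ w → m ≤ energy F w (Metric.ball 0 R)) ∧
      (∀ k, SolidClass q Ω (Metric.ball 0 R) u₀ (w k)) ∧
      Tendsto (fun k => energy F (w k) (Metric.ball 0 R)) atTop (𝓝 m) ∧ 0 ≤ M ∧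
      ∀ k, eLpNorm (Ω.indicator (weakGrad (Metric.ball 0 R) (w k) - weakGrad (Metric.ball 0 R) u₀))
        (ENNReal.ofReal p) ≤ ENNReal.ofReal M := by
  obtain ⟨a, b, ha, hab⟩ := hQ.coercive hΩ hp hpq hF hL hR hcl hu₀
  have hp0 : 0 < p := by linarith
  set B := Metric.ball (0 : Vec n) R with hB
  set S := {e | ∃ w, SolidClass q Ω B u₀ w ∧ e = energy F w B} with hS
  have hne : S.Nonempty := ⟨_, u₀, ⟨hu₀, EventuallyEq.rfl⟩, rfl⟩
  have hbd : BddBelow S := by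
    refine ⟨-b / a, ?_⟩
    rintro _ ⟨w, hw, rfl⟩
    rw [div_le_iff₀ ha]
    have h1 : 0 ≤ ∫ x in Ω, ‖weakGrad B w x - weakGrad B u₀ x‖ ^ p :=
      integral_nonneg fun x => Real.rpow_nonneg (norm_nonneg _) _
    have := hab w hw
    linarith
  obtain ⟨e, -, he, heS⟩ := exists_seq_tendsto_sInf hne hbd
  choose w hw hew using heS
  obtain ⟨C, hC⟩ := he.bddAbove_range
  have hCk : ∀ k, energy F (w k) B ≤ C := fun k => hew k ▸ hC ⟨k, rfl⟩
  have hC0 : 0 ≤ a * C + b :=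
    (integral_nonneg fun x => Real.rpow_nonneg (norm_nonneg _) _).trans ((hab _ (hw 0)).trans
      (add_le_add_left (mul_le_mul_of_nonneg_left (hCk 0) ha.le) _))
  refine ⟨sInf S, w, (a * C + b) ^ (1 / p), fun w hw => csInf_le hbd ⟨w, hw, rfl⟩, hw,
    he.congr hew, Real.rpow_nonneg hC0 _, fun k => ?_⟩
  rw [← ENNReal.rpow_le_rpow_iff hp0, eLpNorm_indicator_eq_eLpNorm_restrict hΩ.isOpen.measurableSet,
    eLpNorm_rpow hp0]
  have hd := ((hw k).memLp_indicator_sub hΩ hpq Metric.isOpen_ball hcl hu₀).2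
  rw [memLp_indicator_iff_restrict hΩ.isOpen.measurableSet] at hd
  rw [lintegral_rpow_eq_ofReal hp0 hd, ENNReal.ofReal_rpow_of_nonneg (Real.rpow_nonneg hC0 _) hp0.le,
    ← Real.rpow_mul hC0, one_div_mul_cancel hp0.ne', Real.rpow_one]
  exact ENNReal.ofReal_le_ofReal ((hab _ (hw k)).trans
    (add_le_add_left (mul_le_mul_of_nonneg_left (hCk k) ha.le) _))

/-- Every admissible sequence runs through the solid class, so its lower limit cannot drop below a
lower bound of the energy, whatever map it converges to. -/
lemma le_solidRelaxedBV {m : ℝ} (h : ∀ w, SolidClass q Ω B u₀ w → m ≤ energy F w B)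
    (U : Vec n → Vec N) : (m : EReal) ≤ solidRelaxedBV q F u₀ U Ω B := by
  refine le_sInf ?_
  rintro _ ⟨w, hw, -, rfl⟩
  exact le_liminf_of_le (by isBoundedDefault)
    (Eventually.of_forall fun k => EReal.coe_le_coe_iff.2 (h _ (hw k)))

lemma le_solidRelaxedW1 {m : ℝ} (h : ∀ w, SolidClass q Ω B u₀ w → m ≤ energy F w B)
    (U : Vec n → Vec N) : (m : EReal) ≤ solidRelaxedW1 p q F u₀ U Ω B := by
  refine le_sInf ?_
  rintro _ ⟨w, hw, -, rfl⟩
  exact le_liminf_of_le (by isBoundedDefault)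
    (Eventually.of_forall fun k => EReal.coe_le_coe_iff.2 (h _ (hw k)))

lemma MemBV.congr {u u' : Vec n → Vec N} (h : MemBV Ω u) (hu : u =ᵐ[volume.restrict Ω] u') :
    MemBV Ω u' :=
  ⟨(memLp_congr_ae hu).1 h.1, totalVar_congr hu ▸ h.2⟩

/-- Existence of minimizers of the weak*-relaxed functional on `BV`. -/
theorem exists_isBVMinimizer (hΩ : IsLipDomain Ω) (hq : 1 ≤ q) {L : ℝ} (hF : Continuous F)
    (hL : ∀ z, |F z| ≤ L * (1 + ‖z‖ ^ q)) (hQ : StronglyQuasiconvex 1 F)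
    (hv : AEStronglyMeasurable v (volume.restrict Ω)) (ht : TraceMem q Ω v) :
    ∃ u, IsBVMinimizer q F v u Ω := by
  obtain ⟨R, u₀, hR, hD⟩ := exists_solidDatum hΩ hq ht
  have hu₀ := hD.2.2.2.1
  have hcl := hD.2.2.1
  obtain ⟨m, w, M, hm, hw, hwm, hM, hwM⟩ := hQ.exists_minimizing_seq hΩ le_rfl hq hF hL hR hcl hu₀
  set B := Metric.ball (0 : Vec n) R with hB
  have hBo : IsOpen B := Metric.isOpen_ball
  have hΩB : Ω ⊆ B := subset_closure.trans hcl
  have hLp := fun k => (hw k).memLp_indicator_sub hΩ hq hBo hcl hu₀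
  have hwg := fun k => (hw k).hasWeakGrad_indicator_sub hΩ hBo hcl hu₀
  obtain ⟨φ, hφ, g, hg, hlim⟩ := exists_subseq_sobolev hΩ.one_le le_rfl hR hM hwg
    (fun k => (hLp k).1) (fun k => (hLp k).2)
    (fun k x hx => indicator_of_notMem (fun h => hx (hΩB h)) _) hwM
  simp only [ENNReal.ofReal_one, memLp_one_iff_integrable] at hLp hg hlim hwM
  have hbv₀ : MemBV B u₀ := (hu₀.mono_exponent hq hD.volume_ne_top).memBV hBo
  have hconv : WeakStarTendstoBV B (fun k => w (φ k)) (glue Ω (u₀ + g) u₀) := by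
    rw [glue_add]
    refine weakStarTendstoBV_of_bound hBo
      (fun k => ((hw (φ k)).1.mono_exponent hq hD.volume_ne_top).memBV hBo |>.integrableOn)
      (hbv₀.integrableOn.add (hg.indicator hΩ.isOpen.measurableSet).integrableOn) ?_
      (M := totalVar B u₀ + ENNReal.ofReal M) ?_ fun k => ?_
    · refine tendsto_of_tendsto_of_tendsto_of_le_of_le tendsto_const_nhds hlim
        (fun _ => zero_le) fun k => ?_
      refine le_trans ?_ (eLpNorm_mono_measure _ (Measure.restrict_le_self (s := B)))
      refine eLpNorm_mono_ae ?_
      filter_upwards [(hw (φ k)).ae_eq_add_indicator hΩ hBo] with x hx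
      by_cases hxΩ : x ∈ Ω
      · simp [hxΩ, sub_sub]
      · simp only [Pi.sub_apply, hx]
        simp [hxΩ]
    · exact ENNReal.add_ne_top.2 ⟨hbv₀.2.ne, ENNReal.ofReal_ne_top⟩
    · rw [totalVar_congr ((hw (φ k)).ae_eq_add_indicator hΩ hBo)]
      refine (totalVar_add_le hbv₀.integrableOn (hLp _).1.integrableOn).trans ?_
      gcongr
      refine (((hwg _).mono (subset_univ B)).totalVar_le (hLp _).2.integrableOn).trans ?_
      refine le_trans ?_ (hwM (φ k))
      rw [eLpNorm_one_eq_lintegral_enorm]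
      exact lintegral_mono' Measure.restrict_le_self le_rfl
  have hval := fun u => relaxedBV_eq hΩ hq hF hL hv hD u
  -- The minimizing subsequence is itself admissible at its limit, which gives the value at most
  -- `m`.
  have hmin : solidRelaxedBV q F u₀ (glue Ω (u₀ + g) u₀) Ω B = m := by
    refine le_antisymm (sInf_le ⟨_, fun k => hw (φ k), hconv, ?_⟩) (le_solidRelaxedBV hm _)
    exact (((continuous_coe_real_ereal.tendsto m).comp hwm).comp hφ.tendsto_atTop).liminf_eq.symm
  refine ⟨u₀ + g, ?_, ?_, ?_, fun u _ => ?_⟩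
  · exact (hconv.2.1.mono hΩB hBo.measurableSet).congr (glue_ae_eq hΩ.isOpen.measurableSet)
  · rw [hval, hmin, ← EReal.coe_sub]
    exact EReal.bot_lt_coe _
  · rw [hval, hmin, ← EReal.coe_sub]
    exact EReal.coe_lt_top _
  · rw [hval, hval, hmin]
    exact EReal.sub_le_sub (le_solidRelaxedBV hm _) le_rfl

lemma tendsto_integral_inner_const_add {α ι : Type*} [Fintype ι] {m : MeasurableSpace α}
    {μ : Measure α} (hp : 1 < p) {f f' : ℕ → α → EuclideanSpace ℝ ι} {g g' h : α → EuclideanSpace ℝ ι}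
    (hf : ∀ k, MemLp (f k) (ENNReal.ofReal p) μ) (hg : MemLp g (ENNReal.ofReal p) μ)
    (hh : MemLp h (ENNReal.ofReal p) μ) (hff : ∀ k, f' k =ᵐ[μ] h + f k) (hgg : g' =ᵐ[μ] h + g)
    (hfg : ∀ i s, MemLp s (ENNReal.ofReal (p / (p - 1))) μ →
      Tendsto (fun k => ∫ x, f k x i * s x ∂μ) atTop (𝓝 (∫ x, g x i * s x ∂μ)))
    {G : α → EuclideanSpace ℝ ι} (hG : MemLp G (ENNReal.ofReal (p / (p - 1))) μ) :
    Tendsto (fun k => ∫ x, inner ℝ (G x) (f' k x) ∂μ) atTop (𝓝 (∫ x, inner ℝ (G x) (g' x) ∂μ)) := by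
  have e : ∀ {f f' : α → EuclideanSpace ℝ ι}, MemLp f (ENNReal.ofReal p) μ → f' =ᵐ[μ] h + f →
      ∫ x, inner ℝ (G x) (f' x) ∂μ = (∫ x, inner ℝ (G x) (h x) ∂μ) + ∫ x, inner ℝ (G x) (f x) ∂μ := by
    intro f f' hf hff
    rw [← integral_add (integrable_inner_conj hp hG hh) (integrable_inner_conj hp hG hf)]
    refine integral_congr_ae (hff.mono fun x hx => ?_)
    simp only [hx, Pi.add_apply, inner_add_right]
  simp only [e (hf _) (hff _), e hg hgg]
  exact (tendsto_integral_inner_of_coord hp hf hg hfg hG).const_add _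

/-- Existence of minimizers of the weakly relaxed functional on Dirichlet classes. -/
theorem exists_isW1Minimizer (hΩ : IsLipDomain Ω) (hp : 1 < p) (hpq : p ≤ q) {L : ℝ}
    (hF : Continuous F) (hL : ∀ z, |F z| ≤ L * (1 + ‖z‖ ^ q)) (hQ : StronglyQuasiconvex p F)
    (hv : MemW1 p Ω v) (ht : TraceMem q Ω v) :
    ∃ u, MemDirichlet p Ω v u ∧ IsW1Minimizer p q F v u Ω := by
  have hP1 : 1 ≤ ENNReal.ofReal p := by simpa using hp.le
  obtain ⟨R, u₀, hR, hD⟩ := exists_solidDatum hΩ (hp.le.trans hpq) ht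
  have hu₀ := hD.2.2.2.1
  have hcl := hD.2.2.1
  obtain ⟨m, w, M, hm, hw, hwm, hM, hwM⟩ := hQ.exists_minimizing_seq hΩ hp.le hpq hF hL hR hcl hu₀
  set B := Metric.ball (0 : Vec n) R with hB
  have hBo : IsOpen B := Metric.isOpen_ball
  have hBc : IsOpen (B \ closure Ω) := hBo.sdiff isClosed_closure
  have hmΩ := hΩ.isOpen.measurableSet
  have hΩB : Ω ⊆ B := subset_closure.trans hcl
  have hLp := fun k => (hw k).memLp_indicator_sub hΩ hpq hBo hcl hu₀
  have hwg := fun k => (hw k).hasWeakGrad_indicator_sub hΩ hBo hcl hu₀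
  obtain ⟨φ, hφ, g, G, hg, hG, hgG, hlim, hz, hZ⟩ := exists_subseq_sobolev_weak hΩ.one_le hp hR hM hwg
    (fun k => (hLp k).1) (fun k => (hLp k).2)
    (fun k x hx => indicator_of_notMem (fun h => hx (hΩB h)) _) hwM
  -- The differences to `u₀` vanish off `Ω`, and strong convergence passes this on to `g`; hence `u₀
  -- + g` has the prescribed outer values and `g` extends by zero.
  have hg0 : g =ᵐ[volume.restrict (B \ closure Ω)] 0 := by
    refine (eLpNorm_eq_zero_iff hg.1.restrict (zero_lt_one.trans_le hP1).ne').1 ?_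
    refine le_antisymm (ge_of_tendsto' hlim fun k => ?_) zero_le
    refine le_trans (le_of_eq ?_) (eLpNorm_mono_measure _
      (Measure.restrict_le_self (s := B \ closure Ω)))
    rw [← eLpNorm_neg]
    refine eLpNorm_congr_ae ((ae_restrict_mem hBc.measurableSet).mono fun x hx => ?_)
    have : x ∉ Ω := fun h => hx.2 (subset_closure h)
    simp [this]
  have hgi : g =ᵐ[volume.restrict B] Ω.indicator g := by
    refine hΩ.ae_of_parts ((ae_restrict_mem hmΩ).mono fun x hx => by simp [hx]) ?_
    filter_upwards [hg0, ae_restrict_mem hBc.measurableSet] with x h1 h2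
    have : x ∉ Ω := fun h => h2.2 (subset_closure h)
    simp [this, h1]
  have hu₀p := hu₀.mono_exponent hpq hD.volume_ne_top
  have hwp := fun k => (hw k).1.mono_exponent hpq hD.volume_ne_top
  have hgB : MemW1 p B g := ⟨hg.restrict B, G, hgG, hG⟩
  have hgl : glue Ω (u₀ + g) u₀ =ᵐ[volume.restrict B] u₀ + g := by
    rw [glue_add]
    exact EventuallyEq.rfl.add hgi.symm
  have hglW : MemW1 p B (glue Ω (u₀ + g) u₀) := (hu₀p.add hgB).congr hgl.symm
  have hconv : WeakTendstoW1 p B (fun k => w (φ k)) (glue Ω (u₀ + g) u₀) := by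
    refine ⟨fun k => hwp _, hglW, fun f hf => ?_, fun f hf => ?_⟩
    · exact tendsto_integral_inner_const_add hp (fun k => (hLp (φ k)).1.restrict B) (hg.restrict B)
        hu₀p.1 (fun k => (hw (φ k)).ae_eq_add_indicator hΩ hBo) hgl hz hf
    · refine tendsto_integral_inner_const_add hp (fun k => (hLp (φ k)).2.restrict B) hG
        (hu₀p.memLp_weakGrad hBo) (fun k => ?_) ?_ hZ hf
      · exact (hwp _).hasWeakGrad.unique'
          (hu₀p.hasWeakGrad.add ((hwg (φ k)).mono (subset_univ _))) hBo
          ((hw (φ k)).ae_eq_add_indicator hΩ hBo)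
      · exact hglW.hasWeakGrad.unique' (hu₀p.hasWeakGrad.add hgG) hBo hgl
  have hval := fun u => relaxedW1_eq hΩ hp hpq hF hL hv.1.1 hD u
  have hmin : solidRelaxedW1 p q F u₀ (glue Ω (u₀ + g) u₀) Ω B = m := by
    refine le_antisymm (sInf_le ⟨_, fun k => hw (φ k), hconv, ?_⟩) (le_solidRelaxedW1 hm _)
    exact (((continuous_coe_real_ereal.tendsto m).comp hwm).comp hφ.tendsto_atTop).liminf_eq.symm
  have hu : MemW1 p Ω (u₀ + g) := (hu₀p.add hgB).mono hΩB
  have huv : MemW1 p Ω (u₀ + g - v) := hu.sub hv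
  have hu₀v : MemW1 p Ω (u₀ - v) := (hu₀p.mono hΩB).sub hv
  refine ⟨u₀ + g, ⟨hu, huv.memW10 hΩ hp.le ?_⟩, hu, ?_, ?_, fun u _ => ?_⟩
  -- In `Ω` the difference to `v` is `(u₀ - v) + g`. The first summand has zero trace and the second
  -- vanishes in `B` off the closure of `Ω`, so each extends by zero to a weakly differentiable map.
  · obtain ⟨t, ht1, ht2⟩ := hD.2.2.2.2
    have h1 := hu₀v.extend_of_zeroTrace hΩ hp.le
      (SameTrace.zeroTrace hΩ (hu₀p.mono hΩB).1.1 hv.1.1 ⟨t, ht1, ht2⟩ ⟨t, ht2, ht2⟩)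
    have h2 := hgG.extend_zero hΩ hBo hcl hg0
    have e : Ω.indicator (u₀ + g - v) = Ω.indicator (u₀ - v) + Ω.indicator g := by
      rw [← indicator_add']
      congr 1
      abel
    rw [e]
    refine (h1.add h2).congr EventuallyEq.rfl ?_
    rw [← indicator_add', Measure.restrict_univ]
    refine (ae_eq_restrict_iff_indicator_ae_eq hmΩ).1 ?_
    refine ((hu₀v.hasWeakGrad.add (hgG.mono hΩB)).unique' huv.hasWeakGrad hΩ.isOpen ?_)
    refine Eventually.of_forall fun x => ?_
    simp only [Pi.add_apply, Pi.sub_apply]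
    abel
  · rw [hval, hmin, ← EReal.coe_sub]
    exact EReal.bot_lt_coe _
  · rw [hval, hmin, ← EReal.coe_sub]
    exact EReal.coe_lt_top _
  · rw [hval, hval, hmin]
    exact EReal.sub_le_sub (le_solidRelaxedW1 hm _) le_rfl

end Existence

end RelaxedMin

theorem proposition5p7 (n N : ℕ) (hn : 1 ≤ n) (Ω : Set (Vec n)) (hΩne : Ω.Nonempty)
    (hΩo : IsOpen Ω) (hΩb : Bornology.IsBounded Ω) (hΩL : HasLipschitzBoundary Ω)
    (p q : ℝ) (hp : 1 ≤ p) (hpq : p ≤ q) (hq : q * ((n : ℝ) - 1) < n * p) :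
    (p = 1 → ∀ F : Mat N n → ℝ, Continuous F → GrowthBound q F → StronglyQuasiconvex 1 F →
      ∀ v : Vec n → Vec N, MemBV Ω v → TraceMem q Ω v →
        (∀ Ω' u₀, IsSolidDatum q Ω v Ω' u₀ → ∀ u, MemBV Ω u →
          relaxedBV q F v u Ω =
            solidRelaxedBV q F u₀ (glue Ω u u₀) Ω Ω' - (energy F u₀ (Ω' \ closure Ω) : EReal)) ∧
        ∃ u, IsBVMinimizer q F v u Ω) ∧
    (1 < p → ∀ F : Mat N n → ℝ, Continuous F → GrowthBound q F → StronglyQuasiconvex p F →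
      ∀ v : Vec n → Vec N, MemW1 p Ω v → TraceMem q Ω v →
        (∀ Ω' u₀, IsSolidDatum q Ω v Ω' u₀ → ∀ u, MemW1 p Ω u →
          relaxedW1 p q F v u Ω =
            solidRelaxedW1 p q F u₀ (glue Ω u u₀) Ω Ω' - (energy F u₀ (Ω' \ closure Ω) : EReal)) ∧
        ∃ u, MemDirichlet p Ω v u ∧ IsW1Minimizer p q F v u Ω) := by

  have hΩ : IsLipDomain Ω := ⟨hn, hΩne, hΩo, hΩb, hΩL⟩
  have hq1 : 1 ≤ q := hp.trans hpq
  constructor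
  · rintro - F hF ⟨L, -, hL⟩ hQ v hv ht
    exact ⟨fun Ω' u₀ hD u _ => relaxedBV_eq hΩ hq1 hF hL hv.1.1 hD u,
      exists_isBVMinimizer hΩ hq1 hF hL hQ hv.1.1 ht⟩
  · rintro hp1 F hF ⟨L, -, hL⟩ hQ v hv ht
    exact ⟨fun Ω' u₀ hD u _ => relaxedW1_eq hΩ hp1 hpq hF hL hv.1.1 hD u,
      exists_isW1Minimizer hΩ hp1 hpq hF hL hQ hv ht⟩
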